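/- Conventions. $p$ is a prime, $k$ a perfect field of characteristic $p$. A \emph{log algebra} $\underline R=(R,M)$ is a commutative ring $R$ with a homomorphism $\alpha$ from a commutative monoid $M$ (written multiplicatively) to $(R,\cdot)$; morphisms are commutative squares. Fix a log algebra $\underline k=(k,N)$ and a log algebra $\underline R=(R,M)$ over $\underline k$. Write $W(\underline k)=(W(k),N)$, $W_n(\underline k)=(W_n(k),N)$, $W_n(\underline R)=(W_n(R),M)$, where the monoids act through Teichmüller lifts. A monoid is \emph{fine} if it is cancellative and finitely generated. Log smoothness of a log algebra over another, both with fine monoids, means that the underlying ring map is of finite presentation and that lifts along square-zero thickenings of fine affine log schemes exist étale locally. The morphism $\operatorname{Spec}\underline R\to\operatorname{Spec}\underline k$ is \emph{integral} if its base change to every fine log scheme over $\operatorname{Spec}\underline k$ is again fine. \emph{Log Dieudonné algebras.} A log Dieudonné algebra over $W(\underline k)$ consists of: a (strictly) commutative differential graded algebra $(A^*,d)$ in degrees $\ge 0$; a morphism of log algebras $W(\underline k)\to(A^0,L)$ with structure map $\alpha:L\to A^0$; a homomorphism $\delta:L\to A^1$ with $d\alpha(l)=\alpha(l)\delta(l)$,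 $d\delta=0$, such that $d$ vanishes on $W(k)$ and $\delta$ on $N$; a graded ring endomorphism $F$ of $A^*$ with $F(x)\equiv x^p \bmod p$ on $A^0$ and $dF=pFd$; and an endomorphism $F_L$ of $L$ with $F\alpha=\alpha F_L$ and $\delta F_L=pF\delta$. Morphisms are the pairs of a map of cdga's and a map of monoids that respect all these data. It is \emph{$p$-compatible} if $F_L(l)=l^p$. It is \emph{saturated} if $A^*$ is $p$-torsion free and $p^iF:A^i\to\{x\in p^iA^i: dx\in p^{i+1}A^{i+1}\}$ is bijective for all $i$; then there is a unique $V$ with $FV=p$. For a saturated $A^*$, its \emph{$V$-completion} is $W(A^*)=\varprojlim_r A^*/(V^rA^*+dV^rA^*)$, with the induced structure and the same monoid $L$, and $A^*$ is \emph{strict} if $A^*\to W(A^*)$ is an isomorphism. The \emph{saturation} $A^*_{\mathfrak{sat}}$ of $A^*$ is obtained by dividing out $p$-power torsion and taking the colimit of $A^*\to\eta_pA^*\to\eta_{p}^2A^*\to\cdots$ along the maps $p^iF$, where $(\eta_pA)^i=\{x\in p^iA^i: dx\in p^{i+1}A^{i+1}\}$; it keeps the monoid $L$. Write $W(A^*)_{\mathfrak{sat}}$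 for the $V$-completion of $A^*_{\mathfrak{sat}}$, and $\kappa:A^*\to W(A^*)_{\mathfrak{sat}}$ for the canonical morphism. \emph{Saturated log de Rham--Witt complex.} A saturated log de Rham--Witt complex of $\underline R/\underline k$ is a strict $p$-compatible log Dieudonné algebra $\mathcal W\omega^*_{\underline R/\underline k}$ over $W(\underline k)$ with a morphism $e:\underline R\to(\mathcal W\omega^0/V\mathcal W\omega^0,L)$ of log algebras over $\underline k$ such that for every strict $p$-compatible log Dieudonné algebra $B^*$ over $W(\underline k)$ and every morphism $g:\underline R\to(B^0/VB^0,L_B)$ of log algebras over $\underline k$ there is exactly one morphism $\mathcal W\omega^*_{\underline R/\underline k}\to B^*$ inducing $g$ through $e$. \emph{Log Frobenius liftings.} A $p$-compatible log Frobenius lifting of $\underline R/\underline k$ consists, for $n\ge1$, of log algebras $\underline A_n=(A_n,M)$ with the same monoid $M$, log smooth over $W_n(\underline k)$, with $\underline A_1=\underline R$ over $W_1(\underline k)=\underline k$; of surjections $A_{n+1}\to A_n$ that are the identity on $M$ and identify $\underline A_n$ with the base change of $\underline A_{n+1}$ along $W_{n+1}(\underline k)\to W_n(\underline k)$; of morphisms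 $\delta_n:\underline A_n\to W_n(\underline R)$ of log algebras compatible with restriction; and of ring maps $\varphi_n:A_{n+1}\to A_n$ that are $m\mapsto m^p$ on $M$, compatible with restriction, with the Frobenius $x\mapsto x^p$ of $R$, and with the Witt vector Frobenius maps $W_{n+1}(k)\to W_n(k)$ and (via $\delta$) $W_{n+1}(R)\to W_n(R)$. Put $\widehat A=\varprojlim A_n$, $\underline{\widehat A}=(\widehat A,M)$, $\varphi=\varprojlim\varphi_n$, and let $$\widehat\omega^*=\widehat\omega^*_{\underline{\widehat A}/W(\underline k)}=\varprojlim_n\omega^*_{\underline A_n/W_n(\underline k)}$$ be the completed log de Rham complex, with the monoid $M$ and $\delta=\operatorname{dlog}$. \textbf{Proposition.} Suppose that $\underline R/\underline k$ is integral and that it admits a $p$-compatible log Frobenius lifting $(\underline A_n,\delta_n,\varphi_n)$. Then: (a) There is exactly one structure $(F,F_L)$ of a log Dieudonné algebra on $\widehat\omega^*$ such that $F=\varphi$ on $\widehat A$, $F(dx)=x^{p-1}dx+d\big((\varphi(x)-x^p)/p\big)$ for $x\in\widehat A$, $F(\operatorname{dlog}m)=\operatorname{dlog}m$ and $F_L(m)=m^p$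 for $m\in M$. In particular $\widehat\omega^*$ is $p$-compatible. (b) $W(\widehat\omega^*)_{\mathfrak{sat}}$ is a saturated log de Rham--Witt complex of $\underline R/\underline k$, for a morphism $e$ from $\underline R$ to $\big(W(\widehat\omega^*)^0_{\mathfrak{sat}}/V,\,M\big)$ such that $\widehat A\to A_1=R\xrightarrow{e}W(\widehat\omega^*)^0_{\mathfrak{sat}}/V$ is induced by $\kappa$ and $e$ is the identity on $M$. (c) Let $(\mathcal W\omega^*_{\underline R/\underline k},e)$ be any saturated log de Rham--Witt complex of $\underline R/\underline k$. There is exactly one morphism of log Dieudonné algebras over $W(\underline k)$ $$\upsilon:\widehat\omega^*_{\underline{\widehat A}/W(\underline k)}\longrightarrow\mathcal W\omega^*_{\underline R/\underline k}$$ that agrees with $e$ on $M$ and whose degree zero part induces $\widehat A\to R\xrightarrow{e}\mathcal W\omega^0_{\underline R/\underline k}/V\mathcal W\omega^0_{\underline R/\underline k}$ modulo $V$. It factors uniquely through $\kappa$, and the resulting morphism is an isomorphism of log Dieudonné algebras $$W\big(\widehat\omega^*_{\underline{\widehat A}/W(\underline k)}\big)_{\mathfrak{sat}}\;\xrightarrow{\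 \sim\ }\;\mathcal W\omega^*_{\underline R/\underline k}.$$ -/

import Mathlib

universe u

/-- A log algebra (pre-log ring): a commutative ring `R` with a monoid homomorphism from a
commutative monoid `M` (written multiplicatively) to the multiplicative monoid of `R`. -/
structure LogRing where
  R : Type u
  M : Type u
  [ring : CommRing R]
  [mon : CommMonoid M]
  α : M →* R

attribute [instance] LogRing.ring LogRing.mon

namespace LogRing

/-- A morphism of log algebras. -/
@[ext]
structure Hom (A B : LogRing.{u}) where
  ring : A.R →+* B.R
  mon : A.M →* B.M
  comm : ∀ m, ring (A.α m) = B.α (mon m)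

def Hom.comp {A B C : LogRing.{u}} (g : Hom B C) (f : Hom A B) : Hom A C where
  ring := g.ring.comp f.ring
  mon := g.mon.comp f.mon
  comm m := by simp [f.comm, g.comm]

/-- The log algebra `(S, M)` obtained from `(R, M)` and a ring homomorphism `R → S`. -/
def push (A : LogRing.{u}) {S : Type u} [CommRing S] (r : A.R →+* S) : LogRing.{u} where
  R := S
  M := A.M
  α := (r : A.R →* S).comp A.α

/-- The relation on `M × Rˣ` whose quotient is the pushout of `M ← α⁻¹(Rˣ) → Rˣ`. -/
def assocCon (A : LogRing.{u}) : Con (A.M × A.Rˣ) :=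
  conGen fun x y => ∃ (m : A.M) (v : A.Rˣ), A.α m = v ∧ x = (m, 1) ∧ y = (1, v)

/-- The log structure associated with `(R, M)`, before sheafification: the monoid
`M ⊕_{α⁻¹(Rˣ)} Rˣ` with its map to `R`. -/
def assoc (A : LogRing.{u}) : LogRing.{u} where
  R := A.R
  M := A.assocCon.Quotient
  α := A.assocCon.lift (A.α.coprod (Units.coeHom A.R)) (by
    refine Con.conGen_le.mpr ?_
    rintro _ _ ⟨m, v, h, rfl, rfl⟩
    simp [Con.ker_rel, h])

/-- Functoriality of the associated log structure. -/
def Hom.assoc {A B : LogRing.{u}} (f : Hom A B) : Hom A.assoc B.assoc where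
  ring := f.ring
  mon := A.assocCon.lift
    (B.assocCon.mk'.comp (f.mon.prodMap (Units.map (f.ring : A.R →* B.R)))) (by
    refine Con.conGen_le.mpr ?_
    rintro _ _ ⟨m, v, h, rfl, rfl⟩
    change B.assocCon.mk' _ = B.assocCon.mk' _
    refine (Con.eq _).mpr (ConGen.Rel.of _ _
      ⟨f.mon m, Units.map (f.ring : A.R →* B.R) v, ?_, ?_, ?_⟩)
    · simp [← f.comm, h]
    · simp
    · simp)
  comm := by
    intro m
    induction m using Con.induction_on with
    | H x =>
      change f.ring (A.α x.1 * x.2) = B.α (f.mon x.1) * f.ring x.2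
      rw [map_mul, f.comm]

/-- The strict morphism `(R, M) → (S, M)` given by a ring homomorphism `R → S`. -/
def toPush (A : LogRing.{u}) {S : Type u} [CommRing S] (r : A.R →+* S) : Hom A (A.push r) where
  ring := r
  mon := MonoidHom.id A.M
  comm _ := rfl

/-- The strict morphism `(S, M) → (S', M)` for ring homomorphisms `R → S → S'`. -/
def pushHom (A : LogRing.{u}) {S S' : Type u} [CommRing S] [CommRing S'] (r : A.R →+* S)
    (r' : A.R →+* S') (g : S →+* S') (h : g.comp r = r') : Hom (A.push r) (A.push r') where
  ring := g
  mon := MonoidHom.id A.M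
  comm m := by subst h; rfl

/-- A fine monoid: integral (that is, cancellative) and finitely generated. -/
structure IsFineMonoid (M : Type u) [CommMonoid M] : Prop where
  integral : IsCancelMul M
  fg : Monoid.FG M

/-- The relation on `X.M × Y.M` whose quotient is the pushout of monoids `X.M ← B.M → Y.M`. -/
def pushoutCon {B X Y : LogRing.{u}} (f : Hom B X) (t : Hom B Y) : Con (X.M × Y.M) :=
  conGen fun x y => ∃ n : B.M, x = (f.mon n, 1) ∧ y = (1, t.mon n)

open scoped TensorProduct in
/-- The fibre product of log schemes, on the level of log algebras: the tensor product of the rings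
with the pushout of the monoids. -/
noncomputable def pushout {B X Y : LogRing.{u}} (f : Hom B X) (t : Hom B Y) : LogRing.{u} :=
  letI := f.ring.toAlgebra
  letI := t.ring.toAlgebra
  { R := X.R ⊗[B.R] Y.R
    M := (pushoutCon f t).Quotient
    α := (pushoutCon f t).lift
      ((((Algebra.TensorProduct.includeLeftRingHom : X.R →+* X.R ⊗[B.R] Y.R) :
          X.R →* X.R ⊗[B.R] Y.R).comp X.α).coprod
        (((Algebra.TensorProduct.includeRight : Y.R →ₐ[B.R] X.R ⊗[B.R] Y.R) :
          Y.R →* X.R ⊗[B.R] Y.R).comp Y.α)) (by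
        refine Con.conGen_le.mpr ?_
        rintro _ _ ⟨n, rfl, rfl⟩
        rw [Con.ker_rel]
        simp only [MonoidHom.coprod_apply, map_one, mul_one, one_mul, MonoidHom.comp_apply,
          MonoidHom.coe_coe, ← f.comm, ← t.comm]
        exact (Algebra.TensorProduct.includeLeft (R := B.R) (S := B.R) (A := X.R)
          (B := Y.R)).commutes (B.α n) |>.trans
          ((Algebra.TensorProduct.includeRight (R := B.R) (A := X.R)
          (B := Y.R)).commutes (B.α n)).symm) }

/-- Integral morphisms: every base change of `f` to a fine log scheme is again fine. Base changes
to affine fine log schemes with a global chart are enough, a base change is automatically coherent,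
and its log structure is integral when its stalks are cancellative (it does not matter here whether
stalks are taken in the étale or in the Zariski topology). -/
def Hom.IsIntegral {B X : LogRing.{u}} (f : Hom B X) : Prop :=
  ∀ (Y : LogRing.{u}), IsFineMonoid Y.M → ∀ (t : Hom B Y.assoc)
    (q : Ideal (pushout f t).R) [q.IsPrime],
    IsCancelMul ((pushout f t).push (algebraMap (pushout f t).R (Localization.AtPrime q))).assoc.M

/-- Log smooth morphisms of affine fine log schemes with global charts: finite presentation and
étale local existence of lifts along log thickenings `(T.R ⧸ I, T.M) ← (T.R, T.M)` with `I² = 0`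
and `T.M` fine. As `B.M` and `X.M` are finitely generated, morphisms of log schemes from
`Spec` of a ring are étale locally morphisms into `assoc` as below. -/
structure Hom.IsLogSmooth {B X : LogRing.{u}} (f : Hom B X) : Prop where
  fine_base : IsFineMonoid B.M
  fine : IsFineMonoid X.M
  finitePresentation : f.ring.FinitePresentation
  lift : ∀ (T : LogRing.{u}), IsFineMonoid T.M → ∀ (I : Ideal T.R), I ^ 2 = ⊥ →
    ∀ (s : Hom X (T.push (Ideal.Quotient.mk I)).assoc) (t : Hom B T.assoc),
      (T.toPush (Ideal.Quotient.mk I)).assoc.comp t = s.comp f →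
      ∃ (D : Type u) (_ : CommRing D) (_ : Algebra T.R D),
        Algebra.Etale T.R D ∧ Module.FaithfullyFlat T.R D ∧
        ∃ g : Hom X (T.push (algebraMap T.R D)).assoc,
          g.comp f = (T.toPush (algebraMap T.R D)).assoc.comp t ∧
          (T.pushHom (algebraMap T.R D)
              ((Ideal.Quotient.mk (I.map (algebraMap T.R D))).comp (algebraMap T.R D))
              (Ideal.Quotient.mk (I.map (algebraMap T.R D))) rfl).assoc.comp g =
            (T.pushHom (Ideal.Quotient.mk I)
              ((Ideal.Quotient.mk (I.map (algebraMap T.R D))).comp (algebraMap T.R D))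
              (Ideal.quotientMap (I.map (algebraMap T.R D)) (algebraMap T.R D)
                Ideal.le_comap_map) (by ext; rfl)).assoc.comp s

end LogRing

/-- A commutative differential graded algebra, concentrated in degrees `≥ 0`. The product of
`x : C i` and `y : C j` is `mul h x y : C n`, for any proof `h` of `i + j = n`. -/
structure CDGA where
  C : ℕ → Type u
  [grp : ∀ i, AddCommGroup (C i)]
  mul : ∀ {i j n : ℕ}, i + j = n → C i →+ C j →+ C n
  one : C 0
  d : ∀ i, C i →+ C (i + 1)
  one_mul : ∀ (i : ℕ) (x : C i), mul (zero_add i) one x = x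
  mul_assoc : ∀ {i j k ij jk n : ℕ} (h₁ : i + j = ij) (h₂ : ij + k = n) (h₃ : j + k = jk)
    (h₄ : i + jk = n) (x : C i) (y : C j) (z : C k),
    mul h₂ (mul h₁ x y) z = mul h₄ x (mul h₃ y z)
  mul_comm : ∀ {i j n : ℕ} (h : i + j = n) (h' : j + i = n) (x : C i) (y : C j),
    mul h x y = (-1 : ℤ) ^ (i * j) • mul h' y x
  mul_self : ∀ {i n : ℕ} (h : i + i = n) (x : C i), Odd i → mul h x x = 0
  d_d : ∀ (i : ℕ) (x : C i), d (i + 1) (d i x) = 0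
  leibniz : ∀ {i j n : ℕ} (h : i + j = n) (h₁ : i + 1 + j = n + 1) (h₂ : i + (j + 1) = n + 1)
    (x : C i) (y : C j), d n (mul h x y) = mul h₁ (d i x) y + (-1 : ℤ) ^ i • mul h₂ x (d j y)

attribute [instance] CDGA.grp

namespace CDGA

/-- The degree zero part of a cdga is a commutative ring. -/
instance commRing (A : CDGA.{u}) : CommRing (A.C 0) :=
  { A.grp 0 with
    mul := fun x y => A.mul (zero_add 0) x y
    one := A.one
    left_distrib := fun x y z => map_add (A.mul (zero_add 0) x) y z
    right_distrib := fun x y z => by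
      change A.mul (zero_add 0) (x + y) z = A.mul (zero_add 0) x z + A.mul (zero_add 0) y z
      rw [map_add, AddMonoidHom.add_apply]
    zero_mul := fun x => by
      change A.mul (zero_add 0) 0 x = 0
      rw [map_zero, AddMonoidHom.zero_apply]
    mul_zero := fun x => map_zero (A.mul (zero_add 0) x)
    mul_assoc := fun x y z => A.mul_assoc _ _ _ _ x y z
    one_mul := fun x => A.one_mul 0 x
    mul_one := fun x => by
      have h := A.mul_comm (zero_add 0) (zero_add 0) x A.one
      rw [A.one_mul, Nat.mul_zero, pow_zero, one_smul] at h
      exact h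
    mul_comm := fun x y => by
      have h := A.mul_comm (zero_add 0) (zero_add 0) x y
      rw [Nat.mul_zero, pow_zero, one_smul] at h
      exact h }

theorem mul_def (A : CDGA.{u}) (x y : A.C 0) : x * y = A.mul (zero_add 0) x y := rfl

theorem one_def (A : CDGA.{u}) : (1 : A.C 0) = A.one := rfl

end CDGA

/-- A log cdga over a base log algebra `B = (B.R, B.M)`: a cdga over `B.R`, a log structure on its
degree zero part under that of `B`, and a log derivation `(d, δ)` over `B` with `d ∘ δ = 0`. -/
structure LogCDGA (B : LogRing.{u}) where
  cdga : CDGA.{u}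
  ι : B.R →+* cdga.C 0
  d_ι : ∀ w, cdga.d 0 (ι w) = 0
  L : Type u
  [mon : CommMonoid L]
  α : L →* cdga.C 0
  ιL : B.M →* L
  α_ιL : ∀ n, α (ιL n) = ι (B.α n)
  δ : L → cdga.C 1
  δ_mul : ∀ l m, δ (l * m) = δ l + δ m
  d_α : ∀ l, cdga.d 0 (α l) = cdga.mul (zero_add 1) (α l) (δ l)
  δ_ιL : ∀ n, δ (ιL n) = 0
  d_δ : ∀ l, cdga.d 1 (δ l) = 0

attribute [instance] LogCDGA.mon

namespace LogCDGA

/-- The degree zero part as a log algebra. -/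
def zero {B : LogRing.{u}} (A : LogCDGA B) : LogRing.{u} where
  R := A.cdga.C 0
  M := A.L
  α := A.α

end LogCDGA

/-! ### Log differentials and the log de Rham complex -/

noncomputable section

namespace LogRing.Hom

variable {B A : LogRing.{u}} (f : Hom B A)

/-- The relations between the generators `d x` (`Sum.inl x`) and `dlog m` (`Sum.inr m`) of the
module of log differentials. -/
inductive OmegaRel : ((A.R ⊕ A.M) →₀ A.R) → Prop
  | add (x y : A.R) : OmegaRel
      (Finsupp.single (.inl (x + y)) 1 - (Finsupp.single (.inl x) 1 + Finsupp.single (.inl y) 1))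
  | mul (x y : A.R) : OmegaRel
      (Finsupp.single (.inl (x * y)) 1 - (Finsupp.single (.inl y) x + Finsupp.single (.inl x) y))
  | base (w : B.R) : OmegaRel (Finsupp.single (.inl (f.ring w)) 1)
  | dlog_mul (l m : A.M) : OmegaRel
      (Finsupp.single (.inr (l * m)) 1 - (Finsupp.single (.inr l) 1 + Finsupp.single (.inr m) 1))
  | d_α (l : A.M) : OmegaRel
      (Finsupp.single (.inl (A.α l)) 1 - Finsupp.single (.inr l) (A.α l))
  | dlog_base (n : B.M) : OmegaRel (Finsupp.single (.inr (f.mon n)) 1)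

/-- The module `ω¹` of log differentials of `A` over `B`, that is, the target of the universal log
derivation `(d, dlog)`. -/
abbrev Omega : Type u :=
  ((A.R ⊕ A.M) →₀ A.R) ⧸ Submodule.span A.R {z | f.OmegaRel z}

/-- The class of a generator. -/
def gen (g : A.R ⊕ A.M) : f.Omega := Submodule.Quotient.mk (Finsupp.single g 1)

theorem mk_single (g : A.R ⊕ A.M) (a : A.R) :
    (Submodule.Quotient.mk (Finsupp.single g a) : f.Omega) = a • f.gen g := by
  rw [gen, ← Submodule.Quotient.mk_smul, Finsupp.smul_single, smul_eq_mul, mul_one]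

theorem rel_eq_zero {z} (h : f.OmegaRel z) : (Submodule.Quotient.mk z : f.Omega) = 0 :=
  (Submodule.Quotient.mk_eq_zero _).mpr (Submodule.subset_span h)

theorem gen_add (x y : A.R) : f.gen (.inl (x + y)) = f.gen (.inl x) + f.gen (.inl y) := by
  have h := f.rel_eq_zero (.add x y)
  rwa [Submodule.Quotient.mk_sub, Submodule.Quotient.mk_add, sub_eq_zero] at h

theorem gen_mul (x y : A.R) :
    f.gen (.inl (x * y)) = x • f.gen (.inl y) + y • f.gen (.inl x) := by
  have h := f.rel_eq_zero (.mul x y)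
  rwa [Submodule.Quotient.mk_sub, Submodule.Quotient.mk_add, sub_eq_zero, mk_single, mk_single,
    mk_single, one_smul] at h

theorem gen_base (w : B.R) : f.gen (.inl (f.ring w)) = 0 := f.rel_eq_zero (.base w)

theorem gen_one : f.gen (.inl 1) = 0 := by
  have h := f.gen_base 1
  rwa [map_one] at h

theorem gen_dlog_mul (l m : A.M) :
    f.gen (.inr (l * m)) = f.gen (.inr l) + f.gen (.inr m) := by
  have h := f.rel_eq_zero (.dlog_mul l m)
  rwa [Submodule.Quotient.mk_sub, Submodule.Quotient.mk_add, sub_eq_zero] at h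

theorem gen_d_α (l : A.M) : f.gen (.inl (A.α l)) = A.α l • f.gen (.inr l) := by
  have h := f.rel_eq_zero (.d_α l)
  rwa [Submodule.Quotient.mk_sub, sub_eq_zero, mk_single, mk_single, one_smul] at h

theorem gen_dlog_base (n : B.M) : f.gen (.inr (f.mon n)) = 0 := f.rel_eq_zero (.dlog_base n)

/-- The exterior algebra `⋀ ω¹`. -/
abbrev Ext : Type u := ExteriorAlgebra A.R f.Omega

/-- The class of `d x` or `dlog m` in the exterior algebra. -/
def egen (g : A.R ⊕ A.M) : f.Ext := ExteriorAlgebra.ι A.R (f.gen g)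

theorem egen_add (x y : A.R) : f.egen (.inl (x + y)) = f.egen (.inl x) + f.egen (.inl y) := by
  rw [egen, gen_add, map_add]; rfl

theorem egen_mul (x y : A.R) :
    f.egen (.inl (x * y)) = x • f.egen (.inl y) + y • f.egen (.inl x) := by
  rw [egen, gen_mul, map_add, map_smul, map_smul]; rfl

theorem ι_anti (v w : f.Omega) :
    ExteriorAlgebra.ι A.R v * ExteriorAlgebra.ι A.R w =
      -(ExteriorAlgebra.ι A.R w * ExteriorAlgebra.ι A.R v) :=
  eq_neg_of_add_eq_zero_left (ExteriorAlgebra.ι_add_mul_swap v w)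

theorem egen_anti (v w) : f.egen v * f.egen w = -(f.egen w * f.egen v) := f.ι_anti _ _

theorem egen_sq (v) : f.egen v * f.egen v = 0 := ExteriorAlgebra.ι_sq_zero _

/-- The map `a g ↦ d a ∧ g` on the free module on the generators. -/
def dFree : ((A.R ⊕ A.M) →₀ A.R) →+ f.Ext :=
  Finsupp.liftAddHom fun g =>
    { toFun := fun a => f.egen (.inl a) * f.egen g
      map_zero' := by
        have h : f.egen (.inl 0) = 0 := by
          have h0 := f.egen_add 0 0
          rw [add_zero] at h0
          exact left_eq_add.mp h0
        rw [h, zero_mul]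
      map_add' := fun a b => by rw [egen_add, add_mul] }

theorem dFree_single (g : A.R ⊕ A.M) (a : A.R) :
    f.dFree (Finsupp.single g a) = f.egen (.inl a) * f.egen g := by
  exact Finsupp.liftAddHom_apply_single _ _ _

theorem dFree_rel {z} (h : f.OmegaRel z) (a : A.R) : f.dFree (a • z) = 0 := by
  cases h with
  | add x y =>
    simp only [smul_sub, smul_add, Finsupp.smul_single, map_sub, map_add, dFree_single,
      egen_add, smul_eq_mul, mul_one, mul_add, sub_self]
  | mul x y =>
    simp only [smul_sub, smul_add, Finsupp.smul_single, map_sub, map_add, dFree_single,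
      egen_mul, smul_eq_mul, mul_one, mul_add, add_mul, smul_mul_assoc, mul_smul_comm]
    rw [f.egen_anti (.inl x) (.inl y)]
    module
  | base w =>
    rw [Finsupp.smul_single, dFree_single]
    simp only [egen, gen_base, map_zero, mul_zero]
  | dlog_mul l m =>
    simp only [smul_sub, smul_add, Finsupp.smul_single, map_sub, map_add, dFree_single,
      egen, gen_dlog_mul, smul_eq_mul, mul_one, mul_add, sub_self]
  | d_α l =>
    simp only [smul_sub, Finsupp.smul_single, map_sub, dFree_single, smul_eq_mul, mul_one,
      egen_mul, add_mul, smul_mul_assoc]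
    have h : f.egen (.inl (A.α l)) = A.α l • f.egen (.inr l) := by
      rw [egen, gen_d_α, map_smul]; rfl
    rw [h, mul_smul_comm, smul_mul_assoc, egen_sq]
    simp
  | dlog_base n =>
    rw [Finsupp.smul_single, dFree_single]
    simp only [egen, gen_dlog_base, map_zero, mul_zero]

theorem dFree_span {z} (hz : z ∈ Submodule.span A.R {z | f.OmegaRel z}) :
    ∀ a : A.R, f.dFree (a • z) = 0 := by
  induction hz using Submodule.span_induction with
  | mem z h => exact f.dFree_rel h
  | zero => intro a; rw [smul_zero, map_zero]
  | add y z _ _ h₁ h₂ => intro a; rw [smul_add, map_add, h₁, h₂, add_zero]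
  | smul b z _ h => intro a; rw [smul_smul, h]

/-- The differential `ω¹ → ⋀² ω¹`. -/
def dOne : f.Omega →+ f.Ext :=
  QuotientAddGroup.lift (Submodule.span A.R {z | f.OmegaRel z}).toAddSubgroup f.dFree (by
    intro z hz
    have h := f.dFree_span hz 1
    rwa [one_smul] at h)

theorem dOne_smul_gen (a : A.R) (g : A.R ⊕ A.M) :
    f.dOne (a • f.gen g) = f.egen (.inl a) * f.egen g := by
  rw [← mk_single]
  exact f.dFree_single g a

theorem dOne_gen (g : A.R ⊕ A.M) : f.dOne (f.gen g) = 0 := by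
  rw [← one_smul A.R (f.gen g), dOne_smul_gen, egen, gen_one, map_zero, zero_mul]

theorem omega_induction {P : f.Omega → Prop} (h0 : P 0) (hadd : ∀ v w, P v → P w → P (v + w))
    (hgen : ∀ (a : A.R) (g : A.R ⊕ A.M), P (a • f.gen g)) (w : f.Omega) : P w := by
  induction w using Submodule.Quotient.induction_on with
  | H z =>
    induction z using Finsupp.induction_linear with
    | zero => exact h0
    | add v w hv hw => exact hadd _ _ hv hw
    | single g a => rw [mk_single]; exact hgen a g

theorem dOne_smul (a : A.R) (w : f.Omega) :
    f.dOne (a • w) = a • f.dOne w + f.egen (.inl a) * ExteriorAlgebra.ι A.R w := by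
  induction w using f.omega_induction with
  | h0 => simp
  | hadd v w hv hw => rw [smul_add, map_add, hv, hw, map_add, map_add, smul_add, mul_add]; abel
  | hgen b g =>
    rw [smul_smul, dOne_smul_gen, dOne_smul_gen, egen_mul, map_smul, add_mul, smul_mul_assoc,
      smul_mul_assoc, mul_smul_comm]
    rfl

/-- The sign involution of the exterior algebra. -/
abbrev sgn : f.Ext →ₐ[A.R] f.Ext := CliffordAlgebra.involute

theorem sgn_ι (w : f.Omega) :
    f.sgn (ExteriorAlgebra.ι A.R w) = -ExteriorAlgebra.ι A.R w :=
  CliffordAlgebra.involute_ι w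

theorem dOne_comm (w : f.Omega) (v : f.Omega) :
    f.dOne w * ExteriorAlgebra.ι A.R v = ExteriorAlgebra.ι A.R v * f.dOne w := by
  induction w using f.omega_induction with
  | h0 => simp
  | hadd v w hv hw => rw [map_add, add_mul, mul_add, hv, hw]
  | hgen b g =>
    rw [dOne_smul_gen, egen, egen, _root_.mul_assoc, f.ι_anti _ v, mul_neg, ← _root_.mul_assoc,
      f.ι_anti _ v, neg_mul, neg_neg, _root_.mul_assoc]

theorem sgn_dOne (w : f.Omega) : f.sgn (f.dOne w) = f.dOne w := by
  induction w using f.omega_induction with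
  | h0 => simp
  | hadd v w hv hw => rw [map_add, map_add, hv, hw]
  | hgen b g => rw [dOne_smul_gen, map_mul, egen, egen, sgn_ι, sgn_ι, neg_mul_neg]

theorem comm_ι (x : f.Ext) (w : f.Omega) :
    ExteriorAlgebra.ι A.R w * x = f.sgn x * ExteriorAlgebra.ι A.R w := by
  induction x using ExteriorAlgebra.induction with
  | algebraMap r => rw [AlgHom.commutes, Algebra.commutes]
  | ι v => rw [sgn_ι, f.ι_anti w v, neg_mul]
  | mul x y hx hy => rw [← _root_.mul_assoc, hx, _root_.mul_assoc, hy, map_mul, _root_.mul_assoc]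
  | add x y hx hy => rw [mul_add, hx, hy, map_add, add_mul]

/-- Pairs `(x, y)` of elements of the exterior algebra with the product
`(x, y) (x', y') = (x x', sgn x y' + y x')`; ring homomorphisms `x ↦ (x, d x)` into this ring
correspond to antiderivations `d`. -/
structure Dbl where
  fst : f.Ext
  snd : f.Ext

namespace Dbl

variable {f}

@[ext]
theorem ext' {x y : f.Dbl} (h₁ : x.fst = y.fst) (h₂ : x.snd = y.snd) : x = y := by
  cases x; cases y; cases h₁; cases h₂; rfl

instance : Zero f.Dbl := ⟨⟨0, 0⟩⟩
instance : One f.Dbl := ⟨⟨1, 0⟩⟩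
instance : Add f.Dbl := ⟨fun x y => ⟨x.fst + y.fst, x.snd + y.snd⟩⟩
instance : Neg f.Dbl := ⟨fun x => ⟨-x.fst, -x.snd⟩⟩
instance : Mul f.Dbl :=
  ⟨fun x y => ⟨x.fst * y.fst, f.sgn x.fst * y.snd + x.snd * y.fst⟩⟩

@[simp] theorem zero_fst : (0 : f.Dbl).fst = 0 := rfl
@[simp] theorem zero_snd : (0 : f.Dbl).snd = 0 := rfl
@[simp] theorem one_fst : (1 : f.Dbl).fst = 1 := rfl
@[simp] theorem one_snd : (1 : f.Dbl).snd = 0 := rfl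
@[simp] theorem add_fst (x y : f.Dbl) : (x + y).fst = x.fst + y.fst := rfl
@[simp] theorem add_snd (x y : f.Dbl) : (x + y).snd = x.snd + y.snd := rfl
@[simp] theorem neg_fst (x : f.Dbl) : (-x).fst = -x.fst := rfl
@[simp] theorem neg_snd (x : f.Dbl) : (-x).snd = -x.snd := rfl
@[simp] theorem mul_fst (x y : f.Dbl) : (x * y).fst = x.fst * y.fst := rfl
@[simp] theorem mul_snd (x y : f.Dbl) :
    (x * y).snd = f.sgn x.fst * y.snd + x.snd * y.fst := rfl

instance : Ring f.Dbl where
  add_assoc x y z := by ext <;> simp [add_assoc]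
  zero_add x := by ext <;> simp
  add_zero x := by ext <;> simp
  add_comm x y := by ext <;> simp [add_comm]
  nsmul := nsmulRec
  zsmul := zsmulRec
  neg_add_cancel x := by ext <;> simp
  left_distrib x y z := by
    ext
    · simp [mul_add]
    · simp only [mul_snd, add_fst, add_snd, mul_add]; abel
  right_distrib x y z := by
    ext
    · simp [add_mul]
    · simp only [mul_snd, add_fst, add_snd, add_mul, map_add]; abel
  zero_mul x := by ext <;> simp
  mul_zero x := by ext <;> simp
  one_mul x := by ext <;> simp
  mul_one x := by ext <;> simp
  mul_assoc x y z := by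
    ext
    · simp [_root_.mul_assoc]
    · simp only [mul_snd, mul_fst, map_mul, mul_add, add_mul, _root_.mul_assoc]; abel

instance : Algebra A.R f.Dbl :=
  RingHom.toAlgebra'
    { toFun := fun a => ⟨algebraMap A.R f.Ext a, f.egen (.inl a)⟩
      map_one' := by ext <;> simp [egen, gen_one]
      map_zero' := by
        have h := f.dFree_single (.inr 1) 0
        ext
        · simp
        · have h0 := f.egen_add 0 0
          rw [add_zero] at h0
          exact left_eq_add.mp h0
      map_add' := fun a b => by ext <;> simp [egen_add]
      map_mul' := fun a b => by
        ext
        · simp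
        · simp only [mul_snd, AlgHom.commutes, egen_mul, Algebra.smul_def]
          rw [Algebra.commutes b] }
    (by
      intro a x
      ext
      · exact Algebra.commutes a x.fst
      · change f.sgn (algebraMap A.R f.Ext a) * x.snd + f.egen (.inl a) * x.fst =
          f.sgn x.fst * f.egen (.inl a) + x.snd * algebraMap A.R f.Ext a
        rw [AlgHom.commutes, Algebra.commutes, egen, comm_ι]
        abel)

theorem algebraMap_fst (a : A.R) : (algebraMap A.R f.Dbl a).fst = algebraMap A.R f.Ext a := rfl
theorem algebraMap_snd (a : A.R) : (algebraMap A.R f.Dbl a).snd = f.egen (.inl a) := rfl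

end Dbl

/-- The ring homomorphism `x ↦ (x, d x)`. -/
def toDbl : f.Ext →ₐ[A.R] f.Dbl :=
  ExteriorAlgebra.lift A.R
    ⟨{ toFun := fun w => ⟨ExteriorAlgebra.ι A.R w, f.dOne w⟩
       map_add' := fun v w => by ext <;> simp
       map_smul' := fun a w => by
        rw [RingHom.id_apply, Algebra.smul_def]
        ext
        · simp [Dbl.algebraMap_fst, Algebra.smul_def]
        · rw [Dbl.mul_snd, Dbl.algebraMap_fst, Dbl.algebraMap_snd, AlgHom.commutes, dOne_smul,
            Algebra.smul_def] },
      fun w => by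
        ext
        · exact ExteriorAlgebra.ι_sq_zero w
        · change f.sgn (ExteriorAlgebra.ι A.R w) * f.dOne w + f.dOne w * ExteriorAlgebra.ι A.R w = 0
          rw [sgn_ι, dOne_comm, neg_mul, neg_add_cancel]⟩

theorem toDbl_ι (w : f.Omega) :
    f.toDbl (ExteriorAlgebra.ι A.R w) = ⟨ExteriorAlgebra.ι A.R w, f.dOne w⟩ :=
  ExteriorAlgebra.lift_ι_apply _ _ _ _

theorem toDbl_fst (x : f.Ext) : (f.toDbl x).fst = x := by
  induction x using ExteriorAlgebra.induction with
  | algebraMap r => rw [AlgHom.commutes]; rfl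
  | ι v => rw [toDbl_ι]
  | mul x y hx hy => rw [map_mul, Dbl.mul_fst, hx, hy]
  | add x y hx hy => rw [map_add, Dbl.add_fst, hx, hy]

/-- The differential of the log de Rham complex, on the whole exterior algebra: the antiderivation
with `d a = da` for `a ∈ A.R`, `d (a db) = da ∧ db` and `d (a dlog m) = da ∧ dlog m`. -/
def dExt : f.Ext →+ f.Ext where
  toFun x := (f.toDbl x).snd
  map_zero' := by rw [map_zero]; rfl
  map_add' x y := by rw [map_add]; rfl

theorem dExt_algebraMap (a : A.R) : f.dExt (algebraMap A.R f.Ext a) = f.egen (.inl a) := by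
  change (f.toDbl (algebraMap A.R f.Ext a)).snd = _
  rw [AlgHom.commutes]
  rfl

theorem dExt_ι (w : f.Omega) : f.dExt (ExteriorAlgebra.ι A.R w) = f.dOne w := by
  change (f.toDbl _).snd = _
  rw [toDbl_ι]

theorem dExt_mul (x y : f.Ext) : f.dExt (x * y) = f.dExt x * y + f.sgn x * f.dExt y := by
  change (f.toDbl _).snd = _
  rw [map_mul, Dbl.mul_snd, toDbl_fst, toDbl_fst, add_comm]
  rfl

theorem dExt_dOne (w : f.Omega) : f.dExt (f.dOne w) = 0 := by
  induction w using f.omega_induction with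
  | h0 => simp
  | hadd v w hv hw => rw [map_add, map_add, hv, hw, add_zero]
  | hgen a g =>
    rw [dOne_smul_gen, egen, egen, dExt_mul, dExt_ι, dExt_ι, dOne_gen, dOne_gen, mul_zero,
      zero_mul, add_zero]

theorem sgn_dExt (x : f.Ext) : f.sgn (f.dExt x) = -f.dExt (f.sgn x) := by
  induction x using ExteriorAlgebra.induction with
  | algebraMap r => rw [AlgHom.commutes, dExt_algebraMap, egen, sgn_ι]
  | ι v => rw [sgn_ι, map_neg, dExt_ι, sgn_dOne, neg_neg]
  | mul x y hx hy =>
    rw [dExt_mul, map_add, map_mul, map_mul, map_mul, dExt_mul, hx, hy, neg_mul, mul_neg]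
    abel
  | add x y hx hy => rw [map_add, map_add, map_add, map_add, hx, hy, neg_add]

theorem dExt_dExt (x : f.Ext) : f.dExt (f.dExt x) = 0 := by
  induction x using ExteriorAlgebra.induction with
  | algebraMap r => rw [dExt_algebraMap, egen, dExt_ι, dOne_gen]
  | ι v => rw [dExt_ι, dExt_dOne]
  | mul x y hx hy =>
    rw [dExt_mul, map_add, dExt_mul, dExt_mul, hx, hy, sgn_dExt]
    simp
  | add x y hx hy => rw [map_add, map_add, hx, hy, add_zero]

theorem sgn_of_mem {i : ℕ} {x : f.Ext} (hx : x ∈ ⋀[A.R]^i f.Omega) :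
    f.sgn x = (-1 : ℤ) ^ i • x := by
  induction hx using Submodule.pow_induction_on_left' with
  | algebraMap r => rw [AlgHom.commutes, pow_zero, one_smul]
  | add x y i hx hy h₁ h₂ => rw [map_add, h₁, h₂, smul_add]
  | mem_mul m hm i x hx h =>
    obtain ⟨w, rfl⟩ := hm
    rw [map_mul, h, sgn_ι, pow_succ, mul_smul_comm, neg_mul, mul_smul, smul_neg, neg_smul, one_smul,
      smul_neg]

theorem dExt_mem {i : ℕ} {x : f.Ext} (hx : x ∈ ⋀[A.R]^i f.Omega) :
    f.dExt x ∈ ⋀[A.R]^(i + 1) f.Omega := by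
  induction hx using Submodule.pow_induction_on_left' with
  | algebraMap r =>
    rw [dExt_algebraMap, zero_add, ExteriorAlgebra.exteriorPower, pow_one]
    exact LinearMap.mem_range_self _ _
  | add x y i hx hy h₁ h₂ => rw [map_add]; exact Submodule.add_mem _ h₁ h₂
  | mem_mul m hm i x hx h =>
    obtain ⟨w, rfl⟩ := hm
    rw [dExt_mul, dExt_ι, sgn_ι, neg_mul]
    refine Submodule.add_mem _ ?_ (Submodule.neg_mem _ ?_)
    · have h2 : f.dOne w ∈ ⋀[A.R]^2 f.Omega := by
        induction w using f.omega_induction with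
        | h0 => simp
        | hadd v w hv hw => rw [map_add]; exact Submodule.add_mem _ hv hw
        | hgen a g =>
          rw [dOne_smul_gen, ExteriorAlgebra.exteriorPower, pow_two]
          exact Submodule.mul_mem_mul (LinearMap.mem_range_self _ _)
            (LinearMap.mem_range_self _ _)
      have h3 := SetLike.mul_mem_graded (A := fun i : ℕ => ⋀[A.R]^i f.Omega) h2 hx
      have e : 2 + i = i + 1 + 1 := by omega
      simpa only [e] using h3
    · rw [ExteriorAlgebra.exteriorPower, pow_succ' _ (i + 1)]
      exact Submodule.mul_mem_mul (LinearMap.mem_range_self _ _) h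

theorem comm_of_mem {i j : ℕ} {x y : f.Ext} (hx : x ∈ ⋀[A.R]^i f.Omega)
    (hy : y ∈ ⋀[A.R]^j f.Omega) : x * y = (-1 : ℤ) ^ (i * j) • (y * x) := by
  induction hx using Submodule.pow_induction_on_left' with
  | algebraMap r => rw [Algebra.commutes, zero_mul, pow_zero, one_smul]
  | add x x' i hx hx' h₁ h₂ => rw [add_mul, mul_add, h₁, h₂, smul_add]
  | mem_mul m hm i x hx h =>
    obtain ⟨w, rfl⟩ := hm
    rw [_root_.mul_assoc, h, mul_smul_comm, ← _root_.mul_assoc, comm_ι, f.sgn_of_mem hy,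
      smul_mul_assoc, smul_mul_assoc, _root_.mul_assoc, smul_smul, ← pow_add, Nat.succ_mul]

theorem sq_of_mem {i : ℕ} {x : f.Ext} (hx : x ∈ ⋀[A.R]^i f.Omega) (hi : Odd i) : x * x = 0 := by
  induction hx using Submodule.pow_induction_on_left' with
  | algebraMap r => exact absurd hi (by decide)
  | add x y i hx hy h₁ h₂ =>
    rw [mul_add, add_mul, add_mul, h₁ hi, h₂ hi, f.comm_of_mem hx hy, (hi.mul hi).neg_one_pow]
    simp
  | mem_mul m hm i x hx h =>
    obtain ⟨w, rfl⟩ := hm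
    rw [_root_.mul_assoc, ← _root_.mul_assoc x, f.comm_of_mem hx (j := 1)
      (by rw [ExteriorAlgebra.exteriorPower, pow_one]; exact LinearMap.mem_range_self _ w), smul_mul_assoc,
      mul_smul_comm, _root_.mul_assoc, ← _root_.mul_assoc, ExteriorAlgebra.ι_sq_zero, zero_mul,
      smul_zero]

theorem one_mem_ext : (1 : f.Ext) ∈ ⋀[A.R]^0 f.Omega := by
  rw [ExteriorAlgebra.exteriorPower, pow_zero]; exact Submodule.one_le.mp le_rfl

theorem algebraMap_mem_ext (a : A.R) : algebraMap A.R f.Ext a ∈ ⋀[A.R]^0 f.Omega := by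
  rw [ExteriorAlgebra.exteriorPower, pow_zero]; exact Submodule.algebraMap_mem a

theorem ι_mem_ext (w : f.Omega) : ExteriorAlgebra.ι A.R w ∈ ⋀[A.R]^1 f.Omega := by
  rw [ExteriorAlgebra.exteriorPower, pow_one]; exact LinearMap.mem_range_self _ w

theorem mul_mem_ext {i j n : ℕ} (h : i + j = n) {x y : f.Ext} (hx : x ∈ ⋀[A.R]^i f.Omega)
    (hy : y ∈ ⋀[A.R]^j f.Omega) : x * y ∈ ⋀[A.R]^n f.Omega := by
  subst h
  exact SetLike.mul_mem_graded (A := fun i : ℕ => ⋀[A.R]^i f.Omega) hx hy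

/-- The cdga `⋀ ω¹` with the differential `d`. -/
def deRhamCDGA : CDGA.{u} where
  C i := ⋀[A.R]^i f.Omega
  mul h := AddMonoidHom.mk' (fun x => AddMonoidHom.mk'
      (fun y => ⟨x.1 * y.1, f.mul_mem_ext h x.2 y.2⟩)
      (fun y z => Subtype.ext (mul_add x.1 y.1 z.1)))
    (fun x y => by ext z; exact add_mul x.1 y.1 z.1)
  one := ⟨1, f.one_mem_ext⟩
  d i := AddMonoidHom.mk' (fun x => ⟨f.dExt x.1, f.dExt_mem x.2⟩)
    (fun x y => Subtype.ext (map_add f.dExt x.1 y.1))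
  one_mul i x := Subtype.ext (_root_.one_mul x.1)
  mul_assoc _ _ _ _ x y z := Subtype.ext (_root_.mul_assoc x.1 y.1 z.1)
  mul_comm _ _ x y := Subtype.ext (f.comm_of_mem x.2 y.2)
  mul_self _ x hi := Subtype.ext (f.sq_of_mem x.2 hi)
  d_d i x := Subtype.ext (f.dExt_dExt x.1)
  leibniz {i j n} h h₁ h₂ x y := Subtype.ext (by
    change f.dExt (x.1 * y.1) = f.dExt x.1 * y.1 + (-1 : ℤ) ^ i • (x.1 * f.dExt y.1)
    rw [dExt_mul, f.sgn_of_mem x.2, smul_mul_assoc])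

/-- The map from `A.R` to the degree zero part of the log de Rham complex. -/
def toDeRham : A.R →+* f.deRhamCDGA.C 0 where
  toFun a := ⟨algebraMap A.R f.Ext a, f.algebraMap_mem_ext a⟩
  map_one' := Subtype.ext (map_one (algebraMap A.R f.Ext))
  map_zero' := Subtype.ext (map_zero (algebraMap A.R f.Ext))
  map_add' a b := Subtype.ext (map_add (algebraMap A.R f.Ext) a b)
  map_mul' a b := Subtype.ext (map_mul (algebraMap A.R f.Ext) a b)

/-- The log de Rham complex `ω*` of `A` over `B`. -/
def deRham : LogCDGA B where
  cdga := f.deRhamCDGA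
  ι := f.toDeRham.comp f.ring
  d_ι w := Subtype.ext (by
    change f.dExt (algebraMap A.R f.Ext (f.ring w)) = 0
    rw [dExt_algebraMap, egen, gen_base, map_zero])
  L := A.M
  α := (f.toDeRham : A.R →* f.deRhamCDGA.C 0).comp A.α
  ιL := f.mon
  α_ιL n := congrArg f.toDeRham (f.comm n).symm
  δ l := ⟨f.egen (.inr l), f.ι_mem_ext _⟩
  δ_mul l m := Subtype.ext (by
    change f.egen (.inr (l * m)) = f.egen (.inr l) + f.egen (.inr m)
    rw [egen, gen_dlog_mul, map_add]; rfl)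
  d_α l := Subtype.ext (by
    change f.dExt (algebraMap A.R f.Ext (A.α l)) =
      algebraMap A.R f.Ext (A.α l) * f.egen (.inr l)
    rw [dExt_algebraMap, egen, gen_d_α, map_smul, Algebra.smul_def]; rfl)
  δ_ιL n := Subtype.ext (by
    change f.egen (.inr (f.mon n)) = 0
    rw [egen, gen_dlog_base, map_zero])
  d_δ l := Subtype.ext (by
    change f.dExt (f.egen (.inr l)) = 0
    rw [egen, dExt_ι, dOne_gen])

end LogRing.Hom

end

/-! ### Quotients and inverse limits of cdgas -/

noncomputable section

namespace CDGA

/-- A morphism of cdgas. -/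
@[ext]
structure Hom (A B : CDGA.{u}) where
  f : ∀ i, A.C i →+ B.C i
  map_one : f 0 A.one = B.one
  map_mul : ∀ {i j n : ℕ} (h : i + j = n) (x : A.C i) (y : A.C j),
    f n (A.mul h x y) = B.mul h (f i x) (f j y)
  map_d : ∀ (i : ℕ) (x : A.C i), f (i + 1) (A.d i x) = B.d i (f i x)

/-- A morphism of cdgas is a ring homomorphism in degree zero. -/
def Hom.zero {A B : CDGA.{u}} (g : Hom A B) : A.C 0 →+* B.C 0 :=
  { g.f 0 with
    map_one' := g.map_one
    map_mul' := fun x y => g.map_mul (zero_add 0) x y }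

theorem Hom.zero_apply {A B : CDGA.{u}} (g : Hom A B) (x : A.C 0) : g.zero x = g.f 0 x := rfl

def Hom.comp {A B D : CDGA.{u}} (g : Hom B D) (f : Hom A B) : Hom A D where
  f i := (g.f i).comp (f.f i)
  map_one := by simp [f.map_one, g.map_one]
  map_mul h x y := by simp [f.map_mul, g.map_mul]
  map_d i x := by simp [f.map_d, g.map_d]

/-- A differential graded ideal. -/
structure DGIdeal (A : CDGA.{u}) where
  I : ∀ i, AddSubgroup (A.C i)
  mul_mem : ∀ {i j n : ℕ} (h : i + j = n) (x : A.C i) {y : A.C j}, y ∈ I j → A.mul h x y ∈ I n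
  d_mem : ∀ {i : ℕ} {x : A.C i}, x ∈ I i → A.d i x ∈ I (i + 1)

variable {A : CDGA.{u}}

theorem DGIdeal.mul_mem_right (I : DGIdeal A) {i j n : ℕ} (h : i + j = n) {x : A.C i} (y : A.C j)
    (hx : x ∈ I.I i) : A.mul h x y ∈ I.I n := by
  rw [A.mul_comm h (by omega)]
  exact zsmul_mem (I.mul_mem _ y hx) _

/-- The quotient of a cdga by a differential graded ideal. -/
def quot (A : CDGA.{u}) (I : DGIdeal A) : CDGA.{u} where
  C i := A.C i ⧸ I.I i
  mul {i j n} h := QuotientAddGroup.lift (I.I i)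
    (AddMonoidHom.mk' (fun x => QuotientAddGroup.map (I.I j) (I.I n) (A.mul h x)
        (fun _ hy => I.mul_mem h x hy))
      (fun x y => by
        ext z
        change ((A.mul h (x + y) z : A.C n) : A.C n ⧸ I.I n) =
          ((A.mul h x z : A.C n) : A.C n ⧸ I.I n) + ((A.mul h y z : A.C n) : A.C n ⧸ I.I n)
        rw [map_add]; rfl))
    (fun x hx => by
      ext z
      exact (QuotientAddGroup.eq_zero_iff _).mpr (I.mul_mem_right h z hx))
  one := (A.one : A.C 0 ⧸ I.I 0)
  d i := QuotientAddGroup.map (I.I i) (I.I (i + 1)) (A.d i) (fun _ hx => I.d_mem hx)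
  one_mul i x := by
    induction x using QuotientAddGroup.induction_on with
    | H x => exact congrArg _ (A.one_mul i x)
  mul_assoc h₁ h₂ h₃ h₄ x y z := by
    induction x using QuotientAddGroup.induction_on with
    | H x =>
    induction y using QuotientAddGroup.induction_on with
    | H y =>
    induction z using QuotientAddGroup.induction_on with
    | H z => exact congrArg _ (A.mul_assoc h₁ h₂ h₃ h₄ x y z)
  mul_comm h h' x y := by
    induction x using QuotientAddGroup.induction_on with
    | H x =>
    induction y using QuotientAddGroup.induction_on with
    | H y => exact congrArg _ (A.mul_comm h h' x y)
  mul_self h x hi := by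
    induction x using QuotientAddGroup.induction_on with
    | H x => exact congrArg _ (A.mul_self h x hi)
  d_d i x := by
    induction x using QuotientAddGroup.induction_on with
    | H x => exact congrArg _ (A.d_d i x)
  leibniz h h₁ h₂ x y := by
    induction x using QuotientAddGroup.induction_on with
    | H x =>
    induction y using QuotientAddGroup.induction_on with
    | H y => exact congrArg _ (A.leibniz h h₁ h₂ x y)

/-- The projection to a quotient. -/
def toQuot (A : CDGA.{u}) (I : DGIdeal A) : Hom A (A.quot I) where
  f i := QuotientAddGroup.mk' (I.I i)
  map_one := rfl
  map_mul _ _ _ := rfl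
  map_d _ _ := rfl

/-- The projection between quotients. -/
def quotMap (A : CDGA.{u}) {I J : DGIdeal A} (h : ∀ i, I.I i ≤ J.I i) :
    Hom (A.quot I) (A.quot J) where
  f i := QuotientAddGroup.map (I.I i) (J.I i) (AddMonoidHom.id _) (h i)
  map_one := rfl
  map_mul h x y := by
    induction x using QuotientAddGroup.induction_on with
    | H x =>
    induction y using QuotientAddGroup.induction_on with
    | H y => rfl
  map_d i x := by
    induction x using QuotientAddGroup.induction_on with
    | H x => rfl

/-- The inverse limit of a tower of cdgas, formed degree by degree. -/
def lim (A : ℕ → CDGA.{u}) (π : ∀ r, Hom (A (r + 1)) (A r)) : CDGA.{u} where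
  C i := ({ carrier := {x | ∀ r, (π r).f i (x (r + 1)) = x r}
            zero_mem' := fun r => by simp
            add_mem' := fun {x y} hx hy r => by simp [hx r, hy r]
            neg_mem' := fun {x} hx r => by simp [hx r] } : AddSubgroup (∀ r, (A r).C i))
  mul {i j n} h := AddMonoidHom.mk' (fun x => AddMonoidHom.mk'
      (fun y => ⟨fun r => (A r).mul h (x.1 r) (y.1 r),
        fun r => by rw [(π r).map_mul, x.2 r, y.2 r]⟩)
      (fun y z => Subtype.ext (funext fun r => map_add ((A r).mul h (x.1 r)) _ _)))
    (fun x y => AddMonoidHom.ext fun z => Subtype.ext (funext fun r =>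
      DFunLike.congr_fun (map_add ((A r).mul h) (x.1 r) (y.1 r)) (z.1 r)))
  one := ⟨fun r => (A r).one, fun r => (π r).map_one⟩
  d i := AddMonoidHom.mk'
    (fun x => ⟨fun r => (A r).d i (x.1 r), fun r => by rw [(π r).map_d, x.2 r]⟩)
    (fun x y => Subtype.ext (funext fun r => map_add ((A r).d i) _ _))
  one_mul i x := Subtype.ext (funext fun r => (A r).one_mul i (x.1 r))
  mul_assoc h₁ h₂ h₃ h₄ x y z :=
    Subtype.ext (funext fun r => (A r).mul_assoc h₁ h₂ h₃ h₄ (x.1 r) (y.1 r) (z.1 r))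
  mul_comm h h' x y := Subtype.ext (funext fun r => (A r).mul_comm h h' (x.1 r) (y.1 r))
  mul_self h x hi := Subtype.ext (funext fun r => (A r).mul_self h (x.1 r) hi)
  d_d i x := Subtype.ext (funext fun r => (A r).d_d i (x.1 r))
  leibniz h h₁ h₂ x y := Subtype.ext (funext fun r => (A r).leibniz h h₁ h₂ (x.1 r) (y.1 r))

/-- The projections from the inverse limit. -/
def limProj (A : ℕ → CDGA.{u}) (π : ∀ r, Hom (A (r + 1)) (A r)) (r : ℕ) :
    Hom (lim A π) (A r) where
  f i := AddMonoidHom.mk' (fun x => x.1 r) (fun _ _ => rfl)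
  map_one := rfl
  map_mul _ _ _ := rfl
  map_d _ _ := rfl

/-- A decreasing filtration of a cdga by differential graded ideals. -/
structure Filtration (A : CDGA.{u}) where
  fil : ℕ → DGIdeal A
  anti : ∀ r i, (fil (r + 1)).I i ≤ (fil r).I i

/-- The completion with respect to a filtration. -/
def completion (A : CDGA.{u}) (G : Filtration A) : CDGA.{u} :=
  lim (fun r => A.quot (G.fil r)) (fun r => A.quotMap (G.anti r))

/-- The canonical map to the completion. -/
def toCompletion (A : CDGA.{u}) (G : Filtration A) : Hom A (A.completion G) where
  f i := AddMonoidHom.mk' (fun x => ⟨fun r => (x : A.C i ⧸ (G.fil r).I i), fun _ => rfl⟩)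
    (fun _ _ => rfl)
  map_one := rfl
  map_mul _ _ _ := rfl
  map_d _ _ := rfl

end CDGA

namespace LogCDGA

variable {B : LogRing.{u}}

/-- The log structure and log derivation induced along a morphism of cdgas. -/
def push (A : LogCDGA B) {D : CDGA.{u}} (g : CDGA.Hom A.cdga D) : LogCDGA B where
  cdga := D
  ι := g.zero.comp A.ι
  d_ι w := by
    change D.d 0 (g.f 0 (A.ι w)) = 0
    rw [← g.map_d, A.d_ι, map_zero]
  L := A.L
  α := (g.zero : A.cdga.C 0 →* D.C 0).comp A.α
  ιL := A.ιL
  α_ιL n := congrArg g.zero (A.α_ιL n)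
  δ l := g.f 1 (A.δ l)
  δ_mul l m := by rw [A.δ_mul, map_add]
  d_α l := by
    change D.d 0 (g.f 0 (A.α l)) = D.mul _ (g.f 0 (A.α l)) (g.f 1 (A.δ l))
    rw [← g.map_d, A.d_α, g.map_mul]
  δ_ιL n := by rw [A.δ_ιL, map_zero]
  d_δ l := by rw [← g.map_d, A.d_δ, map_zero]

end LogCDGA

end

/-! ### Functoriality of the log de Rham complex -/

noncomputable section

namespace LogRing.Hom

variable {B A B' A' : LogRing.{u}} {f : Hom B A} {f' : Hom B' A'} (g : Hom A A') (b : Hom B B')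
  (hgb : g.comp f = f'.comp b)

/-- The images of the generators. -/
def genMap : A.R ⊕ A.M → A'.R ⊕ A'.M := Sum.map g.ring g.mon

/-- The map of log differentials, on the free modules on the generators. -/
def omegaFree (f' : Hom B' A') : ((A.R ⊕ A.M) →₀ A.R) →+ f'.Omega :=
  Finsupp.liftAddHom fun t =>
    { toFun := fun a => g.ring a • f'.gen (g.genMap t)
      map_zero' := by rw [map_zero, zero_smul]
      map_add' := fun a b => by rw [map_add, add_smul] }

theorem omegaFree_single (t : A.R ⊕ A.M) (a : A.R) :
    g.omegaFree f' (Finsupp.single t a) = g.ring a • f'.gen (g.genMap t) :=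
  Finsupp.liftAddHom_apply_single _ _ _

theorem omegaFree_smul (a : A.R) (z : (A.R ⊕ A.M) →₀ A.R) :
    g.omegaFree f' (a • z) = g.ring a • g.omegaFree f' z := by
  induction z using Finsupp.induction_linear with
  | zero => simp
  | add v w hv hw => rw [smul_add, map_add, hv, hw, map_add, smul_add]
  | single t c => rw [Finsupp.smul_single, omegaFree_single, omegaFree_single, smul_eq_mul, map_mul,
      mul_smul]

theorem omegaFree_rel (hgb : g.comp f = f'.comp b) {z} (h : f.OmegaRel z) : g.omegaFree f' z = 0 := by
  cases h with
  | add x y =>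
    simp only [map_sub, map_add, omegaFree_single, map_one, one_smul, genMap, Sum.map_inl, gen_add,
      sub_self]
  | mul x y =>
    simp only [map_sub, map_add, map_mul, omegaFree_single, map_one, one_smul, genMap, Sum.map_inl,
      gen_mul, sub_self]
  | base w =>
    have h : g.ring (f.ring w) = f'.ring (b.ring w) := congrArg (fun t => Hom.ring t w) hgb
    rw [omegaFree_single, map_one, one_smul, genMap, Sum.map_inl, h, gen_base]
  | dlog_mul l m =>
    simp only [map_sub, map_add, map_mul, omegaFree_single, map_one, one_smul, genMap, Sum.map_inr,
      gen_dlog_mul, sub_self]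
  | d_α l =>
    simp only [map_sub, omegaFree_single, map_one, one_smul, genMap, Sum.map_inr, Sum.map_inl,
      g.comm, gen_d_α, sub_self]
  | dlog_base n =>
    have h : g.mon (f.mon n) = f'.mon (b.mon n) := congrArg (fun t => Hom.mon t n) hgb
    rw [omegaFree_single, map_one, one_smul, genMap, Sum.map_inr, h, gen_dlog_base]

/-- The map of log differentials. -/
def omegaMap : f.Omega →+ f'.Omega :=
  QuotientAddGroup.lift (Submodule.span A.R {z | f.OmegaRel z}).toAddSubgroup (g.omegaFree f') (by
    intro z hz
    change z ∈ Submodule.span A.R {z | f.OmegaRel z} at hz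
    change g.omegaFree f' z = 0
    induction hz using Submodule.span_induction with
    | mem z h => exact omegaFree_rel g b hgb h
    | zero => rw [map_zero]
    | add y z _ _ h₁ h₂ => rw [map_add, h₁, h₂, add_zero]
    | smul a z _ h => rw [omegaFree_smul, h, smul_zero])

theorem omegaMap_mk (z : (A.R ⊕ A.M) →₀ A.R) :
    omegaMap g b hgb (Submodule.Quotient.mk z) = g.omegaFree f' z := rfl

theorem omegaMap_gen (t : A.R ⊕ A.M) : omegaMap g b hgb (f.gen t) = f'.gen (g.genMap t) := by
  rw [gen, omegaMap_mk, omegaFree_single, map_one, one_smul]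

theorem omegaMap_smul (a : A.R) (w : f.Omega) :
    omegaMap g b hgb (a • w) = g.ring a • omegaMap g b hgb w := by
  induction w using Submodule.Quotient.induction_on with
  | H z => rw [← Submodule.Quotient.mk_smul, omegaMap_mk, omegaMap_mk, omegaFree_smul]

/-- The map of exterior algebras. -/
def extMap : f.Ext →+* f'.Ext :=
  letI : Algebra A.R f'.Ext := ((algebraMap A'.R f'.Ext).comp g.ring).toAlgebra'
    (fun a x => Algebra.commutes (g.ring a) x)
  (ExteriorAlgebra.lift A.R
    ⟨{ toFun := fun w => ExteriorAlgebra.ι A'.R (omegaMap g b hgb w)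
       map_add' := fun v w => by rw [map_add, map_add]
       map_smul' := fun a w => by
        rw [omegaMap_smul, map_smul, RingHom.id_apply, Algebra.smul_def, Algebra.smul_def]
        rfl },
      fun w => ExteriorAlgebra.ι_sq_zero _⟩ : f.Ext →ₐ[A.R] f'.Ext)

theorem extMap_algebraMap (a : A.R) :
    extMap g b hgb (algebraMap A.R f.Ext a) = algebraMap A'.R f'.Ext (g.ring a) := by
  let : Algebra A.R f'.Ext := ((algebraMap A'.R f'.Ext).comp g.ring).toAlgebra'
    (fun a x => Algebra.commutes (g.ring a) x)
  exact AlgHom.commutes (ExteriorAlgebra.lift A.R _ : f.Ext →ₐ[A.R] f'.Ext) a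

theorem extMap_ι (w : f.Omega) :
    extMap g b hgb (ExteriorAlgebra.ι A.R w) = ExteriorAlgebra.ι A'.R (omegaMap g b hgb w) := by
  let : Algebra A.R f'.Ext := ((algebraMap A'.R f'.Ext).comp g.ring).toAlgebra'
    (fun a x => Algebra.commutes (g.ring a) x)
  exact ExteriorAlgebra.lift_ι_apply A.R _ _ w

theorem extMap_egen (t : A.R ⊕ A.M) :
    extMap g b hgb (f.egen t) = f'.egen (g.genMap t) := by
  rw [egen, extMap_ι, omegaMap_gen, egen]

theorem extMap_sgn (x : f.Ext) : extMap g b hgb (f.sgn x) = f'.sgn (extMap g b hgb x) := by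
  induction x using ExteriorAlgebra.induction with
  | algebraMap r => rw [AlgHom.commutes, extMap_algebraMap, AlgHom.commutes]
  | ι v => rw [sgn_ι, map_neg, extMap_ι, sgn_ι]
  | mul x y hx hy => rw [map_mul, map_mul, hx, hy, map_mul, map_mul]
  | add x y hx hy => rw [map_add, map_add, hx, hy, map_add, map_add]

theorem extMap_dOne (w : f.Omega) :
    extMap g b hgb (f.dOne w) = f'.dOne (omegaMap g b hgb w) := by
  induction w using f.omega_induction with
  | h0 => simp
  | hadd v w hv hw => rw [map_add, map_add, hv, hw, map_add, map_add]
  | hgen a t =>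
    rw [dOne_smul_gen, map_mul, extMap_egen, extMap_egen, omegaMap_smul, omegaMap_gen,
      dOne_smul_gen]
    rfl

theorem extMap_dExt (x : f.Ext) : extMap g b hgb (f.dExt x) = f'.dExt (extMap g b hgb x) := by
  induction x using ExteriorAlgebra.induction with
  | algebraMap r => rw [dExt_algebraMap, extMap_algebraMap, dExt_algebraMap, extMap_egen]; rfl
  | ι v => rw [dExt_ι, extMap_dOne, extMap_ι, dExt_ι]
  | mul x y hx hy => rw [dExt_mul, map_add, map_mul, map_mul, hx, hy, extMap_sgn, map_mul, dExt_mul]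
  | add x y hx hy => rw [map_add, map_add, hx, hy, map_add, map_add]

theorem extMap_mem {i : ℕ} {x : f.Ext} (hx : x ∈ ⋀[A.R]^i f.Omega) :
    extMap g b hgb x ∈ ⋀[A'.R]^i f'.Omega := by
  induction hx using Submodule.pow_induction_on_left' with
  | algebraMap r => rw [extMap_algebraMap]; exact f'.algebraMap_mem_ext _
  | add x y i hx hy h₁ h₂ => rw [map_add]; exact Submodule.add_mem _ h₁ h₂
  | mem_mul m hm i x hx h =>
    obtain ⟨w, rfl⟩ := hm
    rw [map_mul, extMap_ι]
    exact f'.mul_mem_ext (Nat.add_comm 1 i) (f'.ι_mem_ext _) h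

/-- The map of log de Rham complexes induced by a commutative square of log algebras. -/
def deRhamMap : CDGA.Hom f.deRhamCDGA f'.deRhamCDGA where
  f i := AddMonoidHom.mk' (fun x => ⟨extMap g b hgb x.1, extMap_mem g b hgb x.2⟩)
    (fun x y => Subtype.ext (map_add (extMap g b hgb) x.1 y.1))
  map_one := Subtype.ext (map_one (extMap g b hgb))
  map_mul _ x y := Subtype.ext (map_mul (extMap g b hgb) x.1 y.1)
  map_d _ x := Subtype.ext (extMap_dExt g b hgb x.1)

end LogRing.Hom

end

/-! ### Dieudonné algebras, saturation, and completion along the Verschiebung -/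

noncomputable section

/-- A Dieudonné algebra: a cdga with a graded ring endomorphism `F` lifting the Frobenius in degree
zero and satisfying `d F = p F d`. -/
structure DieudonneAlgebra (p : ℕ) where
  cdga : CDGA.{u}
  F : ∀ i, cdga.C i →+ cdga.C i
  F_one : F 0 cdga.one = cdga.one
  F_mul : ∀ {i j n : ℕ} (h : i + j = n) (x : cdga.C i) (y : cdga.C j),
    F n (cdga.mul h x y) = cdga.mul h (F i x) (F j y)
  F_frob : ∀ x : cdga.C 0, ∃ y : cdga.C 0, F 0 x = x ^ p + (p : ℤ) • y
  d_F : ∀ (i : ℕ) (x : cdga.C i), cdga.d i (F i x) = (p : ℤ) • F (i + 1) (cdga.d i x)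

namespace DieudonneAlgebra

variable {p : ℕ}

/-- Torsion-freeness with respect to `p`. -/
def IsTorsionFree (A : DieudonneAlgebra.{u} p) : Prop :=
  ∀ (i : ℕ) (x : A.cdga.C i), (p : ℤ) • x = 0 → x = 0

theorem IsTorsionFree.pow {A : DieudonneAlgebra.{u} p} (hA : A.IsTorsionFree) (r : ℕ) {i : ℕ}
    {x : A.cdga.C i} (h : ((p : ℤ) ^ r) • x = 0) : x = 0 := by
  induction r with
  | zero => simpa using h
  | succ r ih => rw [pow_succ', mul_smul] at h; exact ih (hA _ _ h)

/-- `F` as a ring endomorphism of the degree zero part. -/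
def frob (A : DieudonneAlgebra.{u} p) : A.cdga.C 0 →+* A.cdga.C 0 :=
  { A.F 0 with
    map_one' := A.F_one
    map_mul' := fun x y => A.F_mul (zero_add 0) x y }

/-- The decalage `η_{p^r}`, the `r`-fold iterate of `η_p`:
`(η_{p^r} A)^i = {x ∈ p^{ri} A^i | d x ∈ p^{r(i+1)} A^{i+1}}`. As `i ≥ 0`, this is contained in
`A^i`. -/
def eta (A : DieudonneAlgebra.{u} p) (r i : ℕ) : AddSubgroup (A.cdga.C i) :=
  (zsmulAddGroupHom ((p : ℤ) ^ (r * i))).range ⊓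
    ((zsmulAddGroupHom ((p : ℤ) ^ (r * (i + 1)))).range).comap (A.cdga.d i)

theorem mem_eta {A : DieudonneAlgebra.{u} p} {r i : ℕ} {x : A.cdga.C i} : x ∈ A.eta r i ↔
    (∃ y : A.cdga.C i, (p : ℤ) ^ (r * i) • y = x) ∧
      ∃ z : A.cdga.C (i + 1), (p : ℤ) ^ (r * (i + 1)) • z = A.cdga.d i x := Iff.rfl

/-- The map `φ_F`, equal to `p^i F` in degree `i`. -/
def phi (A : DieudonneAlgebra.{u} p) (i : ℕ) : A.cdga.C i →+ A.cdga.C i :=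
  (zsmulAddGroupHom ((p : ℤ) ^ i)).comp (A.F i)

theorem phi_apply (A : DieudonneAlgebra.{u} p) (i : ℕ) (x : A.cdga.C i) :
    A.phi i x = (p : ℤ) ^ i • A.F i x := rfl

theorem phi_mul (A : DieudonneAlgebra.{u} p) {i j n : ℕ} (h : i + j = n) (x : A.cdga.C i)
    (y : A.cdga.C j) : A.phi n (A.cdga.mul h x y) = A.cdga.mul h (A.phi i x) (A.phi j y) := by
  subst h
  simp only [phi_apply, A.F_mul, map_zsmul, AddMonoidHom.coe_smul, Pi.smul_apply, smul_smul,
    pow_add]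
  rw [mul_comm]

theorem d_phi (A : DieudonneAlgebra.{u} p) (i : ℕ) (x : A.cdga.C i) :
    A.cdga.d i (A.phi i x) = A.phi (i + 1) (A.cdga.d i x) := by
  simp only [phi_apply, map_zsmul, A.d_F, smul_smul, pow_succ]

theorem phi_one (A : DieudonneAlgebra.{u} p) : A.phi 0 A.cdga.one = A.cdga.one := by
  rw [phi_apply, pow_zero, one_smul, A.F_one]

theorem F_phi (A : DieudonneAlgebra.{u} p) (i : ℕ) (x : A.cdga.C i) :
    A.F i (A.phi i x) = A.phi i (A.F i x) := by
  simp only [phi_apply, map_zsmul]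

theorem phi_mem_eta {A : DieudonneAlgebra.{u} p} {r i : ℕ} {x : A.cdga.C i} (hx : x ∈ A.eta r i) :
    A.phi i x ∈ A.eta (r + 1) i := by
  obtain ⟨⟨y, rfl⟩, z, hz⟩ := mem_eta.mp hx
  refine mem_eta.mpr ⟨⟨A.F i y, ?_⟩, A.F (i + 1) z, ?_⟩
  · rw [phi_apply, map_zsmul, smul_smul, ← pow_add]; congr 2; ring
  · rw [d_phi, ← hz, phi_apply, map_zsmul, smul_smul, ← pow_add]; congr 2; ring

theorem eta_mul_mem {A : DieudonneAlgebra.{u} p} {r i j n : ℕ} (h : i + j = n) {x : A.cdga.C i}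
    {y : A.cdga.C j} (hx : x ∈ A.eta r i) (hy : y ∈ A.eta r j) :
    A.cdga.mul h x y ∈ A.eta r n := by
  subst h
  obtain ⟨⟨x₀, hx₀⟩, x₁, hx₁⟩ := mem_eta.mp hx
  obtain ⟨⟨y₀, hy₀⟩, y₁, hy₁⟩ := mem_eta.mp hy
  refine mem_eta.mpr ⟨⟨A.cdga.mul rfl x₀ y₀, ?_⟩,
    A.cdga.mul (by omega) x₁ y₀ + (-1 : ℤ) ^ i • A.cdga.mul (by omega) x₀ y₁, ?_⟩
  · rw [← hx₀, ← hy₀]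
    simp only [map_zsmul, AddMonoidHom.coe_smul, Pi.smul_apply, smul_smul, ← pow_add]
    congr 2; ring
  · rw [A.cdga.leibniz rfl (by omega) (by omega), ← hx₁, ← hy₁, ← hx₀, ← hy₀]
    simp only [map_zsmul, AddMonoidHom.coe_smul, Pi.smul_apply, smul_smul, ← pow_add, smul_add]
    congr 2
    · congr 1; ring
    · ring

theorem eta_d_mem {A : DieudonneAlgebra.{u} p} {r i : ℕ} {x : A.cdga.C i} (hx : x ∈ A.eta r i) :
    A.cdga.d i x ∈ A.eta r (i + 1) :=
  mem_eta.mpr ⟨(mem_eta.mp hx).2, 0, by rw [A.cdga.d_d, smul_zero]⟩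

theorem eta_F_mem {A : DieudonneAlgebra.{u} p} {r i : ℕ} {x : A.cdga.C i} (hx : x ∈ A.eta r i) :
    A.F i x ∈ A.eta r i := by
  obtain ⟨⟨y, rfl⟩, z, hz⟩ := mem_eta.mp hx
  refine mem_eta.mpr ⟨⟨A.F i y, by rw [map_zsmul]⟩, (p : ℤ) • A.F (i + 1) z, ?_⟩
  rw [A.d_F, ← hz, map_zsmul, smul_comm]

theorem eta_one_mem (A : DieudonneAlgebra.{u} p) (r : ℕ) : A.cdga.one ∈ A.eta r 0 := by
  have h : A.cdga.d 0 A.cdga.one = 0 := by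
    have h := A.cdga.leibniz (zero_add 0) (by omega) (by omega) A.cdga.one A.cdga.one
    rw [A.cdga.one_mul, A.cdga.one_mul, A.cdga.mul_comm _ (by omega), A.cdga.one_mul] at h
    simpa using h
  exact mem_eta.mpr ⟨⟨A.cdga.one, by simp⟩, 0, by rw [h, smul_zero]⟩

theorem eta_zero_mem {A : DieudonneAlgebra.{u} p} {i : ℕ} (x : A.cdga.C i) : x ∈ A.eta 0 i :=
  mem_eta.mpr ⟨⟨x, by simp⟩, A.cdga.d i x, by simp⟩

/-- A Dieudonné algebra is saturated if it is `p`-torsion free and `φ_F : A → η_p A` is an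
isomorphism. -/
def IsSaturated (A : DieudonneAlgebra.{u} p) : Prop :=
  A.IsTorsionFree ∧ ∀ (i : ℕ), ∀ x ∈ A.eta 1 i, ∃! y : A.cdga.C i, A.phi i y = x

/-! #### The Verschiebung -/

section verschiebung

variable {A : DieudonneAlgebra.{u} p} (hA : A.IsSaturated)

theorem exists_V (hA : A.IsSaturated) {i : ℕ} (x : A.cdga.C i) : ∃! y : A.cdga.C i, A.F i y = (p : ℤ) • x := by
  have h : (p : ℤ) ^ (i + 1) • x ∈ A.eta 1 i :=
    mem_eta.mpr ⟨⟨(p : ℤ) • x, by rw [one_mul, smul_smul, pow_succ]⟩, A.cdga.d i x, by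
      rw [one_mul, map_zsmul]⟩
  obtain ⟨y, hy, hu⟩ := hA.2 i _ h
  have key : ∀ z : A.cdga.C i, A.F i z = (p : ℤ) • x ↔ A.phi i z = (p : ℤ) ^ (i + 1) • x := by
    intro z
    rw [phi_apply, pow_succ, mul_smul]
    refine ⟨fun h => by rw [h], fun h => ?_⟩
    rw [← sub_eq_zero, ← smul_sub] at h
    exact sub_eq_zero.mp (hA.1.pow _ h)
  exact ⟨y, (key y).mpr hy, fun z hz => hu z ((key z).mp hz)⟩

theorem F_injective (hA : A.IsSaturated) (i : ℕ) : Function.Injective (A.F i) := by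
  intro x y h
  have h0 : A.phi i x ∈ A.eta 1 i := phi_mem_eta (eta_zero_mem x)
  exact (hA.2 i _ h0).unique rfl (by rw [phi_apply, phi_apply, h])

/-- The Verschiebung: `V x` is the unique element with `F (V x) = p x`. -/
def V (i : ℕ) : A.cdga.C i →+ A.cdga.C i :=
  AddMonoidHom.mk' (fun x => (exists_V hA x).choose) (fun x y => by
    apply F_injective hA
    rw [map_add, (exists_V hA x).choose_spec.1, (exists_V hA y).choose_spec.1,
      (exists_V hA (x + y)).choose_spec.1, smul_add])

theorem F_V {i : ℕ} (x : A.cdga.C i) : A.F i (V hA i x) = (p : ℤ) • x :=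
  (exists_V hA x).choose_spec.1

theorem F_d_V {i : ℕ} (x : A.cdga.C i) :
    A.F (i + 1) (A.cdga.d i (V hA i x)) = A.cdga.d i x := by
  have h := A.d_F i (V hA i x)
  rw [F_V, map_zsmul, ← sub_eq_zero, ← smul_sub] at h
  exact (sub_eq_zero.mp (hA.1 _ _ h)).symm

theorem mul_V {i j n : ℕ} (h : i + j = n) (x : A.cdga.C i) (y : A.cdga.C j) :
    A.cdga.mul h x (V hA j y) = V hA n (A.cdga.mul h (A.F i x) y) := by
  apply F_injective hA
  rw [A.F_mul, F_V, F_V, map_zsmul]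

/-- The iterates of the Verschiebung. -/
def Vpow : (r i : ℕ) → A.cdga.C i →+ A.cdga.C i
  | 0, i => AddMonoidHom.id (A.cdga.C i)
  | r + 1, i => (Vpow r i).comp (V hA i)

theorem Vpow_succ (r : ℕ) {i : ℕ} (x : A.cdga.C i) :
    Vpow hA (r + 1) i x = V hA i (Vpow hA r i x) := by
  induction r generalizing x with
  | zero => rfl
  | succ r ih => exact ih (V hA i x)

theorem mul_Vpow (r : ℕ) {i j n : ℕ} (h : i + j = n) (x : A.cdga.C i) (y : A.cdga.C j) :
    ∃ z, A.cdga.mul h x (Vpow hA r j y) = Vpow hA r n z := by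
  induction r generalizing x y with
  | zero => exact ⟨_, rfl⟩
  | succ r ih =>
    obtain ⟨z, hz⟩ := ih (A.F i x) y
    exact ⟨z, by rw [Vpow_succ, mul_V, hz, Vpow_succ]⟩

theorem F_Vpow (r : ℕ) {i : ℕ} (x : A.cdga.C i) :
    A.F i (Vpow hA (r + 1) i x) = (p : ℤ) • Vpow hA r i x := by
  rw [Vpow_succ, F_V]

theorem F_d_Vpow (r : ℕ) {i : ℕ} (x : A.cdga.C i) :
    A.F (i + 1) (A.cdga.d i (Vpow hA (r + 1) i x)) = A.cdga.d i (Vpow hA r i x) := by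
  rw [Vpow_succ, F_d_V]

/-- The subgroup `d V^r A^{i-1}` of `A^i`. -/
def dVRange (r : ℕ) : (i : ℕ) → AddSubgroup (A.cdga.C i)
  | 0 => ⊥
  | i + 1 => (Vpow hA r i).range.map (A.cdga.d i)

/-- The differential graded ideal `V^r A + d V^r A`. -/
def vIdeal (r : ℕ) : CDGA.DGIdeal A.cdga where
  I i := (Vpow hA r i).range ⊔ dVRange hA r i
  mul_mem := by
    intro i j n h x y hy
    obtain ⟨_, ⟨u, rfl⟩, w, hw, rfl⟩ := AddSubgroup.mem_sup.mp hy
    rw [map_add]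
    refine add_mem ?_ ?_
    · obtain ⟨z, hz⟩ := mul_Vpow hA r h x u
      exact AddSubgroup.mem_sup_left ⟨z, hz.symm⟩
    · cases j with
      | zero =>
        rw [show w = 0 from hw, map_zero]
        exact zero_mem _
      | succ j =>
        obtain ⟨_, ⟨v, rfl⟩, rfl⟩ := hw
        subst h
        have hl := A.cdga.leibniz (rfl : i + j = i + j) (by omega : i + 1 + j = i + j + 1)
          (by omega) x (Vpow hA r j v)
        obtain ⟨z, hz⟩ := mul_Vpow hA r (rfl : i + j = i + j) x v
        obtain ⟨z', hz'⟩ := mul_Vpow hA r (by omega : i + 1 + j = i + j + 1) (A.cdga.d i x) v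
        rw [hz, hz'] at hl
        have hs : A.cdga.mul (by omega) x (A.cdga.d j (Vpow hA r j v)) =
            (-1 : ℤ) ^ i • (A.cdga.d (i + j) (Vpow hA r (i + j) z) -
              Vpow hA r (i + j + 1) z') := by
          rw [hl, add_sub_cancel_left, smul_smul, ← mul_pow]
          simp
        change A.cdga.mul _ x (A.cdga.d j (Vpow hA r j v)) ∈ _
        rw [hs]
        refine zsmul_mem (sub_mem (AddSubgroup.mem_sup_right ?_) (AddSubgroup.mem_sup_left ?_)) _
        · exact ⟨_, ⟨z, rfl⟩, rfl⟩
        · exact ⟨z', rfl⟩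
  d_mem := by
    intro i x hx
    obtain ⟨_, ⟨u, rfl⟩, w, hw, rfl⟩ := AddSubgroup.mem_sup.mp hx
    rw [map_add]
    refine add_mem (AddSubgroup.mem_sup_right ⟨_, ⟨u, rfl⟩, rfl⟩) ?_
    cases i with
    | zero =>
      rw [show w = 0 from hw, map_zero]
      exact zero_mem _
    | succ i =>
      obtain ⟨_, _, rfl⟩ := hw
      rw [A.cdga.d_d]
      exact zero_mem _

/-- The filtration `Fil^r = V^r A + d V^r A`. -/
def vFiltration : CDGA.Filtration A.cdga where
  fil := vIdeal hA
  anti r i := by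
    refine sup_le ?_ ?_
    · rintro _ ⟨x, rfl⟩
      exact AddSubgroup.mem_sup_left ⟨V hA i x, rfl⟩
    · cases i with
      | zero => exact bot_le
      | succ i =>
        rintro _ ⟨_, ⟨x, rfl⟩, rfl⟩
        exact AddSubgroup.mem_sup_right ⟨_, ⟨V hA i x, rfl⟩, rfl⟩

theorem F_mem_vIdeal (r : ℕ) {i : ℕ} {x : A.cdga.C i} (hx : x ∈ (vIdeal hA (r + 1)).I i) :
    A.F i x ∈ (vIdeal hA r).I i := by
  obtain ⟨_, ⟨u, rfl⟩, w, hw, rfl⟩ := AddSubgroup.mem_sup.mp hx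
  rw [map_add, F_Vpow]
  refine add_mem (AddSubgroup.mem_sup_left (zsmul_mem (AddMonoidHom.mem_range.mpr ⟨u, rfl⟩) _)) ?_
  cases i with
  | zero =>
    rw [show w = 0 from hw, map_zero]
    exact zero_mem _
  | succ i =>
    obtain ⟨_, ⟨v, rfl⟩, rfl⟩ := hw
    change A.F (i + 1) (A.cdga.d i (Vpow hA (r + 1) i v)) ∈ _
    rw [F_d_Vpow]
    exact AddSubgroup.mem_sup_right ⟨_, ⟨v, rfl⟩, rfl⟩

theorem mem_vIdeal_zero {r : ℕ} {x : A.cdga.C 0} :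
    x ∈ (vIdeal hA r).I 0 ↔ ∃ y, Vpow hA r 0 y = x := by
  change x ∈ (Vpow hA r 0).range ⊔ ⊥ ↔ _
  rw [sup_bot_eq]
  rfl

theorem Vpow_sq (r : ℕ) (x : A.cdga.C 0) :
    ∃ z, Vpow hA (r + 1) 0 x * Vpow hA (r + 1) 0 x = (p : ℤ) • Vpow hA (r + 1) 0 z := by
  obtain ⟨z, hz⟩ := mul_Vpow hA r (zero_add 0) (Vpow hA r 0 x) x
  refine ⟨z, ?_⟩
  rw [CDGA.mul_def, Vpow_succ, mul_V, F_V, map_zsmul, AddMonoidHom.coe_smul, Pi.smul_apply,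
    map_zsmul, hz, Vpow_succ]

end verschiebung

end DieudonneAlgebra

end

/-! #### Completion along the Verschiebung -/

noncomputable section

namespace DieudonneAlgebra

variable {p : ℕ}

section completion

variable {A : DieudonneAlgebra.{u} p} (hA : A.IsSaturated)

theorem frob_sub [hp : Fact p.Prime] (r : ℕ) {a b s t : A.cdga.C 0}
    (hs : A.F 0 a = a ^ p + (p : ℤ) • s) (ht : A.F 0 b = b ^ p + (p : ℤ) • t)
    (h : a - b ∈ (vIdeal hA (r + 1)).I 0) : s - t ∈ (vIdeal hA r).I 0 := by
  obtain ⟨w, hw⟩ := (mem_vIdeal_zero hA).mp h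
  obtain ⟨z, hz⟩ := Vpow_sq hA r w
  have hFw : A.F 0 a - A.F 0 b = (p : ℤ) • Vpow hA r 0 w := by
    rw [← map_sub, ← hw, F_Vpow]
  set v := Vpow hA (r + 1) 0 w with hv
  obtain ⟨c, hc⟩ := exists_add_pow_prime_eq hp.out b v
  have hvp : v ^ p = (p : ℤ) • (Vpow hA (r + 1) 0 z * v ^ (p - 2)) := by
    rw [← congrArg (v ^ ·) (Nat.sub_add_cancel hp.out.two_le)]
    rw [pow_add, pow_two, hz, mul_smul_comm, mul_comm]
  have hab : a = b + v := by rw [hw]; ring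
  have key : s - t = Vpow hA r 0 w - Vpow hA (r + 1) 0 z * v ^ (p - 2) - v * (b * c) := by
    refine sub_eq_zero.mp (hA.1 0 _ ?_)
    rw [hs, ht, hab, hc, hvp] at hFw
    simp only [zsmul_eq_mul] at hFw ⊢
    push_cast at hFw ⊢
    linear_combination hFw
  have hz1 : Vpow hA (r + 1) 0 z ∈ (vIdeal hA r).I 0 :=
    (vFiltration hA).anti r 0 ((mem_vIdeal_zero hA).mpr ⟨z, rfl⟩)
  have hv1 : v ∈ (vIdeal hA r).I 0 :=
    (vFiltration hA).anti r 0 ((mem_vIdeal_zero hA).mpr ⟨w, rfl⟩)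
  rw [key]
  exact sub_mem (sub_mem ((mem_vIdeal_zero hA).mpr ⟨w, rfl⟩)
    ((vIdeal hA r).mul_mem_right (zero_add 0) _ hz1)) ((vIdeal hA r).mul_mem_right (zero_add 0) _ hv1)

/-- The map `A / Fil^(r+1) → A / Fil^r` induced by `F`. -/
def vF (r i : ℕ) :
    (A.cdga.quot (vIdeal hA (r + 1))).C i →+ (A.cdga.quot (vIdeal hA r)).C i :=
  QuotientAddGroup.map _ _ (A.F i) (fun _ h => F_mem_vIdeal hA r h)

theorem vF_quotMap (r i : ℕ) (x : (A.cdga.quot (vIdeal hA (r + 2))).C i) :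
    (A.cdga.quotMap ((vFiltration hA).anti r)).f i (vF hA (r + 1) i x) =
      vF hA r i ((A.cdga.quotMap ((vFiltration hA).anti (r + 1))).f i x) := by
  induction x using QuotientAddGroup.induction_on with
  | H x => rfl

theorem vF_mul (r : ℕ) {i j n : ℕ} (h : i + j = n) (x : (A.cdga.quot (vIdeal hA (r + 1))).C i)
    (y : (A.cdga.quot (vIdeal hA (r + 1))).C j) :
    vF hA r n ((A.cdga.quot _).mul h x y) = (A.cdga.quot _).mul h (vF hA r i x) (vF hA r j y) := by
  induction x using QuotientAddGroup.induction_on with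
  | H x =>
  induction y using QuotientAddGroup.induction_on with
  | H y => exact congrArg _ (A.F_mul h x y)

theorem vF_d (r i : ℕ) (x : (A.cdga.quot (vIdeal hA (r + 1))).C i) :
    (A.cdga.quot _).d i (vF hA r i x) = (p : ℤ) • vF hA r (i + 1) ((A.cdga.quot _).d i x) := by
  induction x using QuotientAddGroup.induction_on with
  | H x => exact congrArg _ (A.d_F i x)

/-- The `V`-completion `W(A) = lim A / (V^r A + d V^r A)` of a saturated Dieudonné algebra. -/
def vCompletion [hp : Fact p.Prime] : DieudonneAlgebra.{u} p where
  cdga := A.cdga.completion (vFiltration hA)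
  F i := AddMonoidHom.mk' (fun x => ⟨fun r => vF hA r i (x.1 (r + 1)), fun r =>
      (vF_quotMap hA r i (x.1 (r + 2))).trans (congrArg (vF hA r i) (x.2 (r + 1)))⟩)
    (fun x y => Subtype.ext (funext fun r => map_add (vF hA r i) (x.1 (r + 1)) (y.1 (r + 1))))
  F_one := Subtype.ext (funext fun r => congrArg (QuotientAddGroup.mk' _) A.F_one)
  F_mul h x y := Subtype.ext (funext fun r => vF_mul hA r h (x.1 (r + 1)) (y.1 (r + 1)))
  F_frob x := by
    have h1 : ∀ r, ∃ a : A.cdga.C 0, (A.cdga.toQuot (vIdeal hA r)).f 0 a = x.1 r :=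
      fun r => QuotientAddGroup.mk'_surjective _ (x.1 r)
    choose a ha using h1
    choose θ hθ using fun r => A.F_frob (a r)
    have hsub : ∀ r, a (r + 1) - a r ∈ (vIdeal hA r).I 0 := by
      intro r
      refine (QuotientAddGroup.eq_zero_iff _).mp ?_
      change (A.cdga.toQuot (vIdeal hA r)).f 0 (a (r + 1) - a r) = 0
      rw [map_sub, ha r, ← x.2 r, ← ha (r + 1)]
      exact sub_self _
    refine ⟨⟨fun r => (A.cdga.toQuot (vIdeal hA r)).f 0 (θ (r + 1)), fun r => ?_⟩, ?_⟩
    · have := frob_sub hA r (hθ (r + 2)) (hθ (r + 1)) (hsub (r + 1))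
      change (A.cdga.toQuot (vIdeal hA r)).f 0 (θ (r + 2)) = _
      rw [← sub_eq_zero, ← map_sub]
      exact (QuotientAddGroup.eq_zero_iff _).mpr this
    · refine Subtype.ext (funext fun r => ?_)
      change vF hA r 0 (x.1 (r + 1)) = (CDGA.limProj (fun r => A.cdga.quot (vIdeal hA r))
          (fun r => A.cdga.quotMap ((vFiltration hA).anti r)) r).zero (x ^ p) +
        (p : ℤ) • (A.cdga.toQuot (vIdeal hA r)).f 0 (θ (r + 1))
      have hx : (CDGA.limProj (fun r => A.cdga.quot (vIdeal hA r))
          (fun r => A.cdga.quotMap ((vFiltration hA).anti r)) r).zero x =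
          (A.cdga.toQuot (vIdeal hA r)).zero (a (r + 1)) := by
        change x.1 r = _
        rw [← x.2 r, ← ha (r + 1)]
        rfl
      have hl : (CDGA.limProj (fun r => A.cdga.quot (vIdeal hA r))
          (fun r => A.cdga.quotMap ((vFiltration hA).anti r)) r).zero (x ^ p) =
          (A.cdga.toQuot (vIdeal hA r)).zero (a (r + 1)) ^ p := by
        rw [← hx]
        exact map_pow (CDGA.limProj (fun r => A.cdga.quot (vIdeal hA r))
          (fun r => A.cdga.quotMap ((vFiltration hA).anti r)) r).zero x p
      refine Eq.trans ?_ (congrArg (· + (p : ℤ) • (A.cdga.toQuot (vIdeal hA r)).f 0 (θ (r + 1))) hl.symm)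
      rw [← map_pow, ← ha (r + 1)]
      change (A.cdga.toQuot (vIdeal hA r)).f 0 (A.F 0 (a (r + 1))) = _
      rw [hθ, map_add, map_zsmul]
      rfl
  d_F i x := Subtype.ext (funext fun r => vF_d hA r i (x.1 (r + 1)))

/-- The canonical map `A → W(A)`. -/
def toVCompletion : CDGA.Hom A.cdga (A.cdga.completion (vFiltration hA)) :=
  A.cdga.toCompletion (vFiltration hA)

theorem toVCompletion_F [hp : Fact p.Prime] (i : ℕ) (x : A.cdga.C i) :
    (toVCompletion hA).f i (A.F i x) = (vCompletion hA).F i ((toVCompletion hA).f i x) := rfl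

/-- A saturated Dieudonné algebra is strict if `A → W(A)` is an isomorphism. -/
def IsStrict : Prop := ∀ i, Function.Bijective ((toVCompletion hA).f i)

end completion

/-- The quotient by the `p`-power torsion. -/
def torsion (A : DieudonneAlgebra.{u} p) : CDGA.DGIdeal A.cdga where
  I i :=
    { carrier := {x | ∃ r : ℕ, (p : ℤ) ^ r • x = 0}
      zero_mem' := ⟨0, by simp⟩
      add_mem' := by
        rintro x y ⟨r, hr⟩ ⟨s, hs⟩
        refine ⟨r + s, ?_⟩
        rw [smul_add, pow_add, mul_smul, mul_smul, hs, smul_zero, add_zero, smul_comm, hr,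
          smul_zero]
      neg_mem' := by
        rintro x ⟨r, hr⟩
        exact ⟨r, by rw [smul_neg, hr, neg_zero]⟩ }
  mul_mem := by
    rintro i j n h x y ⟨r, hr⟩
    exact ⟨r, by rw [← map_zsmul, hr, map_zero]⟩
  d_mem := by
    rintro i x ⟨r, hr⟩
    exact ⟨r, by rw [← map_zsmul, hr, map_zero]⟩

/-- The quotient of a Dieudonné algebra by its `p`-power torsion. -/
def torsionQuot (A : DieudonneAlgebra.{u} p) : DieudonneAlgebra.{u} p where
  cdga := A.cdga.quot A.torsion
  F i := QuotientAddGroup.map (A.torsion.I i) (A.torsion.I i) (A.F i) (by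
    rintro x ⟨r, hr⟩
    exact ⟨r, by rw [← map_zsmul, hr, map_zero]⟩)
  F_one := congrArg (QuotientAddGroup.mk' _) A.F_one
  F_mul h x y := by
    induction x using QuotientAddGroup.induction_on with
    | H x =>
    induction y using QuotientAddGroup.induction_on with
    | H y => exact congrArg _ (A.F_mul h x y)
  F_frob x := by
    induction x using QuotientAddGroup.induction_on with
    | H x =>
      obtain ⟨y, hy⟩ := A.F_frob x
      refine ⟨(A.cdga.toQuot A.torsion).f 0 y, ?_⟩
      change (A.cdga.toQuot A.torsion).f 0 (A.F 0 x) = (A.cdga.toQuot A.torsion).zero x ^ p + _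
      rw [hy, ← map_pow, map_add, map_zsmul]
      rfl
  d_F i x := by
    induction x using QuotientAddGroup.induction_on with
    | H x => exact congrArg _ (A.d_F i x)

theorem torsionQuot_isTorsionFree (A : DieudonneAlgebra.{u} p) : A.torsionQuot.IsTorsionFree := by
  intro i x hx
  induction x using QuotientAddGroup.induction_on with
  | H x =>
    obtain ⟨r, hr⟩ := (QuotientAddGroup.eq_zero_iff _).mp
      (show (((p : ℤ) • x : A.cdga.C i) : A.cdga.C i ⧸ A.torsion.I i) = 0 from hx)
    refine (QuotientAddGroup.eq_zero_iff _).mpr ⟨r + 1, ?_⟩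
    rw [pow_succ, mul_smul, hr]

end DieudonneAlgebra

end

/-! #### Saturation -/

noncomputable section

namespace DieudonneAlgebra

variable {p : ℕ} (A : DieudonneAlgebra.{u} p)

/-- The iterates of `φ_F`. -/
def phiPow (i : ℕ) : ℕ → A.cdga.C i →+ A.cdga.C i
  | 0 => AddMonoidHom.id _
  | n + 1 => (A.phi i).comp (phiPow i n)

theorem phiPow_succ (i n : ℕ) (x : A.cdga.C i) :
    A.phiPow i (n + 1) x = A.phi i (A.phiPow i n x) := rfl

theorem phiPow_add (i m n : ℕ) (x : A.cdga.C i) :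
    A.phiPow i (m + n) x = A.phiPow i m (A.phiPow i n x) := by
  induction m with
  | zero => rw [Nat.zero_add]; rfl
  | succ m ih => rw [Nat.succ_add, phiPow_succ, phiPow_succ, ih]

theorem phiPow_mul (m : ℕ) {i j n : ℕ} (h : i + j = n) (x : A.cdga.C i) (y : A.cdga.C j) :
    A.phiPow n m (A.cdga.mul h x y) = A.cdga.mul h (A.phiPow i m x) (A.phiPow j m y) := by
  induction m with
  | zero => rfl
  | succ m ih => rw [phiPow_succ, ih, phi_mul]; rfl

theorem d_phiPow (m i : ℕ) (x : A.cdga.C i) :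
    A.cdga.d i (A.phiPow i m x) = A.phiPow (i + 1) m (A.cdga.d i x) := by
  induction m with
  | zero => rfl
  | succ m ih => rw [phiPow_succ, d_phi, ih]; rfl

theorem phiPow_one (m : ℕ) : A.phiPow 0 m A.cdga.one = A.cdga.one := by
  induction m with
  | zero => rfl
  | succ m ih => rw [phiPow_succ, ih, phi_one]

theorem F_phiPow (m i : ℕ) (x : A.cdga.C i) : A.F i (A.phiPow i m x) = A.phiPow i m (A.F i x) := by
  induction m with
  | zero => rfl
  | succ m ih => rw [phiPow_succ, F_phi, ih]; rfl

variable {A} in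
theorem phiPow_mem_eta {r n i : ℕ} {x : A.cdga.C i} (hx : x ∈ A.eta r i) :
    A.phiPow i n x ∈ A.eta (n + r) i := by
  induction n with
  | zero => rw [Nat.zero_add]; exact hx
  | succ n ih => rw [Nat.succ_add]; exact phi_mem_eta ih

/-- The transition maps `η_{p^r} A → η_{p^s} A`. -/
def tr (i : ℕ) {r s : ℕ} (h : r ≤ s) : A.eta r i →+ A.eta s i where
  toFun x := ⟨A.phiPow i (s - r) x.1, by
    have := phiPow_mem_eta (n := s - r) x.2
    rwa [Nat.sub_add_cancel h] at this⟩
  map_zero' := Subtype.ext (map_zero _)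
  map_add' x y := Subtype.ext (map_add _ x.1 y.1)

instance (i : ℕ) : DirectedSystem (fun r => A.eta r i) (fun _ _ h => A.tr i h) where
  map_self r x := Subtype.ext (by
    change A.phiPow i (r - r) x.1 = x.1
    rw [Nat.sub_self]; rfl)
  map_map t s r hrs hst x := Subtype.ext (by
    change A.phiPow i (t - s) (A.phiPow i (s - r) x.1) = A.phiPow i (t - r) x.1
    rw [← phiPow_add]; congr 2; omega)

/-- The degree `i` part of the saturation: the colimit of `A → η_p A → η_{p^2} A → …`. -/
def SatC (i : ℕ) : Type u := DirectLimit (fun r => A.eta r i) (fun _ _ h => A.tr i h)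

instance (i : ℕ) : AddCommGroup (A.SatC i) :=
  inferInstanceAs (AddCommGroup (DirectLimit (fun r => A.eta r i) (fun _ _ h => A.tr i h)))

/-- The map from the `r`-th term to the colimit. -/
def satMk (i r : ℕ) : A.eta r i →+ A.SatC i :=
  AddMonoidHom.mk' (fun x => (⟦⟨r, x⟩⟧ : A.SatC i)) (fun x y => (DirectLimit.add_def (G := fun r => A.eta r i)
    (f := fun _ _ h => A.tr i h) r x y).symm)

theorem satMk_surj {i : ℕ} (z : A.SatC i) : ∃ r x, z = A.satMk i r x :=
  DirectLimit.exists_eq_mk (F := fun r => A.eta r i) (fun _ _ h => A.tr i h) z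

theorem satMk_tr {i r s : ℕ} (h : r ≤ s) (x : A.eta r i) :
    A.satMk i s (A.tr i h x) = A.satMk i r x :=
  (Quotient.sound (DirectLimit.r_of_le (F := fun r => A.eta r i) (fun _ _ h => A.tr i h)
    ⟨r, x⟩ s h)).symm

theorem satMk_surj₂ {i j : ℕ} (z : A.SatC i) (w : A.SatC j) :
    ∃ r x y, z = A.satMk i r x ∧ w = A.satMk j r y := by
  obtain ⟨r, x, rfl⟩ := A.satMk_surj z
  obtain ⟨s, y, rfl⟩ := A.satMk_surj w
  exact ⟨max r s, _, _, (A.satMk_tr (le_max_left r s) x).symm,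
    (A.satMk_tr (le_max_right r s) y).symm⟩

theorem satMk_surj₃ {i j k : ℕ} (z : A.SatC i) (w : A.SatC j) (v : A.SatC k) :
    ∃ r x y t, z = A.satMk i r x ∧ w = A.satMk j r y ∧ v = A.satMk k r t := by
  obtain ⟨r, x, y, rfl, rfl⟩ := A.satMk_surj₂ z w
  obtain ⟨s, t, rfl⟩ := A.satMk_surj v
  exact ⟨max r s, _, _, _, (A.satMk_tr (le_max_left r s) x).symm,
    (A.satMk_tr (le_max_left r s) y).symm, (A.satMk_tr (le_max_right r s) t).symm⟩

/-- Multiplication on a term of the colimit. -/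
def etaMul {i j n : ℕ} (h : i + j = n) (r : ℕ) (x : A.eta r i) (y : A.eta r j) : A.eta r n :=
  ⟨A.cdga.mul h x.1 y.1, eta_mul_mem h x.2 y.2⟩

/-- The multiplication of the saturation, as a function. -/
def satMulFun {i j n : ℕ} (h : i + j = n) : A.SatC i → A.SatC j → A.SatC n :=
  DirectLimit.map₂ (F₁ := fun r => A.eta r i) (F₂ := fun r => A.eta r j) (F := fun r => A.eta r n)
    (fun _ _ h => A.tr i h) (fun _ _ h => A.tr j h) (fun _ _ h => A.tr n h) (fun r => A.etaMul h r)
    (fun r s _ x y => Subtype.ext (A.phiPow_mul (s - r) h x.1 y.1))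

theorem satMulFun_mk {i j n : ℕ} (h : i + j = n) (r : ℕ) (x : A.eta r i) (y : A.eta r j) :
    A.satMulFun h (A.satMk i r x) (A.satMk j r y) = A.satMk n r (A.etaMul h r x y) :=
  DirectLimit.map₂_def (F₁ := fun r => A.eta r i) (F₂ := fun r => A.eta r j)
    (F := fun r => A.eta r n) (fun _ _ h => A.tr i h) (fun _ _ h => A.tr j h)
    (fun _ _ h => A.tr n h) (fun r => A.etaMul h r) _ r x y

/-- The multiplication of the saturation. -/
def satMul {i j n : ℕ} (h : i + j = n) : A.SatC i →+ A.SatC j →+ A.SatC n :=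
  AddMonoidHom.mk' (fun z => AddMonoidHom.mk' (A.satMulFun h z) (fun w v => by
      obtain ⟨r, x, y, t, rfl, rfl, rfl⟩ := A.satMk_surj₃ z w v
      rw [← map_add, satMulFun_mk, satMulFun_mk, satMulFun_mk, ← map_add]
      exact congrArg _ (Subtype.ext (map_add (A.cdga.mul h x.1) y.1 t.1))))
    (fun z w => AddMonoidHom.ext fun v => (by
      obtain ⟨r, x, y, t, rfl, rfl, rfl⟩ := A.satMk_surj₃ z w v
      rw [← map_add, satMulFun_mk, satMulFun_mk, satMulFun_mk, ← map_add]
      exact congrArg _ (Subtype.ext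
        (DFunLike.congr_fun (map_add (A.cdga.mul h) x.1 y.1) t.1)) :
      A.satMulFun h (z + w) v = A.satMulFun h z v + A.satMulFun h w v))

theorem satMul_mk {i j n : ℕ} (h : i + j = n) (r : ℕ) (x : A.eta r i) (y : A.eta r j) :
    A.satMul h (A.satMk i r x) (A.satMk j r y) = A.satMk n r (A.etaMul h r x y) :=
  A.satMulFun_mk h r x y

/-- A map of the saturation induced by compatible maps on the terms of the colimit. -/
def satMap {i j : ℕ} (g : A.cdga.C i →+ A.cdga.C j) (hm : ∀ r, ∀ x ∈ A.eta r i, g x ∈ A.eta r j)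
    (hg : ∀ m x, A.phiPow j m (g x) = g (A.phiPow i m x)) : A.SatC i →+ A.SatC j :=
  AddMonoidHom.mk' (DirectLimit.map (F₁ := fun r => A.eta r i) (F₂ := fun r => A.eta r j)
    (fun _ _ h => A.tr i h) (fun _ _ h => A.tr j h) (fun r x => (⟨g x.1, hm r x.1 x.2⟩ : A.eta r j))
    (fun r s hrs x => Subtype.ext (hg (s - r) x.1))) (fun z w => by
      obtain ⟨r, x, y, rfl, rfl⟩ := A.satMk_surj₂ z w
      rw [← map_add]
      refine Eq.trans ?_ (map_add (A.satMk j r) ⟨g x.1, _⟩ ⟨g y.1, _⟩)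
      exact congrArg (A.satMk j r) (Subtype.ext (map_add g x.1 y.1)))

/-- The differential of the saturation. -/
def satD (i : ℕ) : A.SatC i →+ A.SatC (i + 1) :=
  A.satMap (A.cdga.d i) (fun _ _ h => eta_d_mem h) (fun m x => (A.d_phiPow m i x).symm)

/-- The Frobenius of the saturation. -/
def satF (i : ℕ) : A.SatC i →+ A.SatC i :=
  A.satMap (A.F i) (fun _ _ h => eta_F_mem h) (fun m x => (A.F_phiPow m i x).symm)

theorem satD_mk (i r : ℕ) (x : A.eta r i) :
    A.satD i (A.satMk i r x) = A.satMk (i + 1) r ⟨A.cdga.d i x.1, eta_d_mem x.2⟩ := rfl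

theorem satF_mk (i r : ℕ) (x : A.eta r i) :
    A.satF i (A.satMk i r x) = A.satMk i r ⟨A.F i x.1, eta_F_mem x.2⟩ := rfl

theorem satMk_eq_iff {i r : ℕ} (x y : A.eta r i) :
    A.satMk i r x = A.satMk i r y ↔ ∃ m, A.phiPow i m x.1 = A.phiPow i m y.1 := by
  constructor
  · intro h
    obtain ⟨s, hs, _, h⟩ := Quotient.exact h
    exact ⟨s - r, congrArg Subtype.val h⟩
  · rintro ⟨m, h⟩
    rw [← A.satMk_tr (Nat.le_add_left r m) x, ← A.satMk_tr (Nat.le_add_left r m) y]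
    refine congrArg _ (Subtype.ext ?_)
    change A.phiPow i (m + r - r) x.1 = A.phiPow i (m + r - r) y.1
    rw [Nat.add_sub_cancel, h]

/-- The cdga underlying the saturation. -/
def satCDGA : CDGA.{u} where
  C := A.SatC
  mul h := A.satMul h
  one := A.satMk 0 0 ⟨A.cdga.one, A.eta_one_mem 0⟩
  d := A.satD
  one_mul i z := by
    obtain ⟨r, x, rfl⟩ := A.satMk_surj z
    rw [← A.satMk_tr (Nat.zero_le r), satMul_mk]
    refine congrArg _ (Subtype.ext ?_)
    change A.cdga.mul _ (A.phiPow 0 (r - 0) A.cdga.one) x.1 = x.1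
    rw [phiPow_one, A.cdga.one_mul]
  mul_assoc h₁ h₂ h₃ h₄ z w v := by
    obtain ⟨r, x, y, t, rfl, rfl, rfl⟩ := A.satMk_surj₃ z w v
    simp only [satMul_mk]
    exact congrArg _ (Subtype.ext (A.cdga.mul_assoc h₁ h₂ h₃ h₄ x.1 y.1 t.1))
  mul_comm h h' z w := by
    obtain ⟨r, x, y, rfl, rfl⟩ := A.satMk_surj₂ z w
    rw [satMul_mk, satMul_mk, ← map_zsmul]
    exact congrArg _ (Subtype.ext (A.cdga.mul_comm h h' x.1 y.1))
  mul_self h z hi := by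
    obtain ⟨r, x, rfl⟩ := A.satMk_surj z
    rw [satMul_mk, ← map_zero (A.satMk _ r)]
    exact congrArg _ (Subtype.ext (A.cdga.mul_self h x.1 hi))
  d_d i z := by
    obtain ⟨r, x, rfl⟩ := A.satMk_surj z
    rw [satD_mk, satD_mk, ← map_zero (A.satMk _ r)]
    exact congrArg _ (Subtype.ext (A.cdga.d_d i x.1))
  leibniz h h₁ h₂ z w := by
    obtain ⟨r, x, y, rfl, rfl⟩ := A.satMk_surj₂ z w
    rw [satMul_mk, satD_mk, satD_mk, satD_mk, satMul_mk, satMul_mk, ← map_zsmul, ← map_add]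
    exact congrArg _ (Subtype.ext (A.cdga.leibniz h h₁ h₂ x.1 y.1))

theorem satCDGA_mul {i j n : ℕ} (h : i + j = n) (z : A.SatC i) (w : A.SatC j) :
    A.satCDGA.mul h z w = A.satMul h z w := rfl

/-- The terms of the colimit in degree zero, as subrings. -/
def etaZero (r : ℕ) : Subring (A.cdga.C 0) :=
  { A.eta r 0 with
    one_mem' := A.eta_one_mem r
    mul_mem' := fun hx hy => eta_mul_mem (zero_add 0) hx hy }

/-- `satMk 0 r` as a ring homomorphism. -/
def satMkZero (r : ℕ) : A.etaZero r →+* A.satCDGA.C 0 :=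
  { A.satMk 0 r with
    map_one' := by
      change A.satMk 0 r _ = A.satMk 0 0 _
      rw [← A.satMk_tr (Nat.zero_le r)]
      refine congrArg _ (Subtype.ext ?_)
      exact (A.phiPow_one (r - 0)).symm
    map_mul' := fun x y => (A.satMul_mk (zero_add 0) r x y).symm }

theorem d_pow (x : A.cdga.C 0) (n : ℕ) :
    A.cdga.d 0 (x ^ (n + 1)) =
      ((n + 1 : ℕ) : ℤ) • A.cdga.mul (zero_add 1) (x ^ n) (A.cdga.d 0 x) := by
  induction n with
  | zero =>
    have h : x ^ (0 + 1) = x := pow_one x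
    rw [h, pow_zero, CDGA.one_def, A.cdga.one_mul]
    exact (one_smul ℤ _).symm
  | succ n ih =>
    have h := A.cdga.leibniz (zero_add 0) (by omega) (by omega) (x ^ (n + 1)) x
    rw [← CDGA.mul_def, ← pow_succ, ih, map_zsmul, AddMonoidHom.smul_apply, pow_zero, one_smul,
      A.cdga.mul_comm _ (zero_add 1), ← A.cdga.mul_assoc (zero_add 0) (zero_add 1),
      ← CDGA.mul_def, ← pow_succ', Nat.mul_zero, pow_zero, one_smul] at h
    rw [h, Nat.cast_succ (n + 1), add_smul, one_smul]

variable {A} in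
theorem frob_mem_eta [hp : Fact p.Prime] (hA : A.IsTorsionFree) {r : ℕ} {x y : A.cdga.C 0}
    (hx : x ∈ A.eta r 0) (h : A.F 0 x = x ^ p + (p : ℤ) • y) : y ∈ A.eta r 0 := by
  obtain ⟨-, z, hz⟩ := mem_eta.mp hx
  refine mem_eta.mpr ⟨⟨y, by simp⟩,
    A.F 1 z - A.cdga.mul (zero_add 1) (x ^ (p - 1)) z, sub_eq_zero.mp (hA 1 _ ?_)⟩
  have h1 := congrArg (A.cdga.d 0) h
  have h2 := A.d_pow x (p - 1)
  rw [Nat.sub_add_cancel hp.out.one_le] at h2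
  rw [A.d_F, map_add, h2, map_zsmul, ← hz, map_zsmul, map_zsmul, ← sub_eq_iff_eq_add'] at h1
  rw [smul_sub, ← h1, smul_sub, smul_sub]
  exact sub_self _

variable {A}

/-- The saturation of a `p`-torsion free Dieudonné algebra. -/
def satOfTorsionFree [Fact p.Prime] (hA : A.IsTorsionFree) : DieudonneAlgebra.{u} p where
  cdga := A.satCDGA
  F := A.satF
  F_one := congrArg (A.satMk 0 0) (Subtype.ext A.F_one)
  F_mul h z w := by
    obtain ⟨r, x, y, rfl, rfl⟩ := A.satMk_surj₂ z w
    refine (congrArg (A.satF _) (A.satMul_mk h r x y)).trans (Eq.trans ?_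
      (A.satMul_mk h r ⟨A.F _ x.1, eta_F_mem x.2⟩ ⟨A.F _ y.1, eta_F_mem y.2⟩).symm)
    exact congrArg (A.satMk _ r) (Subtype.ext (A.F_mul h x.1 y.1))
  F_frob z := by
    obtain ⟨r, x, rfl⟩ := A.satMk_surj z
    obtain ⟨y, hy⟩ := A.F_frob x.1
    refine ⟨A.satMk 0 r ⟨y, frob_mem_eta hA x.2 hy⟩, ?_⟩
    let x' : A.etaZero r := ⟨x.1, x.2⟩
    have h : (A.satMkZero r x') ^ p = A.satMkZero r (x' ^ p) := (map_pow _ _ _).symm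
    refine Eq.trans ?_ (congrArg (· + (p : ℤ) • A.satMk 0 r ⟨y, frob_mem_eta hA x.2 hy⟩) h.symm)
    refine Eq.trans ?_ (congrArg (A.satMkZero r (x' ^ p) + ·)
      (map_zsmul (A.satMk 0 r) (p : ℤ) ⟨y, frob_mem_eta hA x.2 hy⟩))
    refine Eq.trans ?_ (map_add (A.satMk 0 r) ⟨(x' ^ p).1, (x' ^ p).2⟩
      ((p : ℤ) • ⟨y, frob_mem_eta hA x.2 hy⟩))
    exact congrArg (A.satMk 0 r) (Subtype.ext hy)
  d_F i z := by
    obtain ⟨r, x, rfl⟩ := A.satMk_surj z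
    change A.satD i (A.satF i _) = (p : ℤ) • A.satF _ (A.satD i _)
    rw [satF_mk, satD_mk, satD_mk, satF_mk, ← map_zsmul]
    exact congrArg _ (Subtype.ext (A.d_F i x.1))

/-- The canonical map to the saturation. -/
def toSatOfTorsionFree (A : DieudonneAlgebra.{u} p) : CDGA.Hom A.cdga A.satCDGA where
  f i := AddMonoidHom.mk' (fun x => A.satMk i 0 ⟨x, eta_zero_mem x⟩)
    (fun x y => map_add (A.satMk i 0) ⟨x, eta_zero_mem x⟩ ⟨y, eta_zero_mem y⟩)
  map_one := rfl
  map_mul h x y := (A.satMul_mk h 0 ⟨x, eta_zero_mem x⟩ ⟨y, eta_zero_mem y⟩).symm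
  map_d _ _ := rfl

theorem satOfTorsionFree_phi [Fact p.Prime] (hA : A.IsTorsionFree) (i r : ℕ) (x : A.eta r i) :
    (satOfTorsionFree hA).phi i (A.satMk i r x) =
      A.satMk i r ⟨A.phi i x.1, (A.eta r i).zsmul_mem (eta_F_mem x.2) _⟩ :=
  (map_zsmul (A.satMk i r) ((p : ℤ) ^ i) ⟨A.F i x.1, eta_F_mem x.2⟩).symm

theorem satMk_phi (i r : ℕ) (x : A.eta r i) :
    A.satMk i (r + 1) ⟨A.phi i x.1, phi_mem_eta x.2⟩ = A.satMk i r x := by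
  rw [← A.satMk_tr (Nat.le_succ r) x]
  refine congrArg _ (Subtype.ext ?_)
  change A.phi i x.1 = A.phiPow i (r + 1 - r) x.1
  rw [Nat.add_sub_cancel_left]
  rfl

theorem satMk_phiPow (i r m : ℕ) (x : A.eta r i) :
    A.satMk i (m + r) ⟨A.phiPow i m x.1, phiPow_mem_eta x.2⟩ = A.satMk i r x := by
  rw [← A.satMk_tr (Nat.le_add_left r m) x]
  refine congrArg _ (Subtype.ext ?_)
  change A.phiPow i m x.1 = A.phiPow i (m + r - r) x.1
  rw [Nat.add_sub_cancel]

theorem satOfTorsionFree_isSaturated [Fact p.Prime] (hA : A.IsTorsionFree) :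
    (satOfTorsionFree hA).IsSaturated := by
  have htf : (satOfTorsionFree hA).IsTorsionFree := by
    intro i z hz
    obtain ⟨r, x, rfl⟩ := A.satMk_surj z
    have hz' : A.satMk i r ((p : ℤ) • x) = A.satMk i r 0 := by
      rw [map_zsmul, map_zero]; exact hz
    obtain ⟨m, hm⟩ := (A.satMk_eq_iff _ _).mp hz'
    refine Eq.trans ((A.satMk_eq_iff _ _).mpr ⟨m, ?_⟩) (map_zero (A.satMk i r))
    change A.phiPow i m ((p : ℤ) • x.1) = A.phiPow i m 0 at hm
    change A.phiPow i m x.1 = A.phiPow i m 0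
    rw [map_zsmul, map_zero] at hm
    rw [hA i _ hm, map_zero]
  refine ⟨htf, fun i z hz => ?_⟩
  have hinj : ∀ z w : A.SatC i, (satOfTorsionFree hA).phi i z = (satOfTorsionFree hA).phi i w →
      z = w := by
    intro z w h
    obtain ⟨r, x, y, rfl, rfl⟩ := A.satMk_surj₂ z w
    rw [satOfTorsionFree_phi, satOfTorsionFree_phi] at h
    obtain ⟨m, hm⟩ := (A.satMk_eq_iff _ _).mp h
    refine (A.satMk_eq_iff _ _).mpr ⟨m + 1, ?_⟩
    rw [phiPow_add, phiPow_add]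
    exact hm
  suffices h : ∃ y, (satOfTorsionFree hA).phi i y = z from
    ⟨h.choose, h.choose_spec, fun y hy => hinj _ _ (hy.trans h.choose_spec.symm)⟩
  obtain ⟨⟨y, hy⟩, w, hw⟩ := mem_eta.mp hz
  obtain ⟨r, x, y, w, rfl, rfl, rfl⟩ := A.satMk_surj₃ z y w
  have hy' : A.satMk i r ((p : ℤ) ^ (1 * i) • y) = A.satMk i r x := by
    rw [map_zsmul]; exact hy
  have hw' : A.satMk (i + 1) r ((p : ℤ) ^ (1 * (i + 1)) • w) =
      A.satMk (i + 1) r ⟨A.cdga.d i x.1, eta_d_mem x.2⟩ := by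
    rw [map_zsmul]; exact hw
  obtain ⟨m, hm⟩ := (A.satMk_eq_iff _ _).mp hy'
  obtain ⟨n, hn⟩ := (A.satMk_eq_iff _ _).mp hw'
  change A.phiPow i m ((p : ℤ) ^ (1 * i) • y.1) = _ at hm
  change A.phiPow (i + 1) n ((p : ℤ) ^ (1 * (i + 1)) • w.1) =
    A.phiPow (i + 1) n (A.cdga.d i x.1) at hn
  have hm' : (p : ℤ) ^ (1 * i) • A.phiPow i (n + m) y.1 = A.phiPow i (n + m) x.1 := by
    rw [← map_zsmul, phiPow_add, hm, ← phiPow_add]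
  have hn' : (p : ℤ) ^ (1 * (i + 1)) • A.phiPow (i + 1) (n + m) w.1 =
      A.cdga.d i (A.phiPow i (n + m) x.1) := by
    rw [← map_zsmul, Nat.add_comm n m, phiPow_add, hn, ← phiPow_add, d_phiPow]
  obtain ⟨⟨y₁, hy₁⟩, -⟩ := mem_eta.mp (phiPow_mem_eta (n := n + m) y.2)
  obtain ⟨⟨w₁, hw₁⟩, -⟩ := mem_eta.mp (phiPow_mem_eta (n := n + m) w.2)
  have hX : A.phiPow i (n + m) x.1 ∈ A.eta (n + m + r + 1) i := by
    refine mem_eta.mpr ⟨⟨y₁, ?_⟩, w₁, ?_⟩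
    · rw [← hm', ← hy₁, smul_smul, ← pow_add]; congr 2; ring
    · rw [← hn', ← hw₁, smul_smul, ← pow_add]; congr 2; ring
  refine ⟨A.satMk i _ ⟨_, hX⟩, ?_⟩
  rw [satOfTorsionFree_phi]
  exact (satMk_phi i (n + m + r) ⟨_, phiPow_mem_eta x.2⟩).trans (satMk_phiPow i r (n + m) x)

/-- The saturation of a Dieudonné algebra: the colimit of
`A → η_p A → η_{p^2} A → …` after dividing out the `p`-power torsion. -/
def sat [Fact p.Prime] (A : DieudonneAlgebra.{u} p) : DieudonneAlgebra.{u} p :=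
  satOfTorsionFree A.torsionQuot_isTorsionFree

theorem sat_isSaturated [Fact p.Prime] (A : DieudonneAlgebra.{u} p) : A.sat.IsSaturated :=
  satOfTorsionFree_isSaturated A.torsionQuot_isTorsionFree

/-- The canonical map `A → A_sat`. -/
def toSat [Fact p.Prime] (A : DieudonneAlgebra.{u} p) : CDGA.Hom A.cdga A.sat.cdga :=
  (toSatOfTorsionFree A.torsionQuot).comp (A.cdga.toQuot A.torsion)

theorem toSat_F [Fact p.Prime] (A : DieudonneAlgebra.{u} p) (i : ℕ) (x : A.cdga.C i) :
    A.toSat.f i (A.F i x) = A.sat.F i (A.toSat.f i x) := rfl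

end DieudonneAlgebra

end

/-! ### Log Dieudonné algebras -/

noncomputable section

/-- The Frobenius structures `(F, F_L)` that turn a log cdga over `B` into a log Dieudonné
algebra. -/
@[ext]
structure LogDieudonneStructure (p : ℕ) {B : LogRing.{u}} (A : LogCDGA B) where
  F : ∀ i, A.cdga.C i →+ A.cdga.C i
  FL : A.L →* A.L
  F_one : F 0 A.cdga.one = A.cdga.one
  F_mul : ∀ {i j n : ℕ} (h : i + j = n) (x : A.cdga.C i) (y : A.cdga.C j),
    F n (A.cdga.mul h x y) = A.cdga.mul h (F i x) (F j y)
  F_frob : ∀ x : A.cdga.C 0, ∃ y : A.cdga.C 0, F 0 x = x ^ p + (p : ℤ) • y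
  d_F : ∀ (i : ℕ) (x : A.cdga.C i), A.cdga.d i (F i x) = (p : ℤ) • F (i + 1) (A.cdga.d i x)
  F_α : ∀ l, F 0 (A.α l) = A.α (FL l)
  δ_FL : ∀ l, A.δ (FL l) = (p : ℤ) • F 1 (A.δ l)

/-- A log Dieudonné algebra over `B`. -/
structure LogDieudonneAlgebra (p : ℕ) (B : LogRing.{u}) where
  alg : LogCDGA B
  str : LogDieudonneStructure p alg

namespace LogDieudonneAlgebra

variable {p : ℕ} {B : LogRing.{u}}

/-- The underlying Dieudonné algebra. -/
abbrev da (X : LogDieudonneAlgebra p B) : DieudonneAlgebra.{u} p where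
  cdga := X.alg.cdga
  F := X.str.F
  F_one := X.str.F_one
  F_mul := X.str.F_mul
  F_frob := X.str.F_frob
  d_F := X.str.d_F

/-- A log Dieudonné algebra is `p`-compatible if `F_L` is the `p`-th power map (the monoids are
written multiplicatively). -/
def IsPCompatible (X : LogDieudonneAlgebra p B) : Prop := ∀ l, X.str.FL l = l ^ p

/-- A log Dieudonné algebra is saturated if the underlying Dieudonné algebra is. -/
def IsSaturated (X : LogDieudonneAlgebra p B) : Prop := X.da.IsSaturated

/-- A saturated log Dieudonné algebra is strict if the underlying Dieudonné algebra is. -/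
def IsStrict (X : LogDieudonneAlgebra p B) : Prop :=
  ∃ h : X.IsSaturated, DieudonneAlgebra.IsStrict h

theorem IsStrict.isSaturated {X : LogDieudonneAlgebra p B} (h : X.IsStrict) : X.IsSaturated :=
  h.1

/-- Morphisms of log Dieudonné algebras over `B`. -/
@[ext]
structure Hom (X Y : LogDieudonneAlgebra p B) where
  f : CDGA.Hom X.alg.cdga Y.alg.cdga
  ψ : X.alg.L →* Y.alg.L
  f_F : ∀ (i : ℕ) (x : X.alg.cdga.C i), f.f i (X.str.F i x) = Y.str.F i (f.f i x)
  f_ι : ∀ w, f.f 0 (X.alg.ι w) = Y.alg.ι w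
  ψ_ιL : ∀ n, ψ (X.alg.ιL n) = Y.alg.ιL n
  f_α : ∀ l, f.f 0 (X.alg.α l) = Y.alg.α (ψ l)
  ψ_FL : ∀ l, ψ (X.str.FL l) = Y.str.FL (ψ l)
  f_δ : ∀ l, f.f 1 (X.alg.δ l) = Y.alg.δ (ψ l)

/-- The identity morphism. -/
def Hom.id (X : LogDieudonneAlgebra p B) : Hom X X where
  f := ⟨fun _ => AddMonoidHom.id _, rfl, fun _ _ _ => rfl, fun _ _ => rfl⟩
  ψ := MonoidHom.id _
  f_F _ _ := rfl
  f_ι _ := rfl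
  ψ_ιL _ := rfl
  f_α _ := rfl
  ψ_FL _ := rfl
  f_δ _ := rfl

/-- The composition of morphisms. -/
def Hom.comp {X Y Z : LogDieudonneAlgebra p B} (g : Hom Y Z) (h : Hom X Y) : Hom X Z where
  f := g.f.comp h.f
  ψ := g.ψ.comp h.ψ
  f_F i x := (congrArg (g.f.f i) (h.f_F i x)).trans (g.f_F i _)
  f_ι w := (congrArg (g.f.f 0) (h.f_ι w)).trans (g.f_ι w)
  ψ_ιL n := (congrArg g.ψ (h.ψ_ιL n)).trans (g.ψ_ιL n)
  f_α l := (congrArg (g.f.f 0) (h.f_α l)).trans (g.f_α _)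
  ψ_FL l := (congrArg g.ψ (h.ψ_FL l)).trans (g.ψ_FL _)
  f_δ l := (congrArg (g.f.f 1) (h.f_δ l)).trans (g.f_δ _)

/-- A morphism is an isomorphism if it has a two-sided inverse. -/
def Hom.IsIso {X Y : LogDieudonneAlgebra p B} (g : Hom X Y) : Prop :=
  ∃ h : Hom Y X, g.comp h = Hom.id Y ∧ h.comp g = Hom.id X

/-- The log Dieudonné algebra `(D, L)` obtained from a log Dieudonné algebra `(A, L)` and a morphism
of Dieudonné algebras `A → D`. -/
def push (X : LogDieudonneAlgebra p B) (D : DieudonneAlgebra.{u} p)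
    (g : CDGA.Hom X.alg.cdga D.cdga) (hg : ∀ i x, g.f i (X.str.F i x) = D.F i (g.f i x)) :
    LogDieudonneAlgebra p B where
  alg := X.alg.push g
  str :=
    { F := D.F
      FL := X.str.FL
      F_one := D.F_one
      F_mul := D.F_mul
      F_frob := D.F_frob
      d_F := D.d_F
      F_α := fun l => (hg 0 _).symm.trans (congrArg (g.f 0) (X.str.F_α l))
      δ_FL := fun l => by
        refine (congrArg (g.f 1) (X.str.δ_FL l)).trans ?_
        rw [map_zsmul, hg]
        rfl }

/-- The canonical morphism `(A, L) → (D, L)`. -/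
def toPush (X : LogDieudonneAlgebra p B) (D : DieudonneAlgebra.{u} p)
    (g : CDGA.Hom X.alg.cdga D.cdga) (hg : ∀ i x, g.f i (X.str.F i x) = D.F i (g.f i x)) :
    Hom X (X.push D g hg) where
  f := g
  ψ := MonoidHom.id _
  f_F := hg
  f_ι _ := rfl
  ψ_ιL _ := rfl
  f_α _ := rfl
  ψ_FL _ := rfl
  f_δ _ := rfl

variable [Fact p.Prime]

/-- The saturation of a log Dieudonné algebra. -/
def sat (X : LogDieudonneAlgebra p B) : LogDieudonneAlgebra p B :=
  X.push X.da.sat X.da.toSat X.da.toSat_F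

theorem sat_isSaturated (X : LogDieudonneAlgebra p B) : X.sat.IsSaturated := X.da.sat_isSaturated

/-- The canonical morphism to the saturation. -/
def toSat (X : LogDieudonneAlgebra p B) : Hom X X.sat :=
  X.toPush X.da.sat X.da.toSat X.da.toSat_F

/-- The `V`-completion of a saturated log Dieudonné algebra. -/
def vCompletion (X : LogDieudonneAlgebra p B) (hX : X.IsSaturated) : LogDieudonneAlgebra p B :=
  X.push (DieudonneAlgebra.vCompletion hX) (DieudonneAlgebra.toVCompletion hX)
    (DieudonneAlgebra.toVCompletion_F hX)

/-- The canonical morphism to the `V`-completion. -/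
def toVCompletion (X : LogDieudonneAlgebra p B) (hX : X.IsSaturated) : Hom X (X.vCompletion hX) :=
  X.toPush (DieudonneAlgebra.vCompletion hX) (DieudonneAlgebra.toVCompletion hX)
    (DieudonneAlgebra.toVCompletion_F hX)

/-- The `V`-completed saturation `W(A_sat)`. -/
def vSat (X : LogDieudonneAlgebra p B) : LogDieudonneAlgebra p B :=
  X.sat.vCompletion X.sat_isSaturated

/-- The canonical morphism `A → W(A_sat)`. -/
def toVSat (X : LogDieudonneAlgebra p B) : Hom X X.vSat :=
  (X.sat.toVCompletion X.sat_isSaturated).comp X.toSat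

end LogDieudonneAlgebra

/-! ### Witt vectors of log algebras, and the saturated log de Rham-Witt complex -/

namespace LogRing

/-- The log point `(k, N)`. -/
abbrev logPoint {k N : Type u} [Field k] [CommMonoid N] (β : N →* k) : LogRing.{u} := ⟨k, N, β⟩

/-- The log algebra `W(R, M) = (W(R), M)` with the log structure given by Teichmüller lifts. -/
abbrev witt (p : ℕ) [Fact p.Prime] (A : LogRing.{u}) : LogRing.{u} :=
  ⟨WittVector p A.R, A.M, (WittVector.teichmuller p).comp A.α⟩

/-- The log algebra `W_n(R, M) = (W_n(R), M)`. -/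
abbrev truncWitt (p : ℕ) [Fact p.Prime] (n : ℕ) (A : LogRing.{u}) : LogRing.{u} :=
  ⟨TruncatedWittVector p n A.R, A.M,
    ((WittVector.truncate n : WittVector p A.R →+* TruncatedWittVector p n A.R) :
      WittVector p A.R →* TruncatedWittVector p n A.R).comp ((WittVector.teichmuller p).comp A.α)⟩

/-- The restriction map `W_{n+1}(R, M) → W_n(R, M)`. -/
def truncWittRes (p : ℕ) [Fact p.Prime] (n : ℕ) (A : LogRing.{u}) :
    Hom (A.truncWitt p (n + 1)) (A.truncWitt p n) where
  ring := TruncatedWittVector.truncate n.le_succ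
  mon := MonoidHom.id _
  comm m := TruncatedWittVector.truncate_wittVector_truncate n.le_succ
    (WittVector.teichmuller p (A.α m))

end LogRing

/-- The Frobenius `F : W_{n+1}(S) → W_n(S)`. -/
def TruncatedWittVector.frob {p : ℕ} [Fact p.Prime] {S : Type u} [CommRing S] (n : ℕ)
    (x : TruncatedWittVector p (n + 1) S) : TruncatedWittVector p n S :=
  WittVector.truncate n (WittVector.frobenius x.out)

namespace DieudonneAlgebra

variable {p : ℕ} {A : DieudonneAlgebra.{u} p} (hA : A.IsSaturated)

/-- The ideal `V A⁰` of `A⁰`. -/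
def idealV : Ideal (A.cdga.C 0) where
  carrier := Set.range (V hA 0)
  zero_mem' := ⟨0, map_zero _⟩
  add_mem' := by
    rintro _ _ ⟨x, rfl⟩ ⟨y, rfl⟩
    exact ⟨x + y, map_add _ x y⟩
  smul_mem' := by
    rintro c _ ⟨x, rfl⟩
    exact ⟨A.cdga.mul (zero_add 0) (A.F 0 c) x, (mul_V hA (zero_add 0) c x).symm⟩

theorem natCast_mem_idealV : (p : A.cdga.C 0) ∈ idealV hA := by
  refine ⟨1, F_injective hA 0 ?_⟩
  rw [F_V, zsmul_one]
  have h : A.frob (p : A.cdga.C 0) = p := map_natCast _ p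
  exact (Int.cast_natCast p).trans h.symm

end DieudonneAlgebra

namespace LogDieudonneAlgebra

open LogRing

variable {p : ℕ} [Fact p.Prime] {k N : Type u} [Field k] [CharP k p] [PerfectRing k p]
  [CommMonoid N] {β : N →* k}

/-- The log algebra `(A⁰ / V A⁰, L)`. -/
def modV (X : LogDieudonneAlgebra p ((logPoint β).witt p)) (hX : X.IsSaturated) : LogRing.{u} :=
  X.alg.zero.push (Ideal.Quotient.mk (DieudonneAlgebra.idealV hX))

/-- The projection `A⁰ → A⁰ / V A⁰`. -/
def toModV (X : LogDieudonneAlgebra p ((logPoint β).witt p)) (hX : X.IsSaturated) :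
    X.alg.cdga.C 0 →+* (X.modV hX).R :=
  Ideal.Quotient.mk (DieudonneAlgebra.idealV hX)

/-- The structure map `k = W(k) / p → A⁰ / V A⁰`. -/
def modVRing (X : LogDieudonneAlgebra p ((logPoint β).witt p)) (hX : X.IsSaturated) :
    k →+* (X.modV hX).R :=
  (WittVector.constantCoeff : WittVector p k →+* k).liftOfSurjective (WittVector.constantCoeff_surjective p)
    ⟨(X.toModV hX).comp X.alg.ι, by
      rw [WittVector.ker_constantCoeff, Ideal.span_le, Set.singleton_subset_iff]
      change X.toModV hX (X.alg.ι (p : WittVector p k)) = 0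
      refine (congrArg (X.toModV hX) (map_natCast X.alg.ι p)).trans ?_
      exact Ideal.Quotient.eq_zero_iff_mem.mpr (DieudonneAlgebra.natCast_mem_idealV hX)⟩

theorem modVRing_apply (X : LogDieudonneAlgebra p ((logPoint β).witt p)) (hX : X.IsSaturated)
    (w : WittVector p k) : X.modVRing hX (WittVector.constantCoeff w) = X.toModV hX (X.alg.ι w) :=
  RingHom.liftOfRightInverse_comp_apply _ _ _ _ _

/-- `(A⁰ / V A⁰, L)` as a log algebra over `(k, N)`. -/
def modVBase (X : LogDieudonneAlgebra p ((logPoint β).witt p)) (hX : X.IsSaturated) :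
    LogRing.Hom (logPoint β) (X.modV hX) where
  ring := X.modVRing hX
  mon := X.alg.ιL
  comm n := by
    have h : β n = WittVector.constantCoeff (WittVector.teichmuller p (β n)) :=
      (WittVector.teichmuller_coeff_zero p (β n)).symm
    change X.modVRing hX (β n) = X.toModV hX (X.alg.α (X.alg.ιL n))
    rw [h, modVRing_apply]
    exact congrArg (X.toModV hX) (X.alg.α_ιL n).symm

/-- Functoriality of `(A⁰ / V A⁰, L)`. -/
def modVMap {X Y : LogDieudonneAlgebra p ((logPoint β).witt p)} (hX : X.IsSaturated)
    (hY : Y.IsSaturated) (h : Hom X Y) : LogRing.Hom (X.modV hX) (Y.modV hY) where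
  ring := Ideal.quotientMap (DieudonneAlgebra.idealV hY) h.f.zero (by
    rintro _ ⟨x, rfl⟩
    refine ⟨h.f.f 0 x, DieudonneAlgebra.F_injective hY 0 ?_⟩
    refine (DieudonneAlgebra.F_V hY (h.f.f 0 x)).trans ?_
    refine (map_zsmul (h.f.f 0) (p : ℤ) x).symm.trans ?_
    exact (congrArg (h.f.f 0) (DieudonneAlgebra.F_V hX x).symm).trans
      (h.f_F 0 (DieudonneAlgebra.V hX 0 x)))
  mon := h.ψ
  comm l := congrArg (Y.toModV hY) (h.f_α l)

/-- `(𝒲, e)` is a saturated log de Rham-Witt complex of the log algebra `R` over `(k, N)`: a strict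
`p`-compatible log Dieudonné algebra `𝒲` over `W(k, N)` with a morphism `e : R → 𝒲⁰ / V 𝒲⁰` of log
algebras over `(k, N)` that is universal for strict `p`-compatible log Dieudonné algebras. -/
structure IsSaturatedLogDRW {R : LogRing.{u}} (f : LogRing.Hom (logPoint β) R)
    (𝒲 : LogDieudonneAlgebra p ((logPoint β).witt p)) (h𝒲 : 𝒲.IsStrict)
    (e : LogRing.Hom R (𝒲.modV h𝒲.isSaturated)) : Prop where
  pCompatible : 𝒲.IsPCompatible
  over_base : e.comp f = 𝒲.modVBase h𝒲.isSaturated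
  universal : ∀ (D : LogDieudonneAlgebra p ((logPoint β).witt p)) (hD : D.IsStrict),
    D.IsPCompatible → ∀ g : LogRing.Hom R (D.modV hD.isSaturated),
      g.comp f = D.modVBase hD.isSaturated →
      ∃! h : Hom 𝒲 D, (modVMap h𝒲.isSaturated hD.isSaturated h).comp e = g

end LogDieudonneAlgebra

end

/-! ### Log Frobenius liftings -/

noncomputable section

open LogRing

/-- A `p`-compatible log Frobenius lifting of a log algebra `f : (k, N) → R = (R.R, R.M)`: a system
`(A_n, R.M) → W_n(k, N)` with ring homomorphisms `δ_n : A_n → W_n(R)` and `φ_n : A_{n+1} → A_n`,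
for `n ≥ 1`. Here `A n` stands for `A_{n+1}`. The monoid of each `A_n` is `R.M`, the restriction
maps are the identity on `R.M`, and `φ_n` is the `p`-th power map on `R.M`. -/
structure LogFrobeniusLifting (p : ℕ) [Fact p.Prime] {k N : Type u} [Field k] [CommMonoid N]
    {β : N →* k} {R : LogRing.{u}} (f : LogRing.Hom (logPoint β) R) where
  /-- The log algebras `(A_n, R.M)` over `W_n(k, N)`. -/
  A : ℕ → Type u
  [ring : ∀ n, CommRing (A n)]
  α : ∀ n, R.M →* A n
  ι : ∀ n, TruncatedWittVector p (n + 1) k →+* A n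
  ι_α : ∀ n x, ι n (((logPoint β).truncWitt p (n + 1)).α x) = α n (f.mon x)
  logSmooth : ∀ n, LogRing.Hom.IsLogSmooth
    (⟨ι n, f.mon, ι_α n⟩ : LogRing.Hom ((logPoint β).truncWitt p (n + 1)) ⟨A n, R.M, α n⟩)
  /-- The restriction maps, for which `(A_n, R.M)` is the base change of `(A_{n+1}, R.M)`. -/
  res : ∀ n, A (n + 1) →+* A n
  res_α : ∀ n m, res n (α (n + 1) m) = α n m
  res_ι : ∀ n w, res n (ι (n + 1) w) = ι n (TruncatedWittVector.truncate (n + 1).le_succ w)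
  res_surjective : ∀ n, Function.Surjective (res n)
  ker_res : ∀ n, RingHom.ker (res n) = (RingHom.ker (TruncatedWittVector.truncate (n + 1).le_succ :
    TruncatedWittVector p (n + 1 + 1) k →+* TruncatedWittVector p (n + 1) k)).map (ι (n + 1))
  /-- The identification of `(A_1, R.M)` with `R`, over `W_1(k, N) = (k, N)`. -/
  e : A 0 ≃+* R.R
  e_α : ∀ m, e (α 0 m) = R.α m
  e_ι : ∀ w, e (ι 0 w) = f.ring (w.coeff 0)
  /-- The morphisms `δ_n : W_n(Spec R, R.M) → (Spec A_n, R.M)`. -/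
  δ : ∀ n, A n →+* TruncatedWittVector p (n + 1) R.R
  δM : R.M →* R.M
  δ_α : ∀ n m, δ n (α n m) = (R.truncWitt p (n + 1)).α (δM m)
  res_δ : ∀ n x, TruncatedWittVector.truncate (n + 1).le_succ (δ (n + 1) x) = δ n (res n x)
  /-- The Frobenius morphisms `φ_n`. -/
  φ : ∀ n, A (n + 1) →+* A n
  φ_α : ∀ n m, φ n (α (n + 1) m) = α n (m ^ p)
  φ_res : ∀ n x, φ n (res (n + 1) x) = res n (φ (n + 1) x)
  φ_zero : ∀ x, e (φ 0 x) = e (res 0 x) ^ p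
  φ_ι : ∀ n w, φ n (ι (n + 1) w) = ι n (TruncatedWittVector.frob (n + 1) w)
  φ_δ : ∀ n x, δ n (φ n x) = TruncatedWittVector.frob (n + 1) (δ (n + 1) x)

attribute [instance] LogFrobeniusLifting.ring

namespace LogFrobeniusLifting

variable {p : ℕ} [Fact p.Prime] {k N : Type u} [Field k] [CommMonoid N]
    {β : N →* k} {R : LogRing.{u}} {f : LogRing.Hom (logPoint β) R} (D : LogFrobeniusLifting p f)

/-- The log algebra `(A_{n+1}, R.M)`. -/
abbrev logRing (n : ℕ) : LogRing.{u} := ⟨D.A n, R.M, D.α n⟩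

/-- The structure morphism of `(A_{n+1}, R.M)` over `W_{n+1}(k, N)`. -/
def base (n : ℕ) : LogRing.Hom ((logPoint β).truncWitt p (n + 1)) (D.logRing n) :=
  ⟨D.ι n, f.mon, D.ι_α n⟩

/-- The restriction maps as morphisms of log algebras. -/
def resHom (n : ℕ) : LogRing.Hom (D.logRing (n + 1)) (D.logRing n) :=
  ⟨D.res n, MonoidHom.id _, D.res_α n⟩

theorem resHom_comp_base (n : ℕ) : (D.resHom n).comp (D.base (n + 1)) =
    (D.base n).comp ((logPoint β).truncWittRes p (n + 1)) := by
  refine LogRing.Hom.ext (RingHom.ext fun w => D.res_ι n w) ?_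
  rfl

/-- The ring `Â = lim A_n`. -/
def hatA : Subring (∀ n, D.A n) where
  carrier := {x | ∀ n, D.res n (x (n + 1)) = x n}
  zero_mem' n := map_zero (D.res n)
  one_mem' n := map_one (D.res n)
  add_mem' {x y} hx hy n := (map_add (D.res n) (x (n + 1)) (y (n + 1))).trans
    (congrArg₂ (· + ·) (hx n) (hy n))
  mul_mem' {x y} hx hy n := (map_mul (D.res n) (x (n + 1)) (y (n + 1))).trans
    (congrArg₂ (· * ·) (hx n) (hy n))
  neg_mem' {x} hx n := (map_neg (D.res n) (x (n + 1))).trans (congrArg Neg.neg (hx n))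

/-- The Frobenius lift `φ = lim φ_n` on `Â`. -/
def hatφ (x : D.hatA) : D.hatA :=
  ⟨fun n => D.φ n (x.1 (n + 1)), fun n => by
    rw [← D.φ_res, x.2 (n + 1)]⟩

/-- The projection `Â → A_1 = R`. -/
def hatToR : D.hatA →+* R.R :=
  (D.e : D.A 0 →+* R.R).comp ((Pi.evalRingHom D.A 0).comp D.hatA.subtype)

/-- The restriction maps `ω*_{A_{n+1}/W_{n+1}(k,N)} → ω*_{A_n/W_n(k,N)}` of log de Rham
complexes. -/
def deRhamRes (n : ℕ) : CDGA.Hom (D.base (n + 1)).deRhamCDGA (D.base n).deRhamCDGA :=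
  LogRing.Hom.deRhamMap (D.resHom n) ((logPoint β).truncWittRes p (n + 1)) (D.resHom_comp_base n)

/-- The cdga `lim ω*_{A_n/W_n(k,N)}`. -/
def omegaCDGA : CDGA.{u} := CDGA.lim (fun n => (D.base n).deRhamCDGA) D.deRhamRes

/-- The map from `Â` to the degree zero part of the completed log de Rham complex. -/
def can : D.hatA →+* D.omegaCDGA.C 0 where
  toFun x := ⟨fun n => (D.base n).toDeRham (x.1 n), fun n => Subtype.ext (by
    change LogRing.Hom.extMap _ _ _ (algebraMap _ _ (x.1 (n + 1))) = algebraMap _ _ (x.1 n)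
    rw [LogRing.Hom.extMap_algebraMap]
    exact congrArg _ (x.2 n))⟩
  map_one' := Subtype.ext (funext fun n => map_one (D.base n).toDeRham)
  map_zero' := Subtype.ext (funext fun n => map_zero (D.base n).toDeRham)
  map_add' x y := Subtype.ext (funext fun n => map_add (D.base n).toDeRham (x.1 n) (y.1 n))
  map_mul' x y := Subtype.ext (funext fun n => map_mul (D.base n).toDeRham (x.1 n) (y.1 n))

/-- The structure map `W(k) → Â`. -/
def hatι : WittVector p k →+* D.hatA where
  toFun w := ⟨fun n => D.ι n (WittVector.truncate (n + 1) w), fun n => by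
    rw [D.res_ι, TruncatedWittVector.truncate_wittVector_truncate]⟩
  map_one' := Subtype.ext (funext fun n =>
    map_one ((D.ι n).comp (WittVector.truncate (n + 1))))
  map_zero' := Subtype.ext (funext fun n =>
    map_zero ((D.ι n).comp (WittVector.truncate (n + 1))))
  map_add' x y := Subtype.ext (funext fun n =>
    map_add ((D.ι n).comp (WittVector.truncate (n + 1))) x y)
  map_mul' x y := Subtype.ext (funext fun n =>
    map_mul ((D.ι n).comp (WittVector.truncate (n + 1))) x y)

/-- The log structure of `Â`. -/
def hatα : R.M →* D.hatA where
  toFun m := ⟨fun n => D.α n m, fun n => D.res_α n m⟩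
  map_one' := Subtype.ext (funext fun n => map_one (D.α n))
  map_mul' l m := Subtype.ext (funext fun n => map_mul (D.α n) l m)

/-- The completed log de Rham complex `ω̂* = lim ω*_{A_n/W_n(k,N)}`, as a log cdga over `W(k, N)`
with monoid `R.M`. -/
def omegaHat : LogCDGA ((logPoint β).witt p) where
  cdga := D.omegaCDGA
  ι := D.can.comp D.hatι
  d_ι w := Subtype.ext (funext fun n => (D.base n).deRham.d_ι (WittVector.truncate (n + 1) w))
  L := R.M
  α := (D.can : D.hatA →* D.omegaCDGA.C 0).comp D.hatα
  ιL := f.mon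
  α_ιL x := Subtype.ext (funext fun n => (D.base n).deRham.α_ιL x)
  δ m := ⟨fun n => (D.base n).deRham.δ m, fun n => Subtype.ext (by
    change LogRing.Hom.extMap _ _ _ ((D.base (n + 1)).egen (.inr m)) = (D.base n).egen (.inr m)
    rw [LogRing.Hom.extMap_egen]
    rfl)⟩
  δ_mul l m := Subtype.ext (funext fun n => (D.base n).deRham.δ_mul l m)
  d_α m := Subtype.ext (funext fun n => (D.base n).deRham.d_α m)
  δ_ιL x := Subtype.ext (funext fun n => (D.base n).deRham.δ_ιL x)
  d_δ m := Subtype.ext (funext fun n => (D.base n).deRham.d_δ m)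

/-- The Frobenius structure of the completed log de Rham complex: `F` extends `φ` on `Â`, satisfies
`F (d x) = x^{p-1} d x + d ((φ(x) - x^p) / p)` for `x ∈ Â` and `F (δ m) = δ m` for `m ∈ R.M`, and
`F_L` is the `p`-th power map. -/
structure IsCanonicalFrobenius (S : LogDieudonneStructure p D.omegaHat) : Prop where
  F_can : ∀ x : D.hatA, S.F 0 (D.can x) = D.can (D.hatφ x)
  F_d_can : ∀ x y : D.hatA, D.hatφ x = x ^ p + p * y →
    S.F 1 (D.omegaHat.cdga.d 0 (D.can x)) =
      D.omegaHat.cdga.mul (zero_add 1) (D.can x ^ (p - 1)) (D.omegaHat.cdga.d 0 (D.can x)) +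
        D.omegaHat.cdga.d 0 (D.can y)
  F_δ : ∀ m, S.F 1 (D.omegaHat.δ m) = D.omegaHat.δ m
  FL_eq : ∀ m, S.FL m = m ^ p

variable [CharP k p] [PerfectRing k p]

/-- `υ : (ω̂*, R.M) → 𝒲` is the morphism attached to `e : R → 𝒲⁰ / V 𝒲⁰`: in degree zero it induces
`Â → A_1 = R → 𝒲⁰ / V 𝒲⁰` modulo `V`, and it agrees with `e` on monoids. -/
def IsInduced (S : LogDieudonneStructure p D.omegaHat)
    {𝒲 : LogDieudonneAlgebra p ((logPoint β).witt p)} (h𝒲 : 𝒲.IsSaturated)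
    (e : LogRing.Hom R (𝒲.modV h𝒲)) (υ : LogDieudonneAlgebra.Hom ⟨D.omegaHat, S⟩ 𝒲) : Prop :=
  (∀ x : D.hatA, 𝒲.toModV h𝒲 (υ.f.f 0 (D.can x)) = e.ring (D.hatToR x)) ∧
    ∀ m : R.M, υ.ψ m = e.mon m

end LogFrobeniusLifting

end

/-! The complex `ω̂` is shown to have the mapping property of the log de Rham–Witt complex. For a
strict `p`-compatible log Dieudonné algebra `E`, morphisms `ω̂ → E` that induce a given `R → E⁰ / V
E⁰` exist uniquely. Maps from `ω̂` to a strict algebra extend uniquely to `W(ω̂_sat)`, which is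
itself strict, so `W(ω̂_sat)` represents the functor that defines the log de Rham–Witt complex.
Statement (c) then compares two universal objects.

The arithmetic input is that `Â` has no `p`-torsion, for `F(dx) = dφ(x) / p` makes sense only
through `(φ(x) - x^p) / p`. This comes from a flatness statement
(`LogRing.Hom.IsLogSmooth.mem_span_pow`): in a log smooth algebra over `W_{m+1}(k, N)` the
`p`-torsion is divisible by `p^m`. After passing to an algebraically closed field, one maps a
noetherian ring `P` onto the algebra, namely a monoid algebra over Witt vectors modulo the binomials
that identify the chart of the base with Teichmüller lifts. `P` is `p`-torsion free because a
nonzero binomial with Teichmüller coefficients always eliminates a basis vector. Log smoothness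
lifts the algebra into `P` to any finite order around each closed point. There étale covers have
sections. Artin–Rees and Krull's intersection theorem then carry torsion-freeness of `P` back to the
algebra, and faithful flatness of Witt vectors descends the result.

For (a), `x ↦ x^{p-1} dx + d((φ(x) - x^p) / p)` is a log derivation along `φ`. It descends to the
levels and gives Frobenius maps `ω_{n+1} → ω_n` by the universal property of log differentials, and
their limit is `F`. Uniqueness is a `p`-adic Nakayama argument: differentials, `dlog`s and `Â`
generate `ω̂`, as `ω¹` is finite modulo `p` (`omega_induction`).

For the target side, the completion of a saturated algebra is again saturated and strict
(`vCompletion_isStrict`), which rests on three cancellation rules for `Fil^r = V^r A + dV^r A`. A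
saturated `E` is identified with `η_{p^r} E` by the iterates of `φ_F`, so maps into `E` extend over
the colimit that defines the saturation. Strictness extends them further over the completion.

In degree zero a strict `E` satisfies `E⁰ ≅ W(E⁰ / V E⁰)`, with `E⁰ / V E⁰` reduced. Dwork's lemma
gives `Â → W(Â)`, so `Â → R → E⁰ / V E⁰` lifts to `Â → E⁰` compatibly with Frobenius, and the lift
is unique. Elements with `φ(x) = x^p` go to Teichmüller elements, which fixes the values on the log
structure. The map extends to `ω̂` one quotient `E / Fil^{n+1}` at a time, because `p^{n+1}` kills
that quotient. -/

/-! ### Torsion in quotients of monoid algebras over Witt vectors by binomials -/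

section Binomial

variable {p : ℕ} [Fact p.Prime] {K : Type u} [Field K] [CharP K p]

/-- The binomials `[c] a - [c'] b` with Teichmüller coefficients in a free module over the Witt
vectors. -/
def wittBinomials (p : ℕ) [Fact p.Prime] (K : Type u) [Field K] (S : Type u) :
    Set (S →₀ WittVector p K) :=
  {v | ∃ (a b : S) (c c' : K), v = Finsupp.single a (WittVector.teichmuller p c) -
    Finsupp.single b (WittVector.teichmuller p c')}

/-- The zeroth coefficient of the difference is `c - c' ≠ 0`, and over a field of characteristic `p`
that suffices for a unit. For coefficients other than Teichmüller lifts the difference could be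
divisible by `p`, and elimination would fail. -/
theorem isUnit_teichmuller_sub {c c' : K} (h : c ≠ c') :
    IsUnit (WittVector.teichmuller p c - WittVector.teichmuller p c') := by
  refine WittVector.isUnit_of_coeff_zero_ne_zero _ ?_
  have h1 := map_sub (WittVector.constantCoeff : WittVector p K →+* K)
    (WittVector.teichmuller p c) (WittVector.teichmuller p c')
  have h2 : ∀ x : K, WittVector.constantCoeff (WittVector.teichmuller p x) = x :=
    WittVector.teichmuller_coeff_zero p
  rw [h2, h2] at h1
  exact fun h0 => sub_ne_zero.mpr h (h1.symm.trans h0)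

/-- A nonzero binomial can be used to eliminate a basis vector. -/
theorem exists_elimination {S : Type u} {v : S →₀ WittVector p K}
    (hv : v ∈ wittBinomials p K S) (h0 : v ≠ 0) :
    ∃ (a b : S) (c : K), (∃ r : WittVector p K, Finsupp.single a 1 -
        Finsupp.single b (WittVector.teichmuller p c) = r • v) ∧
      v = v a • (Finsupp.single a 1 - Finsupp.single b (WittVector.teichmuller p c)) := by
  classical
  obtain ⟨a, b, c, c', rfl⟩ := hv
  -- If the two basis vectors coincide, the binomial is a unit times one basis vector; the
  -- coefficient `0` records that no second term remains.
  rcases eq_or_ne a b with rfl | hab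
  · have hc : c ≠ c' := by rintro rfl; exact h0 (sub_self _)
    obtain ⟨u, hu⟩ := isUnit_teichmuller_sub (p := p) hc
    refine ⟨a, a, 0, ⟨(u⁻¹ : (WittVector p K)ˣ), ?_⟩, ?_⟩
    · rw [← Finsupp.single_sub, ← Finsupp.single_sub, ← hu, Finsupp.smul_single, smul_eq_mul, Units.inv_mul,
        WittVector.teichmuller_zero, sub_zero]
    · rw [← Finsupp.single_sub, WittVector.teichmuller_zero, Finsupp.single_zero, sub_zero,
        Finsupp.smul_single, Finsupp.single_eq_same, smul_eq_mul, mul_one]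
  -- If the first coefficient vanishes, the second basis vector is the one to eliminate. Otherwise
  -- `[c]` is invertible with inverse `[c⁻¹]`.
  · rcases eq_or_ne c 0 with rfl | hc
    · have hc' : c' ≠ 0 := by
        rintro rfl
        simp [WittVector.teichmuller_zero] at h0
      have h1 : WittVector.teichmuller p c'⁻¹ * WittVector.teichmuller p c' = 1 := by
        rw [← map_mul, inv_mul_cancel₀ hc', map_one]
      refine ⟨b, b, 0, ⟨-WittVector.teichmuller p c'⁻¹, ?_⟩, ?_⟩
      · simp [WittVector.teichmuller_zero, h1]
      · simp [WittVector.teichmuller_zero]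
    · have h1 : WittVector.teichmuller p c⁻¹ * WittVector.teichmuller p c = 1 := by
        rw [← map_mul, inv_mul_cancel₀ hc, map_one]
      refine ⟨a, b, c⁻¹ * c', ⟨WittVector.teichmuller p c⁻¹, ?_⟩, ?_⟩
      · rw [smul_sub, Finsupp.smul_single, Finsupp.smul_single, smul_eq_mul, h1, smul_eq_mul,
          ← map_mul]
      · have h2 : (Finsupp.single a (WittVector.teichmuller p c) -
            Finsupp.single b (WittVector.teichmuller p c')) a = WittVector.teichmuller p c := by
          simp [hab]
        rw [h2, smul_sub, Finsupp.smul_single, Finsupp.smul_single, smul_eq_mul, mul_one,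
          smul_eq_mul, ← map_mul, mul_inv_cancel_left₀ hc]

/-- The span of finitely many binomials is saturated with respect to `p`. -/
theorem mem_span_binomials_of_smul {S : Type u} (L : List (S →₀ WittVector p K))
    (hL : ∀ v ∈ L, v ∈ wittBinomials p K S) (y : S →₀ WittVector p K)
    (hy : (p : WittVector p K) • y ∈ Submodule.span (WittVector p K) {v | v ∈ L}) :
    y ∈ Submodule.span (WittVector p K) {v | v ∈ L} := by
  classical
  induction hn : L.length generalizing L y with
  | zero =>
    obtain rfl := List.eq_nil_of_length_eq_zero hn
    simp only [List.not_mem_nil, Set.ofPred_false, Submodule.span_empty, Submodule.mem_bot] at hy ⊢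
    have hp : (p : WittVector p K) ≠ 0 := WittVector.irreducible p |>.ne_zero
    exact (smul_eq_zero.mp hy).resolve_left hp
  | succ n ih =>
    obtain ⟨v, L', rfl⟩ := List.exists_cons_of_length_eq_add_one hn
    have hset : {w | w ∈ v :: L'} = insert v {w | w ∈ L'} := by ext; simp
    rw [hset] at hy ⊢
    have hn' : L'.length = n := by simpa using hn
    by_cases h0 : v = 0
    · subst h0
      rw [Submodule.span_insert_zero] at hy ⊢
      exact ih L' (fun w hw => hL w (List.mem_cons_of_mem _ hw)) y hy hn'
    obtain ⟨a, b, c, ⟨r, hr⟩, hva⟩ := exists_elimination (hL v List.mem_cons_self) h0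
    set w := Finsupp.single a 1 - Finsupp.single b (WittVector.teichmuller p c) with hw
    -- Elimination of the coordinate `a`: `π` replaces the basis vector `a` by `[c] b`. It kills
    -- `v`, and it sends binomials to binomials because Teichmüller lifts are multiplicative, so the
    -- induction applies to the shorter list of images.
    let π : (S →₀ WittVector p K) →ₗ[WittVector p K] (S →₀ WittVector p K) :=
      LinearMap.id - (Finsupp.lapply a).smulRight w
    have hπ : ∀ x, π x = x - x a • w := fun x => rfl
    have hπv : π v = 0 := by rw [hπ, ← hva, sub_self]
    have hπs : ∀ s (d : K), ∃ t e, π (Finsupp.single s (WittVector.teichmuller p d)) =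
        Finsupp.single t (WittVector.teichmuller p e) := by
      intro s d
      by_cases hs : s = a
      · subst hs
        refine ⟨b, d * c, ?_⟩
        rw [hπ, Finsupp.single_eq_same, hw, smul_sub, Finsupp.smul_single, smul_eq_mul, mul_one,
          sub_sub_cancel, Finsupp.smul_single, smul_eq_mul, map_mul]
      · refine ⟨s, d, ?_⟩
        rw [hπ, Finsupp.single_eq_of_ne (Ne.symm hs), zero_smul, sub_zero]
    have hmem : ∀ x, x - π x ∈ Submodule.span (WittVector p K) (insert v {w | w ∈ L'}) := by
      intro x
      rw [hπ, sub_sub_cancel, hr]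
      exact Submodule.smul_mem _ _ (Submodule.smul_mem _ _
        (Submodule.subset_span (Set.mem_insert _ _)))
    have hspan : (Submodule.span (WittVector p K) {u | u ∈ L'.map π}) ≤
        Submodule.span (WittVector p K) (insert v {w | w ∈ L'}) := by
      rw [Submodule.span_le]
      intro u hu
      obtain ⟨x, hx, rfl⟩ := List.mem_map.mp hu
      have := Submodule.sub_mem _ (Submodule.subset_span (Set.mem_insert_of_mem v hx)) (hmem x)
      rwa [sub_sub_cancel] at this
    have hπy : π y ∈ Submodule.span (WittVector p K) {u | u ∈ L'.map π} := by
      refine ih (L'.map π) ?_ (π y) ?_ (by simpa using hn')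
      · intro u hu
        obtain ⟨x, hx, rfl⟩ := List.mem_map.mp hu
        obtain ⟨s, t, d, d', rfl⟩ := hL x (List.mem_cons_of_mem _ hx)
        obtain ⟨s', e, h1⟩ := hπs s d
        obtain ⟨t', e', h2⟩ := hπs t d'
        exact ⟨s', t', e, e', by rw [map_sub, h1, h2]⟩
      · rw [← map_smul]
        have h1 := Submodule.mem_map_of_mem (f := π) hy
        rw [Submodule.map_span, Set.image_insert_eq, hπv, Submodule.span_insert_zero] at h1
        refine Submodule.span_mono ?_ h1
        rintro _ ⟨x, hx, rfl⟩
        exact List.mem_map_of_mem hx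
    -- Here `y = (y - π y) + π y`. The first summand is a multiple of `v`, and the second is covered
    -- by the induction.
    have := Submodule.add_mem _ (hmem y) (hspan hπy)
    rwa [sub_add_cancel] at this

/-- The span of any set of binomials is saturated with respect to `p`. -/
theorem mem_span_of_smul_mem_of_binomials {S : Type u} {s : Set (S →₀ WittVector p K)}
    (hs : s ⊆ wittBinomials p K S) (y : S →₀ WittVector p K)
    (hy : (p : WittVector p K) • y ∈ Submodule.span (WittVector p K) s) :
    y ∈ Submodule.span (WittVector p K) s := by
  obtain ⟨t, hts, ht⟩ := Submodule.mem_span_finite_of_mem_span hy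
  have h : {v | v ∈ t.toList} = (t : Set (S →₀ WittVector p K)) := by ext; simp
  have := mem_span_binomials_of_smul t.toList
    (fun v hv => hs (hts (by simpa using hv))) y (by rwa [h])
  rw [h] at this
  exact Submodule.span_mono hts this

end Binomial

/-! ### Lifting along nilpotent thickenings of strictly local log algebras -/

/-- Every étale covering of `Spec R` has a section. -/
def HasEtaleSections (R : Type u) [CommRing R] : Prop :=
  ∀ (D : Type u) [CommRing D] [Algebra R D], Algebra.Etale R D → Module.FaithfullyFlat R D →
    Nonempty (D →ₐ[R] R)

/-- By faithful flatness the closed fibre of the cover is nonempty. By the Nullstellensatz its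
residue fields are finite over `κ`, hence equal to `κ`. The `κ`-point so obtained lifts through the
nilpotent kernel by formal smoothness. -/
theorem hasEtaleSections_of_isNilpotent {R κ : Type u} [CommRing R] [Field κ] [IsAlgClosed κ]
    (π : R →+* κ) (hπ : Function.Surjective π) (hnil : IsNilpotent (RingHom.ker π)) :
    HasEtaleSections R := by
  intro D _ _ hD hfl
  let := π.toAlgebra
  have hm : (RingHom.ker π).IsMaximal := RingHom.ker_isMaximal_of_surjective π hπ
  have hne : (RingHom.ker π).map (algebraMap R D) ≠ ⊤ := by
    intro h
    apply hfl.submodule_ne_top hm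
    rw [Ideal.smul_top_eq_map, h]
    rfl
  obtain ⟨n, hn, hle⟩ := Ideal.exists_le_maximal _ hne
  let := Ideal.Quotient.field n
  have hker : RingHom.ker π ≤ RingHom.ker ((Ideal.Quotient.mk n).comp (algebraMap R D)) := by
    intro x hx
    exact Ideal.Quotient.eq_zero_iff_mem.mpr (hle (Ideal.mem_map_of_mem _ hx))
  let φ : κ →+* D ⧸ n := π.liftOfSurjective hπ ⟨(Ideal.Quotient.mk n).comp (algebraMap R D), hker⟩
  have hφ : φ.comp π = (Ideal.Quotient.mk n).comp (algebraMap R D) :=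
    RingHom.liftOfRightInverse_comp _ _ _ _
  have hft : φ.FiniteType := by
    refine RingHom.FiniteType.of_comp_finiteType (f := π) ?_
    rw [hφ]
    refine (RingHom.FiniteType.of_surjective _ Ideal.Quotient.mk_surjective).comp ?_
    rw [RingHom.finiteType_algebraMap]
    infer_instance
  have hfin : φ.Finite := RingHom.finite_iff_finiteType_of_isJacobsonRing.mpr hft
  have hbij := IsAlgClosed.ringHom_bijective_of_isIntegral φ hfin.to_isIntegral
  let ε := RingEquiv.ofBijective φ hbij
  let g : D →ₐ[R] κ :=
    { (ε.symm : D ⧸ n →+* κ).comp (Ideal.Quotient.mk n) with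
      commutes' := fun r => by
        change ε.symm (Ideal.Quotient.mk n (algebraMap R D r)) = π r
        rw [RingEquiv.symm_apply_eq]
        exact (DFunLike.congr_fun hφ r).symm }
  exact ⟨Algebra.FormallySmooth.liftOfSurjective g (Algebra.ofId R κ) hπ hnil⟩

namespace LogRing

theorem Hom.comp_assoc {A B C : LogRing.{u}} (g : Hom B C) (f : Hom A B) :
    (g.comp f).assoc = g.assoc.comp f.assoc := by
  refine Hom.ext rfl ?_
  ext m
  induction m using Con.induction_on with
  | H x => rfl

/-- The identity morphism of a log algebra. -/
def Hom.id (A : LogRing.{u}) : Hom A A := ⟨RingHom.id _, MonoidHom.id _, fun _ => rfl⟩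

theorem Hom.id_assoc (A : LogRing.{u}) : (Hom.id A).assoc = Hom.id A.assoc := by
  refine Hom.ext rfl ?_
  ext m
  induction m using Con.induction_on with
  | H x => rfl

theorem Hom.id_comp {A B : LogRing.{u}} (f : Hom A B) : (Hom.id B).comp f = f := rfl

theorem Hom.comp_comp {A B C D : LogRing.{u}} (h : Hom C D) (g : Hom B C) (f : Hom A B) :
    (h.comp g).comp f = h.comp (g.comp f) := rfl

/-- Lifting along a square-zero surjection onto an arbitrary ring, when étale covers have
sections. -/
theorem Hom.IsLogSmooth.exists_lift {B X : LogRing.{u}} {f : Hom B X} (hf : f.IsLogSmooth)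
    (T : LogRing.{u}) (hT : IsFineMonoid T.M) (hsec : HasEtaleSections T.R) {S : Type u}
    [CommRing S] (π : T.R →+* S) (hπ : Function.Surjective π) (hker : RingHom.ker π ^ 2 = ⊥)
    (s : Hom X (T.push π).assoc) (t : Hom B T.assoc)
    (h : (T.toPush π).assoc.comp t = s.comp f) :
    ∃ g : Hom X T.assoc, g.comp f = t ∧ (T.toPush π).assoc.comp g = s := by
  let I := RingHom.ker π
  let ε : S ≃+* T.R ⧸ I := (RingHom.quotientKerEquivOfSurjective hπ).symm
  have hε : (ε : S →+* T.R ⧸ I).comp π = Ideal.Quotient.mk I := by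
    ext x
    change ε (π x) = _
    rw [RingEquiv.symm_apply_eq]
    rfl
  obtain ⟨D, _, _, hD, hfl, g, hg, hgs⟩ := hf.lift T hT I hker
    ((T.pushHom π _ (ε : S →+* T.R ⧸ I) hε).assoc.comp s) t (by
      rw [Hom.comp_comp, ← h, ← Hom.comp_comp, ← Hom.comp_assoc]; 
      congr 2
      exact Hom.ext hε.symm rfl)
  -- The lift exists only on the étale cover `D`. Composing with a section `ρ` brings it back to
  -- `T`; `r'` is the map induced by `ρ` modulo the square-zero ideal.
  obtain ⟨ρ⟩ := hsec D hD hfl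
  let r : Hom (T.push (algebraMap T.R D)) T :=
    { ring := (ρ : D →+* T.R)
      mon := MonoidHom.id _
      comm := fun m => ρ.commutes (T.α m) }
  let I' := I.map (algebraMap T.R D)
  have hI' : ∀ x ∈ I', (π.comp (ρ : D →+* T.R)) x = 0 := by
    have : I' ≤ RingHom.ker (π.comp (ρ : D →+* T.R)) := by
      rw [Ideal.map_le_iff_le_comap]
      intro x hx
      change π (ρ (algebraMap T.R D x)) = 0
      rw [ρ.commutes]
      exact hx
    exact this
  let r' : Hom (T.push ((Ideal.Quotient.mk I').comp (algebraMap T.R D))) (T.push π) :=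
    { ring := Ideal.Quotient.lift I' (π.comp (ρ : D →+* T.R)) hI'
      mon := MonoidHom.id _
      comm := fun m => congrArg π (ρ.commutes (T.α m)) }
  have hr : r.comp (T.toPush (algebraMap T.R D)) = Hom.id T :=
    Hom.ext (RingHom.ext fun x => ρ.commutes x) rfl
  refine ⟨r.assoc.comp g, ?_, ?_⟩
  · rw [Hom.comp_comp, hg, ← Hom.comp_comp, ← Hom.comp_assoc, hr]
    rw [Hom.id_assoc, Hom.id_comp]
  · have h1 : ((T.toPush π).comp r).assoc = (r'.comp (T.pushHom (algebraMap T.R D)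
        ((Ideal.Quotient.mk I').comp (algebraMap T.R D)) (Ideal.Quotient.mk I') rfl)).assoc := rfl
    rw [← Hom.comp_comp, ← Hom.comp_assoc, h1, Hom.comp_assoc, Hom.comp_comp, hgs]
    have h2 : r'.comp ((T.pushHom (Ideal.Quotient.mk I) ((Ideal.Quotient.mk I').comp
        (algebraMap T.R D)) (Ideal.quotientMap I' (algebraMap T.R D) Ideal.le_comap_map)
        (by ext; rfl)).comp (T.pushHom π (Ideal.Quotient.mk I) (ε : S →+* T.R ⧸ I) hε)) =
        Hom.id (T.push π) := by
      refine Hom.ext (RingHom.ext fun x => ?_) rfl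
      obtain ⟨x, rfl⟩ := hπ x
      have h3 : ε (π x) = Ideal.Quotient.mk I x := DFunLike.congr_fun hε x
      change r'.ring (Ideal.quotientMap I' (algebraMap T.R D) Ideal.le_comap_map (ε (π x))) = π x
      rw [h3]
      exact congrArg π (ρ.commutes x)
    rw [← Hom.comp_comp, ← Hom.comp_comp, ← Hom.comp_assoc, ← Hom.comp_assoc, Hom.comp_comp, h2,
      Hom.id_assoc, Hom.id_comp]

end LogRing

theorem hasEtaleSections_quotient {Q κ : Type u} [CommRing Q] [Field κ] [IsAlgClosed κ]
    (ρ : Q →+* κ) (hρ : Function.Surjective ρ) (hnil : IsNilpotent (RingHom.ker ρ)) {J : Ideal Q}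
    (hJ : J ≤ RingHom.ker ρ) : HasEtaleSections (Q ⧸ J) := by
  refine hasEtaleSections_of_isNilpotent (Ideal.Quotient.lift J ρ fun x hx => hJ hx)
    (Ideal.Quotient.lift_surjective_of_surjective J _ hρ) ?_
  obtain ⟨n, hn⟩ := hnil
  refine ⟨n, ?_⟩
  rw [Ideal.ker_quotient_lift, ← Ideal.map_pow, hn]
  exact Ideal.map_bot

namespace LogRing

/-- Lifting along a nilpotent thickening of strictly local log algebras, on the level of rings. -/
theorem Hom.IsLogSmooth.exists_ringHom {B X : LogRing.{u}} {f : Hom B X} (hf : f.IsLogSmooth)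
    {Q κ : Type u} [CommRing Q] [Field κ] [IsAlgClosed κ]
    (ρ : Q →+* κ) (hρ : Function.Surjective ρ) (hnil : IsNilpotent (RingHom.ker ρ))
    (a : X.M →* Q) (b : B.R →+* Q) (hab : ∀ n, b (B.α n) = a (f.mon n)) (I : Ideal Q)
    (hI : IsNilpotent I) (s : X.R →+* Q ⧸ I)
    (hs : ∀ x, s (f.ring x) = Ideal.Quotient.mk I (b x))
    (hsα : ∀ m, s (X.α m) = Ideal.Quotient.mk I (a m)) :
    ∃ g : X.R →+* Q, (∀ x, g (f.ring x) = b x) ∧ ∀ x, Ideal.Quotient.mk I (g x) = s x := by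
  -- The thickening carries the chart monoid of `X` itself, so `s` is the identity on monoids at the
  -- start. Later lifts may alter the monoid part, but only their ring part is kept.
  let C : LogRing.{u} := ⟨Q, X.M, a⟩
  let γ : ∀ T : LogRing.{u}, Hom T T.assoc := fun T =>
    { ring := RingHom.id _
      mon := T.assocCon.mk'.comp (MonoidHom.inl _ _)
      comm := fun m => by
        change T.α m = T.α m * ((1 : T.Rˣ) : T.R)
        rw [Units.val_one, mul_one] }
  let t : Hom B C.assoc := (γ C).comp ⟨b, f.mon, hab⟩
  have hIρ : I ≤ RingHom.ker ρ := by
    intro x hx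
    obtain ⟨n, hn⟩ := hI
    have h1 : x ^ n ∈ I ^ n := Ideal.pow_mem_pow hx n
    rw [hn] at h1
    have h2 : ρ x ^ n = 0 := by rw [← map_pow, (Submodule.mem_bot Q).mp h1, map_zero]
    exact eq_zero_of_pow_eq_zero h2
  -- Climb the `I`-adic tower. The kernel of `Q / I^(r+2) → Q / I^(r+1)` has square zero because `2
  -- (r + 1) ≥ r + 2`.
  have key : ∀ r : ℕ, ∃ g : Hom X (C.push (Ideal.Quotient.mk (I ^ (r + 1)))).assoc,
      g.comp f = (C.toPush (Ideal.Quotient.mk (I ^ (r + 1)))).assoc.comp t ∧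
      ∀ x, Ideal.Quotient.factor (Ideal.pow_le_self r.succ_ne_zero) (g.ring x) = s x := by
    intro r
    induction r with
    | zero =>
      let ε : Q ⧸ I →+* Q ⧸ I ^ (0 + 1) := Ideal.Quotient.factor (by rw [zero_add, pow_one])
      let s' : Hom X (C.push (Ideal.Quotient.mk (I ^ (0 + 1)))) :=
        ⟨ε.comp s, MonoidHom.id _, fun m => congrArg ε (hsα m)⟩
      refine ⟨(γ _).comp s', ?_, ?_⟩
      · refine Hom.ext (RingHom.ext fun x => ?_) (MonoidHom.ext fun n => ?_)
        · exact congrArg ε (hs x)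
        · change (C.push _).assocCon.mk' (f.mon n, 1) =
            (C.push _).assocCon.mk' (f.mon n, Units.map _ 1)
          rw [map_one]
      · intro x
        change Ideal.Quotient.factor _ (ε (s x)) = s x
        obtain ⟨y, hy⟩ := Ideal.Quotient.mk_surjective (s x)
        rw [← hy]
        rfl
    | succ r ih =>
      obtain ⟨g, hg, hgs⟩ := ih
      have hle : I ^ (r + 1 + 1) ≤ I ^ (r + 1) := Ideal.pow_le_pow_right (Nat.le_succ _)
      let T := C.push (Ideal.Quotient.mk (I ^ (r + 1 + 1)))
      let π : Q ⧸ I ^ (r + 1 + 1) →+* Q ⧸ I ^ (r + 1) := Ideal.Quotient.factor hle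
      have hker : RingHom.ker π ^ 2 = ⊥ := by
        have h1 : RingHom.ker π = (I ^ (r + 1)).map (Ideal.Quotient.mk (I ^ (r + 1 + 1))) := by
          refine (Ideal.ker_quotient_lift _ _).trans ?_
          rw [Ideal.mk_ker]
        rw [h1, ← Ideal.map_pow, Ideal.map_eq_bot_iff_le_ker, Ideal.mk_ker, ← pow_mul]
        exact Ideal.pow_le_pow_right (by omega)
      obtain ⟨g', hg', hgg'⟩ := hf.exists_lift T hf.fine
        (hasEtaleSections_quotient ρ hρ hnil ((Ideal.pow_le_self (by omega)).trans hIρ)) π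
        (Ideal.Quotient.factor_surjective hle) hker g
        ((C.toPush (Ideal.Quotient.mk (I ^ (r + 1 + 1)))).assoc.comp t) hg.symm
      refine ⟨g', hg', fun x => ?_⟩
      have h2 : π (g'.ring x) = g.ring x := congrArg (fun h => Hom.ring h x) hgg'
      rw [← hgs, ← h2]
      exact (Ideal.Quotient.factor_comp_apply _ _ _).symm
  obtain ⟨r, hr⟩ := hI
  obtain ⟨g, hg, hgs⟩ := key r
  have hr1 : I ^ (r + 1) = ⊥ := by rw [pow_succ, hr]; exact Ideal.bot_mul I
  -- Now `I^(r+1) = 0`; this last lifting, along a map with zero kernel, only replaces `Q / I^(r+1)`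
  -- by `Q`.
  obtain ⟨g', hg', hgg'⟩ := hf.exists_lift C hf.fine (hasEtaleSections_of_isNilpotent ρ hρ hnil)
    (Ideal.Quotient.mk (I ^ (r + 1))) Ideal.Quotient.mk_surjective
    (by rw [Ideal.mk_ker, hr1]; exact Ideal.bot_pow two_ne_zero) g t hg.symm
  refine ⟨g'.ring, fun x => congrArg (fun h => Hom.ring h x) hg', fun x => ?_⟩
  rw [← hgs x]
  have h2 : Ideal.Quotient.mk (I ^ (r + 1)) (g'.ring x) = g.ring x :=
    congrArg (fun h => Hom.ring h x) hgg'
  rw [← h2]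
  rfl

end LogRing

/-! ### Flatness of log smooth algebras over truncated Witt vectors -/

/-- A criterion for the image of a `p`-torsion element of `A` to be divisible by `p ^ m`, in terms
of formal liftings to a noetherian `p`-torsion free ring. -/
theorem mem_span_pow_of_liftings {P A E : Type u} [CommRing P] [CommRing A] [CommRing E]
    [IsNoetherianRing P] (p m : ℕ) (hP : ∀ x : P, (p : P) * x = 0 → x = 0) (ι : A →+* E)
    (θ : P →+* E) (hθ : Function.Surjective θ)
    (hlift : ∀ q : Ideal P, q.IsMaximal → RingHom.ker θ ≤ q → ∀ j : ℕ,
      ∃ g : A →+* P ⧸ (q ^ (j + 1) ⊔ Ideal.span {(p : P) ^ (m + 1)}), ∀ (x : A) (z : P),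
        Ideal.Quotient.mk _ z = g x → θ z - ι x ∈ (q ^ (j + 1)).map θ)
    (y : A) (hy : (p : A) * y = 0) : ι y ∈ Ideal.span {(p : E) ^ m} := by
  by_contra hcon
  have : IsNoetherianRing E := isNoetherianRing_of_surjective P E θ hθ
  let J : Ideal E := Ideal.span {(p : E) ^ m}
  -- The ideal of all `r` with `r ι(y) ∈ p^m E`. If it is proper, it lies in a maximal ideal `𝔮`;
  -- the contradiction will be an element `1 - r` of it with `r ∈ 𝔮`.
  let c : Ideal E := (Submodule.span E {Ideal.Quotient.mk J (ι y)}).annihilator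
  have hc : ∀ r : E, r ∈ c ↔ r * ι y ∈ J := by
    intro r
    rw [Submodule.mem_annihilator_span_singleton, ← Ideal.Quotient.eq_zero_iff_mem, map_mul]
    rfl
  have hctop : c ≠ ⊤ := by
    intro h
    have := (hc 1).mp (h ▸ Submodule.mem_top)
    rw [one_mul] at this
    exact hcon this
  obtain ⟨𝔮, h𝔮, hle⟩ := Ideal.exists_le_maximal _ hctop
  let q : Ideal P := 𝔮.comap θ
  have hq : q.IsMaximal := Ideal.comap_isMaximal_of_surjective θ hθ
  have hkerq : RingHom.ker θ ≤ q := by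
    intro x hx
    change θ x ∈ 𝔮
    rw [hx]
    exact zero_mem _
  have hqmap : ∀ j, (q ^ j).map θ ≤ 𝔮 ^ j := by
    intro j
    rw [Ideal.map_pow]
    exact Ideal.pow_right_mono Ideal.map_comap_le j
  -- The Artin–Rees constant of `(p)` for the `q`-adic filtration. Lifting to order `i + a` below
  -- then leaves order `i` after division by `p`.
  obtain ⟨a, ha⟩ := Ideal.exists_pow_inf_eq_pow_smul q (M := P) (Ideal.span {(p : P)})
  have key : ∀ i : ℕ, Ideal.Quotient.mk J (ι y) ∈ (𝔮 ^ i • ⊤ : Submodule E (E ⧸ J)) := by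
    intro i
    obtain ⟨g, hg⟩ := hlift q hq hkerq (i + a)
    obtain ⟨z, hz⟩ := Ideal.Quotient.mk_surjective (g y)
    -- The class of `p z` is `g(p y) = 0`.
    have h1 : (p : P) * z ∈ q ^ (i + a) ⊔ Ideal.span {(p : P) ^ (m + 1)} := by
      have hle : q ^ (i + a + 1) ⊔ Ideal.span {(p : P) ^ (m + 1)} ≤
          q ^ (i + a) ⊔ Ideal.span {(p : P) ^ (m + 1)} :=
        sup_le_sup_right (Ideal.pow_le_pow_right (Nat.le_succ _)) _
      refine hle ?_
      rw [← Ideal.Quotient.eq_zero_iff_mem, map_mul, hz, map_natCast, ← map_natCast g, ← map_mul,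
        hy, map_zero]
    obtain ⟨v, hv, w', hw', hvw⟩ := Submodule.mem_sup.mp h1
    obtain ⟨w, rfl⟩ := Ideal.mem_span_singleton'.mp hw'
    have hv' : v = p * (z - p ^ m * w) := by
      rw [mul_sub, ← hvw]; ring
    have hv2 : v ∈ (q ^ (i + a) • ⊤ ⊓ Ideal.span {(p : P)} : Submodule P P) := by
      refine ⟨?_, ?_⟩
      · rw [smul_eq_mul, Ideal.mul_top]; exact hv
      · rw [hv']; exact Ideal.mul_mem_right _ _ (Ideal.mem_span_singleton_self _)
    rw [ha (i + a) (Nat.le_add_left _ _), Nat.add_sub_cancel] at hv2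
    have hv3 : v ∈ q ^ i * Ideal.span {(p : P)} := Ideal.mul_mono_right inf_le_right hv2
    obtain ⟨v', hv'', hvv⟩ := Ideal.mem_mul_span_singleton.mp hv3
    -- Division by `p` is allowed because `P` has no `p`-torsion. Thus `z` lies in `p^m P + q^i`,
    -- and its image lies in `p^m E + 𝔮^i`.
    have hz' : z = p ^ m * w + v' := by
      rw [← sub_eq_zero]
      refine hP _ ?_
      have : (p : P) * (z - p ^ m * w) = v' * p := hv'.symm.trans hvv.symm
      linear_combination this
    have h2 : Ideal.Quotient.mk J (ι y) = Ideal.Quotient.mk J (θ v' - (θ z - ι y)) := by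
      rw [Ideal.Quotient.eq, hz']
      refine Ideal.mem_span_singleton'.mpr ⟨θ w, ?_⟩
      rw [map_add, map_mul, map_pow, map_natCast]
      ring
    have h3 : θ v' - (θ z - ι y) ∈ 𝔮 ^ i := sub_mem (hqmap i (Ideal.mem_map_of_mem θ hv''))
      (Ideal.pow_le_pow_right (by omega) (hqmap _ (hg y z hz)))
    rw [h2]
    have h4 : Ideal.Quotient.mk J (θ v' - (θ z - ι y)) =
      (θ v' - (θ z - ι y)) • (1 : E ⧸ J) := by rw [Algebra.smul_def, mul_one]; rfl
    rw [h4]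
    exact Submodule.smul_mem_smul h3 Submodule.mem_top
  -- Krull's intersection theorem: an element of all `𝔮^i (E / J)` is fixed by some `r ∈ 𝔮`.
  obtain ⟨⟨r, hr⟩, hry⟩ := (Ideal.mem_iInf_smul_pow_eq_bot_iff 𝔮 _).mp
    ((Submodule.mem_iInf _).mpr key)
  have h1 : 1 - r ∈ c := by
    rw [hc, ← Ideal.Quotient.eq_zero_iff_mem, sub_mul, one_mul, map_sub, map_mul, sub_eq_zero]
    exact hry.symm
  refine h𝔮.ne_top ((Ideal.eq_top_iff_one _).mpr ?_)
  simpa using add_mem (hle h1) hr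

open scoped TensorProduct in
/-- Divisibility by `n` descends along faithfully flat base change. -/
theorem mem_span_of_one_tmul_mem {W W' A : Type u} [CommRing W] [CommRing W'] [CommRing A]
    [Algebra W W'] [Algebra W A] [Module.FaithfullyFlat W W'] (n : A) (y : A)
    (hy : (1 : W') ⊗ₜ[W] y ∈ Ideal.span {(1 : W') ⊗ₜ[W] n}) : y ∈ Ideal.span {n} := by
  let J : Ideal A := Ideal.span {n}
  rw [← Ideal.Quotient.eq_zero_iff_mem]
  refine (Module.FaithfullyFlat.one_tmul_eq_zero_iff W (A ⧸ J) (A := W') (Ideal.Quotient.mk J y)).mp ?_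
  let φ : W' ⊗[W] A →ₐ[W] W' ⊗[W] (A ⧸ J) :=
    Algebra.TensorProduct.map (AlgHom.id W W') (Ideal.Quotient.mkₐ W J)
  change φ (1 ⊗ₜ y) = 0
  obtain ⟨c, hc⟩ := Ideal.mem_span_singleton'.mp hy
  have h0 : φ (1 ⊗ₜ n) = 0 := by
    have : (Ideal.Quotient.mkₐ W J) n = 0 :=
      Ideal.Quotient.eq_zero_iff_mem.mpr (Ideal.mem_span_singleton_self n)
    rw [Algebra.TensorProduct.map_tmul, this, TensorProduct.tmul_zero]
  rw [← hc, map_mul, h0, mul_zero]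

/-- Over the discrete valuation ring `W(k)` torsion-free modules are flat. The map is local because
the zeroth coefficient detects units, and flat local homomorphisms are faithfully flat. -/
theorem faithfullyFlat_wittVector (p : ℕ) [Fact p.Prime] (k K : Type u) [Field k] [CharP k p]
    [PerfectRing k p] [Field K] [CharP K p] [PerfectRing K p] (i : k →+* K) :
    letI := (WittVector.map i : WittVector p k →+* WittVector p K).toAlgebra
    Module.FaithfullyFlat (WittVector p k) (WittVector p K) := by
  let := (WittVector.map i : WittVector p k →+* WittVector p K).toAlgebra
  have hinj : Function.Injective (algebraMap (WittVector p k) (WittVector p K)) :=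
    WittVector.map_injective i i.injective
  have : IsLocalHom (algebraMap (WittVector p k) (WittVector p K)) := by
    refine ⟨fun x hx => WittVector.isUnit_of_coeff_zero_ne_zero _ fun h0 => ?_⟩
    have h1 := hx.map (WittVector.constantCoeff : WittVector p K →+* K)
    have h2 : WittVector.constantCoeff (algebraMap (WittVector p k) (WittVector p K) x) =
      i (x.coeff 0) := rfl
    rw [h2, h0, map_zero] at h1
    exact not_isUnit_zero h1
  have : FaithfulSMul (WittVector p k) (WittVector p K) :=
    (faithfulSMul_iff_algebraMap_injective _ _).mpr hinj
  have : Module.IsTorsionFree (WittVector p k) (WittVector p K) := inferInstance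
  exact Module.FaithfullyFlat.of_flat_of_isLocalHom

/-- Quotients of monoid algebras over Witt vectors of fields by binomials are `p`-torsion free. -/
theorem monoidAlgebra_quotient_torsionFree {p : ℕ} [Fact p.Prime] {K : Type u} [Field K]
    [CharP K p] {N Mon : Type u} [CommMonoid Mon] (φ : N → Mon) (c : N → K)
    (x : MonoidAlgebra (WittVector p K) Mon ⧸ Ideal.span (Set.range fun n =>
      (MonoidAlgebra.single (φ n) 1 - MonoidAlgebra.single 1 (WittVector.teichmuller p (c n)) :
        MonoidAlgebra (WittVector p K) Mon)))
    (hx : (p : MonoidAlgebra (WittVector p K) Mon ⧸ Ideal.span (Set.range fun n =>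
      (MonoidAlgebra.single (φ n) 1 - MonoidAlgebra.single 1 (WittVector.teichmuller p (c n)) :
        MonoidAlgebra (WittVector p K) Mon))) * x = 0) : x = 0 := by
  obtain ⟨y, rfl⟩ := Ideal.Quotient.mk_surjective x
  rw [← map_natCast (Ideal.Quotient.mk _), ← map_mul, Ideal.Quotient.eq_zero_iff_mem] at hx
  rw [Ideal.Quotient.eq_zero_iff_mem]
  let W := WittVector p K
  -- All monomial multiples of the generators. Their `W`-span is the ideal, and the leading
  -- coefficient `1` is written `[1]` so that they are visibly binomials with Teichmüller
  -- coefficients.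
  let s : Set (Mon →₀ W) := {v | ∃ (μ : Mon) (n : N), v = Finsupp.single (μ * φ n)
    (WittVector.teichmuller p 1) - Finsupp.single μ (WittVector.teichmuller p (c n))}
  have hs : s ⊆ wittBinomials p K Mon := by
    rintro _ ⟨μ, n, rfl⟩
    exact ⟨_, _, _, _, rfl⟩
  let J := Ideal.span (Set.range fun n =>
      (MonoidAlgebra.single (φ n) 1 - MonoidAlgebra.single 1 (WittVector.teichmuller p (c n)) :
        MonoidAlgebra W Mon))
  have hJ : ∀ z : MonoidAlgebra W Mon, z ∈ J ↔ z.coeff ∈ Submodule.span W s := by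
    intro z
    constructor
    · intro hz
      induction hz using Submodule.span_induction with
      | mem z hz =>
        obtain ⟨n, rfl⟩ := hz
        refine Submodule.subset_span ⟨1, n, ?_⟩
        rw [one_mul, map_one]
        rfl
      | zero => exact zero_mem _
      | add a b _ _ ha hb => exact add_mem ha hb
      | smul a z _ hz =>
        have h1 : ∀ (μ : Mon) (r : W) (z : MonoidAlgebra W Mon), z.coeff ∈ Submodule.span W s →
            (MonoidAlgebra.single μ r * z).coeff ∈ Submodule.span W s := by
          intro μ r z hz
          have h2 : ∀ v : Mon →₀ W, v ∈ Submodule.span W s →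
              (MonoidAlgebra.single μ r * MonoidAlgebra.ofCoeff v).coeff ∈ Submodule.span W s := by
            intro v hv
            induction hv using Submodule.span_induction with
            | mem v hv =>
              obtain ⟨ν, n, rfl⟩ := hv
              have h3 : (MonoidAlgebra.single μ r * MonoidAlgebra.ofCoeff (Finsupp.single (ν * φ n)
                (WittVector.teichmuller p 1) - Finsupp.single ν (WittVector.teichmuller p (c n))) :
                  MonoidAlgebra W Mon).coeff = r • (Finsupp.single (μ * ν * φ n)
                (WittVector.teichmuller p 1) -
                  Finsupp.single (μ * ν) (WittVector.teichmuller p (c n))) := by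
                rw [MonoidAlgebra.ofCoeff_sub, mul_sub, MonoidAlgebra.ofCoeff_single,
                  MonoidAlgebra.ofCoeff_single, MonoidAlgebra.single_mul_single,
                  MonoidAlgebra.single_mul_single, ← mul_assoc, smul_sub, Finsupp.smul_single,
                  Finsupp.smul_single]
                rfl
              rw [h3]
              exact Submodule.smul_mem _ _ (Submodule.subset_span ⟨_, _, rfl⟩)
            | zero =>
              rw [MonoidAlgebra.ofCoeff_zero, mul_zero]
              exact zero_mem _
            | add a b _ _ ha hb =>
              rw [MonoidAlgebra.ofCoeff_add, mul_add]
              exact add_mem ha hb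
            | smul t v _ hv =>
              rw [MonoidAlgebra.ofCoeff_smul, mul_smul_comm]
              exact Submodule.smul_mem _ t hv
          exact h2 z.coeff hz
        rw [smul_eq_mul]
        induction a using MonoidAlgebra.induction_linear with
        | zero => rw [zero_mul]; exact zero_mem _
        | add a b ha hb => rw [add_mul]; exact add_mem ha hb
        | single μ r => exact h1 μ r z hz
    · intro hz
      have h2 : ∀ v : Mon →₀ W, v ∈ Submodule.span W s → MonoidAlgebra.ofCoeff v ∈ J := by
        intro v hv
        induction hv using Submodule.span_induction with
        | mem v hv =>
          obtain ⟨ν, n, rfl⟩ := hv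
          have h3 : MonoidAlgebra.ofCoeff (Finsupp.single (ν * φ n)
                (WittVector.teichmuller p 1) - Finsupp.single ν (WittVector.teichmuller p (c n))) =
              (MonoidAlgebra.single ν 1 * (MonoidAlgebra.single (φ n) 1 -
                MonoidAlgebra.single 1 (WittVector.teichmuller p (c n))) :
                  MonoidAlgebra W Mon) := by
            rw [mul_sub, MonoidAlgebra.single_mul_single, MonoidAlgebra.single_mul_single, map_one,
              one_mul, one_mul, mul_one]
            rfl
          rw [h3]
          exact Ideal.mul_mem_left _ _ (Ideal.subset_span ⟨n, rfl⟩)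
        | zero => exact zero_mem _
        | add a b _ _ ha hb => exact add_mem ha hb
        | smul t v _ hv =>
          rw [MonoidAlgebra.ofCoeff_smul, Algebra.smul_def]
          exact Ideal.mul_mem_left _ _ hv
      exact h2 _ hz
  refine (hJ y).mpr (mem_span_of_smul_mem_of_binomials hs _ ?_)
  have h4 : ((p : MonoidAlgebra W Mon) * y).coeff = (p : W) • y.coeff := by
    rw [← nsmul_eq_mul, Nat.cast_smul_eq_nsmul]
    rfl
  rw [← h4]
  exact (hJ _).mp hx

/-- A field that is of finite type over the Witt vectors of an algebraically closed field of
characteristic `p` and in which `p = 0` is algebraically closed. -/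
theorem isAlgClosed_of_finiteType_wittVector {p : ℕ} [Fact p.Prime] {K κ : Type u} [Field K]
    [CharP K p] [IsAlgClosed K] [PerfectRing K p] [Field κ] (g : WittVector p K →+* κ)
    (hg : g.FiniteType) (hp : (p : κ) = 0) : IsAlgClosed κ := by
  have hker : RingHom.ker (WittVector.constantCoeff : WittVector p K →+* K) ≤ RingHom.ker g := by
    rw [WittVector.ker_constantCoeff, Ideal.span_le, Set.singleton_subset_iff]
    exact (map_natCast g p).trans hp
  let φ : K →+* κ := RingHom.liftOfSurjective WittVector.constantCoeff
    (WittVector.constantCoeff_surjective p) ⟨g, hker⟩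
  have hφ : φ.comp WittVector.constantCoeff = g := RingHom.liftOfRightInverse_comp _ _ _ _
  have hft : φ.FiniteType := by
    refine RingHom.FiniteType.of_comp_finiteType 
      (f := (WittVector.constantCoeff : WittVector p K →+* K)) ?_
    rwa [hφ]
  have hfin : φ.Finite := RingHom.finite_iff_finiteType_of_isJacobsonRing.mpr hft
  exact IsAlgClosed.of_ringEquiv K κ
    (RingEquiv.ofBijective φ (IsAlgClosed.ringHom_bijective_of_isIntegral φ hfin.to_isIntegral))

/-- Lifting of a log smooth log algebra over `W_{m+1}(k, N)` to infinitesimal neighbourhoods of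
closed points of a log algebra over the Witt vectors of an algebraically closed field. -/
theorem LogRing.Hom.IsLogSmooth.exists_lifting {p : ℕ} [Fact p.Prime] {k N : Type u} [Field k]
    [CharP k p] [PerfectRing k p] [CommMonoid N] {β : N →* k} {m : ℕ} {X : LogRing.{u}}
    {f : LogRing.Hom ((LogRing.logPoint β).truncWitt p (m + 1)) X} (hf : f.IsLogSmooth)
    {K : Type u} [Field K] [CharP K p] [IsAlgClosed K] [PerfectRing K p] (i : k →+* K)
    {P E : Type u} [CommRing P] [CommRing E] (c : WittVector p K →+* P) (hPft : c.FiniteType)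
    (θ : P →+* E) (hθ : Function.Surjective θ) (hpE : (p : E) ^ (m + 1) = 0) (ι : X.R →+* E)
    (hι : ∀ w, ι (f.ring (WittVector.truncate (m + 1) w)) = θ (c (WittVector.map i w)))
    (a₁ : X.M →* P) (ha₁ : ∀ l, θ (a₁ l) = ι (X.α l))
    (hβ : ∀ n, a₁ (f.mon n) = c (WittVector.teichmuller p (i (β n))))
    (q : Ideal P) (hq : q.IsMaximal) (hkq : RingHom.ker θ ≤ q) (j : ℕ) :
    ∃ g : X.R →+* P ⧸ (q ^ (j + 1) ⊔ Ideal.span {(p : P) ^ (m + 1)}), ∀ (x : X.R) (z : P),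
        Ideal.Quotient.mk _ z = g x → θ z - ι x ∈ (q ^ (j + 1)).map θ := by
  let W := WittVector p k
  let trunc : W →+* TruncatedWittVector p (m + 1) k := WittVector.truncate (m + 1)
  have htrunc : Function.Surjective trunc := WittVector.truncate_surjective p (m + 1) k
  -- An infinitesimal neighbourhood of the closed point `q`. The summand `p^(m+1)` makes `W(k) → P /
  -- 𝔞` factor through `W_{m+1}(k)`.
  let 𝔞 : Ideal P := q ^ (j + 1) ⊔ Ideal.span {(p : P) ^ (m + 1)}
  have hpker : (p : P) ^ (m + 1) ∈ RingHom.ker θ := by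
    rw [RingHom.mem_ker, map_pow, map_natCast, hpE]
  have hpq : (p : P) ∈ q := hq.isPrime.mem_of_pow_mem _ (hkq hpker)
  let := Ideal.Quotient.field q
  have halg : IsAlgClosed (P ⧸ q) := by
    refine isAlgClosed_of_finiteType_wittVector (p := p) (K := K)
      ((Ideal.Quotient.mk q).comp c) ?_ ?_
    · exact (RingHom.FiniteType.of_surjective _ Ideal.Quotient.mk_surjective).comp
        hPft
    · rw [← map_natCast (Ideal.Quotient.mk q)]
      exact Ideal.Quotient.eq_zero_iff_mem.mpr hpq
  have haq : 𝔞 ≤ q := sup_le (Ideal.pow_le_self j.succ_ne_zero) (by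
    rw [Ideal.span_le, Set.singleton_subset_iff]
    exact hkq hpker)
  have hnilq : (q.map (Ideal.Quotient.mk 𝔞)) ^ (j + 1) = ⊥ := by
    rw [← Ideal.map_pow, Ideal.map_eq_bot_iff_le_ker, Ideal.mk_ker]
    exact le_sup_left
  let ρ : P ⧸ 𝔞 →+* P ⧸ q := Ideal.Quotient.factor haq
  have hρker : RingHom.ker ρ = q.map (Ideal.Quotient.mk 𝔞) := by
    refine (Ideal.ker_quotient_lift _ _).trans ?_
    rw [Ideal.mk_ker]
  -- As `(P / 𝔞) / I` is a quotient of `E`, the map `ι` gives a point of `X` in it, and log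
  -- smoothness lifts this point to `P / 𝔞`.
  let I : Ideal (P ⧸ 𝔞) := (RingHom.ker θ).map (Ideal.Quotient.mk 𝔞)
  have hI : IsNilpotent I := ⟨j + 1, le_bot_iff.mp
    ((Ideal.pow_right_mono (Ideal.map_mono hkq) _).trans hnilq.le)⟩
  let b₀ : W →+* P ⧸ 𝔞 := ((Ideal.Quotient.mk 𝔞).comp c).comp
    (WittVector.map i)
  have hb₀ : RingHom.ker trunc ≤ RingHom.ker b₀ := by
    intro x hx
    have h1 : x ∈ Ideal.span {(p : W) ^ (m + 1)} :=
      (WittVector.mem_span_p_pow_iff_le_coeff_eq_zero _ _).mpr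
        ((WittVector.mem_ker_truncate _ _).mp hx)
    obtain ⟨c, rfl⟩ := Ideal.mem_span_singleton'.mp h1
    rw [RingHom.mem_ker, map_mul, map_pow, map_natCast, ← map_natCast (Ideal.Quotient.mk 𝔞),
      ← map_pow]
    rw [Ideal.Quotient.eq_zero_iff_mem.mpr
      ((le_sup_right : _ ≤ 𝔞) (Ideal.mem_span_singleton_self _)), mul_zero]
  let b : TruncatedWittVector p (m + 1) k →+* P ⧸ 𝔞 := trunc.liftOfSurjective htrunc ⟨b₀, hb₀⟩
  have hb : ∀ w, b (trunc w) = b₀ w := fun w => RingHom.liftOfRightInverse_comp_apply _ _ _ _ _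
  let a : X.M →* P ⧸ 𝔞 :=
    (Ideal.Quotient.mk 𝔞 : P →* P ⧸ 𝔞).comp a₁
  let Q : Type u := (P ⧸ 𝔞) ⧸ I
  let r : P →+* Q := (Ideal.Quotient.mk I).comp (Ideal.Quotient.mk 𝔞)
  have hr : RingHom.ker θ ≤ RingHom.ker r := fun x hx =>
    Ideal.Quotient.eq_zero_iff_mem.mpr (Ideal.mem_map_of_mem _ hx)
  let r' : E →+* Q := θ.liftOfSurjective hθ ⟨r, hr⟩
  have hr' : ∀ x : P, r' (θ x) = r x := fun x =>
    RingHom.liftOfRightInverse_comp_apply θ _ _ ⟨r, hr⟩ x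
  obtain ⟨g, -, hg⟩ := hf.exists_ringHom ρ (Ideal.Quotient.factor_surjective haq)
    ⟨j + 1, by rw [hρker]; exact hnilq⟩ a b (by
      intro n
      change b (trunc (WittVector.teichmuller p (β n))) = a (f.mon n)
      rw [hb]
      change Ideal.Quotient.mk 𝔞 (c (WittVector.map i
        (WittVector.teichmuller p (β n)))) = Ideal.Quotient.mk 𝔞 (a₁ (f.mon n))
      rw [WittVector.map_teichmuller, hβ]) I hI (r'.comp ι) (by
      intro x
      obtain ⟨w, rfl⟩ := htrunc x
      rw [hb]
      change r' (ι (f.ring (WittVector.truncate (m + 1) w))) = _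
      rw [hι, hr']
      rfl) (by
      intro m
      change r' (ι (X.α m)) = _
      rw [← ha₁, hr']
      rfl)
  refine ⟨g, fun x z hz => ?_⟩
  obtain ⟨z', hz'⟩ := hθ (ι x)
  -- Modulo `I` the map `g` is `ι`, so `z - z'` lies in `ker θ + 𝔞`. Since `θ` kills `ker θ` and
  -- `p^(m+1)`, only the part in `q^(j+1)` survives.
  have h1 : Ideal.Quotient.mk I (Ideal.Quotient.mk 𝔞 z) = Ideal.Quotient.mk I
      (Ideal.Quotient.mk 𝔞 z') := by
    rw [hz, hg]
    change r' (ι x) = r z'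
    rw [← hz', hr']
  rw [Ideal.Quotient.eq, ← map_sub] at h1
  obtain ⟨v, hv, hvz⟩ := (Ideal.mem_map_iff_of_surjective _ Ideal.Quotient.mk_surjective).mp h1
  have h2 : z - z' - v ∈ 𝔞 := Ideal.Quotient.eq.mp hvz.symm
  obtain ⟨c, hc, d, hd, hcd⟩ := Submodule.mem_sup.mp h2
  obtain ⟨d', rfl⟩ := Ideal.mem_span_singleton'.mp hd
  have hv0 : θ v = 0 := hv
  have h3 : θ z - ι x = θ c := by
    rw [← hz', ← map_sub]
    have : z - z' = v + c + d' * (p : P) ^ (m + 1) := by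
      rw [add_assoc, hcd]; ring
    rw [this, map_add, map_add, hv0, map_mul, map_pow, map_natCast, hpE, mul_zero, zero_add,
      add_zero]
  change θ z - ι x ∈ _
  rw [h3]
  exact Ideal.mem_map_of_mem θ hc

open scoped TensorProduct in
/-- Log smooth log algebras over `W_{m+1}(k, N)` are flat over `W_{m+1}(k)`: their `p`-torsion
elements are divisible by `p ^ m`. -/
theorem LogRing.Hom.IsLogSmooth.mem_span_pow {p : ℕ} [Fact p.Prime] {k N : Type u} [Field k]
    [CharP k p] [PerfectRing k p] [CommMonoid N] {β : N →* k} {m : ℕ} {X : LogRing.{u}}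
    {f : LogRing.Hom ((LogRing.logPoint β).truncWitt p (m + 1)) X} (hf : f.IsLogSmooth)
    (y : X.R) (hy : (p : X.R) * y = 0) : y ∈ Ideal.span {(p : X.R) ^ m} := by
  -- Over an algebraically closed field the residue fields at the closed points used below are
  -- algebraically closed, so étale covers of the infinitesimal neighbourhoods have sections.
  let K := AlgebraicClosure k
  have : CharP K p := charP_of_injective_algebraMap (algebraMap k K).injective p
  have : PerfectRing K p := inferInstance
  let W := WittVector p k
  let W' := WittVector p K
  let := (WittVector.map (algebraMap k K) : W →+* W').toAlgebra
  have : Module.FaithfullyFlat W W' := faithfullyFlat_wittVector p k K (algebraMap k K)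
  let trunc : W →+* TruncatedWittVector p (m + 1) k := WittVector.truncate (m + 1)
  have htrunc : Function.Surjective trunc := WittVector.truncate_surjective p (m + 1) k
  let a₀ : W →+* X.R := RingHom.comp f.ring trunc
  let := a₀.toAlgebra
  have hpW : trunc ((p : W) ^ (m + 1)) = 0 := by
    rw [← RingHom.mem_ker, WittVector.mem_ker_truncate]
    exact fun i hi => (WittVector.mem_span_p_pow_iff_le_coeff_eq_zero _ _).mp
      (Ideal.mem_span_singleton_self _) i hi
  have hpA : (p : X.R) ^ (m + 1) = 0 := by
    rw [← map_natCast a₀, ← map_pow]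
    exact (congrArg f.ring hpW).trans (map_zero _)
  have hft : a₀.FiniteType := (RingHom.FiniteType.of_finitePresentation hf.finitePresentation).comp
    (RingHom.FiniteType.of_surjective _ htrunc)
  obtain ⟨s, hs⟩ := (hft : Algebra.FiniteType W X.R).out
  let S : Submonoid X.R := Submonoid.closure s
  have : Monoid.FG S := (Monoid.fg_iff_submonoid_fg S).mpr ⟨s, rfl⟩
  have : Monoid.FG X.M := hf.fine.fg
  let Mon := X.M × S
  let P₀ := MonoidAlgebra W' Mon
  -- The factor `X.M` of `Mon` lifts the chart to `P`, and the factor `S`, generated by algebra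
  -- generators, makes `P → E` surjective. The binomials force the chart to restrict to Teichmüller
  -- lifts on `N`, without which `P` would not lie over the base log algebra.
  let J : Ideal P₀ := Ideal.span (Set.range fun n : N =>
      (MonoidAlgebra.single ((f.mon n, 1) : Mon) 1 -
        MonoidAlgebra.single 1 (WittVector.teichmuller p (algebraMap k K (β n))) : P₀))
  let P := P₀ ⧸ J
  have hfl : Monoid.FG Mon := inferInstance
  have hPft : Algebra.FiniteType W' P := inferInstance
  have : IsNoetherianRing P := Algebra.FiniteType.isNoetherianRing W' P
  have hPtf : ∀ x : P, (p : P) * x = 0 → x = 0 := fun x hx =>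
    monoidAlgebra_quotient_torsionFree (fun n : N => ((f.mon n, 1) : Mon))
      (fun n => algebraMap k K (β n)) x hx
  let E := W' ⊗[W] X.R
  let ι : X.R →+* E := (Algebra.TensorProduct.includeRight : X.R →ₐ[W] E)
  have hι : ∀ w : W, ι (a₀ w) = algebraMap W' E (WittVector.map (algebraMap k K) w) := fun w =>
    (Algebra.TensorProduct.includeRight : X.R →ₐ[W] E).commutes w
  let F₀ : Mon →* E := (ι : X.R →* E).comp (X.α.coprod S.subtype)
  have hF₀ : ∀ m s, F₀ (m, s) = ι (X.α m * s) := fun _ _ => rfl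
  let θ₀ : P₀ →ₐ[W'] E := MonoidAlgebra.lift W' E Mon F₀
  have hθ₀ : ∀ x r, θ₀ (MonoidAlgebra.single x r) = r • F₀ x := fun x r =>
    MonoidAlgebra.lift_single _ _ _
  have hβ : ∀ n, X.α (f.mon n) = a₀ (WittVector.teichmuller p (β n)) := fun n => (f.comm n).symm
  have hJ : ∀ x ∈ J, θ₀ x = 0 := by
    have : J ≤ RingHom.ker θ₀ := by
      rw [Ideal.span_le]
      rintro _ ⟨n, rfl⟩
      change θ₀ _ = 0
      rw [map_sub, hθ₀, hθ₀, one_smul, hF₀, map_one, OneMemClass.coe_one, mul_one, hβ, hι,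
        WittVector.map_teichmuller, Algebra.smul_def, mul_one, sub_self]
    exact this
  let θ : P →ₐ[W'] E := Ideal.Quotient.liftₐ J θ₀ hJ
  have hθmk : ∀ x, θ (Ideal.Quotient.mk J x) = θ₀ x := fun _ => rfl
  have hθ : Function.Surjective θ := by
    intro e
    change e ∈ θ.range
    induction e using TensorProduct.induction_on with
    | zero => exact zero_mem _
    | add a b ha hb => exact add_mem ha hb
    | tmul c a =>
      have h1 : c ⊗ₜ[W] a = c • ι a := by
        change _ = c • ((1 : W') ⊗ₜ[W] a)
        rw [TensorProduct.smul_tmul', smul_eq_mul, mul_one]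
      rw [h1]
      refine Subalgebra.smul_mem _ ?_ c
      clear h1
      have ha : a ∈ Submodule.span W (S : Set X.R) := by
        rw [← Algebra.adjoin_eq_span, hs]
        trivial
      induction ha using Submodule.span_induction with
      | mem a ha =>
        refine ⟨Ideal.Quotient.mk J (MonoidAlgebra.single (1, ⟨a, ha⟩) 1), ?_⟩
        change θ₀ _ = _
        rw [hθ₀, one_smul, hF₀, map_one, one_mul]
      | zero => rw [map_zero]; exact zero_mem _
      | add a b _ _ ha hb => rw [map_add]; exact add_mem ha hb
      | smul w a _ ha =>
        rw [Algebra.smul_def, map_mul]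
        refine mul_mem ?_ ha
        exact (hι w) ▸ Subalgebra.algebraMap_mem _ _
  have hpE : (p : E) ^ (m + 1) = 0 := by
    rw [← map_natCast ι, ← map_pow, hpA, map_zero]
  refine mem_span_of_one_tmul_mem (W := W) (W' := W') _ y ?_
  have hmain := mem_span_pow_of_liftings p m hPtf ι (θ : P →+* E) hθ ?_ y hy
  · have h2 : (1 : W') ⊗ₜ[W] ((p : X.R) ^ m) = (p : E) ^ m := by
      rw [← map_natCast ι, ← map_pow]
      rfl
    rw [h2]
    exact hmain
  refine hf.exists_lifting (algebraMap k K) (algebraMap W' P)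
    ((RingHom.finiteType_algebraMap).mpr hPft) (θ : P →+* E) hθ hpE ι
    (fun w => (hι w).trans (θ.commutes _).symm)
    ((Ideal.Quotient.mk J : P₀ →* P).comp ((MonoidAlgebra.of W' Mon).comp (MonoidHom.inl _ _)))
    ?_ ?_
  · intro l
    change θ₀ (MonoidAlgebra.single (l, 1) 1) = _
    rw [hθ₀, one_smul, hF₀, OneMemClass.coe_one, mul_one]
  · intro n
    exact Ideal.Quotient.eq.mpr (Ideal.subset_span ⟨n, rfl⟩)

/-! ### Graded maps out of the log de Rham complex -/

noncomputable section

namespace CDGA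

variable (E : CDGA.{u})

theorem mul_one (i : ℕ) (x : E.C i) : E.mul (add_zero i) x E.one = x := by
  rw [E.mul_comm _ (zero_add i), E.one_mul, Nat.mul_zero, pow_zero, one_smul]

theorem mul_zero_comm (i : ℕ) (r : E.C 0) (x : E.C i) :
    E.mul (add_zero i) x r = E.mul (zero_add i) r x := by
  rw [E.mul_comm _ (zero_add i), Nat.mul_zero, pow_zero, one_smul]

instance module (i : ℕ) : Module (E.C 0) (E.C i) where
  smul r x := E.mul (zero_add i) r x
  one_smul x := E.one_mul i x
  mul_smul r s x := E.mul_assoc (zero_add 0) (zero_add i) (zero_add i) (zero_add i) r s x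
  smul_zero r := map_zero (E.mul (zero_add i) r)
  smul_add r := map_add (E.mul (zero_add i) r)
  add_smul r s x := by
    change E.mul (zero_add i) (r + s) x = E.mul (zero_add i) r x + E.mul (zero_add i) s x
    rw [map_add, AddMonoidHom.add_apply]
  zero_smul x := by
    change E.mul (zero_add i) 0 x = 0
    rw [map_zero, AddMonoidHom.zero_apply]

theorem smul_def {i : ℕ} (r : E.C 0) (x : E.C i) : r • x = E.mul (zero_add i) r x := rfl

theorem d_one : E.d 0 E.one = 0 := by
  have h := E.leibniz (zero_add 0) (by omega) (by omega) E.one E.one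
  rw [E.one_mul, E.one_mul, E.mul_comm _ (by omega), E.one_mul] at h
  simpa using h

theorem smul_mul {i j n : ℕ} (h : i + j = n) (r : E.C 0) (x : E.C i) (y : E.C j) :
    E.mul h (r • x) y = r • E.mul h x y :=
  E.mul_assoc (zero_add i) h h (zero_add n) r x y

theorem d_smul {i : ℕ} (r : E.C 0) (x : E.C i) :
    E.d i (r • x) = E.mul (Nat.add_comm 1 i) (E.d 0 r) x + r • E.d i x := by
  rw [smul_def, E.leibniz (zero_add i) (Nat.add_comm 1 i) (zero_add (i + 1)), pow_zero, one_smul,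
    smul_def]

theorem d_mul (r s : E.C 0) : E.d 0 (r * s) = r • E.d 0 s + s • E.d 0 r := by
  have h := E.d_smul r s
  rw [mul_zero_comm, ← smul_def] at h
  rw [add_comm (r • _)]
  exact h

section graded

open DirectSum

/-- The graded multiplication of a cdga. -/
abbrev gMul : GradedMonoid.GMul E.C where
  mul x y := E.mul rfl x y

/-- The graded unit of a cdga. -/
abbrev gOne : GradedMonoid.GOne E.C := ⟨E.one⟩

attribute [local instance] gMul gOne

theorem gmul_eq {i j n : ℕ} (h : i + j = n) (x : E.C i) (y : E.C j) :
    (⟨i + j, E.mul rfl x y⟩ : GradedMonoid E.C) = ⟨n, E.mul h x y⟩ := by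
  subst h; rfl

/-- The graded monoid structure of a cdga. -/
abbrev gMonoid : GradedMonoid.GMonoid E.C where
  one_mul := fun ⟨i, x⟩ => by
    change (⟨0 + i, E.mul rfl E.one x⟩ : GradedMonoid E.C) = _
    rw [E.gmul_eq (zero_add i), E.one_mul]
  mul_one := fun ⟨i, x⟩ => by
    change (⟨i + 0, E.mul rfl x E.one⟩ : GradedMonoid E.C) = _
    rw [E.gmul_eq (add_zero i), E.mul_one]
  mul_assoc := fun ⟨i, x⟩ ⟨j, y⟩ ⟨k, z⟩ => by
    change (⟨i + j + k, E.mul rfl (E.mul rfl x y) z⟩ : GradedMonoid E.C) =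
      ⟨i + (j + k), E.mul rfl x (E.mul rfl y z)⟩
    rw [E.gmul_eq (add_assoc i j k), E.mul_assoc rfl (add_assoc i j k) rfl rfl]

attribute [local instance] gMonoid

/-- The graded semiring structure of a cdga. -/
abbrev gSemiring : DirectSum.GSemiring E.C where
  mul_zero x := map_zero (E.mul rfl x)
  zero_mul y := by
    change E.mul rfl 0 y = 0
    rw [map_zero, AddMonoidHom.zero_apply]
  mul_add x y z := map_add (E.mul rfl x) y z
  add_mul x y z := by
    change E.mul rfl (x + y) z = E.mul rfl x z + E.mul rfl y z
    rw [map_add, AddMonoidHom.add_apply]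
  natCast n := n • E.one
  natCast_zero := zero_smul _ _
  natCast_succ n := by
    change (n + 1) • E.one = n • E.one + E.one
    rw [add_smul, one_smul]

attribute [local instance] gSemiring

/-- The graded ring structure of a cdga. -/
abbrev gRing : DirectSum.GRing E.C where
  intCast n := n • E.one
  intCast_ofNat n := by
    change (n : ℤ) • E.one = n • E.one
    exact natCast_zsmul _ _
  intCast_negSucc_ofNat n := by
    change (Int.negSucc n) • E.one = -((n + 1) • E.one)
    exact negSucc_zsmul _ _

attribute [local instance] gRing

/-- The total ring of a cdga. -/
def Tot : Type u := ⨁ i, E.C i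

instance : Ring E.Tot := inferInstanceAs (Ring (⨁ i, E.C i))

/-- The inclusion of the degree `i` part in the total ring. -/
def inTot (i : ℕ) : E.C i →+ E.Tot := DirectSum.of E.C i

/-- The projection of the total ring to the degree `i` part. -/
def ofTot (i : ℕ) : E.Tot →+ E.C i := DFinsupp.evalAddMonoidHom i

theorem ofTot_inTot (i : ℕ) (x : E.C i) : E.ofTot i (E.inTot i x) = x :=
  DirectSum.of_eq_same i x

theorem inTot_injective (i : ℕ) : Function.Injective (E.inTot i) :=
  DirectSum.of_injective i

theorem inTot_mul {i j n : ℕ} (h : i + j = n) (x : E.C i) (y : E.C j) :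
    E.inTot i x * E.inTot j y = E.inTot n (E.mul h x y) := by
  subst h
  exact DirectSum.of_mul_of x y

theorem inTot_one : E.inTot 0 E.one = 1 := rfl

theorem tot_induction {P : E.Tot → Prop} (zero : P 0) (of : ∀ i x, P (E.inTot i x))
    (add : ∀ x y, P x → P y → P (x + y)) (x : E.Tot) : P x :=
  DirectSum.induction_on x zero of add

end graded

/-- The inclusion of the degree zero part in the total ring. -/
def zeroTot : E.C 0 →+* E.Tot :=
  { E.inTot 0 with
    map_one' := E.inTot_one
    map_mul' := fun x y => (E.inTot_mul (zero_add 0) x y).symm }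

/-- In products with a factor of degree zero the sign is trivial. Centrality is what makes the
noncommutative total ring an algebra over `A.R`, as the universal property of the exterior algebra
requires. -/
theorem zeroTot_comm (r : E.C 0) (x : E.Tot) : E.zeroTot r * x = x * E.zeroTot r := by
  induction x using E.tot_induction with
  | zero => rw [mul_zero, zero_mul]
  | of i x =>
    change E.inTot 0 r * E.inTot i x = E.inTot i x * E.inTot 0 r
    rw [E.inTot_mul (zero_add i), E.inTot_mul (add_zero i), mul_zero_comm]
  | add x y hx hy => rw [mul_add, add_mul, hx, hy]

end CDGA

namespace LogRing.Hom

variable {B A : LogRing.{u}} (f : Hom B A) {E : CDGA.{u}}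

/-- The ring homomorphism from the exterior algebra of the log differentials to the total ring of
a cdga given by a semilinear map in degree one. -/
def extLift (a : A.R →+* E.C 0) (v : f.Omega →+ E.C 1) (hv : ∀ r w, v (r • w) = a r • v w) :
    f.Ext →+* E.Tot :=
  letI : Algebra A.R E.Tot := (E.zeroTot.comp a).toAlgebra' fun r x => E.zeroTot_comm (a r) x
  (ExteriorAlgebra.lift A.R
    ⟨{ toFun := fun w => E.inTot 1 (v w)
       map_add' := fun v w => by rw [map_add, map_add]
       map_smul' := fun r w => by
        rw [hv, RingHom.id_apply, Algebra.smul_def]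
        exact (E.inTot_mul (zero_add 1) (a r) (v w)).symm },
      fun w => by
        change E.inTot 1 (v w) * E.inTot 1 (v w) = 0
        rw [E.inTot_mul rfl, E.mul_self rfl _ odd_one, map_zero]⟩ : f.Ext →ₐ[A.R] E.Tot)

variable (a : A.R →+* E.C 0) (v : f.Omega →+ E.C 1) (hv : ∀ r w, v (r • w) = a r • v w)

theorem extLift_algebraMap (r : A.R) :
    f.extLift a v hv (algebraMap A.R f.Ext r) = E.inTot 0 (a r) := by
  let : Algebra A.R E.Tot := (E.zeroTot.comp a).toAlgebra' fun r x => E.zeroTot_comm (a r) x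
  exact AlgHom.commutes (ExteriorAlgebra.lift A.R _ : f.Ext →ₐ[A.R] E.Tot) r

theorem extLift_ι (w : f.Omega) :
    f.extLift a v hv (ExteriorAlgebra.ι A.R w) = E.inTot 1 (v w) := by
  let : Algebra A.R E.Tot := (E.zeroTot.comp a).toAlgebra' fun r x => E.zeroTot_comm (a r) x
  exact ExteriorAlgebra.lift_ι_apply A.R _ _ w

/-- A product of `i` elements of degree one has degree `i`, so projecting the image of `⋀^i` to
degree `i` loses nothing. -/
theorem extLift_mem {i : ℕ} {x : f.Ext} (hx : x ∈ ⋀[A.R]^i f.Omega) :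
    ∃ y, f.extLift a v hv x = E.inTot i y := by
  induction hx using Submodule.pow_induction_on_left' with
  | algebraMap r => exact ⟨_, f.extLift_algebraMap a v hv r⟩
  | add x y i hx hy h₁ h₂ =>
    obtain ⟨x', hx'⟩ := h₁
    obtain ⟨y', hy'⟩ := h₂
    exact ⟨x' + y', by rw [map_add, hx', hy', map_add]⟩
  | mem_mul m hm i x hx h =>
    obtain ⟨w, rfl⟩ := hm
    obtain ⟨y, hy⟩ := h
    exact ⟨_, by rw [map_mul, extLift_ι, hy, E.inTot_mul (Nat.add_comm 1 i)]⟩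

/-- The map from `⋀^i ω¹` to the degree `i` part of a cdga given by a semilinear map in degree
one. -/
def gradedLift (i : ℕ) : f.deRhamCDGA.C i →+ E.C i :=
  AddMonoidHom.mk' (fun x => E.ofTot i (f.extLift a v hv x.1)) (fun x y => by
    change E.ofTot i (f.extLift a v hv (x.1 + y.1)) = _
    rw [map_add, map_add])

theorem inTot_gradedLift (i : ℕ) (x : f.deRhamCDGA.C i) :
    E.inTot i (f.gradedLift a v hv i x) = f.extLift a v hv x.1 := by
  obtain ⟨y, hy⟩ := f.extLift_mem a v hv x.2
  change E.inTot i (E.ofTot i (f.extLift a v hv x.1)) = _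
  rw [hy, CDGA.ofTot_inTot]

theorem gradedLift_one : f.gradedLift a v hv 0 f.deRhamCDGA.one = E.one := by
  apply E.inTot_injective 0
  exact (f.inTot_gradedLift a v hv 0 _).trans (map_one (f.extLift a v hv))

theorem gradedLift_toDeRham (r : A.R) : f.gradedLift a v hv 0 (f.toDeRham r) = a r := by
  apply E.inTot_injective 0
  exact (f.inTot_gradedLift a v hv 0 _).trans (f.extLift_algebraMap a v hv r)

theorem gradedLift_ι (w : f.Omega) :
    f.gradedLift a v hv 1 ⟨ExteriorAlgebra.ι A.R w, f.ι_mem_ext w⟩ = v w := by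
  apply E.inTot_injective 1
  exact (f.inTot_gradedLift a v hv 1 _).trans (f.extLift_ι a v hv w)

theorem gradedLift_mul {i j n : ℕ} (h : i + j = n) (x : f.deRhamCDGA.C i)
    (y : f.deRhamCDGA.C j) : f.gradedLift a v hv n (f.deRhamCDGA.mul h x y) =
      E.mul h (f.gradedLift a v hv i x) (f.gradedLift a v hv j y) := by
  apply E.inTot_injective n
  refine (f.inTot_gradedLift a v hv n _).trans ?_
  refine Eq.trans ?_ (E.inTot_mul h _ _)
  refine Eq.trans (map_mul (f.extLift a v hv) x.1 y.1) ?_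
  rw [inTot_gradedLift, inTot_gradedLift]

/-- The element `d x` or `dlog m` of the log de Rham complex. -/
def genEl (g : A.R ⊕ A.M) : f.deRhamCDGA.C 1 := ⟨f.egen g, f.ι_mem_ext _⟩

theorem d_toDeRham (r : A.R) : f.deRhamCDGA.d 0 (f.toDeRham r) = f.genEl (.inl r) :=
  Subtype.ext (f.dExt_algebraMap r)

theorem d_genEl (g : A.R ⊕ A.M) : f.deRhamCDGA.d 1 (f.genEl g) = 0 :=
  Subtype.ext (by
    change f.dExt (ExteriorAlgebra.ι A.R (f.gen g)) = 0
    rw [dExt_ι, dOne_gen])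

theorem gradedLift_genEl (g : A.R ⊕ A.M) : f.gradedLift a v hv 1 (f.genEl g) = v (f.gen g) :=
  f.gradedLift_ι a v hv _

theorem gradedLift_smul {i : ℕ} (r : A.R) (x : f.deRhamCDGA.C i) :
    f.gradedLift a v hv i (f.toDeRham r • x) = a r • f.gradedLift a v hv i x := by
  rw [CDGA.smul_def, gradedLift_mul, gradedLift_toDeRham, CDGA.smul_def]

theorem val_smul {i : ℕ} (r : A.R) (x : f.deRhamCDGA.C i) :
    (f.toDeRham r • x : f.deRhamCDGA.C i) = (⟨r • x.1, Submodule.smul_mem _ r x.2⟩ :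
      ⋀[A.R]^i f.Omega) :=
  Subtype.ext (Algebra.smul_def r x.1).symm

/-- Induction for elements of the log de Rham complex. -/
theorem deRham_induction {Q : ∀ i, f.deRhamCDGA.C i → Prop}
    (hzero : ∀ r, Q 0 (f.toDeRham r))
    (hadd : ∀ i x y, Q i x → Q i y → Q i (x + y))
    (hgen : ∀ (g : A.R ⊕ A.M) (i : ℕ) (x : f.deRhamCDGA.C i), Q i x →
      Q (i + 1) (f.deRhamCDGA.mul (Nat.add_comm 1 i) (f.genEl g) x))
    (hsmul : ∀ (r : A.R) (i : ℕ) (x : f.deRhamCDGA.C i), Q i x →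
      Q i (f.toDeRham r • x))
    (i : ℕ) (x : f.deRhamCDGA.C i) : Q i x := by
  obtain ⟨x, hx⟩ := x
  induction hx using Submodule.pow_induction_on_left' with
  | algebraMap r => exact hzero r
  | add x y i hx hy h₁ h₂ => exact hadd i ⟨x, hx⟩ ⟨y, hy⟩ h₁ h₂
  | mem_mul m hm i x hx h =>
    obtain ⟨w, rfl⟩ := hm
    have h0 : ∀ w : f.Omega, Q (i + 1) (f.deRhamCDGA.mul (Nat.add_comm 1 i)
        ⟨ExteriorAlgebra.ι A.R w, f.ι_mem_ext w⟩ ⟨x, hx⟩) := by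
      intro w
      induction w using f.omega_induction with
      | h0 =>
        -- `Q` is not assumed for zero in positive degrees, so zero is produced as `0 • (d1 · x)`.
        have := hsmul 0 _ _ (hgen (.inl 1) i ⟨x, hx⟩ h)
        convert this
        refine Subtype.ext ?_
        change ExteriorAlgebra.ι A.R (0 : f.Omega) * x = algebraMap A.R f.Ext 0 * _
        rw [map_zero, map_zero, zero_mul, zero_mul]
      | hadd v w hv hw =>
        convert hadd _ _ _ hv hw
        refine Subtype.ext ?_
        change ExteriorAlgebra.ι A.R (v + w) * x =
          ExteriorAlgebra.ι A.R v * x + ExteriorAlgebra.ι A.R w * x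
        rw [map_add, add_mul]
      | hgen r g =>
        convert hsmul r _ _ (hgen g i ⟨x, hx⟩ h)
        refine Subtype.ext ?_
        refine Eq.trans ?_ (Algebra.smul_def r (ExteriorAlgebra.ι A.R (f.gen g) * x))
        change ExteriorAlgebra.ι A.R (r • f.gen g) * x = _
        rw [map_smul, smul_mul_assoc]
    exact h0 w

/-- The graded lift intertwines the differentials up to the factor `c` if it does so on
generators. -/
theorem d_gradedLift (c : ℤ) (h₀ : ∀ r, E.d 0 (a r) = c • v (f.gen (.inl r)))
    (h₁ : ∀ g, E.d 1 (v (f.gen g)) = 0) (i : ℕ) (x : f.deRhamCDGA.C i) :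
    E.d i (f.gradedLift a v hv i x) =
      c • f.gradedLift a v hv (i + 1) (f.deRhamCDGA.d i x) := by
  induction i, x using f.deRham_induction with
  | hzero r => rw [gradedLift_toDeRham, h₀, d_toDeRham, gradedLift_genEl]
  | hadd i x y hx hy => rw [map_add, map_add, hx, hy, map_add, map_add, smul_add]
  | hgen g i x hx =>
    rw [gradedLift_mul, gradedLift_genEl, E.leibniz _ (by omega : 1 + 1 + i = i + 1 + 1)
      (by omega : 1 + (i + 1) = i + 1 + 1), h₁, hx,
      f.deRhamCDGA.leibniz _ (by omega : 1 + 1 + i = i + 1 + 1)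
      (by omega : 1 + (i + 1) = i + 1 + 1), d_genEl]
    simp only [map_zero, AddMonoidHom.zero_apply, zero_add, map_zsmul]
    rw [gradedLift_mul, gradedLift_genEl, smul_comm]
  | hsmul r i x hx =>
    rw [gradedLift_smul, E.d_smul, f.deRhamCDGA.d_smul, map_add, gradedLift_mul, d_toDeRham,
      gradedLift_genEl, gradedLift_smul, h₀, hx, map_zsmul, AddMonoidHom.smul_apply, smul_add,
      smul_comm c (a r)]

end LogRing.Hom

end

/-! ### The universal property of log differentials -/

noncomputable section

namespace LogRing.Hom

variable {B A : LogRing.{u}} (f : Hom B A) {E : CDGA.{u}}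

/-- A log derivation along a ring homomorphism `a` with values in the degree one part of a cdga. -/
structure LogDer (E : CDGA.{u}) (a : A.R →+* E.C 0) where
  D : A.R →+ E.C 1
  δ : A.M → E.C 1
  D_mul : ∀ x y, D (x * y) = a x • D y + a y • D x
  D_base : ∀ w, D (f.ring w) = 0
  δ_mul : ∀ l m, δ (l * m) = δ l + δ m
  D_α : ∀ l, D (A.α l) = a (A.α l) • δ l
  δ_base : ∀ n, δ (f.mon n) = 0

namespace LogDer

variable {f} {a : A.R →+* E.C 0} (t : f.LogDer E a)

/-- The value on a generator. -/
def onGen : A.R ⊕ A.M → E.C 1 := Sum.elim t.D t.δ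

/-- The map on the free module on the generators. -/
def free : ((A.R ⊕ A.M) →₀ A.R) →+ E.C 1 :=
  Finsupp.liftAddHom fun g =>
    { toFun := fun r => a r • t.onGen g
      map_zero' := by rw [map_zero, zero_smul]
      map_add' := fun r s => by rw [map_add, add_smul] }

theorem free_single (g : A.R ⊕ A.M) (r : A.R) :
    t.free (Finsupp.single g r) = a r • t.onGen g :=
  Finsupp.liftAddHom_apply_single _ _ _

theorem free_smul (r : A.R) (z : (A.R ⊕ A.M) →₀ A.R) : t.free (r • z) = a r • t.free z := by
  induction z using Finsupp.induction_linear with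
  | zero => simp
  | add v w hv hw => rw [smul_add, map_add, hv, hw, map_add, smul_add]
  | single g c => rw [Finsupp.smul_single, free_single, free_single, smul_eq_mul, map_mul, mul_smul]

theorem free_rel {z} (h : f.OmegaRel z) : t.free z = 0 := by
  cases h with
  | add x y =>
    simp only [map_sub, map_add, free_single, map_one, one_smul, onGen, Sum.elim_inl, sub_self]
  | mul x y =>
    simp only [map_sub, map_add, free_single, map_one, one_smul, onGen, Sum.elim_inl, t.D_mul,
      sub_self]
  | base w => simp only [free_single, onGen, Sum.elim_inl, t.D_base, smul_zero]
  | dlog_mul l m =>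
    simp only [map_sub, map_add, free_single, map_one, one_smul, onGen, Sum.elim_inr, t.δ_mul,
      sub_self]
  | d_α l =>
    simp only [map_sub, free_single, map_one, one_smul, onGen, Sum.elim_inr, Sum.elim_inl,
      t.D_α, sub_self]
  | dlog_base n => simp only [free_single, onGen, Sum.elim_inr, t.δ_base, smul_zero]

/-- The map on the module of log differentials. -/
def lift : f.Omega →+ E.C 1 :=
  QuotientAddGroup.lift (Submodule.span A.R {z | f.OmegaRel z}).toAddSubgroup t.free (by
    intro z hz
    change z ∈ Submodule.span A.R {z | f.OmegaRel z} at hz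
    change t.free z = 0
    induction hz using Submodule.span_induction with
    | mem z h => exact t.free_rel h
    | zero => rw [map_zero]
    | add y z _ _ h₁ h₂ => rw [map_add, h₁, h₂, add_zero]
    | smul r z _ h => rw [free_smul, h, smul_zero])

theorem lift_gen (g : A.R ⊕ A.M) : t.lift (f.gen g) = t.onGen g := by
  refine (t.free_single g 1).trans ?_
  rw [map_one, one_smul]

theorem lift_smul (r : A.R) (w : f.Omega) : t.lift (r • w) = a r • t.lift w := by
  induction w using Submodule.Quotient.induction_on with
  | H z => exact t.free_smul r z

/-- The graded map out of the log de Rham complex. -/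
def graded (i : ℕ) : f.deRhamCDGA.C i →+ E.C i := f.gradedLift a t.lift t.lift_smul i

theorem graded_one : t.graded 0 f.deRhamCDGA.one = E.one := f.gradedLift_one _ _ _

theorem graded_toDeRham (r : A.R) : t.graded 0 (f.toDeRham r) = a r :=
  f.gradedLift_toDeRham _ _ _ r

theorem graded_genEl (g : A.R ⊕ A.M) : t.graded 1 (f.genEl g) = t.onGen g :=
  (f.gradedLift_genEl _ _ _ g).trans (t.lift_gen g)

theorem graded_mul {i j n : ℕ} (h : i + j = n) (x : f.deRhamCDGA.C i) (y : f.deRhamCDGA.C j) :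
    t.graded n (f.deRhamCDGA.mul h x y) = E.mul h (t.graded i x) (t.graded j y) :=
  f.gradedLift_mul _ _ _ h x y

/-- The constant `c` is `1` for morphisms of complexes and `p` for the Frobenius, where `dF = pFd`.
-/
theorem d_graded (c : ℤ) (h₀ : ∀ r, E.d 0 (a r) = c • t.D r) (h₁ : ∀ r, E.d 1 (t.D r) = 0)
    (h₂ : ∀ m, E.d 1 (t.δ m) = 0) (i : ℕ) (x : f.deRhamCDGA.C i) :
    E.d i (t.graded i x) = c • t.graded (i + 1) (f.deRhamCDGA.d i x) := by
  refine f.d_gradedLift _ _ _ c (fun r => ?_) ?_ i x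
  · rw [lift_gen]; exact h₀ r
  · rintro (r | m)
    · rw [lift_gen]; exact h₁ r
    · rw [lift_gen]; exact h₂ m

/-- The morphism of cdgas given by a log derivation that extends the differential. -/
def hom (h₀ : ∀ r, E.d 0 (a r) = t.D r) (h₁ : ∀ m, E.d 1 (t.δ m) = 0) :
    CDGA.Hom f.deRhamCDGA E where
  f := t.graded
  map_one := t.graded_one
  map_mul := t.graded_mul
  map_d i x := by
    rw [t.d_graded 1 (fun r => by rw [h₀, one_smul]) (fun r => by rw [← h₀, E.d_d]) h₁, one_smul]

end LogDer

/-- Two additive multiplicative families out of the log de Rham complex agree if they agree on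
generators. -/
theorem deRham_ext {g h : ∀ i, f.deRhamCDGA.C i →+ E.C i}
    (hg : ∀ {i j n : ℕ} (e : i + j = n) x y,
      g n (f.deRhamCDGA.mul e x y) = E.mul e (g i x) (g j y))
    (hh : ∀ {i j n : ℕ} (e : i + j = n) x y,
      h n (f.deRhamCDGA.mul e x y) = E.mul e (h i x) (h j y))
    (h₀ : ∀ r, g 0 (f.toDeRham r) = h 0 (f.toDeRham r))
    (h₁ : ∀ t, g 1 (f.genEl t) = h 1 (f.genEl t)) (i : ℕ) (x : f.deRhamCDGA.C i) :
    g i x = h i x := by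
  induction i, x using f.deRham_induction with
  | hzero r => exact h₀ r
  | hadd i x y hx hy => rw [map_add, map_add, hx, hy]
  | hgen t i x hx => rw [hg, hh, h₁, hx]
  | hsmul r i x hx => rw [CDGA.smul_def, hg, hh, h₀, hx]

end LogRing.Hom

end

/-! ### Towers with `p`-adic kernels -/

/-- An abelian group `L` is the limit of a tower of surjections `G (n + 1) → G n` with kernels
`p ^ (n + 1) G (n + 1)`, where `p ^ (n + 1)` kills `G n`. -/
structure IsPadicTower (p : ℕ) {G : ℕ → Type*} [∀ n, AddCommGroup (G n)]
    (π : ∀ n, G (n + 1) →+ G n) {L : Type*} [AddCommGroup L] (pr : ∀ n, L →+ G n) : Prop where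
  compat : ∀ n x, π n (pr (n + 1) x) = pr n x
  sep : ∀ x, (∀ n, pr n x = 0) → x = 0
  complete : ∀ g : ∀ n, G n, (∀ n, π n (g (n + 1)) = g n) → ∃ x, ∀ n, pr n x = g n
  surj : ∀ n, Function.Surjective (π n)
  ker : ∀ n x, π n x = 0 → ∃ y, x = (p : ℤ) ^ (n + 1) • y
  kill : ∀ n (x : G n), (p : ℤ) ^ (n + 1) • x = 0

namespace IsPadicTower

variable {p : ℕ} {G : ℕ → Type*} [∀ n, AddCommGroup (G n)]
    {π : ∀ n, G (n + 1) →+ G n} {L : Type*} [AddCommGroup L] {pr : ∀ n, L →+ G n}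

/-- An element of level `n` is completed to a coherent sequence by the transition maps below `n` and
by chosen preimages above `n`. -/
theorem pr_surjective (h : IsPadicTower p π pr) (n : ℕ) : Function.Surjective (pr n) := by
  classical
  have below : ∀ n (x : G n), ∃ g : ∀ m, G m, (∀ m < n, π m (g (m + 1)) = g m) ∧ g n = x := by
    intro n
    induction n with
    | zero => exact fun x => ⟨Function.update 0 0 x, by simp, by simp⟩
    | succ n ih =>
      intro x
      obtain ⟨g, hg, hx⟩ := ih (π n x)
      refine ⟨Function.update g (n + 1) x, fun m hm => ?_, by simp⟩
      rw [Function.update_of_ne (a := m) (by omega)]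
      obtain rfl | hmn := eq_or_ne m n
      · rw [Function.update_self, hx]
      · rw [Function.update_of_ne (by omega), hg m (by omega)]
  intro x
  obtain ⟨g, hg, hx⟩ := below n x
  choose s hs using h.surj
  -- Up to `n` the sequence `g` is copied; from there on the section `s` is iterated.
  let g' : ∀ m, G m := Nat.rec (g 0) (fun m y => if m < n then g (m + 1) else s m y)
  have hg0 : ∀ m ≤ n, g' m = g m := by
    rintro (_ | m) hm
    · rfl
    · exact if_pos hm
  obtain ⟨y, hy⟩ := h.complete g' (fun m => by
    by_cases hm : m < n
    · rw [hg0 _ hm, hg0 _ hm.le, hg m hm]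
    · rw [show g' (m + 1) = s m (g' m) from if_neg hm, hs])
  exact ⟨y, by rw [hy, hg0 n le_rfl, hx]⟩

/-- The sum of the series `∑ p ^ j z_j`. -/
theorem exists_sum (h : IsPadicTower p π pr) (z : ℕ → L) :
    ∃ s : L, ∀ n, pr n s = ∑ j ∈ Finset.range (n + 1), (p : ℤ) ^ j • pr n (z j) := by
  refine h.complete _ fun n => ?_
  rw [map_sum, Finset.sum_range_succ]
  simp only [map_zsmul, h.compat]
  rw [h.kill, add_zero]

theorem pr_pow_smul (h : IsPadicTower p π pr) (n : ℕ) (x : L) :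
    pr n ((p : ℤ) ^ (n + 1) • x) = 0 := by rw [map_zsmul, h.kill]

theorem separated (h : IsPadicTower p π pr) {x : L} (hx : ∀ n, ∃ y, x = (p : ℤ) ^ n • y) :
    x = 0 :=
  h.sep x fun n => by
    obtain ⟨y, rfl⟩ := hx (n + 1)
    exact h.pr_pow_smul n y

/-- The sum of the series `∑ p ^ j z_j`. -/
noncomputable def sum (h : IsPadicTower p π pr) (z : ℕ → L) : L := (h.exists_sum z).choose

theorem pr_sum (h : IsPadicTower p π pr) (z : ℕ → L) (n : ℕ) :
    pr n (h.sum z) = ∑ j ∈ Finset.range (n + 1), (p : ℤ) ^ j • pr n (z j) :=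
  (h.exists_sum z).choose_spec n

theorem sum_eq (h : IsPadicTower p π pr) (z : ℕ → L) :
    h.sum z = z 0 + (p : ℤ) • h.sum fun j => z (j + 1) := by
  refine sub_eq_zero.mp (h.sep _ fun n => ?_)
  rw [map_sub, map_add, map_zsmul, pr_sum, pr_sum, Finset.sum_range_succ', Finset.smul_sum,
    Finset.sum_range_succ _ n]
  simp only [smul_smul, ← pow_succ', h.kill, pow_zero, one_smul, add_zero]
  abel

/-- Successive approximation: an element of the kernel at level `n` is `p^(n+1) z₀` plus an element
of the kernel at level `n + 1`, and so on. The quotient is the convergent series `∑ p^j z_j`. -/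
theorem ker_pr (h : IsPadicTower p π pr) (n : ℕ) {x : L} (hx : pr n x = 0) :
    ∃ y, x = (p : ℤ) ^ (n + 1) • y := by
  have step : ∀ m, ∀ x : L, ∃ z, pr m x = 0 → pr (m + 1) (x - (p : ℤ) ^ (m + 1) • z) = 0 := by
    intro m x
    by_cases hx : pr m x = 0
    · obtain ⟨g, hg⟩ := h.ker m (pr (m + 1) x) (by rw [h.compat, hx])
      obtain ⟨z, rfl⟩ := h.pr_surjective (m + 1) g
      exact ⟨z, fun _ => by rw [map_sub, map_zsmul, ← hg, sub_self]⟩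
    -- A default value, so that the correction is a function of every `x`.
    · exact ⟨0, fun h => absurd h hx⟩
  choose z hz using step
  -- The remainder after `m` corrections; it vanishes at level `n + m`.
  let t : ℕ → L := Nat.rec x (fun m y => y - (p : ℤ) ^ (n + m + 1) • z (n + m) y)
  have ht : ∀ m, pr (n + m) (t m) = 0 := by
    intro m
    induction m with
    | zero => exact hx
    | succ m ih => exact hz (n + m) (t m) ih
  refine ⟨h.sum fun m => z (n + m) (t m), ?_⟩
  have key : ∀ m, x - (p : ℤ) ^ (n + 1) • h.sum (fun m => z (n + m) (t m)) =
      t m - (p : ℤ) ^ (n + m + 1) • h.sum (fun j => z (n + (m + j)) (t (m + j))) := by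
    intro m
    induction m with
    | zero => simp only [zero_add]; rfl
    | succ m ih =>
      rw [ih, h.sum_eq, show t (m + 1) = t m - (p : ℤ) ^ (n + m + 1) • z (n + m) (t m) from rfl,
        smul_add, smul_smul, ← pow_succ, sub_sub]
      simp only [add_zero, Nat.add_assoc, Nat.add_comm 1]
  refine sub_eq_zero.mp (h.sep _ fun m => ?_)
  rw [key m, map_sub, map_zsmul, show n + m + 1 = n + (m + 1) from rfl, pow_add, mul_smul,
    smul_comm, h.kill, sub_zero]
  have h1 := ht m
  clear_value t
  clear key ht
  -- The remainder vanishes at level `n + m`, hence also at the lower level `m` at which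
  -- separatedness is tested.
  have h2 : ∀ k, pr (k + m) (t m) = 0 → pr m (t m) = 0 := by
    intro k
    induction k with
    | zero => rw [zero_add]; exact id
    | succ k ih =>
      intro hk
      apply ih
      rw [show k + 1 + m = k + m + 1 by omega] at hk
      rw [← h.compat, hk, map_zero]
  exact h2 n h1

end IsPadicTower

/-! ### The tower of a log Frobenius lifting -/

namespace TruncatedWittVector

variable {p : ℕ} [Fact p.Prime] {k : Type u} [Field k] [CharP k p] [PerfectRing k p]

theorem natCast_pow_eq_zero (n : ℕ) : (p : TruncatedWittVector p n k) ^ n = 0 := by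
  have h : WittVector.truncate n ((p : WittVector p k) ^ n) = 0 := by
    rw [← RingHom.mem_ker, WittVector.mem_ker_truncate]
    exact (WittVector.mem_span_p_pow_iff_le_coeff_eq_zero _ n).mp
      (Ideal.mem_span_singleton_self _)
  rwa [map_pow, map_natCast] at h

/-- Over a perfect field, the Witt vectors with `n` vanishing leading coefficients are the multiples
of `p^n`. This turns the base change condition on a log Frobenius lifting into a statement about
powers of `p`. -/
theorem ker_truncate (n : ℕ) : RingHom.ker (TruncatedWittVector.truncate n.le_succ :
    TruncatedWittVector p (n + 1) k →+* TruncatedWittVector p n k) = 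
      Ideal.span {(p : TruncatedWittVector p (n + 1) k) ^ n} := by
  refine le_antisymm (fun x hx => ?_) ?_
  · obtain ⟨w, rfl⟩ := WittVector.truncate_surjective p (n + 1) k x
    rw [RingHom.mem_ker, TruncatedWittVector.truncate_wittVector_truncate, ← RingHom.mem_ker,
      WittVector.mem_ker_truncate, ← WittVector.mem_span_p_pow_iff_le_coeff_eq_zero,
      Ideal.mem_span_singleton] at hx
    have := map_dvd (WittVector.truncate (n + 1) : WittVector p k →+* _) hx
    rwa [map_pow, map_natCast, ← Ideal.mem_span_singleton] at this
  · rw [Ideal.span_le, Set.singleton_subset_iff, SetLike.mem_coe, RingHom.mem_ker, map_pow,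
      map_natCast, natCast_pow_eq_zero]

end TruncatedWittVector

namespace LogFrobeniusLifting

variable {p : ℕ} [Fact p.Prime] {k N : Type u} [Field k] [CommMonoid N]
    {β : N →* k} {R : LogRing.{u}} {f : LogRing.Hom (LogRing.logPoint β) R}
    (D : LogFrobeniusLifting p f)

/-- The projection `Â → A_n`. -/
def hatProj (n : ℕ) : D.hatA →+* D.A n := (Pi.evalRingHom D.A n).comp D.hatA.subtype

theorem deRhamRes_toDeRham (n : ℕ) (x : D.A (n + 1)) :
    (D.deRhamRes n).f 0 ((D.base (n + 1)).toDeRham x) = (D.base n).toDeRham (D.res n x) :=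
  Subtype.ext (LogRing.Hom.extMap_algebraMap _ _ _ _)

theorem deRhamRes_genEl (n : ℕ) (t : D.A (n + 1) ⊕ R.M) :
    (D.deRhamRes n).f 1 ((D.base (n + 1)).genEl t) =
      (D.base n).genEl (Sum.map (D.res n) id t) :=
  Subtype.ext (LogRing.Hom.extMap_egen _ _ _ _)

theorem deRhamRes_surjective (n i : ℕ) : Function.Surjective ((D.deRhamRes n).f i) := by
  intro x
  induction i, x using (D.base n).deRham_induction with
  | hzero r =>
    obtain ⟨s, rfl⟩ := D.res_surjective n r
    exact ⟨_, D.deRhamRes_toDeRham n s⟩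
  | hadd i x y hx hy =>
    obtain ⟨x, rfl⟩ := hx
    obtain ⟨y, rfl⟩ := hy
    exact ⟨x + y, map_add _ _ _⟩
  | hgen t i x hx =>
    obtain ⟨x, rfl⟩ := hx
    obtain ⟨s, rfl⟩ : ∃ s, Sum.map (D.res n) id s = t :=
      Function.Surjective.sumMap (D.res_surjective n) Function.surjective_id t
    exact ⟨(D.base (n + 1)).deRhamCDGA.mul (Nat.add_comm 1 i) ((D.base (n + 1)).genEl s) x, by
      rw [(D.deRhamRes n).map_mul, deRhamRes_genEl]⟩
  | hsmul r i x hx =>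
    obtain ⟨x, rfl⟩ := hx
    obtain ⟨s, rfl⟩ := D.res_surjective n r
    exact ⟨(D.base (n + 1)).toDeRham s • x, by
      rw [CDGA.smul_def, (D.deRhamRes n).map_mul, deRhamRes_toDeRham, CDGA.smul_def]⟩

variable [CharP k p] [PerfectRing k p]

theorem natCast_pow_eq_zero (n : ℕ) : (p : D.A n) ^ (n + 1) = 0 := by
  have h := congrArg (D.ι n) (TruncatedWittVector.natCast_pow_eq_zero (p := p) (k := k) (n + 1))
  rwa [map_pow, map_natCast, map_zero] at h

/-- `A n` is an algebra over `W_{n+1}(k)`, hence killed by `p^(n+1)`. The kernel of `W_{n+2}(k) →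
W_{n+1}(k)` is generated by `p^(n+1)`, and by `ker_res` so is the kernel of `res`. -/
theorem isPadicTower : IsPadicTower p (fun n => (D.res n : D.A (n + 1) →+ D.A n))
    (fun n => (D.hatProj n : D.hatA →+ D.A n)) where
  compat n x := x.2 n
  sep x hx := Subtype.ext (funext hx)
  complete g hg := ⟨⟨g, hg⟩, fun _ => rfl⟩
  surj := D.res_surjective
  ker n x hx := by
    have h : x ∈ RingHom.ker (D.res n) := hx
    rw [D.ker_res, TruncatedWittVector.ker_truncate, Ideal.map_span, Set.image_singleton, map_pow,
      map_natCast, Ideal.mem_span_singleton] at h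
    obtain ⟨y, rfl⟩ := h
    exact ⟨y, by simp [zsmul_eq_mul]⟩
  kill n x := by
    rw [zsmul_eq_mul]
    push_cast
    rw [D.natCast_pow_eq_zero, zero_mul]

/-- If `p x = 0`, the component of `x` in `A (n + 1)`, which is log smooth over `W_{n+2}(k, N)`, is
divisible by `p^(n+1)`. Its restriction to `A n` therefore vanishes. -/
theorem hatA_torsionFree {x : D.hatA} (hx : (p : D.hatA) * x = 0) : x = 0 := by
  refine D.isPadicTower.sep x fun n => ?_
  have h1 : (p : D.A (n + 1)) * x.1 (n + 1) = 0 := by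
    have := congrArg (D.hatProj (n + 1)) hx
    rwa [map_mul, map_natCast, map_zero] at this
  have h2 := (D.logSmooth (n + 1)).mem_span_pow _ h1
  obtain ⟨y, hy⟩ := Ideal.mem_span_singleton.mp h2
  change x.1 n = 0
  rw [← x.2 n]
  refine (congrArg (D.res n) hy).trans ?_
  rw [map_mul, map_pow, map_natCast, D.natCast_pow_eq_zero, zero_mul]

theorem deRham_natCast_pow_smul (n i : ℕ) (x : (D.base n).deRhamCDGA.C i) :
    (p : ℤ) ^ (n + 1) • x = 0 := by
  have h : (p : ℤ) ^ (n + 1) • x = (D.base n).toDeRham ((p : D.A n) ^ (n + 1)) • x := by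
    have h1 : ∀ m : ℕ, (m : ℤ) • x = (D.base n).toDeRham (m : D.A n) • x := fun m => by
      rw [natCast_zsmul, map_natCast]
      exact (Nat.cast_smul_eq_nsmul ((D.base n).deRhamCDGA.C 0) m x).symm
    have h2 := h1 (p ^ (n + 1))
    rwa [Nat.cast_pow, Nat.cast_pow] at h2
  rw [h, D.natCast_pow_eq_zero, map_zero, zero_smul]

end LogFrobeniusLifting

/-! ### The completed log de Rham complex as a `p`-adic tower -/

namespace CDGA

/-- The differential graded ideal `c E`. -/
def smulIdeal (E : CDGA.{u}) (c : ℤ) : DGIdeal E where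
  I i := (zsmulAddGroupHom c).range
  mul_mem := by
    rintro i j n h x _ ⟨y, rfl⟩
    exact ⟨E.mul h x y, (map_zsmul (E.mul h x) c y).symm⟩
  d_mem := by
    rintro i _ ⟨y, rfl⟩
    exact ⟨E.d i y, (map_zsmul (E.d i) c y).symm⟩

theorem mem_smulIdeal {E : CDGA.{u}} {c : ℤ} {i : ℕ} {x : E.C i} :
    x ∈ (E.smulIdeal c).I i ↔ ∃ y, c • y = x := Iff.rfl

theorem toQuot_eq_zero {E : CDGA.{u}} {I : DGIdeal E} {i : ℕ} {x : E.C i} :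
    (E.toQuot I).f i x = 0 ↔ x ∈ I.I i := QuotientAddGroup.eq_zero_iff x

theorem toQuot_surjective {E : CDGA.{u}} (I : DGIdeal E) (i : ℕ) :
    Function.Surjective ((E.toQuot I).f i) := QuotientAddGroup.mk'_surjective _

theorem Hom.map_smul {E E' : CDGA.{u}} (g : Hom E E') {i : ℕ} (r : E.C 0) (x : E.C i) :
    g.f i (r • x) = g.f 0 r • g.f i x := g.map_mul _ r x

end CDGA

namespace LogFrobeniusLifting

variable {p : ℕ} [Fact p.Prime] {k N : Type u} [Field k] [CommMonoid N]
    {β : N →* k} {R : LogRing.{u}} {f : LogRing.Hom (LogRing.logPoint β) R}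
    (D : LogFrobeniusLifting p f) [CharP k p] [PerfectRing k p]

/-- The map `A_n → ω⁰_{n+1} / p ^ (n + 1)`. -/
noncomputable def quotRing (n : ℕ) : D.A n →+*
    ((D.base (n + 1)).deRhamCDGA.quot ((D.base (n + 1)).deRhamCDGA.smulIdeal
      ((p : ℤ) ^ (n + 1)))).C 0 :=
  (D.res n).liftOfSurjective (D.res_surjective n)
    ⟨(CDGA.toQuot _ _).zero.comp (D.base (n + 1)).toDeRham, fun x hx => by
      obtain ⟨y, rfl⟩ := D.isPadicTower.ker n x hx
      refine CDGA.toQuot_eq_zero.mpr (CDGA.mem_smulIdeal.mpr ⟨(D.base (n + 1)).toDeRham y, ?_⟩)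
      rw [map_zsmul]⟩

theorem quotRing_res (n : ℕ) (x : D.A (n + 1)) :
    D.quotRing n (D.res n x) = (CDGA.toQuot _ _).f 0 ((D.base (n + 1)).toDeRham x) :=
  RingHom.liftOfRightInverse_comp_apply _ _ _ _ _

/-- The derivation `A_n → ω¹_{n+1} / p ^ (n + 1)`. -/
noncomputable def quotD (n : ℕ) : D.A n →+
    ((D.base (n + 1)).deRhamCDGA.quot ((D.base (n + 1)).deRhamCDGA.smulIdeal
      ((p : ℤ) ^ (n + 1)))).C 1 :=
  (D.res n : D.A (n + 1) →+ D.A n).liftOfSurjective (D.res_surjective n)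
    ⟨((CDGA.toQuot _ _).f 1).comp (((D.base (n + 1)).deRhamCDGA.d 0).comp
      ((D.base (n + 1)).toDeRham : D.A (n + 1) →+ _)), fun x hx => by
      obtain ⟨y, rfl⟩ := D.isPadicTower.ker n x hx
      refine CDGA.toQuot_eq_zero.mpr (CDGA.mem_smulIdeal.mpr
        ⟨(D.base (n + 1)).deRhamCDGA.d 0 ((D.base (n + 1)).toDeRham y), ?_⟩)
      rw [AddMonoidHom.comp_apply, map_zsmul, map_zsmul]
      rfl⟩

theorem quotD_res (n : ℕ) (x : D.A (n + 1)) :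
    D.quotD n (D.res n x) = (CDGA.toQuot _ _).f 1
      ((D.base (n + 1)).deRhamCDGA.d 0 ((D.base (n + 1)).toDeRham x)) :=
  AddMonoidHom.liftOfRightInverse_comp_apply _ _ _ _ _

/-- The log derivation of `A_n` with values in `ω¹_{n+1} / p ^ (n + 1)`. -/
noncomputable def quotDer (n : ℕ) : (D.base n).LogDer
    ((D.base (n + 1)).deRhamCDGA.quot ((D.base (n + 1)).deRhamCDGA.smulIdeal
      ((p : ℤ) ^ (n + 1)))) (D.quotRing n) where
  D := D.quotD n
  δ m := (CDGA.toQuot _ _).f 1 ((D.base (n + 1)).genEl (.inr m))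
  D_mul x y := by
    obtain ⟨x, rfl⟩ := D.res_surjective n x
    obtain ⟨y, rfl⟩ := D.res_surjective n y
    rw [← map_mul, quotD_res, quotD_res, quotD_res, quotRing_res, quotRing_res, map_mul,
      CDGA.d_mul, map_add, CDGA.Hom.map_smul, CDGA.Hom.map_smul]
  D_base w := by
    obtain ⟨w, rfl⟩ := WittVector.truncate_surjective p (n + 1) k w
    have h := D.res_ι n (WittVector.truncate (n + 2) w)
    rw [TruncatedWittVector.truncate_wittVector_truncate] at h
    refine (congrArg (D.quotD n) h.symm).trans ?_
    rw [quotD_res]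
    exact (congrArg _ ((D.base (n + 1)).deRham.d_ι (WittVector.truncate (n + 2) w))).trans
      (map_zero _)
  δ_mul l m := (congrArg _ ((D.base (n + 1)).deRham.δ_mul l m)).trans (map_add _ _ _)
  D_α l := by
    refine (congrArg (D.quotD n) (D.res_α n l).symm).trans ?_
    rw [quotD_res]
    refine Eq.trans ?_ (congrArg (fun t => D.quotRing n t • (CDGA.toQuot _ _).f 1
      ((D.base (n + 1)).genEl (.inr l))) (D.res_α n l))
    rw [quotRing_res, ← CDGA.Hom.map_smul]
    exact congrArg _ ((D.base (n + 1)).deRham.d_α l)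
  δ_base x := (congrArg _ ((D.base (n + 1)).deRham.δ_ιL x)).trans (map_zero _)

/-- Reduction modulo `p^(n+1)` factors through restriction to level `n`. Hence the kernel of
restriction lies in `p^(n+1) ω_{n+1}`, in all degrees and without computing with exterior powers. -/
theorem quotDer_deRhamRes (n i : ℕ) (x : (D.base (n + 1)).deRhamCDGA.C i) :
    (D.quotDer n).graded i ((D.deRhamRes n).f i x) = (CDGA.toQuot _ _).f i x := by
  refine (D.base (n + 1)).deRham_ext (E := CDGA.quot _ _)
    (g := fun i => ((D.quotDer n).graded i).comp ((D.deRhamRes n).f i))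
    (h := fun i => (CDGA.toQuot _ _).f i) (fun e x y => ?_) (fun e x y => ?_) (fun r => ?_)
    ?_ i x
  · simp only [AddMonoidHom.comp_apply]
    rw [(D.deRhamRes n).map_mul, LogRing.Hom.LogDer.graded_mul]
  · exact (CDGA.toQuot _ _).map_mul e x y
  · rw [AddMonoidHom.comp_apply, deRhamRes_toDeRham, LogRing.Hom.LogDer.graded_toDeRham,
      quotRing_res]
  · intro t
    rw [AddMonoidHom.comp_apply, deRhamRes_genEl, LogRing.Hom.LogDer.graded_genEl]
    cases t with
    | inl x =>
      refine (D.quotD_res n x).trans ?_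
      rw [LogRing.Hom.d_toDeRham]
    | inr m => rfl

theorem omega_isPadicTower (i : ℕ) : IsPadicTower p (fun n => (D.deRhamRes n).f i)
    (fun n => (CDGA.limProj (fun n => (D.base n).deRhamCDGA) D.deRhamRes n).f i) where
  compat n x := x.2 n
  sep x hx := Subtype.ext (funext hx)
  complete g hg := ⟨⟨g, hg⟩, fun _ => rfl⟩
  surj n := D.deRhamRes_surjective n i
  ker n x hx := by
    have h := D.quotDer_deRhamRes n i x
    rw [hx, map_zero] at h
    obtain ⟨y, hy⟩ := CDGA.mem_smulIdeal.mp (CDGA.toQuot_eq_zero.mp h.symm)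
    exact ⟨y, hy.symm⟩
  kill n x := D.deRham_natCast_pow_smul n i x

end LogFrobeniusLifting

/-! ### The divided Frobenius derivation -/

noncomputable section

open MvPolynomial in
/-- The polynomial `((X + Y) ^ p - X ^ p - Y ^ p) / p` and its partial derivatives. -/
theorem exists_frobenius_defect (p : ℕ) (hp : p.Prime) : ∃ P : MvPolynomial (Fin 2) ℤ,
    (X 0 + X 1) ^ p = X 0 ^ p + X 1 ^ p + (p : MvPolynomial (Fin 2) ℤ) * P ∧
    pderiv 0 P = (X 0 + X 1) ^ (p - 1) - X 0 ^ (p - 1) ∧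
    pderiv 1 P = (X 0 + X 1) ^ (p - 1) - X 1 ^ (p - 1) := by
  obtain ⟨r, hr⟩ := exists_add_pow_prime_eq hp (X 0 : MvPolynomial (Fin 2) ℤ) (X 1)
  have hp0 : (p : MvPolynomial (Fin 2) ℤ) ≠ 0 := Nat.cast_ne_zero.mpr hp.ne_zero
  refine ⟨X 0 * X 1 * r, by rw [hr]; ring, ?_, ?_⟩
  -- Differentiating the identity for `(X + Y)^p` gives `p` times the claim, and `p` cancels in the
  -- integral polynomial ring.
  · have h := congrArg (pderiv 0) hr
    simp only [Derivation.leibniz_pow, map_add, pderiv_X_self, mul_assoc (p : MvPolynomial _ ℤ)] at h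
    rw [Derivation.leibniz, Derivation.map_natCast, pderiv_X_of_ne (by decide)] at h
    apply mul_left_cancel₀ hp0
    simp only [nsmul_eq_mul, smul_eq_mul, mul_zero, mul_one, add_zero, mul_assoc] at h ⊢
    linear_combination -h
  · have h := congrArg (pderiv 1) hr
    simp only [Derivation.leibniz_pow, map_add, pderiv_X_self, mul_assoc (p : MvPolynomial _ ℤ)] at h
    rw [Derivation.leibniz, Derivation.map_natCast, pderiv_X_of_ne (by decide)] at h
    apply mul_left_cancel₀ hp0
    simp only [nsmul_eq_mul, smul_eq_mul, mul_zero, mul_one, add_zero, mul_assoc, zero_add] at h ⊢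
    linear_combination -h

namespace CDGA

variable {E : CDGA.{u}}

theorem d_one' : E.d 0 1 = 0 := E.d_one

theorem d_intCast (n : ℤ) : E.d 0 (n : E.C 0) = 0 := by
  rw [← zsmul_one, map_zsmul, d_one', smul_zero]

theorem d_aeval (x y : E.C 0) (P : MvPolynomial (Fin 2) ℤ) :
    E.d 0 (MvPolynomial.aeval ![x, y] P) =
      MvPolynomial.aeval ![x, y] (MvPolynomial.pderiv 0 P) • E.d 0 x +
      MvPolynomial.aeval ![x, y] (MvPolynomial.pderiv 1 P) • E.d 0 y := by
  induction P using MvPolynomial.induction_on with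
  | C n =>
    rw [MvPolynomial.pderiv_C, MvPolynomial.pderiv_C, map_zero, zero_smul, zero_smul, add_zero,
      MvPolynomial.aeval_C]
    exact d_intCast n
  | add P Q hP hQ =>
    simp only [map_add, hP, hQ, add_smul]
    abel
  | mul_X P i hP =>
    rw [map_mul, d_mul, hP]
    simp only [Derivation.leibniz, map_add, smul_eq_mul, map_mul, MvPolynomial.aeval_X]
    fin_cases i
    · rw [Fin.zero_eta, MvPolynomial.pderiv_X_self, MvPolynomial.pderiv_X_of_ne (by decide)]
      simp only [Matrix.cons_val_zero, map_one, map_zero]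
      module
    · rw [Fin.mk_one, MvPolynomial.pderiv_X_self, MvPolynomial.pderiv_X_of_ne (by decide)]
      simp only [Matrix.cons_val_one, Matrix.cons_val_zero, map_one, map_zero]
      module

theorem d_pow_succ (x : E.C 0) (n : ℕ) :
    E.d 0 (x ^ (n + 1)) = ((n + 1 : ℕ) : E.C 0) • x ^ n • E.d 0 x := by
  induction n with
  | zero => simp
  | succ n ih =>
    rw [pow_succ, d_mul, ih]
    push_cast
    module

variable {p : ℕ} [hp : Fact p.Prime] {B : Type*} [CommRing B] (c : B →+* E.C 0)
  (htf : ∀ x : B, (p : B) * x = 0 → x = 0) (φ : B →+* B) (θ : B → B)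
  (hθ : ∀ x, φ x = x ^ p + p * θ x)

include htf hθ

-- Formally `θ = (φ - (·)^p) / p`. The identity is additivity of `φ` divided by `p`, which is
-- legitimate as `B` has no `p`-torsion.
omit hp in
theorem theta_add (P : MvPolynomial (Fin 2) ℤ) (hP : (MvPolynomial.X 0 + MvPolynomial.X 1) ^ p =
    MvPolynomial.X 0 ^ p + MvPolynomial.X 1 ^ p + (p : MvPolynomial (Fin 2) ℤ) * P) (x y : B) :
    θ (x + y) = θ x + θ y - MvPolynomial.aeval ![x, y] P := by
  have h := congrArg (MvPolynomial.aeval ![x, y]) hP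
  simp only [map_pow, map_add, map_mul, map_natCast, MvPolynomial.aeval_X, Matrix.cons_val_zero,
    Matrix.cons_val_one] at h
  have h1 := map_add φ x y
  rw [hθ, hθ, hθ] at h1
  refine sub_eq_zero.mp (htf _ ?_)
  linear_combination h1 - h

omit hp in
theorem theta_mul (x y : B) :
    θ (x * y) = x ^ p * θ y + y ^ p * θ x + p * (θ x * θ y) := by
  have h1 := map_mul φ x y
  rw [hθ, hθ, hθ] at h1
  refine sub_eq_zero.mp (htf _ ?_)
  linear_combination h1

/-- The derivation `x ↦ x ^ (p - 1) d x + d ((φ x - x ^ p) / p)`. -/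
def frobD : B →+ E.C 1 :=
  AddMonoidHom.mk' (fun x => c x ^ (p - 1) • E.d 0 (c x) + E.d 0 (c (θ x))) (fun x y => by
    -- Neither summand is additive. The defect of `x^(p-1) dx` and that of `dθ(x)`, which is `dP(x,
    -- y)` up to sign, cancel by the formulas for the partial derivatives of `P`.
    obtain ⟨P, hP, h0, h1⟩ := exists_frobenius_defect p hp.out
    have h2 : c (MvPolynomial.aeval ![x, y] P) = MvPolynomial.aeval ![c x, c y] P := by
      rw [MvPolynomial.aeval_def, MvPolynomial.aeval_def, MvPolynomial.hom_eval₂]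
      congr 1
      · exact RingHom.ext_int _ _
      · ext i; fin_cases i <;> rfl
    rw [theta_add htf φ θ hθ P hP, map_sub, map_add, map_add, h2, map_sub, d_aeval, h0, h1]
    simp only [map_add, map_sub, map_pow, MvPolynomial.aeval_X, Matrix.cons_val_zero,
      Matrix.cons_val_one]
    module)

theorem frobD_apply (x : B) : frobD c htf φ θ hθ x =
    c x ^ (p - 1) • E.d 0 (c x) + E.d 0 (c (θ x)) := rfl

/-- Morally this is the Leibniz rule for `dφ` divided by `p`. As `E` may have `p`-torsion, the terms
are expanded instead, and only the ring `B` is divided by `p`. -/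
theorem frobD_mul (x y : B) : frobD c htf φ θ hθ (x * y) =
    c (φ x) • frobD c htf φ θ hθ y + c (φ y) • frobD c htf φ θ hθ x := by
  have hpow : ∀ z : E.C 0, z ^ p = z ^ (p - 1) * z := fun z => by
    rw [← pow_succ, Nat.sub_add_cancel hp.out.one_le]
  have hdpow : ∀ z : E.C 0, E.d 0 (z ^ p) = (p : E.C 0) • z ^ (p - 1) • E.d 0 z := fun z => by
    have h := d_pow_succ z (p - 1)
    rwa [Nat.sub_add_cancel hp.out.one_le] at h
  simp only [frobD_apply, theta_mul htf φ θ hθ, hθ, map_add, map_mul, map_pow, map_natCast, d_mul,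
    hdpow, mul_pow]
  have : E.d 0 (p : E.C 0) = 0 := by exact_mod_cast d_intCast (E := E) (p : ℤ)
  simp only [this, hpow]
  module

/-- The differential of `x^(p-1) dx` contains the factor `dx · dx = 0`. -/
theorem d_frobD (x : B) : E.d 1 (frobD c htf φ θ hθ x) = 0 := by
  -- Since `p ≥ 2`, the exponent `p - 1` is a successor, as the formula for `d(x^(n+1))` demands.
  obtain ⟨n, hn⟩ : ∃ n, p = n + 2 := ⟨p - 2, by have := hp.out.two_le; omega⟩
  rw [frobD_apply, map_add, E.d_d, add_zero, show p - 1 = n + 1 by omega, d_smul, E.d_d, smul_zero,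
    add_zero, d_pow_succ, smul_mul, smul_mul, E.mul_self _ _ odd_one, smul_zero, smul_zero]

theorem d_phi_eq (x : B) : E.d 0 (c (φ x)) = (p : ℤ) • frobD c htf φ θ hθ x := by
  have h := d_pow_succ (c x) (p - 1)
  rw [Nat.sub_add_cancel hp.out.one_le] at h
  rw [frobD_apply, hθ, map_add, map_add, map_pow, h, map_mul, map_natCast, d_mul, smul_add,
    natCast_zsmul, natCast_zsmul, ← Nat.cast_smul_eq_nsmul (E.C 0), ← Nat.cast_smul_eq_nsmul (E.C 0)]
  have : E.d 0 (p : E.C 0) = 0 := by exact_mod_cast d_intCast (E := E) (p : ℤ)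
  rw [this, smul_zero, add_zero]

end CDGA

end

/-! ### The Frobenius of the completed log de Rham complex -/

noncomputable section

namespace LogCDGA

variable {B : LogRing.{u}} (A : LogCDGA B)

theorem δ_one : A.δ 1 = 0 := by
  have h := A.δ_mul 1 1
  rw [_root_.mul_one] at h
  exact left_eq_add.mp h

theorem δ_pow (l : A.L) (n : ℕ) : A.δ (l ^ n) = (n : ℤ) • A.δ l := by
  induction n with
  | zero => rw [pow_zero, δ_one, Nat.cast_zero, zero_smul]
  | succ n ih => rw [pow_succ, A.δ_mul, ih, Nat.cast_succ, add_smul, one_smul]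

end LogCDGA

namespace LogRing.Hom

variable {B A : LogRing.{u}} (f : Hom B A)

theorem toDeRham_injective : Function.Injective f.toDeRham := fun _ _ h =>
  (ExteriorAlgebra.algebraMap_leftInverse f.Omega).injective (congrArg Subtype.val h)

theorem toDeRham_surjective : Function.Surjective f.toDeRham := by
  rintro ⟨x, hx⟩
  rw [ExteriorAlgebra.exteriorPower, pow_zero] at hx
  obtain ⟨r, rfl⟩ := Submodule.mem_one.mp hx
  exact ⟨r, rfl⟩

end LogRing.Hom

namespace LogFrobeniusLifting

variable {p : ℕ} [hp : Fact p.Prime] {k N : Type u} [Field k] [CommMonoid N]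
    {β : N →* k} {R : LogRing.{u}} {f : LogRing.Hom (LogRing.logPoint β) R}
    (D : LogFrobeniusLifting p f)

theorem can_surjective : Function.Surjective D.can := by
  rintro ⟨x, hx⟩
  choose a ha using fun n => (D.base n).toDeRham_surjective (x n)
  refine ⟨⟨a, fun n => (D.base n).toDeRham_injective ?_⟩, Subtype.ext (funext ha)⟩
  rw [← deRhamRes_toDeRham, ha, ha]
  exact hx n

/-- The projection `ω̂ → ω_n`. -/
def omegaProj (n : ℕ) : CDGA.Hom D.omegaCDGA (D.base n).deRhamCDGA :=
  CDGA.limProj (fun n => (D.base n).deRhamCDGA) D.deRhamRes n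

theorem omega_ext {i : ℕ} {x y : D.omegaCDGA.C i}
    (h : ∀ n, (D.omegaProj n).f i x = (D.omegaProj n).f i y) : x = y :=
  Subtype.ext (funext h)

/-- The element `dlog m` of `ω̂¹`. -/
def dlog (m : R.M) : D.omegaCDGA.C 1 := D.omegaHat.δ m

theorem omegaProj_can (n : ℕ) (x : D.hatA) :
    (D.omegaProj n).f 0 (D.can x) = (D.base n).toDeRham (D.hatProj n x) := rfl

theorem deRhamRes_omegaProj (n : ℕ) {i : ℕ} (x : D.omegaCDGA.C i) :
    (D.deRhamRes n).f i ((D.omegaProj (n + 1)).f i x) = (D.omegaProj n).f i x := x.2 n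

/-- The Frobenius lift on `Â` as a ring homomorphism. -/
def hatφHom : D.hatA →+* D.hatA where
  toFun := D.hatφ
  map_one' := Subtype.ext (funext fun n => map_one (D.φ n))
  map_zero' := Subtype.ext (funext fun n => map_zero (D.φ n))
  map_add' x y := Subtype.ext (funext fun n => map_add (D.φ n) (x.1 (n + 1)) (y.1 (n + 1)))
  map_mul' x y := Subtype.ext (funext fun n => map_mul (D.φ n) (x.1 (n + 1)) (y.1 (n + 1)))

theorem hatProj_hatφHom (n : ℕ) (x : D.hatA) :
    D.hatProj n (D.hatφHom x) = D.φ n (D.hatProj (n + 1) x) := rfl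

theorem hatφHom_hatα (m : R.M) : D.hatφHom (D.hatα m) = D.hatα m ^ p := by
  rw [← map_pow]
  exact Subtype.ext (funext fun n => D.φ_α n m)

theorem hatφHom_hatι [CharP k p] (w : WittVector p k) :
    D.hatφHom (D.hatι w) = D.hatι (WittVector.frobenius w) := by
  refine Subtype.ext (funext fun n => ?_)
  change D.φ n (D.ι (n + 1) (WittVector.truncate (n + 2) w)) =
    D.ι n (WittVector.truncate (n + 1) (WittVector.frobenius w))
  rw [D.φ_ι]
  congr 1
  refine TruncatedWittVector.ext fun i => ?_
  rw [TruncatedWittVector.frob, WittVector.coeff_truncate, WittVector.coeff_truncate,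
    WittVector.coeff_frobenius_charP, WittVector.coeff_frobenius_charP]
  congr 1
  have h := TruncatedWittVector.coeff_out (WittVector.truncate (n + 2) w)
    (Fin.castLE (Nat.le_succ _) i : Fin (n + 2))
  rw [WittVector.coeff_truncate] at h
  exact h

variable [CharP k p] [PerfectRing k p]

/-- The map `φ₁` induces the `p`-th power on `A_1 = R`, so `φ(x) - x^p` dies in `A_1`, and the
kernel of `Â → A_1` is `p Â`. -/
theorem exists_hatθ (x : D.hatA) : ∃ y, D.hatφHom x = x ^ p + p * y := by
  have h : D.hatProj 0 (D.hatφHom x - x ^ p) = 0 := by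
    rw [map_sub, sub_eq_zero, map_pow]
    apply D.e.injective
    rw [map_pow, hatProj_hatφHom, D.φ_zero]
    congr 2
    exact x.2 0
  obtain ⟨y, hy⟩ := D.isPadicTower.ker_pr 0 (x := D.hatφHom x - x ^ p) h
  rw [zero_add, pow_one, natCast_zsmul, nsmul_eq_mul, sub_eq_iff_eq_add'] at hy
  exact ⟨y, hy⟩

/-- The map `x ↦ (φ x - x ^ p) / p` on `Â`. -/
def hatθ (x : D.hatA) : D.hatA := (D.exists_hatθ x).choose

theorem hatφHom_eq (x : D.hatA) : D.hatφHom x = x ^ p + p * D.hatθ x :=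
  (D.exists_hatθ x).choose_spec

theorem hatθ_unique {x y : D.hatA} (h : D.hatφHom x = x ^ p + p * y) : D.hatθ x = y := by
  refine sub_eq_zero.mp (D.hatA_torsionFree ?_)
  rw [D.hatφHom_eq x] at h
  linear_combination h

/-- The divided Frobenius derivation `Â → ω̂¹`. -/
def frobD : D.hatA →+ D.omegaCDGA.C 1 :=
  CDGA.frobD D.can (fun _ => D.hatA_torsionFree) D.hatφHom D.hatθ D.hatφHom_eq

theorem frobD_apply (x : D.hatA) : D.frobD x =
    D.can x ^ (p - 1) • D.omegaCDGA.d 0 (D.can x) + D.omegaCDGA.d 0 (D.can (D.hatθ x)) := rfl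

theorem frobD_mul (x y : D.hatA) : D.frobD (x * y) =
    D.can (D.hatφHom x) • D.frobD y + D.can (D.hatφHom y) • D.frobD x :=
  CDGA.frobD_mul _ _ _ _ _ x y

omit [CharP k p] [PerfectRing k p] in
theorem d_can_hatι (w : WittVector p k) : D.omegaCDGA.d 0 (D.can (D.hatι w)) = 0 :=
  D.omegaHat.d_ι w

/-- The Witt vector Frobenius also lifts the `p`-th power, so `θ` of a constant is a constant, and
both terms are multiples of differentials of constants. -/
theorem frobD_hatι (w : WittVector p k) : D.frobD (D.hatι w) = 0 := by
  obtain ⟨v, hv⟩ : ∃ v, WittVector.frobenius w = w ^ p + p * v := by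
    have h : WittVector.frobenius w - w ^ p ∈
        RingHom.ker (WittVector.constantCoeff : WittVector p k →+* k) := by
      rw [RingHom.mem_ker, map_sub, map_pow, sub_eq_zero]
      exact WittVector.coeff_frobenius_charP p w 0
    rw [WittVector.ker_constantCoeff, Ideal.mem_span_singleton] at h
    obtain ⟨v, hv⟩ := h
    exact ⟨v, by rw [← hv]; ring⟩
  have h : D.hatθ (D.hatι w) = D.hatι v := D.hatθ_unique (by
    rw [hatφHom_hatι, hv, map_add, map_pow, map_mul, map_natCast])
  rw [frobD_apply, h, d_can_hatι, d_can_hatι, smul_zero, add_zero]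

/-- On the log structure `φ` is exactly the `p`-th power, so `θ` vanishes there. What remains is
`α^(p-1) dα = α^p dlog`, the compatibility that permits `F(dlog m) = dlog m`. -/
theorem frobD_hatα (m : R.M) : D.frobD (D.hatα m) =
    D.can (D.hatφHom (D.hatα m)) • D.dlog m := by
  have h : D.hatθ (D.hatα m) = 0 := D.hatθ_unique (by
    rw [hatφHom_hatα, mul_zero, add_zero])
  have h1 : D.omegaCDGA.d 0 (D.can (D.hatα m)) = D.can (D.hatα m) • D.dlog m :=
    D.omegaHat.d_α m
  rw [frobD_apply, h, map_zero, map_zero, add_zero, hatφHom_hatα, h1, smul_smul, ← pow_succ,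
    Nat.sub_add_cancel hp.out.one_le, map_pow]

/-- The divided Frobenius derivation `A_{n+1} → ω¹_n`. -/
def frobDLevel (n : ℕ) : D.A (n + 1) →+ (D.base n).deRhamCDGA.C 1 :=
  (D.hatProj (n + 1) : D.hatA →+ D.A (n + 1)).liftOfSurjective
    (D.isPadicTower.pr_surjective (n + 1))
    ⟨((D.omegaProj n).f 1).comp D.frobD, fun x hx => by
      obtain ⟨y, rfl⟩ := D.isPadicTower.ker_pr (n + 1) hx
      change (D.omegaProj n).f 1 (D.frobD _) = 0
      -- The kernel of `Â → A (n + 1)` is `p^(n+2) Â`, while `p^(n+1)` already kills level `n` of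
      -- the complex.
      rw [map_zsmul, map_zsmul, pow_succ, mul_comm, mul_smul, deRham_natCast_pow_smul, smul_zero]⟩

theorem frobDLevel_hatProj (n : ℕ) (x : D.hatA) :
    D.frobDLevel n (D.hatProj (n + 1) x) = (D.omegaProj n).f 1 (D.frobD x) :=
  AddMonoidHom.liftOfRightInverse_comp_apply _ _ _ _ _

/-- The log derivation that defines the Frobenius `ω_{n+1} → ω_n`. -/
def frobDer (n : ℕ) : (D.base (n + 1)).LogDer (D.base n).deRhamCDGA
    ((D.base n).toDeRham.comp (D.φ n)) where
  D := D.frobDLevel n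
  δ m := (D.base n).genEl (.inr m)
  D_mul x y := by
    obtain ⟨x, rfl⟩ := D.isPadicTower.pr_surjective (n + 1) x
    obtain ⟨y, rfl⟩ := D.isPadicTower.pr_surjective (n + 1) y
    refine (congrArg (D.frobDLevel n) (map_mul (D.hatProj (n + 1)) x y).symm).trans ?_
    rw [frobDLevel_hatProj, frobD_mul, map_add, CDGA.Hom.map_smul, CDGA.Hom.map_smul]
    refine (congrArg₂ (· + ·) ?_ ?_)
    · exact congrArg _ (D.frobDLevel_hatProj n y).symm
    · exact congrArg _ (D.frobDLevel_hatProj n x).symm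
  D_base w := by
    obtain ⟨w, rfl⟩ := WittVector.truncate_surjective p (n + 2) k w
    refine (D.frobDLevel_hatProj n (D.hatι w)).trans ?_
    rw [frobD_hatι, map_zero]
  δ_mul l m := (D.base n).deRham.δ_mul l m
  D_α l := by
    refine (D.frobDLevel_hatProj n (D.hatα l)).trans ?_
    rw [frobD_hatα, CDGA.Hom.map_smul]
    rfl
  δ_base x := (D.base n).deRham.δ_ιL x

/-- The Frobenius `ω_{n+1} → ω_n`. -/
def frobLevel (n i : ℕ) : (D.base (n + 1)).deRhamCDGA.C i →+ (D.base n).deRhamCDGA.C i :=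
  (D.frobDer n).graded i

theorem frobLevel_mul (n : ℕ) {i j m : ℕ} (h : i + j = m) (x y) :
    D.frobLevel n m ((D.base (n + 1)).deRhamCDGA.mul h x y) =
      (D.base n).deRhamCDGA.mul h (D.frobLevel n i x) (D.frobLevel n j y) :=
  (D.frobDer n).graded_mul h x y

theorem frobLevel_toDeRham (n : ℕ) (x : D.A (n + 1)) :
    D.frobLevel n 0 ((D.base (n + 1)).toDeRham x) = (D.base n).toDeRham (D.φ n x) :=
  (D.frobDer n).graded_toDeRham x

theorem frobLevel_inl (n : ℕ) (x : D.hatA) :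
    D.frobLevel n 1 ((D.base (n + 1)).genEl (.inl (D.hatProj (n + 1) x))) =
      (D.omegaProj n).f 1 (D.frobD x) :=
  ((D.frobDer n).graded_genEl _).trans (D.frobDLevel_hatProj n x)

theorem frobLevel_inr (n : ℕ) (m : R.M) :
    D.frobLevel n 1 ((D.base (n + 1)).genEl (.inr m)) = (D.base n).genEl (.inr m) :=
  (D.frobDer n).graded_genEl _

theorem d_frobLevel (n i : ℕ) (x : (D.base (n + 1)).deRhamCDGA.C i) :
    (D.base n).deRhamCDGA.d i (D.frobLevel n i x) =
      (p : ℤ) • D.frobLevel n (i + 1) ((D.base (n + 1)).deRhamCDGA.d i x) := by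
  refine (D.frobDer n).d_graded p (fun x => ?_) (fun x => ?_) (fun m => ?_) i x
  · obtain ⟨x, rfl⟩ := D.isPadicTower.pr_surjective (n + 1) x
    have h := congrArg ((D.omegaProj n).f 1) (CDGA.d_phi_eq D.can (fun _ => D.hatA_torsionFree)
      D.hatφHom D.hatθ D.hatφHom_eq x)
    rw [(D.omegaProj n).map_d, map_zsmul] at h
    exact h.trans (congrArg _ (D.frobDLevel_hatProj n x).symm)
  · obtain ⟨x, rfl⟩ := D.isPadicTower.pr_surjective (n + 1) x
    refine (congrArg _ (D.frobDLevel_hatProj n x)).trans ?_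
    rw [← (D.omegaProj n).map_d]
    exact (congrArg _ (CDGA.d_frobD _ _ _ _ _ x)).trans (map_zero _)
  · exact (D.base n).d_genEl _

theorem frobLevel_res (n i : ℕ) (x : (D.base (n + 2)).deRhamCDGA.C i) :
    (D.deRhamRes n).f i (D.frobLevel (n + 1) i x) =
      D.frobLevel n i ((D.deRhamRes (n + 1)).f i x) := by
  refine (D.base (n + 2)).deRham_ext (E := (D.base n).deRhamCDGA)
    (g := fun i => ((D.deRhamRes n).f i).comp (D.frobLevel (n + 1) i))
    (h := fun i => (D.frobLevel n i).comp ((D.deRhamRes (n + 1)).f i))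
    (fun e x y => ?_) (fun e x y => ?_) (fun r => ?_) ?_ i x
  · simp only [AddMonoidHom.comp_apply, frobLevel_mul, (D.deRhamRes n).map_mul]
  · simp only [AddMonoidHom.comp_apply, frobLevel_mul, (D.deRhamRes (n + 1)).map_mul]
  · refine (congrArg ((D.deRhamRes n).f 0) (D.frobLevel_toDeRham (n + 1) r)).trans ?_
    rw [deRhamRes_toDeRham]
    refine Eq.trans ?_ (congrArg (D.frobLevel n 0) (D.deRhamRes_toDeRham (n + 1) r).symm)
    rw [frobLevel_toDeRham, D.φ_res]
  · rintro (x | m)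
    · obtain ⟨x, rfl⟩ := D.isPadicTower.pr_surjective (n + 2) x
      change (D.deRhamRes n).f 1 (D.frobLevel (n + 1) 1 _) = D.frobLevel n 1 _
      refine (congrArg _ (D.frobLevel_inl (n + 1) x)).trans ?_
      rw [deRhamRes_omegaProj, ← frobLevel_inl]
      refine congrArg _ (Eq.symm ?_)
      refine (D.deRhamRes_genEl (n + 1) _).trans ?_
      exact congrArg (fun t => (D.base (n + 1)).genEl (.inl t)) (x.2 (n + 1))
    · change (D.deRhamRes n).f 1 (D.frobLevel (n + 1) 1 _) = D.frobLevel n 1 _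
      rw [frobLevel_inr, deRhamRes_genEl]
      refine Eq.trans ?_ (congrArg _ (D.deRhamRes_genEl (n + 1) (.inr m)).symm)
      exact (D.frobLevel_inr n m).symm

/-- The Frobenius of `ω̂`. -/
def omegaF (i : ℕ) : D.omegaCDGA.C i →+ D.omegaCDGA.C i :=
  AddMonoidHom.mk' (fun x => ⟨fun n => D.frobLevel n i (x.1 (n + 1)), fun n => by
      rw [frobLevel_res, x.2 (n + 1)]⟩)
    (fun x y => Subtype.ext (funext fun n => map_add (D.frobLevel n i) (x.1 (n + 1)) (y.1 (n + 1))))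

theorem omegaF_can (x : D.hatA) : D.omegaF 0 (D.can x) = D.can (D.hatφHom x) :=
  D.omega_ext fun n => D.frobLevel_toDeRham n _

theorem omegaF_d_can (x : D.hatA) : D.omegaF 1 (D.omegaCDGA.d 0 (D.can x)) = D.frobD x :=
  D.omega_ext fun n => by
    refine Eq.trans ?_ (D.frobLevel_inl n x)
    change D.frobLevel n 1 ((D.base (n + 1)).deRhamCDGA.d 0 _) = _
    exact congrArg _ ((D.base (n + 1)).d_toDeRham _)

theorem omegaF_δ (m : R.M) : D.omegaF 1 (D.omegaHat.δ m) = D.omegaHat.δ m :=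
  D.omega_ext fun n => D.frobLevel_inr n m

/-- The Frobenius structure of the completed log de Rham complex. -/
def omegaStr : LogDieudonneStructure p D.omegaHat where
  F := D.omegaF
  FL := powMonoidHom p
  F_one := (D.omegaF_can 1).trans (congrArg D.can (map_one D.hatφHom))
  F_mul h x y := D.omega_ext fun n => D.frobLevel_mul n h _ _
  F_frob x := by
    obtain ⟨x, rfl⟩ := D.can_surjective x
    refine ⟨D.can (D.hatθ x), (D.omegaF_can x).trans ?_⟩
    have h : D.can (D.hatφHom x) = D.can x ^ p + (p : ℤ) • D.can (D.hatθ x) := by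
      rw [hatφHom_eq, map_add, map_pow, map_mul, map_natCast, natCast_zsmul, nsmul_eq_mul]
    exact h
  d_F i x := D.omega_ext fun n => D.d_frobLevel n i (x.1 (n + 1))
  F_α m := by
    refine (D.omegaF_can (D.hatα m)).trans (congrArg D.can ?_)
    exact (D.hatφHom_hatα m).trans (map_pow D.hatα m p).symm
  δ_FL m := by
    refine (D.omegaHat.δ_pow m p).trans ?_
    exact (congrArg ((p : ℤ) • ·) (D.omegaF_δ m)).symm

theorem omegaStr_isCanonicalFrobenius : D.IsCanonicalFrobenius D.omegaStr where
  F_can := D.omegaF_can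
  F_d_can x y h := by
    have hy : D.hatθ x = y := D.hatθ_unique h
    subst hy
    exact (D.omegaF_d_can x).trans (D.frobD_apply x)
  F_δ := D.omegaF_δ
  FL_eq _ := rfl

end LogFrobeniusLifting

end

/-! ### Generation of the completed log de Rham complex -/

noncomputable section

namespace LogRing.Hom

variable {B A : LogRing.{u}} (f : Hom B A)

/-- By the Leibniz rule and additivity of `dlog`, the differentials of algebra generators and the
`dlog`s of monoid generators span. -/
theorem finite_omega (hf : f.ring.FiniteType) (hM : Monoid.FG A.M) :
    Module.Finite A.R f.Omega := by
  let := f.ring.toAlgebra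
  obtain ⟨s, hs⟩ : (⊤ : Subalgebra B.R A.R).FG := hf.out
  obtain ⟨t, ht⟩ := hM.fg_top
  set P := Submodule.span A.R (f.gen '' (Sum.inl '' (s : Set A.R) ∪ Sum.inr '' (t : Set A.M)))
    with hP
  have h1 : ∀ x : A.R, f.gen (.inl x) ∈ P := by
    intro x
    have hx : x ∈ Algebra.adjoin B.R (s : Set A.R) := hs ▸ Algebra.mem_top
    induction hx using Algebra.adjoin_induction with
    | mem x hx => exact Submodule.subset_span ⟨_, .inl ⟨x, hx, rfl⟩, rfl⟩
    | algebraMap r =>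
      rw [show f.gen (.inl (algebraMap B.R A.R r)) = 0 from f.gen_base r]
      exact zero_mem _
    | add x y _ _ hx hy => rw [gen_add]; exact add_mem hx hy
    | mul x y _ _ hx hy =>
      rw [gen_mul]; exact add_mem (P.smul_mem _ hy) (P.smul_mem _ hx)
  have h2 : ∀ m : A.M, f.gen (.inr m) ∈ P := by
    intro m
    have hm : m ∈ Submonoid.closure (t : Set A.M) := ht ▸ Submonoid.mem_top m
    induction hm using Submonoid.closure_induction with
    | mem m hm => exact Submodule.subset_span ⟨_, .inr ⟨m, hm, rfl⟩, rfl⟩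
    | one =>
      have h := f.gen_dlog_base 1
      rw [map_one] at h
      rw [h]
      exact zero_mem _
    | mul l m _ _ hl hm => rw [gen_dlog_mul]; exact add_mem hl hm
  have hfg : P.FG := Submodule.fg_span (Set.Finite.image _
    ((s.finite_toSet.image _).union (t.finite_toSet.image _)))
  have htop : P = ⊤ := by
    refine eq_top_iff.mpr fun w _ => ?_
    induction w using f.omega_induction with
    | h0 => exact zero_mem _
    | hadd v w hv hw => exact add_mem (hv trivial) (hw trivial)
    | hgen a g =>
      refine P.smul_mem _ ?_
      cases g with
      | inl x => exact h1 x
      | inr m => exact h2 m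
  exact ⟨htop ▸ hfg⟩

theorem exists_generators (hf : f.ring.FiniteType) (hM : Monoid.FG A.M) (i : ℕ) :
    ∃ (n : ℕ) (e : Fin n → f.deRhamCDGA.C i), ∀ x, ∃ c : Fin n → A.R,
      x = ∑ j, f.toDeRham (c j) • e j := by
  have := f.finite_omega hf hM
  have hfg : (⋀[A.R]^i f.Omega).FG := by
    rw [ExteriorAlgebra.exteriorPower]
    exact Submodule.FG.pow (by rw [LinearMap.range_eq_map]; exact this.fg_top.map _) i
  obtain ⟨n, e, he⟩ := Submodule.fg_iff_exists_fin_generating_family.mp hfg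
  have he' : ∀ j, e j ∈ ⋀[A.R]^i f.Omega := fun j => he ▸ Submodule.subset_span ⟨j, rfl⟩
  refine ⟨n, fun j => ⟨e j, he' j⟩, fun x => ?_⟩
  obtain ⟨c, hc⟩ := Submodule.mem_span_range_iff_exists_fun A.R |>.mp (Submodule.ext_iff.mp he x.1 |>.mpr x.2)
  refine ⟨c, ?_⟩
  have h : ∀ j, @HSMul.hSMul (f.deRhamCDGA.C 0) (f.deRhamCDGA.C i) (f.deRhamCDGA.C i) _
    (f.toDeRham (c j)) (⟨e j, he' j⟩ : f.deRhamCDGA.C i) =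
    (c j • (⟨e j, he' j⟩ : ⋀[A.R]^i f.Omega)) := fun j => f.val_smul (c j) _
  rw [Finset.sum_congr rfl fun j _ => h j]
  refine Subtype.ext (hc.symm.trans ?_)
  exact (map_sum (Submodule.subtype (⋀[A.R]^i f.Omega))
    (fun j => c j • (⟨e j, he' j⟩ : ⋀[A.R]^i f.Omega)) _).symm

end LogRing.Hom

namespace LogFrobeniusLifting

variable {p : ℕ} [hp : Fact p.Prime] {k N : Type u} [Field k] [CommMonoid N]
    {β : N →* k} {R : LogRing.{u}} {f : LogRing.Hom (LogRing.logPoint β) R}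
    (D : LogFrobeniusLifting p f) [CharP k p] [PerfectRing k p]

theorem omegaProj_isPadicTower (i : ℕ) : IsPadicTower p (fun n => (D.deRhamRes n).f i)
    (fun n => (D.omegaProj n).f i) := D.omega_isPadicTower i

/-- Induction for elements of the completed log de Rham complex. -/
theorem omega_induction {Q : ∀ i, D.omegaCDGA.C i → Prop}
    (hcan : ∀ x, Q 0 (D.can x))
    (hadd : ∀ i x y, Q i x → Q i y → Q i (x + y))
    (hd : ∀ a i x, Q i x → Q (i + 1)
      (D.omegaCDGA.mul (Nat.add_comm 1 i) (D.omegaCDGA.d 0 (D.can a)) x))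
    (hdlog : ∀ m i x, Q i x → Q (i + 1) (D.omegaCDGA.mul (Nat.add_comm 1 i) (D.dlog m) x))
    (hsmul : ∀ a i x, Q i x → Q i (D.can a • x))
    (i : ℕ) (x : D.omegaCDGA.C i) : Q i x := by
  -- Level `0` is the reduction modulo `p`. Each element there is built by the operations that
  -- preserve `Q`, and performing the same operations upstairs gives a lift with `Q`.
  have lift : ∀ i (y : (D.base 0).deRhamCDGA.C i), ∃ e, Q i e ∧ (D.omegaProj 0).f i e = y := by
    intro i y
    induction i, y using (D.base 0).deRham_induction with
    | hzero r =>
      obtain ⟨s, rfl⟩ := D.isPadicTower.pr_surjective 0 r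
      exact ⟨D.can s, hcan s, rfl⟩
    | hadd i x y hx hy =>
      obtain ⟨x, hx, rfl⟩ := hx
      obtain ⟨y, hy, rfl⟩ := hy
      exact ⟨x + y, hadd i x y hx hy, map_add _ _ _⟩
    | hgen t i x hx =>
      obtain ⟨x, hx, rfl⟩ := hx
      cases t with
      | inl r =>
        obtain ⟨s, rfl⟩ := D.isPadicTower.pr_surjective 0 r
        refine ⟨_, hd s i x hx, ?_⟩
        rw [(D.omegaProj 0).map_mul, (D.omegaProj 0).map_d, omegaProj_can]
        refine congrArg (fun t => (D.base 0).deRhamCDGA.mul (Nat.add_comm 1 i) t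
          ((D.omegaProj 0).f i x)) ?_
        exact (D.base 0).d_toDeRham _
      | inr m =>
        refine ⟨_, hdlog m i x hx, ?_⟩
        rw [(D.omegaProj 0).map_mul]
        rfl
    | hsmul r i x hx =>
      obtain ⟨x, hx, rfl⟩ := hx
      obtain ⟨s, rfl⟩ := D.isPadicTower.pr_surjective 0 r
      exact ⟨_, hsmul s i x hx, CDGA.Hom.map_smul _ _ _⟩
  have hzero : ∀ i, Q i 0 := fun i => by
    obtain ⟨e, he, -⟩ := lift i 0
    have := hsmul 0 i e he
    rwa [map_zero, zero_smul] at this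
  obtain ⟨n, ē, hē⟩ := (D.base 0).exists_generators
    (RingHom.FiniteType.of_finitePresentation (D.logSmooth 0).finitePresentation) (D.logSmooth 0).fine.fg i
  choose e he hpe using fun j => lift i (ē j)
  -- Nakayama: lifts `e j` of generators modulo `p` generate up to `p ω̂`, because the kernel of the
  -- projection to level `0` is `p ω̂`.
  have step : ∀ x : D.omegaCDGA.C i, ∃ (a : Fin n → D.hatA) (y : D.omegaCDGA.C i),
      x = ∑ j, D.can (a j) • e j + (p : ℤ) • y := by
    intro x
    obtain ⟨c, hc⟩ := hē ((D.omegaProj 0).f i x)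
    choose a ha using fun j => D.isPadicTower.pr_surjective 0 (c j)
    have h : (D.omegaProj 0).f i (x - ∑ j, D.can (a j) • e j) = 0 := by
      rw [map_sub, map_sum, hc, sub_eq_zero]
      refine Finset.sum_congr rfl fun j _ => ?_
      rw [CDGA.Hom.map_smul, hpe, ← ha]
      rfl
    obtain ⟨y, hy⟩ := (D.omegaProj_isPadicTower i).ker_pr 0 h
    exact ⟨a, y, by rw [zero_add, pow_one] at hy; rw [← hy]; abel⟩
  choose a y hay using step
  -- The error terms `y^[m] x` contribute coefficients `p^m a(y^[m] x)`, whose series converges in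
  -- `Â`.
  let s : Fin n → D.omegaCDGA.C i → D.hatA := fun j x =>
    D.isPadicTower.sum fun m => a (y^[m] x) j
  have hs : ∀ j x, s j x = a x j + (p : ℤ) • s j (y x) := fun j x =>
    D.isPadicTower.sum_eq _
  -- The remainder for `x` is `p` times the remainder for `y x`, so it is divisible by every `p^m`
  -- and vanishes.
  have key : ∀ x, x = ∑ j, D.can (s j x) • e j := by
    intro x
    refine sub_eq_zero.mp ((D.omegaProj_isPadicTower i).separated fun m => ?_)
    induction m generalizing x with
    | zero => exact ⟨_, (by rw [pow_zero, one_smul])⟩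
    | succ m ih =>
      obtain ⟨z, hz⟩ := ih (y x)
      refine ⟨z, ?_⟩
      rw [pow_succ', mul_smul, ← hz, smul_sub, Finset.smul_sum]
      have h1 : ∑ j, D.can (s j x) • e j = ∑ j, D.can (a x j) • e j +
          ∑ j, (p : ℤ) • D.can (s j (y x)) • e j := by
        rw [← Finset.sum_add_distrib]
        refine Finset.sum_congr rfl fun j _ => ?_
        rw [hs j x, map_add, map_zsmul, add_smul, smul_assoc]
      rw [h1, sub_eq_iff_eq_add]
      refine (hay x).trans ?_
      abel
  rw [key x]
  generalize s = s
  have : ∀ t : Finset (Fin n), Q i (∑ j ∈ t, D.can (s j x) • e j) := by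
    intro t
    induction t using Finset.induction_on with
    | empty => rw [Finset.sum_empty]; exact hzero i
    | insert j t hj ih =>
      rw [Finset.sum_insert hj]
      exact hadd i _ _ (hsmul _ i _ (he j)) ih
  exact this _

/-- Two additive multiplicative families out of `ω̂` agree if they agree on generators. -/
theorem omega_hom_ext {E : CDGA.{u}} {g h : ∀ i, D.omegaCDGA.C i →+ E.C i}
    (hg : ∀ {i j n : ℕ} (e : i + j = n) x y,
      g n (D.omegaCDGA.mul e x y) = E.mul e (g i x) (g j y))
    (hh : ∀ {i j n : ℕ} (e : i + j = n) x y,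
      h n (D.omegaCDGA.mul e x y) = E.mul e (h i x) (h j y))
    (h₀ : ∀ a, g 0 (D.can a) = h 0 (D.can a))
    (h₁ : ∀ a, g 1 (D.omegaCDGA.d 0 (D.can a)) = h 1 (D.omegaCDGA.d 0 (D.can a)))
    (h₂ : ∀ m, g 1 (D.dlog m) = h 1 (D.dlog m)) (i : ℕ) (x : D.omegaCDGA.C i) :
    g i x = h i x := by
  induction i, x using D.omega_induction with
  | hcan a => exact h₀ a
  | hadd i x y hx hy => rw [map_add, map_add, hx, hy]
  | hd a i x hx => rw [hg, hh, h₁, hx]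
  | hdlog m i x hx => rw [hg, hh, h₂, hx]
  | hsmul r i x hx => rw [CDGA.smul_def, hg, hh, h₀, hx]

/-- The three conditions prescribe `F` on the generators `x`, `dx` and `dlog m`. The second applies
to every `x`, with `hatθ x` as the divided difference. -/
theorem IsCanonicalFrobenius.unique {S T : LogDieudonneStructure p D.omegaHat}
    (hS : D.IsCanonicalFrobenius S) (hT : D.IsCanonicalFrobenius T) : S = T := by
  refine LogDieudonneStructure.ext ?_ (MonoidHom.ext fun m => by rw [hS.FL_eq, hT.FL_eq])
  funext i
  refine AddMonoidHom.ext fun x => ?_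
  refine D.omega_hom_ext (E := D.omegaCDGA) (g := S.F) (h := T.F) S.F_mul T.F_mul
    (fun a => ?_) (fun a => ?_) (fun m => ?_) i x
  · exact (hS.F_can a).trans (hT.F_can a).symm
  · exact (hS.F_d_can a _ (D.hatφHom_eq a)).trans (hT.F_d_can a _ (D.hatφHom_eq a)).symm
  · exact (hS.F_δ m).trans (hT.F_δ m).symm

theorem existsUnique_canonicalFrobenius :
    ∃! S : LogDieudonneStructure p D.omegaHat, D.IsCanonicalFrobenius S :=
  ⟨D.omegaStr, D.omegaStr_isCanonicalFrobenius, fun _ h =>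
    h.unique D D.omegaStr_isCanonicalFrobenius⟩

end LogFrobeniusLifting

end

/-! ### Strictness of the completion along the Verschiebung -/

noncomputable section

namespace DieudonneAlgebra

variable {p : ℕ} {A : DieudonneAlgebra.{u} p} (hA : A.IsSaturated)

-- The saturation condition with the factor `p^i` cancelled: the image of `F` contains all `x` with
-- `dx` divisible by `p`.
include hA in
theorem exists_F_eq {i : ℕ} {x : A.cdga.C i} {z : A.cdga.C (i + 1)}
    (h : A.cdga.d i x = (p : ℤ) • z) : ∃ y, A.F i y = x := by
  have hx : (p : ℤ) ^ i • x ∈ A.eta 1 i :=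
    mem_eta.mpr ⟨⟨x, by rw [one_mul]⟩, z, by rw [one_mul, map_zsmul, h, smul_smul, pow_succ]⟩
  obtain ⟨y, hy, -⟩ := hA.2 i _ hx
  refine ⟨y, sub_eq_zero.mp (hA.1.pow i ?_)⟩
  rw [smul_sub, sub_eq_zero]
  exact hy

theorem V_F {i : ℕ} (x : A.cdga.C i) : V hA i (A.F i x) = (p : ℤ) • x :=
  F_injective hA i (by rw [F_V, map_zsmul])

theorem V_d {i : ℕ} (x : A.cdga.C i) :
    V hA (i + 1) (A.cdga.d i x) = (p : ℤ) • A.cdga.d i (V hA i x) :=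
  F_injective hA (i + 1) (by rw [F_V, map_zsmul, F_d_V])

include hA in
theorem smul_injective {i : ℕ} {x y : A.cdga.C i} (h : (p : ℤ) • x = (p : ℤ) • y) : x = y := by
  rw [← sub_eq_zero, ← smul_sub] at h
  exact sub_eq_zero.mp (hA.1 i _ h)

theorem Vpow_F (r : ℕ) {i : ℕ} (x : A.cdga.C i) :
    Vpow hA (r + 1) i (A.F i x) = (p : ℤ) • Vpow hA r i x := by
  change Vpow hA r i (V hA i (A.F i x)) = _
  rw [V_F, map_zsmul]

theorem Vpow_add (r s : ℕ) {i : ℕ} (x : A.cdga.C i) :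
    Vpow hA (r + s) i x = Vpow hA r i (Vpow hA s i x) := by
  induction r with
  | zero => rw [Nat.zero_add]; rfl
  | succ r ih => rw [Nat.succ_add, Vpow_succ, ih, Vpow_succ]

/-- Iterating `F d V = d`. In this way `F^r` recovers `dx` from `dV^r x`, which is how divisibility
by `p` is detected in the next lemmas. -/
theorem F_iterate_d_Vpow (r : ℕ) {i : ℕ} (x : A.cdga.C i) :
    (A.F (i + 1))^[r] (A.cdga.d i (Vpow hA r i x)) = A.cdga.d i x := by
  induction r with
  | zero => rfl
  | succ r ih => rw [Function.iterate_succ_apply, F_d_Vpow, ih]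

theorem F_iterate_zsmul (r : ℕ) {i : ℕ} (c : ℤ) (x : A.cdga.C i) :
    (A.F i)^[r] (c • x) = c • (A.F i)^[r] x := by
  induction r generalizing x with
  | zero => rfl
  | succ r ih => rw [Function.iterate_succ_apply, map_zsmul, ih, Function.iterate_succ_apply]

theorem mem_dVRange_succ {r i : ℕ} {x : A.cdga.C (i + 1)} :
    x ∈ dVRange hA r (i + 1) ↔ ∃ b, A.cdga.d i (Vpow hA r i b) = x := by
  constructor
  · rintro ⟨_, ⟨b, rfl⟩, rfl⟩
    exact ⟨b, rfl⟩
  · rintro ⟨b, rfl⟩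
    exact ⟨_, ⟨b, rfl⟩, rfl⟩

theorem d_eq_zero_of_mem_dVRange {r i : ℕ} {x : A.cdga.C i} (hx : x ∈ dVRange hA r i) :
    A.cdga.d i x = 0 := by
  cases i with
  | zero => rw [show x = 0 from hx, map_zero]
  | succ i =>
    obtain ⟨b, rfl⟩ := (mem_dVRange_succ hA).mp hx
    rw [A.cdga.d_d]

theorem mem_vIdeal {r i : ℕ} {x : A.cdga.C i} :
    x ∈ (vIdeal hA r).I i ↔ ∃ a, ∃ w ∈ dVRange hA r i, Vpow hA r i a + w = x := by
  constructor
  · intro hx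
    obtain ⟨_, ⟨u, rfl⟩, w, hw, rfl⟩ := AddSubgroup.mem_sup.mp hx
    exact ⟨u, w, hw, rfl⟩
  · rintro ⟨a, w, hw, rfl⟩
    exact AddSubgroup.mem_sup.mpr ⟨_, ⟨a, rfl⟩, w, hw, rfl⟩

theorem mem_vIdeal_zero_left {i : ℕ} (x : A.cdga.C i) : x ∈ (vIdeal hA 0).I i :=
  (mem_vIdeal hA).mpr ⟨x, 0, zero_mem _, add_zero _⟩

theorem V_mem_vIdeal {r i : ℕ} {x : A.cdga.C i} (hx : x ∈ (vIdeal hA r).I i) :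
    V hA i x ∈ (vIdeal hA (r + 1)).I i := by
  obtain ⟨a, w, hw, rfl⟩ := (mem_vIdeal hA).mp hx
  rw [map_add, ← Vpow_succ]
  refine add_mem ((mem_vIdeal hA).mpr ⟨a, 0, zero_mem _, add_zero _⟩) ?_
  cases i with
  | zero => rw [show w = 0 from hw, map_zero]; exact zero_mem _
  | succ i =>
    obtain ⟨b, rfl⟩ := (mem_dVRange_succ hA).mp hw
    rw [V_d, ← Vpow_succ]
    exact zsmul_mem ((mem_vIdeal hA).mpr ⟨0, _, (mem_dVRange_succ hA).mpr ⟨b, rfl⟩,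
      by rw [map_zero, zero_add]⟩) _

/-- From `p x = dV^(r+1) b` one gets `db = p F^(r+1) x`, hence `b = F b'`. As `V^(r+1) F = p V^r`,
the factor `p` cancels. -/
theorem mem_dVRange_of_smul {r i : ℕ} {x : A.cdga.C i} (h : (p : ℤ) • x ∈ dVRange hA (r + 1) i) :
    x ∈ dVRange hA r i := by
  cases i with
  | zero => exact hA.1 _ _ h
  | succ i =>
    obtain ⟨b, hb⟩ := (mem_dVRange_succ hA).mp h
    have h1 : A.cdga.d i b = (p : ℤ) • (A.F (i + 1))^[r + 1] x := by
      rw [← F_iterate_zsmul, ← hb, F_iterate_d_Vpow]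
    obtain ⟨b', rfl⟩ := exists_F_eq hA h1
    refine (mem_dVRange_succ hA).mpr ⟨b', smul_injective hA ?_⟩
    rw [← hb, Vpow_F, map_zsmul]

/-- Write `p x = V^(r+1) a + w` with `w` exact. Applying `F^(r+1) d` shows `p ∣ da`, so `a = F a'`
and `V^(r+1) a = p V^r a'`. What is left is `p (x - V^r a') = w`, the previous case. One step of the
filtration is lost. -/
theorem mem_vIdeal_of_smul {r i : ℕ} {x : A.cdga.C i}
    (h : (p : ℤ) • x ∈ (vIdeal hA (r + 1)).I i) : x ∈ (vIdeal hA r).I i := by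
  obtain ⟨a, w, hw, hx⟩ := (mem_vIdeal hA).mp h
  have h1 : A.cdga.d i a = (p : ℤ) • (A.F (i + 1))^[r + 1] (A.cdga.d i x) := by
    rw [← F_iterate_zsmul, ← map_zsmul, ← hx, map_add, d_eq_zero_of_mem_dVRange hA hw, add_zero,
      F_iterate_d_Vpow]
  obtain ⟨a', rfl⟩ := exists_F_eq hA h1
  refine (mem_vIdeal hA).mpr ⟨a', x - Vpow hA r i a', mem_dVRange_of_smul hA ?_, by abel⟩
  rw [smul_sub, ← hx, Vpow_F, add_sub_cancel_left]
  exact hw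

/-- Since `V F = p` and `V` raises the filtration by one, the step lost on cancelling `p` is
regained. -/
theorem mem_vIdeal_of_F {r i : ℕ} {y : A.cdga.C i} (h : A.F i y ∈ (vIdeal hA r).I i) :
    y ∈ (vIdeal hA r).I i :=
  mem_vIdeal_of_smul hA (by rw [← V_F hA]; exact V_mem_vIdeal hA h)

/-- The description of the image of `F` modulo `Fil^r`. The exact part `dV^r b` of the error is
absorbed by changing `x` by `V^r b`; in the other part `V^r a` one finds `a = F a'`, so it is `p
V^(r-1) a'` and can be moved into `z` (for `r > 0`). -/
theorem exists_F_sub_mem {r i : ℕ} {x : A.cdga.C i} {z : A.cdga.C (i + 1)}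
    (h : A.cdga.d i x - (p : ℤ) • z ∈ (vIdeal hA r).I (i + 1)) :
    ∃ y, x - A.F i y ∈ (vIdeal hA r).I i := by
  cases r with
  | zero => exact ⟨0, mem_vIdeal_zero_left hA _⟩
  | succ r =>
    obtain ⟨a, w, hw, hx⟩ := (mem_vIdeal hA).mp h
    obtain ⟨b, rfl⟩ := (mem_dVRange_succ hA).mp hw
    have h1 : A.cdga.d (i + 1) a = (p : ℤ) • (A.F (i + 2))^[r + 1] (A.cdga.d (i + 1) (-z)) := by
      have h2 := congrArg (A.cdga.d (i + 1)) hx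
      rw [map_add, A.cdga.d_d, add_zero, map_sub, A.cdga.d_d, zero_sub, map_zsmul, ← smul_neg,
        ← map_neg] at h2
      rw [← F_iterate_zsmul, ← h2, F_iterate_d_Vpow]
    obtain ⟨a', rfl⟩ := exists_F_eq hA h1
    have h3 : A.cdga.d i (x - Vpow hA (r + 1) i b) = (p : ℤ) • (z + Vpow hA r (i + 1) a') := by
      rw [Vpow_F] at hx
      rw [map_sub, smul_add, ← sub_eq_iff_eq_add', sub_right_comm, sub_eq_iff_eq_add]
      exact hx.symm
    obtain ⟨y, hy⟩ := exists_F_eq hA h3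
    refine ⟨y, (mem_vIdeal hA).mpr ⟨b, 0, zero_mem _, ?_⟩⟩
    rw [hy]; abel

end DieudonneAlgebra

end

/-! ### Saturatedness and strictness of the completion -/

noncomputable section

namespace DieudonneAlgebra

variable {p : ℕ} [hp : Fact p.Prime] {A : DieudonneAlgebra.{u} p} (hA : A.IsSaturated)

/-- The class of an element modulo `Fil^r`. -/
def modFil (r : ℕ) {i : ℕ} : A.cdga.C i →+ (A.cdga.quot (vIdeal hA r)).C i :=
  (A.cdga.toQuot (vIdeal hA r)).f i

omit hp in
theorem modFil_eq_zero {r i : ℕ} {x : A.cdga.C i} :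
    modFil hA r x = 0 ↔ x ∈ (vIdeal hA r).I i := CDGA.toQuot_eq_zero

omit hp in
theorem modFil_eq {r i : ℕ} {x y : A.cdga.C i} :
    modFil hA r x = modFil hA r y ↔ x - y ∈ (vIdeal hA r).I i := by
  rw [← modFil_eq_zero, map_sub, sub_eq_zero]

omit hp in
theorem vIdeal_anti {r s i : ℕ} (h : r ≤ s) : (vIdeal hA s).I i ≤ (vIdeal hA r).I i :=
  antitone_nat_of_succ_le (f := fun r => (vIdeal hA r).I i)
    (fun r => (vFiltration hA).anti r i) h

omit hp in
theorem modFil_mono {r s i : ℕ} (h : r ≤ s) {x y : A.cdga.C i}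
    (hxy : modFil hA s x = modFil hA s y) : modFil hA r x = modFil hA r y :=
  (modFil_eq hA).mpr (vIdeal_anti hA h ((modFil_eq hA).mp hxy))

/-- The component of an element of the completion modulo `Fil^r`. -/
def comp (r : ℕ) {i : ℕ} : (vCompletion hA).cdga.C i →+ (A.cdga.quot (vIdeal hA r)).C i :=
  (CDGA.limProj (fun r => A.cdga.quot (vIdeal hA r))
    (fun r => A.cdga.quotMap ((vFiltration hA).anti r)) r).f i

theorem completion_ext {i : ℕ} {x y : (vCompletion hA).cdga.C i}
    (h : ∀ r, comp hA r x = comp hA r y) : x = y := Subtype.ext (funext h)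

theorem exists_rep {i : ℕ} (x : (vCompletion hA).cdga.C i) :
    ∃ a : ℕ → A.cdga.C i, ∀ r, comp hA r x = modFil hA r (a r) := by
  choose a ha using fun r => CDGA.toQuot_surjective (vIdeal hA r) i (x.1 r)
  exact ⟨a, fun r => (ha r).symm⟩

theorem comp_of_le {r s i : ℕ} (h : r ≤ s) {x : (vCompletion hA).cdga.C i} {a : A.cdga.C i}
    (hx : comp hA s x = modFil hA s a) : comp hA r x = modFil hA r a := by
  induction h with
  | refl => exact hx
  | step h ih =>
    refine ih ((x.2 _).symm.trans ?_)
    exact congrArg _ hx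

theorem exists_of_coherent {i : ℕ} (a : ℕ → A.cdga.C i)
    (ha : ∀ r, a (r + 1) - a r ∈ (vIdeal hA r).I i) :
    ∃ x : (vCompletion hA).cdga.C i, ∀ r, comp hA r x = modFil hA r (a r) :=
  ⟨⟨fun r => modFil hA r (a r), fun r => (modFil_eq hA).mpr (ha r)⟩, fun _ => rfl⟩

theorem rep_coherent {i : ℕ} {x : (vCompletion hA).cdga.C i} {a : ℕ → A.cdga.C i}
    (ha : ∀ r, comp hA r x = modFil hA r (a r)) (r : ℕ) : a (r + 1) - a r ∈ (vIdeal hA r).I i := by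
  rw [← modFil_eq, ← ha, ← comp_of_le hA (Nat.le_succ r) (ha (r + 1))]

theorem comp_F {i r : ℕ} {x : (vCompletion hA).cdga.C i} {a : A.cdga.C i}
    (h : comp hA (r + 1) x = modFil hA (r + 1) a) :
    comp hA r ((vCompletion hA).F i x) = modFil hA r (A.F i a) :=
  congrArg (vF hA r i) h

theorem comp_d {i r : ℕ} {x : (vCompletion hA).cdga.C i} {a : A.cdga.C i}
    (h : comp hA r x = modFil hA r a) :
    comp hA r ((vCompletion hA).cdga.d i x) = modFil hA r (A.cdga.d i a) :=
  congrArg ((A.cdga.quot (vIdeal hA r)).d i) h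

theorem comp_toVCompletion {i r : ℕ} (x : A.cdga.C i) :
    comp hA r ((toVCompletion hA).f i x) = modFil hA r x := rfl

/-- Cancelling `p` costs one step of the filtration, so level `r` is read off from a representative
at level `r + 1`. -/
theorem vCompletion_isTorsionFree : (vCompletion hA).IsTorsionFree := by
  intro i x hx
  obtain ⟨a, ha⟩ := exists_rep hA x
  refine completion_ext hA fun r => ?_
  rw [comp_of_le hA (Nat.le_succ r) (ha (r + 1)), map_zero, modFil_eq_zero]
  refine mem_vIdeal_of_smul hA ((modFil_eq_zero hA).mp ?_)
  rw [map_zsmul, ← ha, ← map_zsmul, hx, map_zero]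

theorem vCompletion_F_injective {i : ℕ} {x : (vCompletion hA).cdga.C i}
    (hx : (vCompletion hA).F i x = 0) : x = 0 := by
  obtain ⟨a, ha⟩ := exists_rep hA x
  refine completion_ext hA fun r => ?_
  rw [comp_of_le hA (Nat.le_succ r) (ha (r + 1)), map_zero, modFil_eq_zero]
  refine mem_vIdeal_of_F hA ((modFil_eq_zero hA).mp ?_)
  rw [← comp_F hA (ha (r + 1)), hx, map_zero]

/-- Solve `F w_r ≡ a_r` modulo `Fil^r` for each `r`. The solutions are coherent because `F` reflects
membership in `Fil^r`. -/
theorem vCompletion_exists_F {i : ℕ} {y : (vCompletion hA).cdga.C i}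
    {z : (vCompletion hA).cdga.C (i + 1)} (h : (vCompletion hA).cdga.d i y = (p : ℤ) • z) :
    ∃ w, (vCompletion hA).F i w = y := by
  obtain ⟨a, ha⟩ := exists_rep hA y
  obtain ⟨c, hc⟩ := exists_rep hA z
  have h1 : ∀ r, ∃ w, a r - A.F i w ∈ (vIdeal hA r).I i := fun r =>
    exists_F_sub_mem hA (z := c r) (by
      rw [← modFil_eq, ← comp_d hA (ha r), h, map_zsmul, map_zsmul, hc])
  choose w hw using h1
  obtain ⟨x, hx⟩ := exists_of_coherent hA w (fun r => by
    refine mem_vIdeal_of_F hA ?_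
    have h2 := sub_mem (rep_coherent hA ha r)
      (sub_mem (vIdeal_anti hA (Nat.le_succ r) (hw (r + 1))) (hw r))
    rw [map_sub]
    convert h2 using 1
    abel)
  refine ⟨x, completion_ext hA fun r => ?_⟩
  rw [comp_F hA (hx (r + 1)), comp_of_le hA (Nat.le_succ r) (ha (r + 1)), eq_comm, modFil_eq]
  exact vIdeal_anti hA (Nat.le_succ r) (hw (r + 1))

-- Converse to `exists_F_eq`: for torsion-free `E`, the factors `p^i` in the definition of `η_p` can
-- be stripped, leaving conditions on `F` alone.
omit hp in
theorem isSaturated_of_exists_F {E : DieudonneAlgebra.{u} p} (h : E.IsTorsionFree)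
    (hinj : ∀ (i : ℕ) (x : E.cdga.C i), E.F i x = 0 → x = 0)
    (hF : ∀ (i : ℕ) (y : E.cdga.C i) z, E.cdga.d i y = (p : ℤ) • z → ∃ w, E.F i w = y) :
    E.IsSaturated := by
  refine ⟨h, fun i x hx => ?_⟩
  obtain ⟨⟨y, rfl⟩, z, hz⟩ := mem_eta.mp hx
  have h1 : E.cdga.d i y = (p : ℤ) • z := by
    refine sub_eq_zero.mp (h.pow i ?_)
    rw [map_zsmul, one_mul, one_mul] at hz
    rw [smul_sub, ← hz, smul_smul, pow_succ, sub_self]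
  obtain ⟨w, rfl⟩ := hF i y z h1
  refine ⟨w, by rw [one_mul]; rfl, fun v hv => ?_⟩
  refine sub_eq_zero.mp (hinj i _ (h.pow i ?_))
  rw [map_sub, smul_sub, sub_eq_zero]
  rw [one_mul] at hv
  exact hv

theorem vCompletion_isSaturated : (vCompletion hA).IsSaturated :=
  isSaturated_of_exists_F (vCompletion_isTorsionFree hA)
    (fun _ _ h => vCompletion_F_injective hA h) (fun _ _ _ h => vCompletion_exists_F hA h)

/-- Applying `V` to representatives gives a coherent sequence whose image under `F` is `p x`. By
injectivity of `F` it represents `V x`. -/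
theorem comp_V {i r : ℕ} {x : (vCompletion hA).cdga.C i} {a : A.cdga.C i}
    (h : comp hA r x = modFil hA r a) :
    comp hA r (V (vCompletion_isSaturated hA) i x) = modFil hA r (V hA i a) := by
  obtain ⟨b, hb⟩ := exists_rep hA x
  obtain ⟨y, hy⟩ := exists_of_coherent hA (fun r => V hA i (b r)) (fun r => by
    rw [← map_sub]
    exact vIdeal_anti hA (Nat.le_succ r) (V_mem_vIdeal hA (rep_coherent hA hb r)))
  have hyx : V (vCompletion_isSaturated hA) i x = y := by
    refine F_injective (vCompletion_isSaturated hA) i ?_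
    rw [F_V]
    refine completion_ext hA fun r => ?_
    rw [comp_F hA (hy (r + 1)), F_V, map_zsmul, map_zsmul,
      comp_of_le hA (Nat.le_succ r) (hb (r + 1))]
  rw [hyx, hy, modFil_eq, ← map_sub]
  refine vIdeal_anti hA (Nat.le_succ r) (V_mem_vIdeal hA ((modFil_eq hA).mp ?_))
  rw [← hb, h]

theorem comp_Vpow (s : ℕ) {i r : ℕ} {x : (vCompletion hA).cdga.C i} {a : A.cdga.C i}
    (h : comp hA r x = modFil hA r a) :
    comp hA r (Vpow (vCompletion_isSaturated hA) s i x) = modFil hA r (Vpow hA s i a) := by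
  induction s with
  | zero => exact h
  | succ s ih => rw [Vpow_succ, Vpow_succ]; exact comp_V hA ih

theorem comp_eq_zero_of_mem {i r : ℕ} {x : (vCompletion hA).cdga.C i}
    (hx : x ∈ (vIdeal (vCompletion_isSaturated hA) r).I i) : comp hA r x = 0 := by
  obtain ⟨a, w, hw, rfl⟩ := (mem_vIdeal _).mp hx
  obtain ⟨a', ha'⟩ := exists_rep hA a
  rw [map_add, comp_Vpow hA r (ha' r), (modFil_eq_zero hA).mpr
    ((mem_vIdeal hA).mpr ⟨a' r, 0, zero_mem _, add_zero _⟩), zero_add]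
  cases i with
  | zero => rw [show w = 0 from hw, map_zero]
  | succ i =>
    obtain ⟨b, rfl⟩ := (mem_dVRange_succ _).mp hw
    obtain ⟨b', hb'⟩ := exists_rep hA b
    rw [comp_d hA (comp_Vpow hA r (hb' r)), modFil_eq_zero]
    exact (mem_vIdeal hA).mpr ⟨0, _, (mem_dVRange_succ hA).mpr ⟨b' r, rfl⟩,
      by rw [map_zero, zero_add]⟩

/-- The series `∑ V^j a_j` converges in the completion, and `V^r` of its sum is `∑ V^(r+j) a_j`. -/
theorem exists_series {i : ℕ} (r : ℕ) (a : ℕ → A.cdga.C i) :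
    ∃ x : (vCompletion hA).cdga.C i, ∀ s, comp hA s (Vpow (vCompletion_isSaturated hA) r i x) =
      modFil hA s (∑ j ∈ Finset.range s, Vpow hA (r + j) i (a j)) := by
  obtain ⟨x, hx⟩ := exists_of_coherent hA (fun s => ∑ j ∈ Finset.range s, Vpow hA j i (a j))
    (fun s => by
      rw [Finset.sum_range_succ, add_sub_cancel_left]
      exact (mem_vIdeal hA).mpr ⟨a s, 0, zero_mem _, add_zero _⟩)
  refine ⟨x, fun s => ?_⟩
  rw [comp_Vpow hA r (hx s), map_sum]
  simp only [Vpow_add]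

/-- The increments of a representing sequence from level `r` on have the form `V^(r+j) a_j +
dV^(r+j) b_j`. Summing the two series separately gives `x = V^r α + dV^r β`, so no closure of
`Fil^r` is needed. -/
theorem mem_of_comp_eq_zero {i r : ℕ} {x : (vCompletion hA).cdga.C i}
    (hx : comp hA r x = 0) : x ∈ (vIdeal (vCompletion_isSaturated hA) r).I i := by
  classical
  obtain ⟨u, hu⟩ := exists_rep hA x
  -- The representative at level `r` may be taken to be `0`, so that telescoping starts at zero.
  obtain ⟨v, hv, hvr⟩ : ∃ v : ℕ → A.cdga.C i, (∀ s, comp hA s x = modFil hA s (v s)) ∧ v r = 0 :=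
    ⟨Function.update u r 0, fun s => by
      obtain rfl | hs := eq_or_ne s r
      · rw [Function.update_self, hx, map_zero]
      · rw [Function.update_of_ne hs, hu], Function.update_self ..⟩
  have h1 := fun j => (mem_vIdeal hA).mp (rep_coherent hA hv (r + j))
  choose a w hw haw using h1
  have hsum : ∀ s, comp hA s x = modFil hA s (∑ j ∈ Finset.range s, Vpow hA (r + j) i (a j)) +
      modFil hA s (∑ j ∈ Finset.range s, w j) := by
    intro s
    rw [← map_add, ← Finset.sum_add_distrib, comp_of_le hA (Nat.le_add_left s r) (hv (r + s))]
    congr 1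
    simp only [haw]
    have := Finset.sum_range_sub (fun j => v (r + j)) s
    rw [add_zero, hvr, sub_zero] at this
    exact this.symm
  obtain ⟨α, hα⟩ := exists_series hA r a
  refine (mem_vIdeal _).mpr ⟨α, x - Vpow (vCompletion_isSaturated hA) r i α, ?_, by abel⟩
  have hy : ∀ s, comp hA s (x - Vpow (vCompletion_isSaturated hA) r i α) =
      modFil hA s (∑ j ∈ Finset.range s, w j) := fun s => by
    rw [map_sub, hsum, hα, add_sub_cancel_left]
  revert hy
  generalize x - Vpow (vCompletion_isSaturated hA) r i α = y
  intro hy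
  clear hsum haw hv hvr v hu u hx x hα α
  cases i with
  | zero =>
    refine completion_ext hA fun s => ?_
    rw [hy, Finset.sum_eq_zero fun j _ => show w j = 0 from hw j, map_zero, map_zero]
  | succ i =>
    choose b hb using fun j => (mem_dVRange_succ hA).mp (hw j)
    obtain ⟨β, hβ⟩ := exists_series hA r b
    refine (mem_dVRange_succ _).mpr ⟨β, completion_ext hA fun s => ?_⟩
    rw [comp_d hA (hβ s), hy, map_sum]
    simp only [hb]

/-- Level `r` of the completion vanishes exactly on its own `Fil^r`, so completing again changes
nothing. A coherent family of elements of the completion is represented by the diagonal `a r r`. -/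
theorem vCompletion_isStrict : IsStrict (vCompletion_isSaturated hA) := by
  have hcomp : ∀ {i r : ℕ} (x : (vCompletion hA).cdga.C i),
      x ∈ (vIdeal (vCompletion_isSaturated hA) r).I i ↔ comp hA r x = 0 := fun x =>
    ⟨comp_eq_zero_of_mem hA, mem_of_comp_eq_zero hA⟩
  intro i
  constructor
  · refine (injective_iff_map_eq_zero _).mpr fun x hx => completion_ext hA fun r => ?_
    have h1 : modFil (vCompletion_isSaturated hA) r x = 0 :=
      (congrArg (comp (vCompletion_isSaturated hA) r) hx).trans
        (map_zero (comp (vCompletion_isSaturated hA) r))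
    rw [map_zero]
    exact (hcomp x).mp ((modFil_eq_zero _).mp h1)
  · intro X
    obtain ⟨ξ, hξ⟩ := exists_rep (vCompletion_isSaturated hA) X
    choose a ha using fun r => exists_rep hA (ξ r)
    obtain ⟨x, hx⟩ := exists_of_coherent hA (fun r => a r r) (fun r => by
      have h1 := (hcomp _).mp (rep_coherent _ hξ r)
      rw [map_sub, comp_of_le hA (Nat.le_succ r) (ha (r + 1) (r + 1)), ha r r, ← map_sub] at h1
      exact (modFil_eq_zero hA).mp h1)
    refine ⟨x, completion_ext _ fun r => ?_⟩
    rw [comp_toVCompletion, hξ, modFil_eq, hcomp, map_sub, hx, ha r r, sub_self]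

end DieudonneAlgebra

end

/-! ### The universal property of the completed saturation -/

noncomputable section

namespace DieudonneAlgebra

variable {p : ℕ}

section phiPow

variable {E : DieudonneAlgebra.{u} p} (hE : E.IsSaturated)

include hE

theorem phi_injective (i : ℕ) : Function.Injective (E.phi i) := fun x y h =>
  F_injective hE i (sub_eq_zero.mp (hE.1.pow i (by
    rw [smul_sub, sub_eq_zero]; exact h)))

theorem phiPow_injective (i r : ℕ) : Function.Injective (E.phiPow i r) := by
  induction r with
  | zero => exact fun _ _ h => h
  | succ r ih => exact fun x y h => ih (phi_injective hE i h)

theorem pow_smul_injective (r : ℕ) {i : ℕ} {x y : E.cdga.C i}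
    (h : (p : ℤ) ^ r • x = (p : ℤ) ^ r • y) : x = y :=
  sub_eq_zero.mp (hE.1.pow r (by rw [smul_sub, sub_eq_zero, h]))

/-- Write `w = p^((r+1)i) u` and `dw = p^((r+1)(i+1)) z`. Then `du` is divisible by `p` and `dz =
0`, so `u` and `z` are both values of `F`; their preimages witness membership in `η_{p^r}`. -/
theorem exists_phi_of_mem_eta {r i : ℕ} {w : E.cdga.C i} (hw : w ∈ E.eta (r + 1) i) :
    ∃ y ∈ E.eta r i, E.phi i y = w := by
  obtain ⟨⟨u, rfl⟩, z, hz⟩ := mem_eta.mp hw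
  have hdu : E.cdga.d i u = (p : ℤ) • (p : ℤ) ^ r • z := by
    refine pow_smul_injective hE ((r + 1) * i) ?_
    rw [← map_zsmul, ← hz, smul_smul, smul_smul]
    congr 1; ring
  obtain ⟨u', rfl⟩ := exists_F_eq hE hdu
  have hdz : E.cdga.d (i + 1) z = (p : ℤ) • 0 := by
    refine pow_smul_injective hE ((r + 1) * (i + 1)) ?_
    rw [← map_zsmul, hz, E.cdga.d_d, smul_zero, smul_zero]
  obtain ⟨z', rfl⟩ := exists_F_eq hE hdz
  refine ⟨(p : ℤ) ^ (r * i) • u', mem_eta.mpr ⟨⟨u', rfl⟩, z', ?_⟩, ?_⟩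
  · apply phi_injective hE (i + 1)
    rw [map_zsmul, ← d_phi, map_zsmul, phi_apply, phi_apply, smul_smul, smul_smul]
    refine Eq.trans ?_ (hz.trans ?_)
    · congr 1; ring
    · congr 2; ring
  · rw [map_zsmul, phi_apply, smul_smul]
    congr 1; ring

theorem exists_phiPow_of_mem_eta (r : ℕ) {i : ℕ} {w : E.cdga.C i} (hw : w ∈ E.eta r i) :
    ∃ y, E.phiPow i r y = w := by
  induction r generalizing w with
  | zero => exact ⟨w, rfl⟩
  | succ r ih =>
    obtain ⟨y, hy, rfl⟩ := exists_phi_of_mem_eta hE hw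
    obtain ⟨y, rfl⟩ := ih hy
    exact ⟨y, rfl⟩

end phiPow

section hom

variable {A E : DieudonneAlgebra.{u} p} (g : CDGA.Hom A.cdga E.cdga)
  (hg : ∀ i x, g.f i (A.F i x) = E.F i (g.f i x))

include hg

theorem hom_phiPow (i r : ℕ) (x : A.cdga.C i) :
    g.f i (A.phiPow i r x) = E.phiPow i r (g.f i x) := by
  induction r with
  | zero => rfl
  | succ r ih => rw [phiPow_succ, phi_apply, map_zsmul, hg, ih]; rfl

omit hg in
theorem hom_mem_eta {i r : ℕ} {x : A.cdga.C i} (hx : x ∈ A.eta r i) : g.f i x ∈ E.eta r i := by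
  obtain ⟨⟨y, rfl⟩, z, hz⟩ := mem_eta.mp hx
  exact mem_eta.mpr ⟨⟨g.f i y, (map_zsmul _ _ _).symm⟩, g.f (i + 1) z, by
    rw [← map_zsmul, hz, g.map_d]⟩

theorem hom_V (hA : A.IsSaturated) (hE : E.IsSaturated) {i : ℕ} (x : A.cdga.C i) :
    g.f i (V hA i x) = V hE i (g.f i x) :=
  F_injective hE i (by rw [← hg, F_V, F_V, map_zsmul])

theorem hom_Vpow (hA : A.IsSaturated) (hE : E.IsSaturated) (r : ℕ) {i : ℕ} (x : A.cdga.C i) :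
    g.f i (Vpow hA r i x) = Vpow hE r i (g.f i x) := by
  induction r with
  | zero => rfl
  | succ r ih => rw [Vpow_succ, Vpow_succ, hom_V g hg hA hE, ih]

theorem hom_mem_vIdeal (hA : A.IsSaturated) (hE : E.IsSaturated) {r i : ℕ} {x : A.cdga.C i}
    (hx : x ∈ (vIdeal hA r).I i) : g.f i x ∈ (vIdeal hE r).I i := by
  obtain ⟨a, w, hw, rfl⟩ := (mem_vIdeal hA).mp hx
  refine (mem_vIdeal hE).mpr ⟨g.f i a, g.f i w, ?_, by rw [map_add, hom_Vpow g hg hA hE]⟩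
  cases i with
  | zero => rw [show w = 0 from hw, map_zero]; exact zero_mem _
  | succ i =>
    obtain ⟨b, rfl⟩ := (mem_dVRange_succ hA).mp hw
    exact (mem_dVRange_succ hE).mpr ⟨g.f i b, by rw [g.map_d, hom_Vpow g hg hA hE]⟩

end hom

section sat

variable {A E : DieudonneAlgebra.{u} p} (hE : E.IsSaturated) (g : CDGA.Hom A.cdga E.cdga)
  (hg : ∀ i x, g.f i (A.F i x) = E.F i (g.f i x))

include hE hg

/-- The iterate `φ_F^r` maps `E` bijectively onto `η_{p^r} E`, so the class of `x` at stage `r` must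
go to `φ_F^{-r}(g x)`. Injectivity of the iterates makes this independent of the stage. -/
theorem exists_satLift_apply {i : ℕ} (z : A.SatC i) :
    ∃ y : E.cdga.C i, ∀ r (x : A.eta r i), z = A.satMk i r x → E.phiPow i r y = g.f i x.1 := by
  obtain ⟨r, x, rfl⟩ := A.satMk_surj z
  obtain ⟨y, hy⟩ := exists_phiPow_of_mem_eta hE r (hom_mem_eta g x.2)
  refine ⟨y, fun s x' h => ?_⟩
  rw [← A.satMk_tr (le_max_left r s), ← A.satMk_tr (le_max_right r s) x', satMk_eq_iff] at h
  obtain ⟨m, hm⟩ := h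
  change A.phiPow i m (A.phiPow i (max r s - r) x.1) =
    A.phiPow i m (A.phiPow i (max r s - s) x'.1) at hm
  have h1 := congrArg (g.f i) hm
  rw [← phiPow_add, ← phiPow_add, hom_phiPow g hg, hom_phiPow g hg, ← hy, ← phiPow_add] at h1
  apply phiPow_injective hE i (m + (max r s - s))
  rw [← h1, ← phiPow_add]
  congr 2
  omega

/-- The map from the colimit. -/
def satLiftFun {i : ℕ} (z : A.SatC i) : E.cdga.C i := (exists_satLift_apply hE g hg z).choose

theorem satLiftFun_spec {i r : ℕ} (x : A.eta r i) :
    E.phiPow i r (satLiftFun hE g hg (A.satMk i r x)) = g.f i x.1 :=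
  (exists_satLift_apply hE g hg _).choose_spec r x rfl

theorem satLiftFun_eq {i r : ℕ} (x : A.eta r i) {y : E.cdga.C i}
    (h : E.phiPow i r y = g.f i x.1) : satLiftFun hE g hg (A.satMk i r x) = y :=
  phiPow_injective hE i r ((satLiftFun_spec hE g hg x).trans h.symm)

/-- The additive map from the colimit. -/
def satLiftHom (i : ℕ) : A.SatC i →+ E.cdga.C i :=
  AddMonoidHom.mk' (satLiftFun hE g hg) (fun z w => by
    obtain ⟨r, x, y, rfl, rfl⟩ := A.satMk_surj₂ z w
    refine (congrArg (satLiftFun hE g hg) (map_add (A.satMk i r) x y).symm).trans ?_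
    refine satLiftFun_eq hE g hg _ ?_
    rw [map_add, satLiftFun_spec, satLiftFun_spec, ← map_add]
    rfl)

/-- The morphism from the colimit `A → η_p A → …` to a saturated Dieudonné algebra. -/
def satLift : CDGA.Hom A.satCDGA E.cdga where
  f i := satLiftHom hE g hg i
  map_one := satLiftFun_eq hE g hg _ g.map_one.symm
  map_mul h z w := by
    obtain ⟨r, x, y, rfl, rfl⟩ := A.satMk_surj₂ z w
    refine (congrArg (satLiftFun hE g hg) (A.satMul_mk h r x y)).trans ?_
    refine satLiftFun_eq hE g hg _ ?_
    rw [phiPow_mul]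
    refine Eq.trans ?_ (g.map_mul h x.1 y.1).symm
    exact congrArg₂ (fun a b => E.cdga.mul h a b) (satLiftFun_spec hE g hg x)
      (satLiftFun_spec hE g hg y)
  map_d i z := by
    obtain ⟨r, x, rfl⟩ := A.satMk_surj z
    refine satLiftFun_eq hE g hg (⟨A.cdga.d i x.1, eta_d_mem x.2⟩ : A.eta r (i + 1)) ?_
    refine (E.d_phiPow r i _).symm.trans ?_
    refine (congrArg (E.cdga.d i) (satLiftFun_spec hE g hg x)).trans ?_
    exact (g.map_d i x.1).symm

theorem satLift_F {i : ℕ} (z : A.SatC i) :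
    (satLift hE g hg).f i (A.satF i z) = E.F i ((satLift hE g hg).f i z) := by
  obtain ⟨r, x, rfl⟩ := A.satMk_surj z
  refine satLiftFun_eq hE g hg (⟨A.F i x.1, eta_F_mem x.2⟩ : A.eta r i) ?_
  refine (E.F_phiPow r i _).symm.trans ?_
  refine (congrArg (E.F i) (satLiftFun_spec hE g hg x)).trans ?_
  exact (hg i x.1).symm

theorem satLift_toSat {i : ℕ} (x : A.cdga.C i) :
    (satLift hE g hg).f i ((toSatOfTorsionFree A).f i x) = g.f i x :=
  satLiftFun_eq hE g hg (⟨x, eta_zero_mem x⟩ : A.eta 0 i) rfl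

end sat

section torsion

variable {A E : DieudonneAlgebra.{u} p} (hE : E.IsSaturated) (g : CDGA.Hom A.cdga E.cdga)

include hE

/-- The morphism from the quotient by the torsion. -/
def torsionLift : CDGA.Hom A.torsionQuot.cdga E.cdga where
  f i := QuotientAddGroup.lift (A.torsion.I i) (g.f i) (by
    rintro x ⟨r, hr⟩
    refine hE.1.pow r ?_
    rw [← map_zsmul, hr, map_zero])
  map_one := g.map_one
  map_mul h x y := by
    induction x using QuotientAddGroup.induction_on with
    | H x =>
    induction y using QuotientAddGroup.induction_on with
    | H y => exact g.map_mul h x y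
  map_d i x := by
    induction x using QuotientAddGroup.induction_on with
    | H x => exact g.map_d i x

theorem torsionLift_F (hg : ∀ i x, g.f i (A.F i x) = E.F i (g.f i x)) (i : ℕ)
    (x : A.torsionQuot.cdga.C i) : (torsionLift hE g).f i (A.torsionQuot.F i x) =
      E.F i ((torsionLift hE g).f i x) := by
  induction x using QuotientAddGroup.induction_on with
  | H x => exact hg i x

end torsion

section vCompletion

variable [hp : Fact p.Prime] {A E : DieudonneAlgebra.{u} p} (hA : A.IsSaturated)
  {hE : E.IsSaturated} (hs : IsStrict hE) (g : CDGA.Hom A.cdga E.cdga)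
  (hg : ∀ i x, g.f i (A.F i x) = E.F i (g.f i x))

omit hp in
include hs in
theorem eq_of_modFil {i : ℕ} {x y : E.cdga.C i} (h : ∀ r, modFil hE r x = modFil hE r y) :
    x = y := (hs i).1 (Subtype.ext (funext h))

include hs hg

/-- Morphisms preserve `Fil^r`, so the images of representatives form a coherent sequence, which
converges because `E` is strict. -/
theorem exists_vLift_apply {i : ℕ} (x : (vCompletion hA).cdga.C i) :
    ∃ y : E.cdga.C i, ∀ r a, comp hA r x = modFil hA r a → modFil hE r y = modFil hE r (g.f i a) := by
  obtain ⟨a, ha⟩ := exists_rep hA x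
  have key : ∀ r (b c : A.cdga.C i), b - c ∈ (vIdeal hA r).I i →
      g.f i b - g.f i c ∈ (vIdeal hE r).I i := fun r b c h => by
    rw [← map_sub]; exact hom_mem_vIdeal g hg hA hE h
  obtain ⟨y', hy'⟩ := exists_of_coherent hE (fun r => g.f i (a r)) (fun r =>
    key _ _ _ (rep_coherent hA ha r))
  obtain ⟨y, rfl⟩ := (hs i).2 y'
  refine ⟨y, fun r b hb => ?_⟩
  refine (hy' r).trans ((modFil_eq hE).mpr (key r _ _ ((modFil_eq hA).mp ?_)))
  rw [← ha, hb]

/-- The map from the completion. -/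
def vLiftFun {i : ℕ} (x : (vCompletion hA).cdga.C i) : E.cdga.C i :=
  (exists_vLift_apply hA hs g hg x).choose

theorem modFil_vLiftFun {i r : ℕ} {x : (vCompletion hA).cdga.C i} {a : A.cdga.C i}
    (h : comp hA r x = modFil hA r a) :
    modFil hE r (vLiftFun hA hs g hg x) = modFil hE r (g.f i a) :=
  (exists_vLift_apply hA hs g hg x).choose_spec r a h

/-- The morphism from the completion to a strict Dieudonné algebra. -/
def vLift : CDGA.Hom (vCompletion hA).cdga E.cdga where
  f i := AddMonoidHom.mk' (vLiftFun hA hs g hg) (fun x y => by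
    obtain ⟨a, ha⟩ := exists_rep hA x
    obtain ⟨b, hb⟩ := exists_rep hA y
    refine eq_of_modFil hs fun r => ?_
    rw [map_add, modFil_vLiftFun hA hs g hg (ha r), modFil_vLiftFun hA hs g hg (hb r),
      modFil_vLiftFun hA hs g hg (a := a r + b r) (by rw [map_add, map_add, ha, hb]), map_add,
      map_add])
  map_one := eq_of_modFil hs fun r => by
    refine (modFil_vLiftFun hA hs g hg (a := A.cdga.one) rfl).trans ?_
    rw [g.map_one]
  map_mul {i j n} h x y := by
    obtain ⟨a, ha⟩ := exists_rep hA x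
    obtain ⟨b, hb⟩ := exists_rep hA y
    refine eq_of_modFil hs fun r => ?_
    refine (modFil_vLiftFun hA hs g hg (a := A.cdga.mul h (a r) (b r)) ?_).trans ?_
    · exact congrArg₂ (fun s t => (A.cdga.quot (vIdeal hA r)).mul h s t) (ha r) (hb r)
    · rw [g.map_mul]
      exact congrArg₂ (fun s t => (E.cdga.quot (vIdeal hE r)).mul h s t)
        (modFil_vLiftFun hA hs g hg (ha r)).symm (modFil_vLiftFun hA hs g hg (hb r)).symm
  map_d i x := by
    obtain ⟨a, ha⟩ := exists_rep hA x
    refine eq_of_modFil hs fun r => ?_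
    refine (modFil_vLiftFun hA hs g hg (comp_d hA (ha r))).trans ?_
    rw [g.map_d]
    exact congrArg ((E.cdga.quot (vIdeal hE r)).d i) (modFil_vLiftFun hA hs g hg (ha r)).symm

theorem vLift_F {i : ℕ} (x : (vCompletion hA).cdga.C i) :
    (vLift hA hs g hg).f i ((vCompletion hA).F i x) = E.F i ((vLift hA hs g hg).f i x) := by
  obtain ⟨a, ha⟩ := exists_rep hA x
  refine eq_of_modFil hs fun r => ?_
  refine (modFil_vLiftFun hA hs g hg (comp_F hA (ha (r + 1)))).trans ?_
  rw [hg]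
  exact congrArg (vF hE r i) (modFil_vLiftFun hA hs g hg (ha (r + 1))).symm

theorem vLift_toVCompletion {i : ℕ} (x : A.cdga.C i) :
    (vLift hA hs g hg).f i ((toVCompletion hA).f i x) = g.f i x :=
  eq_of_modFil hs fun _ => modFil_vLiftFun hA hs g hg rfl

-- Density: modulo `Fil^r` of the completion, `x` comes from an element of `A`. Both morphisms
-- preserve `Fil^r`, and the strict target is separated.
omit hg in
theorem vCompletion_hom_ext (g h : CDGA.Hom (vCompletion hA).cdga E.cdga)
    (hg : ∀ i x, g.f i ((vCompletion hA).F i x) = E.F i (g.f i x))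
    (hh : ∀ i x, h.f i ((vCompletion hA).F i x) = E.F i (h.f i x))
    (hgh : ∀ i x, g.f i ((toVCompletion hA).f i x) = h.f i ((toVCompletion hA).f i x)) :
    g = h := by
  refine CDGA.Hom.ext (funext fun i => AddMonoidHom.ext fun x => ?_)
  obtain ⟨a, ha⟩ := exists_rep hA x
  refine eq_of_modFil hs fun r => ?_
  obtain ⟨t, ht⟩ : ∃ t : (vCompletion hA).cdga.C i, t = (toVCompletion hA).f i (a r) := ⟨_, rfl⟩
  have ht' : comp hA r t = modFil hA r (a r) := by rw [ht]; rfl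
  have h1 : x - t ∈ (vIdeal (vCompletion_isSaturated hA) r).I i :=
    mem_of_comp_eq_zero hA (by rw [map_sub, sub_eq_zero, ha, ht'])
  have h2 := hom_mem_vIdeal g hg _ hE h1
  have h3 := hom_mem_vIdeal h hh _ hE h1
  have h5 : g.f i t = h.f i t := by rw [ht]; exact hgh i _
  have h4 := sub_mem h2 h3
  rw [map_sub, map_sub, h5, sub_sub_sub_cancel_right] at h4
  exact (modFil_eq hE).mpr h4

end vCompletion

section vSat

theorem satOfTorsionFree_phiPow [Fact p.Prime] {A : DieudonneAlgebra.{u} p} (hA : A.IsTorsionFree)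
    (i r m : ℕ) (x : A.eta r i) : ∃ h : A.phiPow i m x.1 ∈ A.eta r i,
      (satOfTorsionFree hA).phiPow i m (A.satMk i r x) = A.satMk i r ⟨A.phiPow i m x.1, h⟩ := by
  induction m with
  | zero => exact ⟨x.2, rfl⟩
  | succ m ih =>
    obtain ⟨h, e⟩ := ih
    refine ⟨(A.eta r i).zsmul_mem (eta_F_mem h) _, ?_⟩
    refine (congrArg ((satOfTorsionFree hA).phi i) e).trans ?_
    exact satOfTorsionFree_phi hA i r ⟨_, h⟩

/-- The transition maps of the colimit are iterates of `φ_F`, so a power of `φ_F` moves any element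
into the image of `A`. As `φ_F` is injective on saturated targets, morphisms from the saturation are
determined on `A`. -/
theorem exists_phiPow_eq_toSat [Fact p.Prime] (A : DieudonneAlgebra.{u} p) {i : ℕ}
    (z : A.sat.cdga.C i) : ∃ r y, A.sat.phiPow i r z = A.toSat.f i y := by
  obtain ⟨r, x, rfl⟩ := A.torsionQuot.satMk_surj z
  obtain ⟨h, e⟩ := satOfTorsionFree_phiPow A.torsionQuot_isTorsionFree i r r x
  obtain ⟨y, hy⟩ := QuotientAddGroup.mk_surjective x.1
  refine ⟨r, y, e.trans ?_⟩
  refine Eq.trans ?_ ((A.torsionQuot.satMk_phiPow i 0 r ⟨x.1, eta_zero_mem _⟩).trans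
    (congrArg (A.torsionQuot.satMk i 0) (Subtype.ext hy.symm)))
  rfl

variable [hp : Fact p.Prime] {A E : DieudonneAlgebra.{u} p}
  {hE : E.IsSaturated} (hs : IsStrict hE)

include hs

theorem exists_vSat_lift (g : CDGA.Hom A.cdga E.cdga)
    (hg : ∀ i x, g.f i (A.F i x) = E.F i (g.f i x)) :
    ∃ h : CDGA.Hom (vCompletion A.sat_isSaturated).cdga E.cdga,
      (∀ i x, h.f i ((vCompletion A.sat_isSaturated).F i x) = E.F i (h.f i x)) ∧
      ∀ i x, h.f i ((toVCompletion A.sat_isSaturated).f i (A.toSat.f i x)) = g.f i x := by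
  have h1 := torsionLift_F hE g hg
  have h2 : ∀ i z, (satLift hE (torsionLift hE g) h1).f i (A.sat.F i z) = E.F i _ :=
    fun i z => satLift_F hE (torsionLift hE g) h1 z
  refine ⟨vLift A.sat_isSaturated hs (satLift hE (torsionLift hE g) h1) h2,
    fun i x => vLift_F A.sat_isSaturated hs _ h2 x, fun i x => ?_⟩
  refine (vLift_toVCompletion A.sat_isSaturated hs _ h2 _).trans ?_
  exact satLift_toSat hE (torsionLift hE g) h1 _

theorem vSat_hom_ext (g h : CDGA.Hom (vCompletion A.sat_isSaturated).cdga E.cdga)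
    (hg : ∀ i x, g.f i ((vCompletion A.sat_isSaturated).F i x) = E.F i (g.f i x))
    (hh : ∀ i x, h.f i ((vCompletion A.sat_isSaturated).F i x) = E.F i (h.f i x))
    (hgh : ∀ i x, g.f i ((toVCompletion A.sat_isSaturated).f i (A.toSat.f i x)) =
      h.f i ((toVCompletion A.sat_isSaturated).f i (A.toSat.f i x))) : g = h := by
  refine vCompletion_hom_ext A.sat_isSaturated hs g h hg hh fun i z => ?_
  obtain ⟨r, y, hy⟩ := A.exists_phiPow_eq_toSat z
  have key : ∀ g : CDGA.Hom (vCompletion A.sat_isSaturated).cdga E.cdga,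
      (∀ i x, g.f i ((vCompletion A.sat_isSaturated).F i x) = E.F i (g.f i x)) →
      E.phiPow i r (g.f i ((toVCompletion A.sat_isSaturated).f i z)) =
        g.f i ((toVCompletion A.sat_isSaturated).f i (A.toSat.f i y)) := by
    intro g hg
    have hg' : ∀ i x, (g.comp (toVCompletion A.sat_isSaturated)).f i (A.sat.F i x) =
        E.F i ((g.comp (toVCompletion A.sat_isSaturated)).f i x) := fun i x =>
      hg i ((toVCompletion A.sat_isSaturated).f i x)
    refine (hom_phiPow (A := A.sat) _ hg' i r z).symm.trans ?_
    rw [hy]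
    rfl
  exact phiPow_injective hE i r ((key g hg).trans ((hgh i y).trans (key h hh).symm))

end vSat

end DieudonneAlgebra

end

/-! ### Frobenius lifts and Witt vectors -/

noncomputable section

namespace WittVector

variable {p : ℕ} [hp : Fact p.Prime] {B : Type*} [CommRing B]

theorem ghostComponent_eq_sum (x : WittVector p B) (n : ℕ) :
    ghostComponent n x = ∑ i ∈ Finset.range (n + 1), (p : B) ^ i * x.coeff i ^ p ^ (n - i) := by
  rw [ghostComponent_apply, aeval_wittPolynomial]

/-- The `n`-th ghost component equals `p^n x_n` plus terms in earlier coefficients, and `p^n` can be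
cancelled. -/
theorem ghostMap_injective (hB : ∀ x : B, (p : B) * x = 0 → x = 0) :
    Function.Injective (ghostMap : WittVector p B → ℕ → B) := by
  intro x y h
  have hpow : ∀ (n : ℕ) (a : B), (p : B) ^ n * a = 0 → a = 0 := by
    intro n
    induction n with
    | zero => intro a ha; rwa [pow_zero, one_mul] at ha
    | succ n ih => intro a ha; exact ih a (hB _ (by rw [← mul_assoc, ← pow_succ', ha]))
  ext n
  induction n using Nat.strong_induction_on with
  | _ n ih =>
    have h1 : ghostComponent n x = ghostComponent n y := congrFun h n
    rw [ghostComponent_eq_sum, ghostComponent_eq_sum, Finset.sum_range_succ,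
      Finset.sum_range_succ, Finset.sum_congr rfl fun i hi => by
        rw [ih i (Finset.mem_range.mp hi)]] at h1
    rw [Nat.sub_self, pow_zero, pow_one, pow_one] at h1
    exact sub_eq_zero.mp (hpow n _ (by linear_combination h1))

variable (φ : B →+* B)

variable (p) in
/-- The Witt coordinates of an element of a ring with a Frobenius lift. -/
def dworkCoeff (x : B) (n : ℕ) : B :=
  -- A solution of the `n`-th ghost equation if there is one, and an arbitrary value otherwise;
  -- solvability is proved in `sum_dworkCoeff`.
  Classical.epsilon fun v => (p : B) ^ n * v =
    φ^[n] x - ∑ i : Fin n, (p : B) ^ i.1 * dworkCoeff x i.1 ^ p ^ (n - i.1)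

-- Dwork's lemma. From `φ(a) ≡ a^p` modulo `p` follows `φ(a)^{p^(n-i)} ≡ a^{p^(n+1-i)}` modulo
-- `p^(n+1-i)`. Applying `φ` to the `n`-th ghost equation then shows that the next one is solvable.
omit hp in
theorem sum_dworkCoeff (hφ : ∀ x, ∃ y, φ x = x ^ p + p * y) (x : B) (n : ℕ) :
    ∑ i ∈ Finset.range (n + 1), (p : B) ^ i * dworkCoeff p φ x i ^ p ^ (n - i) = φ^[n] x := by
  have key : ∀ n, (∃ v, (p : B) ^ n * v =
      φ^[n] x - ∑ i ∈ Finset.range n, (p : B) ^ i * dworkCoeff p φ x i ^ p ^ (n - i)) →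
      ∑ i ∈ Finset.range (n + 1), (p : B) ^ i * dworkCoeff p φ x i ^ p ^ (n - i) = φ^[n] x := by
    intro n hn
    rw [← Fin.sum_univ_eq_sum_range
      (fun i => (p : B) ^ i * dworkCoeff p φ x i ^ p ^ (n - i))] at hn
    have h := Classical.epsilon_spec hn
    rw [Finset.sum_range_succ, Nat.sub_self, pow_zero, pow_one, ← Fin.sum_univ_eq_sum_range
      (fun i => (p : B) ^ i * dworkCoeff p φ x i ^ p ^ (n - i))]
    rw [← eq_sub_iff_add_eq']
    conv_lhs => rw [dworkCoeff]
    exact h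
  induction n with
  | zero => exact key 0 ⟨x, by simp⟩
  | succ n ih =>
    refine key (n + 1) ?_
    suffices h : (p : B) ^ (n + 1) ∣ φ^[n + 1] x - ∑ i ∈ Finset.range (n + 1),
        (p : B) ^ i * dworkCoeff p φ x i ^ p ^ (n + 1 - i) from
      h.imp fun _ h => h.symm
    rw [Function.iterate_succ_apply', ← ih, map_sum, ← Finset.sum_sub_distrib]
    refine Finset.dvd_sum fun i hi => ?_
    have hi' : i ≤ n := Nat.lt_succ_iff.mp (Finset.mem_range.mp hi)
    obtain ⟨y, hy⟩ := hφ (dworkCoeff p φ x i)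
    have h1 : (p : B) ∣ φ (dworkCoeff p φ x i) - dworkCoeff p φ x i ^ p :=
      ⟨y, by rw [hy]; ring⟩
    obtain ⟨z, hz⟩ := dvd_sub_pow_of_dvd_sub h1 (n - i)
    refine ⟨z, ?_⟩
    rw [map_mul, map_pow, map_pow, map_natCast, ← mul_sub,
      show n + 1 - i = 1 + (n - i) by omega, pow_add p, pow_one, pow_mul, hz, ← mul_assoc,
      ← pow_add]
    congr 2
    omega

theorem ghostComponent_mk_dworkCoeff (hφ : ∀ x, ∃ y, φ x = x ^ p + p * y) (x : B) (n : ℕ) :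
    ghostComponent n (mk p (dworkCoeff p φ x)) = φ^[n] x := by
  rw [ghostComponent_eq_sum]
  exact sum_dworkCoeff φ hφ x n

/-- A ring without `p`-torsion and with a Frobenius lift `φ` maps to its ring of Witt vectors, with
ghost components the powers of `φ`. -/
def ofFrobeniusLift (hB : ∀ x : B, (p : B) * x = 0 → x = 0)
    (hφ : ∀ x, ∃ y, φ x = x ^ p + p * y) : B →+* WittVector p B where
  toFun x := mk p (dworkCoeff p φ x)
  map_one' := ghostMap_injective hB (funext fun n => by
    rw [ghostMap_apply, ghostComponent_mk_dworkCoeff φ hφ, iterate_map_one, map_one]; rfl)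
  map_zero' := ghostMap_injective hB (funext fun n => by
    rw [ghostMap_apply, ghostComponent_mk_dworkCoeff φ hφ, iterate_map_zero, map_zero]; rfl)
  map_mul' x y := ghostMap_injective hB (funext fun n => by
    rw [map_mul, Pi.mul_apply]
    simp only [ghostMap_apply]
    rw [ghostComponent_mk_dworkCoeff φ hφ, ghostComponent_mk_dworkCoeff φ hφ,
      ghostComponent_mk_dworkCoeff φ hφ, iterate_map_mul])
  map_add' x y := ghostMap_injective hB (funext fun n => by
    rw [map_add, Pi.add_apply]
    simp only [ghostMap_apply]
    rw [ghostComponent_mk_dworkCoeff φ hφ, ghostComponent_mk_dworkCoeff φ hφ,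
      ghostComponent_mk_dworkCoeff φ hφ, iterate_map_add])

section

variable (hB : ∀ x : B, (p : B) * x = 0 → x = 0) (hφ : ∀ x, ∃ y, φ x = x ^ p + p * y)

theorem ghostComponent_ofFrobeniusLift (x : B) (n : ℕ) :
    ghostComponent n (ofFrobeniusLift φ hB hφ x) = φ^[n] x :=
  ghostComponent_mk_dworkCoeff φ hφ x n

theorem coeff_zero_ofFrobeniusLift (x : B) : (ofFrobeniusLift φ hB hφ x).coeff 0 = x := by
  have h := ghostComponent_ofFrobeniusLift φ hB hφ x 0
  rw [ghostComponent_eq_sum] at h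
  simpa using h

theorem frobenius_ofFrobeniusLift (x : B) :
    frobenius (ofFrobeniusLift φ hB hφ x) = ofFrobeniusLift φ hB hφ (φ x) :=
  ghostMap_injective hB (funext fun n => by
    simp only [ghostMap_apply]
    rw [ghostComponent_frobenius, ghostComponent_ofFrobeniusLift, ghostComponent_ofFrobeniusLift,
      Function.iterate_succ_apply])

theorem ofFrobeniusLift_eq_teichmuller {x : B} (hx : φ x = x ^ p) :
    ofFrobeniusLift φ hB hφ x = teichmuller p x :=
  ghostMap_injective hB (funext fun n => by
    simp only [ghostMap_apply]
    rw [ghostComponent_ofFrobeniusLift, ghostComponent_teichmuller]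
    induction n with
    | zero => simp
    | succ n ih => rw [Function.iterate_succ_apply', ih, map_pow, hx, ← pow_mul, pow_succ']
    )

end

/-- In characteristic `p` the Witt vector Frobenius raises each coefficient to the `p`-th power,
which is injective on a reduced ring. -/
theorem frobenius_injective {S : Type*} [CommRing S] [IsReduced S] (hS : (p : S) = 0) :
    Function.Injective (frobenius : WittVector p S → WittVector p S) := by
  intro x y h
  cases subsingleton_or_nontrivial S
  · exact WittVector.ext fun _ => Subsingleton.elim _ _
  have : CharP S p := (CharP.charP_iff_prime_eq_zero hp.out).mpr hS
  ext n
  have h1 := congrArg (fun w => w.coeff n) h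
  simp only [coeff_frobenius_charP] at h1
  exact frobenius_inj S p h1

theorem exists_verschiebung {S : Type*} [CommRing S] {x : WittVector p S} (h : x.coeff 0 = 0) :
    ∃ y, verschiebung y = x := by
  refine ⟨x.shift 1, (verschiebung_shift x 0 (by simpa using h)).trans ?_⟩
  ext n
  rw [shift_coeff, Nat.zero_add]

end WittVector

end

/-! ### The degree zero part of a strict Dieudonné algebra -/

noncomputable section

namespace DieudonneAlgebra

variable {p : ℕ} [hp : Fact p.Prime] {E : DieudonneAlgebra.{u} p} (hE : E.IsSaturated)

omit hp in
theorem mem_vIdeal_one {x : E.cdga.C 0} : x ∈ (vIdeal hE 1).I 0 ↔ x ∈ idealV hE := by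
  rw [mem_vIdeal_zero]
  rfl

-- Since `p = V F`, the `p`-adic filtration is finer than `Fil`. This allows maps from `Â` and its
-- levels to pass to the quotients of `E`.
omit hp in
theorem pow_smul_mem_vIdeal (r : ℕ) {i : ℕ} (x : E.cdga.C i) :
    (p : ℤ) ^ r • x ∈ (vIdeal hE r).I i := by
  induction r generalizing x with
  | zero => exact mem_vIdeal_zero_left hE _
  | succ r ih =>
    rw [pow_succ', mul_smul, ← V_F hE, map_zsmul]
    exact V_mem_vIdeal hE (ih _)

omit hp in
theorem frob_apply (x : E.cdga.C 0) : E.frob x = E.F 0 x := rfl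

omit hp in
theorem exists_frob_eq (x : E.cdga.C 0) : ∃ y, E.frob x = x ^ p + p * y := by
  obtain ⟨y, hy⟩ := E.F_frob x
  exact ⟨y, hy.trans (by rw [zsmul_eq_mul, Int.cast_natCast])⟩

omit hp in
include hE in
theorem natCast_mul_eq_zero (x : E.cdga.C 0) (h : (p : E.cdga.C 0) * x = 0) : x = 0 :=
  hE.1 0 x (by rw [zsmul_eq_mul, Int.cast_natCast, h])

omit hp in
/-- The ring `E⁰ / V E⁰`. -/
abbrev ModV : Type u := E.cdga.C 0 ⧸ idealV hE

omit hp in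
/-- The projection to `E⁰ / V E⁰`. -/
abbrev mkV : E.cdga.C 0 →+* ModV hE := Ideal.Quotient.mk (idealV hE)

omit hp in
theorem mkV_eq_zero {x : E.cdga.C 0} : mkV hE x = 0 ↔ x ∈ idealV hE :=
  Ideal.Quotient.eq_zero_iff_mem

omit hp in
theorem natCast_modV : (p : ModV hE) = 0 := by
  rw [← map_natCast (mkV hE), mkV_eq_zero]
  exact natCast_mem_idealV hE

/-- If `a^p ∈ V E⁰`, then `F a = a^p + p y` lies in `V E⁰` too, and `F` reflects membership in
`Fil^1`. -/
theorem isReduced_modV : IsReduced (ModV hE) := by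
  refine (isReduced_iff_pow_one_lt p hp.out.one_lt).mpr fun x hx => ?_
  obtain ⟨a, rfl⟩ := Ideal.Quotient.mk_surjective x
  obtain ⟨y, hy⟩ := exists_frob_eq a
  rw [← map_pow, mkV_eq_zero] at hx
  rw [mkV_eq_zero, ← mem_vIdeal_one]
  refine mem_vIdeal_of_F hE ((mem_vIdeal_one hE).mpr ?_)
  rw [← frob_apply, hy]
  exact add_mem hx (Ideal.mul_mem_right _ _ (natCast_mem_idealV hE))

/-- The map from `E⁰` to the ring of Witt vectors of `E⁰ / V E⁰`. -/
def toWitt : E.cdga.C 0 →+* WittVector p (ModV hE) :=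
  (WittVector.map (mkV hE)).comp
    (WittVector.ofFrobeniusLift E.frob (natCast_mul_eq_zero hE) exists_frob_eq)

theorem coeff_zero_toWitt (x : E.cdga.C 0) : (toWitt hE x).coeff 0 = mkV hE x := by
  refine (WittVector.map_coeff _ _ _).trans ?_
  rw [WittVector.coeff_zero_ofFrobeniusLift]

theorem frobenius_toWitt (x : E.cdga.C 0) :
    WittVector.frobenius (toWitt hE x) = toWitt hE (E.F 0 x) := by
  refine ((WittVector.frobenius_isPoly p).map _ _).symm.trans ?_
  rw [WittVector.frobenius_ofFrobeniusLift]
  rfl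

theorem toWitt_eq_teichmuller {x : E.cdga.C 0} (hx : E.F 0 x = x ^ p) :
    toWitt hE x = WittVector.teichmuller p (mkV hE x) := by
  refine (congrArg (WittVector.map (mkV hE))
    (WittVector.ofFrobeniusLift_eq_teichmuller E.frob _ _ hx)).trans ?_
  exact WittVector.map_teichmuller p _ _

/-- Compare after the Frobenius, which is injective since `E⁰ / V E⁰` is reduced of characteristic
`p`; both sides become multiplication by `p`. -/
theorem toWitt_V (x : E.cdga.C 0) :
    toWitt hE (V hE 0 x) = WittVector.verschiebung (toWitt hE x) := by
  have := isReduced_modV hE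
  refine WittVector.frobenius_injective (natCast_modV hE) ?_
  rw [frobenius_toWitt, F_V, zsmul_eq_mul, Int.cast_natCast, map_mul, map_natCast,
    WittVector.frobenius_verschiebung, mul_comm]

theorem toWitt_Vpow (r : ℕ) (x : E.cdga.C 0) :
    toWitt hE (Vpow hE r 0 x) = WittVector.verschiebung^[r] (toWitt hE x) := by
  induction r with
  | zero => rfl
  | succ r ih => rw [Vpow_succ, toWitt_V, ih, Function.iterate_succ_apply']

variable {hE} (hs : IsStrict hE)

include hs

omit hp in
theorem eq_zero_of_forall_mem {x : E.cdga.C 0} (h : ∀ r, x ∈ (vIdeal hE r).I 0) : x = 0 :=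
  eq_of_modFil hs fun r => by rw [map_zero, modFil_eq_zero]; exact h r

/-- A vanishing zeroth coefficient gives `x = V y`, and then `y` maps to zero as well. Repeating
this puts `x` in every `V^r E⁰`. -/
theorem toWitt_injective : Function.Injective (toWitt hE) := by
  refine (injective_iff_map_eq_zero _).mpr fun x hx => eq_zero_of_forall_mem hs fun r => ?_
  rw [mem_vIdeal_zero]
  induction r generalizing x with
  | zero => exact ⟨x, rfl⟩
  | succ r ih =>
    have h0 := coeff_zero_toWitt hE x
    rw [hx, WittVector.zero_coeff, eq_comm, mkV_eq_zero] at h0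
    obtain ⟨y, rfl⟩ := h0
    rw [toWitt_V] at hx
    obtain ⟨z, rfl⟩ := ih y (WittVector.verschiebung_injective p _ (hx.trans (map_zero _).symm))
    exact ⟨z, Vpow_succ hE r z⟩

/-- Peel off coefficients: each Witt vector is `toWitt x + V v`. The series `∑ V^j x_j` converges
because `E` is strict, and its image has the same coefficients. -/
theorem toWitt_surjective : Function.Surjective (toWitt hE) := by
  intro w
  have step : ∀ w : WittVector p (ModV hE), ∃ (x : E.cdga.C 0) (v : WittVector p (ModV hE)),
      w = toWitt hE x + WittVector.verschiebung v := by
    intro w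
    obtain ⟨x, hx⟩ := Ideal.Quotient.mk_surjective (w.coeff 0)
    have h : (w - toWitt hE x).coeff 0 = 0 := by
      rw [← WittVector.constantCoeff_apply, map_sub, WittVector.constantCoeff_apply,
        WittVector.constantCoeff_apply, coeff_zero_toWitt, ← hx, sub_self]
    obtain ⟨v, hv⟩ := WittVector.exists_verschiebung h
    exact ⟨x, v, by rw [hv]; ring⟩
  choose x v hxv using step
  have hsum : ∀ r, w = toWitt hE (∑ j ∈ Finset.range r, Vpow hE j 0 (x (v^[j] w))) +
      WittVector.verschiebung^[r] (v^[r] w) := by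
    intro r
    induction r with
    | zero => simp
    | succ r ih =>
      have h := hxv (v^[r] w)
      rw [Finset.sum_range_succ, map_add, toWitt_Vpow, add_assoc]
      refine ih.trans (congrArg _ ?_)
      conv_lhs => rw [h]
      rw [iterate_map_add, Function.iterate_succ_apply, Function.iterate_succ_apply']
  obtain ⟨y', hy'⟩ := exists_of_coherent hE (fun r => ∑ j ∈ Finset.range r, Vpow hE j 0 (x (v^[j] w)))
    (fun r => by
      rw [Finset.sum_range_succ, add_sub_cancel_left]
      exact (mem_vIdeal_zero hE).mpr ⟨_, rfl⟩)
  obtain ⟨y, rfl⟩ := (hs 0).2 y'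
  refine ⟨y, ?_⟩
  ext n
  have h1 : y - ∑ j ∈ Finset.range (n + 1), Vpow hE j 0 (x (v^[j] w)) ∈
      (vIdeal hE (n + 1)).I 0 := (modFil_eq hE).mp (hy' (n + 1))
  obtain ⟨z, hz⟩ := (mem_vIdeal_zero hE).mp h1
  have h2 : toWitt hE y - w =
      WittVector.verschiebung^[n + 1] (toWitt hE z - v^[n + 1] w) := by
    rw [iterate_map_sub, ← toWitt_Vpow, hz, map_sub]
    conv_lhs => rw [hsum (n + 1)]
    ring
  have h3 := WittVector.le_coeff_eq_iff_le_sub_coeff_eq_zero (x := toWitt hE y) (y := w)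
    (n := n + 1) |>.mpr (fun i hi => by
      rw [h2]; exact WittVector.iterate_verschiebung_coeff_eq_zero _ hi)
  exact h3 n (Nat.lt_succ_self n)

/-- A ring with Frobenius lift maps to a strict Dieudonné algebra once it does so modulo `V`. -/
theorem exists_zero_lift {B : Type u} [CommRing B] (hB : ∀ x : B, (p : B) * x = 0 → x = 0)
    (φ : B →+* B) (hφ : ∀ x, ∃ y, φ x = x ^ p + p * y) (g : B →+* ModV hE) :
    ∃ h : B →+* E.cdga.C 0, (∀ x, mkV hE (h x) = g x) ∧ (∀ x, h (φ x) = E.F 0 (h x)) ∧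
      ∀ b a, φ b = b ^ p → E.F 0 a = a ^ p → g b = mkV hE a → h b = a := by
  -- With `E⁰ ≅ W(E⁰ / V E⁰)`, the lift is the composite `B → W(B) → W(E⁰ / V E⁰)`. Elements with `φ
  -- b = b^p` go to Teichmüller elements, hence the third property.
  let c := RingEquiv.ofBijective (toWitt hE) ⟨toWitt_injective hs, toWitt_surjective hs⟩
  let h : B →+* E.cdga.C 0 := (c.symm : _ →+* E.cdga.C 0).comp
    ((WittVector.map g).comp (WittVector.ofFrobeniusLift φ hB hφ))
  have hc : ∀ x, toWitt hE (h x) = WittVector.map g (WittVector.ofFrobeniusLift φ hB hφ x) :=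
    fun x => c.apply_symm_apply _
  refine ⟨h, fun x => ?_, fun x => toWitt_injective hs ?_, fun b a hb ha hba =>
    toWitt_injective hs ?_⟩
  · rw [← coeff_zero_toWitt, hc, WittVector.map_coeff, WittVector.coeff_zero_ofFrobeniusLift]
  · rw [hc, ← WittVector.frobenius_ofFrobeniusLift, ← frobenius_toWitt, hc]
    exact (WittVector.frobenius_isPoly p).map _ _
  · rw [hc, WittVector.ofFrobeniusLift_eq_teichmuller φ hB hφ hb, WittVector.map_teichmuller, hba,
      toWitt_eq_teichmuller hE ha]

-- Raising to the `p`-th power improves a congruence by one step: in the binomial expansion `p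
-- V^(r+1) t = V^(r+2) F t`, and `(V^(r+1) t)^2` is `p` times a value of `V^(r+1)`.
omit hs in
theorem pow_sub_pow_mem {r : ℕ} {a b : E.cdga.C 0} (h : a - b ∈ (vIdeal hE (r + 1)).I 0) :
    a ^ p - b ^ p ∈ (vIdeal hE (r + 2)).I 0 := by
  obtain ⟨t, ht⟩ := (mem_vIdeal_zero hE).mp h
  obtain ⟨c, hc⟩ := exists_add_pow_prime_eq hp.out b (Vpow hE (r + 1) 0 t)
  have hmul : ∀ x y : E.cdga.C 0, y ∈ (vIdeal hE (r + 2)).I 0 → x * y ∈ (vIdeal hE (r + 2)).I 0 :=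
    fun x y hy => (vIdeal hE (r + 2)).mul_mem (zero_add 0) x hy
  have hp' : ∀ x, (p : E.cdga.C 0) * Vpow hE (r + 1) 0 x ∈ (vIdeal hE (r + 2)).I 0 := fun x => by
    refine (mem_vIdeal_zero hE).mpr ⟨E.F 0 x, ?_⟩
    rw [Vpow_F, zsmul_eq_mul, Int.cast_natCast]
  have h1 : Vpow hE (r + 1) 0 t ^ p ∈ (vIdeal hE (r + 2)).I 0 := by
    have h3 : Vpow hE (r + 1) 0 t ^ p = Vpow hE (r + 1) 0 t ^ (p - 2) *
        (Vpow hE (r + 1) 0 t * Vpow hE (r + 1) 0 t) := by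
      rw [← pow_two, ← pow_add, Nat.sub_add_cancel hp.out.two_le]
    obtain ⟨z, hz⟩ := Vpow_sq hE r t
    rw [h3, hz, zsmul_eq_mul, Int.cast_natCast]
    exact hmul _ _ (hp' z)
  have h2 : a = b + Vpow hE (r + 1) 0 t := by rw [ht]; ring
  rw [h2, hc, add_assoc, add_sub_cancel_left]
  refine add_mem h1 ?_
  rw [show (p : E.cdga.C 0) * b * Vpow hE (r + 1) 0 t * c =
    (b * c) * (p * Vpow hE (r + 1) 0 t) by ring]
  exact hmul _ _ (hp' t)

/-- If `g ≡ h` modulo `Fil^(r+1)` and `φ x = x^p + p y`, then `F(g x - h x) = g(x)^p - h(x)^p + p (g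
y - h y)` lies in `Fil^(r+2)`, and `F` reflects this. Separatedness of `E` concludes. -/
theorem zero_lift_unique {B : Type u} [CommRing B] {φ : B →+* B}
    (hφ : ∀ x, ∃ y, φ x = x ^ p + p * y) {g h : B →+* E.cdga.C 0}
    (hg : ∀ x, g (φ x) = E.F 0 (g x)) (hh : ∀ x, h (φ x) = E.F 0 (h x))
    (hgh : ∀ x, mkV hE (g x) = mkV hE (h x)) : g = h := by
  have key : ∀ r x, g x - h x ∈ (vIdeal hE (r + 1)).I 0 := by
    intro r
    induction r with
    | zero =>
      intro x
      rw [mem_vIdeal_one]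
      exact Ideal.Quotient.eq.mp (hgh x)
    | succ r ih =>
      intro x
      refine mem_vIdeal_of_F hE ?_
      obtain ⟨y, hy⟩ := hφ x
      obtain ⟨t, ht⟩ := (mem_vIdeal_zero hE).mp (ih y)
      rw [map_sub, ← hg, ← hh, hy]
      simp only [map_add, map_pow, map_mul, map_natCast]
      rw [add_sub_add_comm, ← mul_sub, ← ht]
      refine add_mem (pow_sub_pow_mem (ih x)) ((mem_vIdeal_zero hE).mpr ⟨E.F 0 t, ?_⟩)
      rw [Vpow_F, zsmul_eq_mul, Int.cast_natCast]
  refine RingHom.ext fun x => sub_eq_zero.mp (eq_zero_of_forall_mem hs fun r => ?_)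
  exact vIdeal_anti hE r.le_succ (key r x)

/-- No compatibility with Frobenius is assumed. As `k` is perfect, a Teichmüller lift is a `p^r`-th
power of another one, so agreement modulo `V` improves to agreement modulo every `Fil^r`; and a map
from `W(k)` to a ring in which `p^r = 0` is determined by its values on Teichmüller lifts. -/
theorem ringHom_witt_ext {k : Type*} [Field k] [CharP k p] [PerfectRing k p]
    {g h : WittVector p k →+* E.cdga.C 0} (hgh : ∀ x, mkV hE (g x) = mkV hE (h x)) : g = h := by
  have key : ∀ r (a : k), g (WittVector.teichmuller p a) - h (WittVector.teichmuller p a) ∈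
      (vIdeal hE (r + 1)).I 0 := by
    intro r
    induction r with
    | zero =>
      intro a
      rw [mem_vIdeal_one]
      exact Ideal.Quotient.eq.mp (hgh _)
    | succ r ih =>
      intro a
      obtain ⟨b, rfl⟩ := (PerfectRing.bijective_frobenius (R := k) (p := p)).2 a
      change g (WittVector.teichmuller p (b ^ p)) - h (WittVector.teichmuller p (b ^ p)) ∈ _
      rw [map_pow, map_pow, map_pow]
      exact pow_sub_pow_mem (ih b)
  refine RingHom.ext fun x => eq_of_modFil hs fun r => ?_
  let q : E.cdga.C 0 →+* (E.cdga.quot (vIdeal hE r)).C 0 := (E.cdga.toQuot (vIdeal hE r)).zero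
  have hq : q.comp g = q.comp h := by
    refine WittVector.eq_of_apply_teichmuller_eq _ _ ⟨r, ?_⟩ fun a => ?_
    · rw [← map_natCast q, ← map_pow]
      refine (modFil_eq_zero hE).mpr ?_
      have h1 := pow_smul_mem_vIdeal hE r (1 : E.cdga.C 0)
      rwa [zsmul_one, Int.cast_pow, Int.cast_natCast] at h1
    · exact (modFil_eq hE).mpr (vIdeal_anti hE r.le_succ (key r a))
  exact congrArg (fun f => f x) hq

end DieudonneAlgebra

end

/-! ### Maps out of the completed log de Rham complex -/

noncomputable section

namespace LogFrobeniusLifting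

variable {p : ℕ} [hp : Fact p.Prime] {k N : Type u} [Field k] [CommMonoid N]
    {β : N →* k} {R : LogRing.{u}} {f : LogRing.Hom (LogRing.logPoint β) R}
    (D : LogFrobeniusLifting p f) [CharP k p] [PerfectRing k p]

/-- A homomorphism from `Â` to the degree zero part of a cdga with the values of `dlog`. -/
structure HatDer (E : CDGA.{u}) where
  h : D.hatA →+* E.C 0
  δ : R.M → E.C 1
  d_hatι : ∀ w, E.d 0 (h (D.hatι w)) = 0
  δ_mul : ∀ l m, δ (l * m) = δ l + δ m
  d_hatα : ∀ m, E.d 0 (h (D.hatα m)) = h (D.hatα m) • δ m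
  δ_base : ∀ n, δ (f.mon n) = 0
  d_δ : ∀ m, E.d 1 (δ m) = 0

namespace HatDer

variable {D} {E : CDGA.{u}} (t : D.HatDer E) {n : ℕ} (I : CDGA.DGIdeal E)
  (hI : ∀ x : E.C 0, (p : ℤ) ^ (n + 1) • x ∈ I.I 0)

/-- The ring homomorphism induced on `A_n`. -/
def levelRing : D.A n →+* (E.quot I).C 0 :=
  (D.hatProj n).liftOfSurjective (D.isPadicTower.pr_surjective n)
    ⟨(E.toQuot I).zero.comp t.h, fun x hx => by
      obtain ⟨y, rfl⟩ := D.isPadicTower.ker_pr n hx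
      refine CDGA.toQuot_eq_zero.mpr ?_
      rw [map_zsmul]
      exact hI _⟩

theorem levelRing_hatProj (x : D.hatA) :
    t.levelRing I hI (D.hatProj n x) = (E.toQuot I).f 0 (t.h x) :=
  RingHom.liftOfRightInverse_comp_apply _ _ _ _ _

/-- The log derivation induced on `A_n`. -/
def levelDer : (D.base n).LogDer (E.quot I) (t.levelRing I hI) where
  D := ((E.quot I).d 0).comp (t.levelRing I hI : D.A n →+ (E.quot I).C 0)
  δ m := (E.toQuot I).f 1 (t.δ m)
  D_mul x y := (congrArg ((E.quot I).d 0) (map_mul (t.levelRing I hI) x y)).trans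
    ((E.quot I).d_mul _ _)
  D_base w := by
    obtain ⟨w, rfl⟩ := WittVector.truncate_surjective p (n + 1) k w
    refine (congrArg ((E.quot I).d 0) (t.levelRing_hatProj I hI (D.hatι w))).trans ?_
    rw [← (E.toQuot I).map_d, t.d_hatι, map_zero]
  δ_mul l m := by rw [t.δ_mul, map_add]
  D_α m := by
    refine (congrArg ((E.quot I).d 0) (t.levelRing_hatProj I hI (D.hatα m))).trans ?_
    rw [← (E.toQuot I).map_d, t.d_hatα, CDGA.Hom.map_smul]
    exact congrArg (fun r : (E.quot I).C 0 => r • (E.toQuot I).f 1 (t.δ m))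
      (t.levelRing_hatProj I hI (D.hatα m)).symm
  δ_base m := (congrArg ((E.toQuot I).f 1) (t.δ_base m)).trans (map_zero _)

/-- The morphism induced on the log de Rham complex of `A_n`. -/
def levelHom : CDGA.Hom (D.base n).deRhamCDGA (E.quot I) :=
  (t.levelDer I hI).hom (fun _ => rfl) (fun m => by
    refine ((E.toQuot I).map_d 1 _).symm.trans ?_
    rw [t.d_δ, map_zero])

theorem levelHom_toDeRham (x : D.hatA) :
    (t.levelHom I hI).f 0 ((D.base n).toDeRham (D.hatProj n x)) = (E.toQuot I).f 0 (t.h x) :=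
  ((t.levelDer I hI).graded_toDeRham _).trans (t.levelRing_hatProj I hI x)

theorem levelHom_inl (x : D.hatA) :
    (t.levelHom I hI).f 1 ((D.base n).genEl (.inl (D.hatProj n x))) =
      (E.toQuot I).f 1 (E.d 0 (t.h x)) := by
  refine ((t.levelDer I hI).graded_genEl _).trans ?_
  refine (congrArg ((E.quot I).d 0) (t.levelRing_hatProj I hI x)).trans ?_
  exact ((E.toQuot I).map_d 0 _).symm

theorem levelHom_inr (m : R.M) :
    (t.levelHom I hI).f 1 ((D.base n).genEl (.inr m)) = (E.toQuot I).f 1 (t.δ m) :=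
  (t.levelDer I hI).graded_genEl _

theorem quotMap_levelHom (J : CDGA.DGIdeal E) (hJ : ∀ x : E.C 0, (p : ℤ) ^ (n + 2) • x ∈ J.I 0)
    (hIJ : ∀ i, J.I i ≤ I.I i) {i : ℕ} (x : (D.base (n + 1)).deRhamCDGA.C i) :
    (E.quotMap hIJ).f i ((t.levelHom (n := n + 1) J hJ).f i x) =
      (t.levelHom I hI).f i ((D.deRhamRes n).f i x) := by
  refine (D.base (n + 1)).deRham_ext
    (g := fun i => ((E.quotMap hIJ).comp (t.levelHom (n := n + 1) J hJ)).f i)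
    (h := fun i => ((t.levelHom I hI).comp (D.deRhamRes n)).f i)
    (CDGA.Hom.map_mul _) (CDGA.Hom.map_mul _) (fun r => ?_) (fun g => ?_) i x
  · obtain ⟨r, rfl⟩ := D.isPadicTower.pr_surjective (n + 1) r
    refine (congrArg ((E.quotMap hIJ).f 0) (t.levelHom_toDeRham J hJ r)).trans ?_
    refine Eq.trans ?_ (congrArg ((t.levelHom I hI).f 0) (D.deRhamRes_toDeRham n _)).symm
    rw [show D.res n ((D.hatProj (n + 1) : D.hatA →+ D.A (n + 1)) r) = D.hatProj n r from r.2 n,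
      levelHom_toDeRham]
    rfl
  · refine Eq.trans ?_ (congrArg ((t.levelHom I hI).f 1) (D.deRhamRes_genEl n _)).symm
    cases g with
    | inl r =>
      obtain ⟨r, rfl⟩ := D.isPadicTower.pr_surjective (n + 1) r
      refine (congrArg ((E.quotMap hIJ).f 1) (t.levelHom_inl J hJ r)).trans ?_
      rw [Sum.map_inl,
        show D.res n ((D.hatProj (n + 1) : D.hatA →+ D.A (n + 1)) r) = D.hatProj n r from r.2 n,
        levelHom_inl]
      rfl
    | inr m =>
      refine (congrArg ((E.quotMap hIJ).f 1) (t.levelHom_inr J hJ m)).trans ?_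
      exact (t.levelHom_inr I hI m).symm

end HatDer

section

variable {D} {E : DieudonneAlgebra.{u} p} {hE : E.IsSaturated}
  (hs : DieudonneAlgebra.IsStrict hE) (t : D.HatDer E.cdga)

open DieudonneAlgebra

/-- The morphism to `E / Fil^{n+1}`. -/
def HatDer.filHom (t : D.HatDer E.cdga) (hE : E.IsSaturated) (n : ℕ) :
    CDGA.Hom D.omegaCDGA (E.cdga.quot (vIdeal hE (n + 1))) :=
  (t.levelHom (vIdeal hE (n + 1)) fun _ => pow_smul_mem_vIdeal hE (n + 1) _).comp (D.omegaProj n)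

theorem HatDer.quotMap_filHom (n : ℕ) {i : ℕ} (x : D.omegaCDGA.C i) :
    (E.cdga.quotMap ((vFiltration hE).anti (n + 1))).f i ((t.filHom hE (n + 1)).f i x) =
      (t.filHom hE n).f i x :=
  (t.quotMap_levelHom (vIdeal hE (n + 1)) (fun _ => pow_smul_mem_vIdeal hE (n + 1) _)
    (vIdeal hE (n + 2)) (fun _ => pow_smul_mem_vIdeal hE (n + 2) _)
    ((vFiltration hE).anti (n + 1)) _).trans
    (congrArg ((t.levelHom (vIdeal hE (n + 1)) _).f i) (D.deRhamRes_omegaProj n x))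

include hs

/-- The maps to `E / Fil^(n+1)`, each factoring through level `n` of `ω̂`, are compatible, and a
strict `E` is the limit of these quotients. -/
theorem exists_omegaLift_apply {i : ℕ} (x : D.omegaCDGA.C i) :
    ∃ y : E.cdga.C i, ∀ n, modFil hE (n + 1) y = (t.filHom hE n).f i x := by
  choose a ha using fun n => CDGA.toQuot_surjective (vIdeal hE (n + 1)) i ((t.filHom hE n).f i x)
  have ha' : ∀ n, modFil hE (n + 1) (a n) = (t.filHom hE n).f i x := ha
  have hco : ∀ n, a (n + 1) - a n ∈ (vIdeal hE (n + 1)).I i := fun n => by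
    rw [← modFil_eq, ha', ← t.quotMap_filHom n x, ← ha' (n + 1)]
    rfl
  obtain ⟨y', hy'⟩ := exists_of_coherent hE a (fun n => vIdeal_anti hE n.le_succ (hco n))
  obtain ⟨y, rfl⟩ := (hs i).2 y'
  refine ⟨y, fun n => ?_⟩
  refine (hy' (n + 1)).trans (Eq.trans ?_ (ha' n))
  exact (modFil_eq hE).mpr (hco n)

/-- The map on elements from the completed log de Rham complex. -/
def omegaLiftFun {i : ℕ} (x : D.omegaCDGA.C i) : E.cdga.C i :=
  (exists_omegaLift_apply hs t x).choose

theorem modFil_omegaLiftFun {i : ℕ} (x : D.omegaCDGA.C i) (n : ℕ) :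
    modFil hE (n + 1) (omegaLiftFun hs t x) = (t.filHom hE n).f i x :=
  (exists_omegaLift_apply hs t x).choose_spec n

omit [CharP k p] [PerfectRing k p] hp in
theorem eq_of_modFil_succ {i : ℕ} {x y : E.cdga.C i}
    (h : ∀ n, modFil hE (n + 1) x = modFil hE (n + 1) y) : x = y :=
  eq_of_modFil hs fun n => modFil_mono hE n.le_succ (h n)

/-- The morphism from the completed log de Rham complex to a strict Dieudonné algebra. -/
def omegaLift : CDGA.Hom D.omegaCDGA E.cdga where
  f i := AddMonoidHom.mk' (omegaLiftFun hs t) fun x y => eq_of_modFil_succ hs fun n => by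
    rw [map_add, modFil_omegaLiftFun, modFil_omegaLiftFun, modFil_omegaLiftFun, map_add]
  map_one := eq_of_modFil_succ hs fun n =>
    (modFil_omegaLiftFun hs t _ n).trans (t.filHom hE n).map_one
  map_mul h x y := eq_of_modFil_succ hs fun n => by
    refine (modFil_omegaLiftFun hs t _ n).trans (((t.filHom hE n).map_mul h x y).trans ?_)
    exact congrArg₂ (fun a b => (E.cdga.quot (vIdeal hE (n + 1))).mul h a b)
      (modFil_omegaLiftFun hs t x n).symm (modFil_omegaLiftFun hs t y n).symm
  map_d i x := eq_of_modFil_succ hs fun n => by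
    refine (modFil_omegaLiftFun hs t _ n).trans (((t.filHom hE n).map_d i x).trans ?_)
    exact congrArg ((E.cdga.quot (vIdeal hE (n + 1))).d i) (modFil_omegaLiftFun hs t x n).symm

theorem omegaLift_can (x : D.hatA) : (omegaLift hs t).f 0 (D.can x) = t.h x :=
  eq_of_modFil_succ hs fun n => (modFil_omegaLiftFun hs t _ n).trans
    (t.levelHom_toDeRham (vIdeal hE (n + 1)) _ x)

theorem omegaLift_dlog (m : R.M) : (omegaLift hs t).f 1 (D.dlog m) = t.δ m :=
  eq_of_modFil_succ hs fun n => (modFil_omegaLiftFun hs t _ n).trans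
    (t.levelHom_inr (vIdeal hE (n + 1)) _ m)

end

end LogFrobeniusLifting

end

/-! ### The saturated log de Rham–Witt complex of a log Frobenius lifting -/

noncomputable section

namespace LogDieudonneAlgebra

open LogRing

section vSat

variable {p : ℕ} [Fact p.Prime] {B : LogRing.{u}} {X Z : LogDieudonneAlgebra p B}

theorem vSat_isStrict (X : LogDieudonneAlgebra p B) : X.vSat.IsStrict :=
  ⟨_, DieudonneAlgebra.vCompletion_isStrict X.da.sat_isSaturated⟩

theorem vSat_hom_ext (hZ : Z.IsStrict) {g h : X.vSat.Hom Z}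
    (hgh : g.comp X.toVSat = h.comp X.toVSat) : g = h := by
  have h1 : ∀ i x, g.f.f i (X.toVSat.f.f i x) = h.f.f i (X.toVSat.f.f i x) := fun i x =>
    congrArg (fun q : X.Hom Z => q.f.f i x) hgh
  have h2 : g.f = h.f :=
    DieudonneAlgebra.vSat_hom_ext (A := X.da) (E := Z.da) hZ.2 g.f h.f g.f_F h.f_F h1
  exact Hom.ext h2 (congrArg (fun q : X.Hom Z => q.ψ) hgh)

theorem exists_vSat_lift (hZ : Z.IsStrict) (υ : X.Hom Z) :
    ∃ Υ : X.vSat.Hom Z, Υ.comp X.toVSat = υ := by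
  obtain ⟨h, hF, hh⟩ := DieudonneAlgebra.exists_vSat_lift (A := X.da) (E := Z.da) hZ.2 υ.f υ.f_F
  refine ⟨⟨h, υ.ψ, hF, fun w => ?_, υ.ψ_ιL, fun l => ?_, υ.ψ_FL, fun l => ?_⟩, ?_⟩
  · exact (hh 0 _).trans (υ.f_ι w)
  · exact (hh 0 _).trans (υ.f_α l)
  · exact (hh 1 _).trans (υ.f_δ l)
  · exact Hom.ext (CDGA.Hom.ext (funext fun i => AddMonoidHom.ext fun x => hh i x)) rfl

theorem existsUnique_vSat_lift (hZ : Z.IsStrict) (υ : X.Hom Z) :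
    ∃! Υ : X.vSat.Hom Z, Υ.comp X.toVSat = υ := by
  obtain ⟨Υ, rfl⟩ := exists_vSat_lift hZ υ
  exact ⟨Υ, rfl, fun _ h => vSat_hom_ext hZ h⟩

end vSat

variable {p : ℕ} [Fact p.Prime] {k N : Type u} [Field k] [CharP k p] [PerfectRing k p]
  [CommMonoid N] {β : N →* k}

omit [CharP k p] [PerfectRing k p] in
theorem modVMap_id {X : LogDieudonneAlgebra p ((logPoint β).witt p)} (hX : X.IsSaturated) :
    modVMap hX hX (Hom.id X) = ⟨RingHom.id _, MonoidHom.id _, fun _ => rfl⟩ :=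
  LogRing.Hom.ext (Ideal.Quotient.ringHom_ext rfl) rfl

omit [CharP k p] [PerfectRing k p] in
theorem modVMap_comp {X Y Z : LogDieudonneAlgebra p ((logPoint β).witt p)} (hX : X.IsSaturated)
    (hY : Y.IsSaturated) (hZ : Z.IsSaturated) (g : Hom Y Z) (h : Hom X Y) :
    modVMap hX hZ (g.comp h) = (modVMap hY hZ g).comp (modVMap hX hY h) :=
  LogRing.Hom.ext (Ideal.Quotient.ringHom_ext rfl) rfl

variable {R : LogRing.{u}} {f : LogRing.Hom (logPoint β) R}

theorem IsSaturatedLogDRW.eq_id {X : LogDieudonneAlgebra p ((logPoint β).witt p)}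
    {hX : X.IsStrict} {e : LogRing.Hom R (X.modV hX.isSaturated)}
    (h : IsSaturatedLogDRW f X hX e) {g : X.Hom X}
    (hg : (modVMap hX.isSaturated hX.isSaturated g).comp e = e) : g = Hom.id X :=
  (h.universal X hX h.pCompatible e h.over_base).unique hg (by rw [modVMap_id]; rfl)

theorem IsSaturatedLogDRW.isIso {X Y : LogDieudonneAlgebra p ((logPoint β).witt p)}
    {hX : X.IsStrict} {hY : Y.IsStrict} {eX : LogRing.Hom R (X.modV hX.isSaturated)}
    {eY : LogRing.Hom R (Y.modV hY.isSaturated)} (h : IsSaturatedLogDRW f X hX eX)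
    (h' : IsSaturatedLogDRW f Y hY eY) {g : X.Hom Y}
    (hg : (modVMap hX.isSaturated hY.isSaturated g).comp eX = eY) : g.IsIso := by
  obtain ⟨g', hg', -⟩ := h'.universal X hX h.pCompatible eX h.over_base
  refine ⟨g', h'.eq_id ?_, h.eq_id ?_⟩
  · rw [modVMap_comp hY.isSaturated hX.isSaturated]
    exact (congrArg (LogRing.Hom.comp (modVMap _ _ g)) hg').trans hg
  · rw [modVMap_comp hX.isSaturated hY.isSaturated]
    exact (congrArg (LogRing.Hom.comp (modVMap _ _ g')) hg).trans hg'

-- By `p`-compatibility `p F(δ l) = δ(l^p) = p δ(l)`, and `p` cancels in a saturated algebra.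
omit [CharP k p] [PerfectRing k p] in
theorem F_δ {Z : LogDieudonneAlgebra p ((logPoint β).witt p)} (hZ : Z.IsSaturated)
    (hp : Z.IsPCompatible) (l : Z.alg.L) : Z.str.F 1 (Z.alg.δ l) = Z.alg.δ l := by
  refine DieudonneAlgebra.smul_injective (A := Z.da) hZ ?_
  exact (Z.str.δ_FL l).symm.trans ((congrArg Z.alg.δ (hp l)).trans (Z.alg.δ_pow l p))

end LogDieudonneAlgebra

/-! ### The universal morphism out of the completed log de Rham complex -/

namespace LogFrobeniusLifting

open LogRing LogDieudonneAlgebra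

variable {p : ℕ} [hp : Fact p.Prime] {k N : Type u} [Field k] [CommMonoid N]
    {β : N →* k} {R : LogRing.{u}} {f : LogRing.Hom (logPoint β) R}
    (D : LogFrobeniusLifting p f) [CharP k p] [PerfectRing k p]

omit [CharP k p] [PerfectRing k p] in
theorem hatToR_hatα (m : R.M) : D.hatToR (D.hatα m) = R.α m := D.e_α m

omit [CharP k p] [PerfectRing k p] in
theorem hatToR_hatι (w : WittVector p k) :
    D.hatToR (D.hatι w) = f.ring (WittVector.constantCoeff w) := by
  refine (D.e_ι _).trans (congrArg f.ring ?_)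
  exact WittVector.coeff_truncate w 0

theorem hatToR_surjective : Function.Surjective D.hatToR :=
  D.e.surjective.comp (D.isPadicTower.pr_surjective 0)

theorem exists_of_hatToR_eq_zero {x : D.hatA} (h : D.hatToR x = 0) : ∃ y, x = (p : ℤ) • y := by
  obtain ⟨y, hy⟩ := D.isPadicTower.ker_pr 0 (D.e.injective (h.trans (map_zero D.e).symm))
  exact ⟨y, by rw [hy, zero_add, pow_one]⟩

section

variable {S : LogDieudonneStructure p D.omegaHat}
  {Z : LogDieudonneAlgebra p ((logPoint β).witt p)} (hZ : Z.IsStrict)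
  (g : LogRing.Hom R (Z.modV hZ.isSaturated))

/-- Lift `Â → R → Z⁰ / V Z⁰` to `Â → Z⁰` by the Witt vector description of `Z⁰`, then extend to `ω̂`
with `dlog m ↦ δ(g m)`. -/
theorem exists_isInduced (hS : D.IsCanonicalFrobenius S) (hc : Z.IsPCompatible)
    (hg : g.comp f = Z.modVBase hZ.isSaturated) :
    ∃ υ : Hom ⟨D.omegaHat, S⟩ Z, D.IsInduced S hZ.isSaturated g υ := by
  have hE : Z.da.IsSaturated := hZ.1
  have hs : DieudonneAlgebra.IsStrict hE := hZ.2
  obtain ⟨h, h1, h2, h3⟩ := DieudonneAlgebra.exists_zero_lift hs (B := D.hatA)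
    (fun _ => D.hatA_torsionFree) D.hatφHom (fun x => ⟨_, D.hatφHom_eq x⟩) (g.ring.comp D.hatToR)
  -- Both sides lift the same class modulo `V`, and Frobenius acts on both elements as the `p`-th
  -- power; so both are the same Teichmüller element.
  have hα : ∀ m, h (D.hatα m) = Z.alg.α (g.mon m) := fun m => by
    refine h3 _ _ (D.hatφHom_hatα m) ?_ ?_
    · exact (Z.str.F_α _).trans ((congrArg Z.alg.α (hc _)).trans (map_pow Z.alg.α _ p))
    · refine (congrArg g.ring (D.hatToR_hatα m)).trans ?_
      exact g.comm m
  have hι : ∀ w, h (D.hatι w) = Z.alg.ι w := fun w => by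
    refine congrArg (fun q => q w) (DieudonneAlgebra.ringHom_witt_ext hs (g := h.comp D.hatι)
      (h := Z.alg.ι) fun w => ?_)
    refine (h1 _).trans ?_
    refine (congrArg g.ring (D.hatToR_hatι w)).trans ?_
    refine Eq.trans ?_ (Z.modVRing_apply hZ.isSaturated w)
    exact congrArg (fun q : LogRing.Hom _ _ => q.ring (WittVector.constantCoeff w)) hg
  have hmon : ∀ n, g.mon (f.mon n) = Z.alg.ιL n := fun n =>
    congrArg (fun q : LogRing.Hom _ _ => q.mon n) hg
  let t : D.HatDer Z.da.cdga :=
    { h := h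
      δ := fun m => Z.alg.δ (g.mon m)
      d_hatι := fun w => by rw [hι]; exact Z.alg.d_ι w
      δ_mul := fun l m => by rw [map_mul]; exact Z.alg.δ_mul _ _
      d_hatα := fun m => by rw [hα]; exact Z.alg.d_α _
      δ_base := fun n => by rw [hmon]; exact Z.alg.δ_ιL n
      d_δ := fun m => Z.alg.d_δ _ }
  let υ : CDGA.Hom D.omegaCDGA Z.da.cdga := omegaLift hs t
  have υ_can : ∀ x, υ.f 0 (D.can x) = h x := omegaLift_can hs t
  have υ_dlog : ∀ m, υ.f 1 (D.dlog m) = Z.alg.δ (g.mon m) := omegaLift_dlog hs t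
  have hF₀ : ∀ a, υ.f 0 (S.F 0 (D.can a)) = Z.str.F 0 (υ.f 0 (D.can a)) := fun a => by
    refine (congrArg (υ.f 0) (hS.F_can a)).trans ((υ_can (D.hatφHom a)).trans ?_)
    exact (h2 a).trans (congrArg (Z.str.F 0) (υ_can a).symm)
  -- It suffices to compare on generators. On `dx` the comparison is made after multiplication by
  -- `p`, where `dF = pFd` reduces it to degree zero; `Z` has no `p`-torsion.
  have hF : ∀ i x, υ.f i (S.F i x) = Z.str.F i (υ.f i x) := by
    refine D.omega_hom_ext (E := Z.da.cdga) (g := fun i => (υ.f i).comp (S.F i))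
      (h := fun i => (Z.str.F i).comp (υ.f i)) (fun e x y => ?_) (fun e x y => ?_) hF₀
      (fun a => ?_) (fun m => ?_)
    · exact (congrArg (υ.f _) (S.F_mul e x y)).trans (υ.map_mul e _ _)
    · exact (congrArg (Z.str.F _) (υ.map_mul e x y)).trans (Z.str.F_mul e _ _)
    · refine DieudonneAlgebra.smul_injective (A := Z.da) hE ?_
      refine (map_zsmul (υ.f 1) _ _).symm.trans ?_
      refine (congrArg (υ.f 1) (S.d_F 0 (D.can a)).symm).trans ?_
      refine (υ.map_d 0 _).trans ((congrArg (Z.da.cdga.d 0) (hF₀ a)).trans ?_)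
      refine (Z.str.d_F 0 _).trans ?_
      exact congrArg (fun z => (p : ℤ) • Z.str.F 1 z) (υ.map_d 0 (D.can a)).symm
    · refine (congrArg (υ.f 1) (hS.F_δ m)).trans ((υ_dlog m).trans ?_)
      refine (LogDieudonneAlgebra.F_δ hZ.isSaturated hc _).symm.trans ?_
      exact congrArg (Z.str.F 1) (υ_dlog m).symm
  refine ⟨⟨υ, g.mon, hF, fun w => (υ_can _).trans (hι w), hmon, fun m => (υ_can _).trans (hα m),
    fun m => ?_, υ_dlog⟩, fun x => ?_, fun m => rfl⟩
  · refine (congrArg g.mon (hS.FL_eq m)).trans ((map_pow g.mon m p).trans (hc _).symm)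
  · exact (congrArg (Z.toModV hZ.isSaturated) (υ_can x)).trans (h1 x)

/-- In degree zero the two morphisms agree modulo `V` and commute with Frobenius, so they agree on
`Â`. The values on `dx` follow from this, and those on `dlog m` from the maps of monoids. -/
theorem isInduced_unique (hS : D.IsCanonicalFrobenius S) {υ υ' : Hom ⟨D.omegaHat, S⟩ Z}
    (h : D.IsInduced S hZ.isSaturated g υ) (h' : D.IsInduced S hZ.isSaturated g υ') : υ = υ' := by
  have hψ : υ.ψ = υ'.ψ := MonoidHom.ext fun m => (h.2 m).trans (h'.2 m).symm
  have hF : ∀ (υ : Hom ⟨D.omegaHat, S⟩ Z) x,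
      υ.f.f 0 (D.can (D.hatφHom x)) = Z.da.F 0 (υ.f.f 0 (D.can x)) := fun υ x =>
    (congrArg (υ.f.f 0) (hS.F_can x).symm).trans (υ.f_F 0 _)
  have h₀ : ∀ x, υ.f.f 0 (D.can x) = υ'.f.f 0 (D.can x) := fun x =>
    congrArg (fun q => q x) (DieudonneAlgebra.zero_lift_unique (E := Z.da) hZ.2
      (φ := D.hatφHom) (fun x => ⟨_, D.hatφHom_eq x⟩) (g := υ.f.zero.comp D.can)
      (h := υ'.f.zero.comp D.can) (hF υ) (hF υ') fun x => (h.1 x).trans (h'.1 x).symm)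
  refine Hom.ext (CDGA.Hom.ext (funext fun i => AddMonoidHom.ext fun x => ?_)) hψ
  refine D.omega_hom_ext (g := υ.f.f) (h := υ'.f.f) υ.f.map_mul υ'.f.map_mul h₀ (fun a => ?_)
    (fun m => ?_) i x
  · refine (υ.f.map_d 0 _).trans (Eq.trans ?_ (υ'.f.map_d 0 _).symm)
    exact congrArg (Z.alg.cdga.d 0) (h₀ a)
  · refine (υ.f_δ m).trans (Eq.trans ?_ (υ'.f_δ m).symm)
    rw [hψ]

end

variable (S : LogDieudonneStructure p D.omegaHat)

/-- The morphism from `R` to the `V`-completed saturation modulo `V`. -/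
def toModVSat : LogRing.Hom R (LogDieudonneAlgebra.modV
    (LogDieudonneAlgebra.vSat ⟨D.omegaHat, S⟩) (vSat_isStrict _).isSaturated) where
  ring := D.hatToR.liftOfSurjective D.hatToR_surjective
    ⟨((LogDieudonneAlgebra.toModV _ (vSat_isStrict _).isSaturated).comp
      (LogDieudonneAlgebra.toVSat ⟨D.omegaHat, S⟩).f.zero).comp D.can, by
      generalize ((LogDieudonneAlgebra.toModV _ (vSat_isStrict _).isSaturated).comp
        (LogDieudonneAlgebra.toVSat ⟨D.omegaHat, S⟩).f.zero).comp D.can = q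
      intro x hx
      obtain ⟨y, rfl⟩ := D.exists_of_hatToR_eq_zero hx
      have h : (p : (LogDieudonneAlgebra.modV (LogDieudonneAlgebra.vSat ⟨D.omegaHat, S⟩)
          (vSat_isStrict _).isSaturated).R) = 0 := DieudonneAlgebra.natCast_modV _
      rw [RingHom.mem_ker, map_zsmul, zsmul_eq_mul, Int.cast_natCast, h, zero_mul]⟩
  mon := MonoidHom.id _
  comm m := by
    rw [← D.hatToR_hatα]
    exact RingHom.liftOfRightInverse_comp_apply _ _ _ _ _

theorem toModVSat_hatToR (x : D.hatA) : (D.toModVSat S).ring (D.hatToR x) =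
    LogDieudonneAlgebra.toModV _ (vSat_isStrict _).isSaturated
      ((LogDieudonneAlgebra.toVSat ⟨D.omegaHat, S⟩).f.f 0 (D.can x)) :=
  RingHom.liftOfRightInverse_comp_apply _ _ _ _ _

theorem isInduced_toVSat : D.IsInduced S (vSat_isStrict _).isSaturated (D.toModVSat S)
    (LogDieudonneAlgebra.toVSat ⟨D.omegaHat, S⟩) :=
  ⟨fun x => (D.toModVSat_hatToR S x).symm, fun _ => rfl⟩

theorem toModVSat_comp : (D.toModVSat S).comp f =
    (LogDieudonneAlgebra.vSat ⟨D.omegaHat, S⟩).modVBase (vSat_isStrict _).isSaturated := by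
  refine LogRing.Hom.ext (RingHom.ext fun c => ?_) rfl
  obtain ⟨w, rfl⟩ := WittVector.constantCoeff_surjective p c
  refine Eq.trans ?_ (LogDieudonneAlgebra.modVRing_apply _ _ w).symm
  refine (congrArg (D.toModVSat S).ring (D.hatToR_hatι w).symm).trans ?_
  exact D.toModVSat_hatToR S _

/-- As `Â → R` is surjective, inducing `g` on `R` can be tested on `Â`. This translates the
universal property over `R` into the mapping property of `ω̂`. -/
theorem modVMap_comp_toModVSat_eq_iff {Z : LogDieudonneAlgebra p ((logPoint β).witt p)}
    (hZ : Z.IsSaturated) (g : LogRing.Hom R (Z.modV hZ))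
    (Υ : (LogDieudonneAlgebra.vSat ⟨D.omegaHat, S⟩).Hom Z) :
    (modVMap (vSat_isStrict _).isSaturated hZ Υ).comp (D.toModVSat S) = g ↔
      D.IsInduced S hZ g (Υ.comp (LogDieudonneAlgebra.toVSat ⟨D.omegaHat, S⟩)) := by
  have key : ∀ x, ((modVMap (vSat_isStrict _).isSaturated hZ Υ).comp (D.toModVSat S)).ring
      (D.hatToR x) = Z.toModV hZ ((Υ.comp (LogDieudonneAlgebra.toVSat ⟨D.omegaHat, S⟩)).f.f 0
        (D.can x)) := fun x =>
    congrArg (modVMap (vSat_isStrict _).isSaturated hZ Υ).ring (D.toModVSat_hatToR S x)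
  constructor
  · rintro rfl
    exact ⟨fun x => (key x).symm, fun _ => rfl⟩
  · rintro ⟨h1, h2⟩
    refine LogRing.Hom.ext (RingHom.ext fun x => ?_) (MonoidHom.ext h2)
    obtain ⟨x, rfl⟩ := D.hatToR_surjective x
    exact (key x).trans (h1 x)

variable {S}

theorem isSaturatedLogDRW_vSat (hS : D.IsCanonicalFrobenius S) :
    IsSaturatedLogDRW f (LogDieudonneAlgebra.vSat ⟨D.omegaHat, S⟩) (vSat_isStrict _)
      (D.toModVSat S) where
  pCompatible := hS.FL_eq
  over_base := D.toModVSat_comp S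
  universal Z hZ hc g hg := by
    obtain ⟨υ, hυ⟩ := D.exists_isInduced hZ g hS hc hg
    obtain ⟨Υ, rfl, hΥ⟩ := existsUnique_vSat_lift hZ υ
    refine ⟨Υ, (D.modVMap_comp_toModVSat_eq_iff S _ g Υ).mpr hυ, fun Υ' h => hΥ Υ' ?_⟩
    exact D.isInduced_unique hZ g hS ((D.modVMap_comp_toModVSat_eq_iff S _ g Υ').mp h) hυ

end LogFrobeniusLifting

end

theorem mainTheorem11 (p : ℕ) [Fact p.Prime] {k N : Type u} [Field k] [CharP k p]
    [PerfectRing k p] [CommMonoid N] (β : N →* k) (R : LogRing.{u})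
    (f : LogRing.Hom (LogRing.logPoint β) R) (hf : f.IsIntegral)
    (D : LogFrobeniusLifting p f) :
    -- the completed log de Rham complex has a unique canonical Frobenius structure
    (∃! S : LogDieudonneStructure p D.omegaHat, D.IsCanonicalFrobenius S) ∧
    ∀ S : LogDieudonneStructure p D.omegaHat, D.IsCanonicalFrobenius S →
      let X : LogDieudonneAlgebra p ((LogRing.logPoint β).witt p) := ⟨D.omegaHat, S⟩
      -- its `V`-completed saturation is a saturated log de Rham-Witt complex of `R`
      (∃ (hY : X.vSat.IsStrict) (e : LogRing.Hom R (X.vSat.modV hY.isSaturated)),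
        D.IsInduced S hY.isSaturated e X.toVSat ∧
        LogDieudonneAlgebra.IsSaturatedLogDRW f X.vSat hY e) ∧
      -- and for every saturated log de Rham-Witt complex of `R`, the canonical map `υ` exists, is
      -- unique, and induces an isomorphism from the `V`-completed saturation
      ∀ (𝒲 : LogDieudonneAlgebra p ((LogRing.logPoint β).witt p)) (h𝒲 : 𝒲.IsStrict)
        (e : LogRing.Hom R (𝒲.modV h𝒲.isSaturated)),
        LogDieudonneAlgebra.IsSaturatedLogDRW f 𝒲 h𝒲 e →
        (∃! υ : X.Hom 𝒲, D.IsInduced S h𝒲.isSaturated e υ) ∧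
        ∀ υ : X.Hom 𝒲, D.IsInduced S h𝒲.isSaturated e υ →
          ∃ Υ : X.vSat.Hom 𝒲, (∀ Υ' : X.vSat.Hom 𝒲, Υ'.comp X.toVSat = υ ↔ Υ' = Υ) ∧ Υ.IsIso := by
  refine ⟨D.existsUnique_canonicalFrobenius, fun S hS => ⟨⟨LogDieudonneAlgebra.vSat_isStrict _,
    D.toModVSat S, D.isInduced_toVSat S, D.isSaturatedLogDRW_vSat hS⟩, fun 𝒲 h𝒲 e he => ?_⟩⟩
  obtain ⟨υ, hυ⟩ := D.exists_isInduced h𝒲 e hS he.pCompatible he.over_base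
  refine ⟨⟨υ, hυ, fun _ h => D.isInduced_unique h𝒲 e hS h hυ⟩, fun υ hυ => ?_⟩
  obtain ⟨Υ, rfl, hΥ⟩ := LogDieudonneAlgebra.existsUnique_vSat_lift h𝒲 υ
  -- `Υ` carries the universal datum of `W(ω̂_sat)` to `e`, so it is a morphism between two
  -- universal objects over `R`, hence an isomorphism.
  exact ⟨Υ, fun Υ' => ⟨hΥ Υ', fun h => by rw [h]⟩, (D.isSaturatedLogDRW_vSat hS).isIso he
    ((D.modVMap_comp_toModVSat_eq_iff S _ e Υ).mpr hυ)⟩
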